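/- **Setting.** Let $\Omega\subset\mathbb R^3$ be a bounded open set with $C^2$ boundary, $\Omega^c=\mathbb R^3\setminus\overline\Omega$, and let $n(x)$ be the unit normal to $\partial\Omega$ at $x$ pointing inside $\Omega$; put $\gamma_\pm=\{(x,v)\in\partial\Omega\times\mathbb R^3:\ n(x)\cdot v\gtrless 0\}$. Let $\varepsilon>0$, $\mathfrak c\in\mathbb R^3$, and $$\mu_{\mathfrak c}(v)=(2\pi)^{-3/2}e^{-|v-\varepsilon\mathfrak c|^2/2},\qquad M^w(v)=(2\pi)^{-1}e^{-|v|^2/2}.$$ Let $Q(f,g)=Q^+(f,g)-Q^-(f,g)$ be the Boltzmann collision operator $$Q^+(f,g)(v)=\int_{\mathbb R^3}\!dv_*\int_{|\omega|=1}\!d\omega\,B(\omega,v-v_*)f(v')g(v_*'),\qquad Q^-(f,g)(v)=f(v)\int_{\mathbb R^3}\!dv_*\int_{|\omega|=1}\!d\omega\,B(\omega,v-v_*)g(v_*),$$ $v'=v-\omega\,((v-v_*)\cdot\omega)$, $v_*'=v_*+\omega\,((v-v_*)\cdot\omega)$, for a hard potential with angular cutoff: $B(\omega,V)=|V|^\theta\,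 b(|\omega\cdot V|/|V|)$ with $0\le\theta\le1$ and $b\ge0$ measurable, integrable on $[0,1]$ and not a.e. zero there (hard spheres: $\theta=1$, $b(z)=z$). Let $$\mathcal P^w_\gamma(G)(x,v)=M^w(v)\int_{\{n(x)\cdot w>0\}}G(x,w)\,n(x)\cdot w\,dw ,$$ and write $F^+=\max\{F,0\}$, $F^-=\max\{-F,0\}$. Equations $v\cdot\nabla F=S$ are understood in the mild sense: on almost every line $s\mapsto(x+sv,v)$, $F$ is locally absolutely continuous inside $\Omega^c$ with derivative $S$; the values of $F$ on $\gamma_\pm$ are its limits along these lines, for almost every point of $\gamma_\pm$. The condition $F\to\mu_{\mathfrak c}$ as $|x|\to\infty$ means that for every $\delta>0$ the set $\{x\in\Omega^c:\ \int_{\mathbb R^3}|F(x,v)-\mu_{\mathfrak c}(v)|\,dv>\delta\}$ has finite Lebesgue measure (for $F$ as below, this holds if $F(x,v)\to\mu_{\mathfrak c}(v)$ as $|x|\to\infty$ for a.e. $v$, and also if $\mu_{\mathfrak c}^{-1/2}(F-\mu_{\mathfrak c})\in L^p(\Omega^c\times\mathbb R^3)$ for some $p<\infty$). **Proposition.** Let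 $F$ be measurable with $\mu_{\mathfrak c}^{-1/2}F\in L^\infty(\Omega^c\times\mathbb R^3)$, and suppose that $F$ solves $$v\cdot\nabla F=\varepsilon^{-1}\big[Q(F^+,F^+)-Q(\mu_{\mathfrak c},F^-)-Q(F^-,\mu_{\mathfrak c})\big]\ \text{ in }\Omega^c\times\mathbb R^3,\qquad F=\mathcal P^w_\gamma(F^+)\ \text{ on }\gamma_-,\qquad F\to\mu_{\mathfrak c}\ \text{ as }|x|\to\infty .$$ Then $F^-=0$ almost everywhere in $\Omega^c\times\mathbb R^3$ and almost everywhere on $\gamma_+\cup\gamma_-$. Moreover $F$, as well as $F^+$, solves the Boltzmann problem with diffuse reflection $$v\cdot\nabla F=\varepsilon^{-1}Q(F,F)\ \text{ in }\Omega^c\times\mathbb R^3,\qquad F=\mathcal P^w_\gamma(F)\ \text{ on }\gamma_-,\qquad F\to\mu_{\mathfrak c}\ \text{ as }|x|\to\infty .$$ -/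

import Mathlib

open MeasureTheory Set Filter Topology
open scoped InnerProductSpace ENNReal

noncomputable section

namespace ExteriorBoltzmann

/-- Euclidean space `ℝ³`, used both for positions and for velocities. -/
abbrev E : Type := EuclideanSpace ℝ (Fin 3)

/-! ### Geometry -/

/-- `Ω` has a `C²` boundary and `n` is, at the points of `∂Ω`, the unit normal pointing inside `Ω`:
near each boundary point `x` one has `Ω = {φ < 0}` for a `C²` function `φ` with `∇φ(x) ≠ 0`,
and `n(x) = - ∇φ(x) / |∇φ(x)|`. -/
def HasC2BoundaryWithInnerNormal (Ω : Set E) (n : E → E) : Prop :=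
  ∀ x ∈ frontier Ω, ∃ φ : E → ℝ, ∃ U ∈ 𝓝 x, ContDiffOn ℝ 2 φ U ∧ gradient φ x ≠ 0 ∧
    (∀ y ∈ U, (y ∈ Ω ↔ φ y < 0)) ∧ n x = -(‖gradient φ x‖⁻¹ • gradient φ x)

/-- The region `Ω^c = ℝ³ ∖ closure Ω` occupied by the gas. -/
def gas (Ω : Set E) : Set E := (closure Ω)ᶜ

/-- The measure `dS(x) dv` on `∂Ω × ℝ³` (`dS` is the surface area). On `{n(x) · v ≠ 0}` it has the
same null sets as `|n(x) · v| dS(x) dv`. -/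
def phaseBoundary (Ω : Set E) : Measure (E × E) :=
  (μHE[2].restrict (frontier Ω)).prod volume

/-! ### Maxwellians -/

/-- The Maxwellian `M_{1,u,1}(v) = (2π)^{-3/2} exp(-|v-u|²/2)`. -/
def maxwellian (u v : E) : ℝ := (2 * Real.pi) ^ (-(3 / 2) : ℝ) * Real.exp (-‖v - u‖ ^ 2 / 2)

/-- The wall Maxwellian `M^w(v) = (2π)^{-1} exp(-|v|²/2)`. -/
def wallMaxwellian (v : E) : ℝ := (2 * Real.pi)⁻¹ * Real.exp (-‖v‖ ^ 2 / 2)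

/-! ### The collision operator -/

/-- Hard potentials with exponent `θ ∈ [0,1]` and angular cutoff:
`B(ω,V) = |V|^θ b(|ω·V|/|V|)` with `b ≥ 0` integrable (so that `∫ B(ω,V) dω` is a constant times
`|V|^θ`) and not almost everywhere zero. Hard spheres are `θ = 1`, `b(z) = z` for `z ≥ 0`. -/
structure IsCutoffHardPotential (θ : ℝ) (B : E → E → ℝ) : Prop where
  theta_nonneg : 0 ≤ θ
  theta_le_one : θ ≤ 1
  exists_angular : ∃ b : ℝ → ℝ, Measurable b ∧ (∀ z, 0 ≤ b z) ∧
    IntegrableOn b (Icc 0 1) ∧ ¬ (b =ᵐ[volume.restrict (Icc 0 1)] 0) ∧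
    ∀ ω V : E, ‖ω‖ = 1 → B ω V = ‖V‖ ^ θ * b (|⟪ω, V⟫_ℝ| / ‖V‖)

/-- `v' = v - ω ((v - v_*) · ω)`. -/
def vPrime (ω v vs : E) : E := v - ⟪v - vs, ω⟫_ℝ • ω

/-- `v_*' = v_* + ω ((v - v_*) · ω)`. -/
def vsPrime (ω v vs : E) : E := vs + ⟪v - vs, ω⟫_ℝ • ω

/-- Surface measure on the unit sphere. -/
def sphereMeasure : Measure (Metric.sphere (0 : E) 1) := (volume : Measure E).toSphere

/-- Gain term `Q⁺(f,g)`. -/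
def Qplus (B : E → E → ℝ) (f g : E → ℝ) (v : E) : ℝ :=
  ∫ vs : E, ∫ ω : Metric.sphere (0 : E) 1,
    B ω (v - vs) * f (vPrime ω v vs) * g (vsPrime ω v vs) ∂sphereMeasure

/-- Loss term `Q⁻(f,g)`. -/
def Qminus (B : E → E → ℝ) (f g : E → ℝ) (v : E) : ℝ :=
  f v * ∫ vs : E, ∫ ω : Metric.sphere (0 : E) 1, B ω (v - vs) * g vs ∂sphereMeasure

/-- The Boltzmann collision operator `Q(f,g) = Q⁺(f,g) - Q⁻(f,g)`. -/
def Q (B : E → E → ℝ) (f g : E → ℝ) (v : E) : ℝ := Qplus B f g v - Qminus B f g v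

/-! ### Positive and negative parts, right hand sides -/

/-- `F⁺ = max {F, 0}`. -/
def posP (F : E → E → ℝ) (x v : E) : ℝ := max (F x v) 0

/-- `F⁻ = max {-F, 0}`. -/
def negP (F : E → E → ℝ) (x v : E) : ℝ := max (-F x v) 0

/-- The right hand side `ε⁻¹ Q(F,F)` of the Boltzmann equation. -/
def boltzmannRHS (B : E → E → ℝ) (ε : ℝ) (F : E → E → ℝ) (x v : E) : ℝ :=
  ε⁻¹ * Q B (F x) (F x) v

/-- The right hand side `ε⁻¹ [Q(F⁺,F⁺) - (Q(μ_𝔠,F⁻) + Q(F⁻,μ_𝔠))]` of the modified equation,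
where `μ_𝔠 = M_{1,ε𝔠,1}`. -/
def modifiedRHS (B : E → E → ℝ) (ε : ℝ) (c : E) (F : E → E → ℝ) (x v : E) : ℝ :=
  ε⁻¹ * (Q B (posP F x) (posP F x) v
    - (Q B (maxwellian (ε • c)) (negP F x) v + Q B (negP F x) (maxwellian (ε • c)) v))

/-! ### Solutions -/

/-- `v · ∇F = S` in `Ω^c × ℝ³`: on almost every characteristic line `F` is absolutely continuous
in `Ω^c`, with derivative `S` (mild formulation). -/
def SolvesTransport (Ω : Set E) (S F : E → E → ℝ) : Prop :=
  ∀ᵐ p : E × E, p.1 ∈ gas Ω → ∀ t : ℝ, (∀ s ∈ uIcc 0 t, p.1 + s • p.2 ∈ gas Ω) →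
    IntervalIntegrable (fun s => S (p.1 + s • p.2) p.2) volume 0 t ∧
    F (p.1 + t • p.2) p.2 = F p.1 p.2 + ∫ s in (0 : ℝ)..t, S (p.1 + s • p.2) p.2

/-- The values of `F` on `γ₋ = {n(x) · v < 0}` and on `γ₊ = {n(x) · v > 0}` are the traces of `F`,
i.e. its limits along the characteristics (which leave `∂Ω` into the gas on `γ₋`, and
arrive at `∂Ω` from the gas on `γ₊`). -/
def HasTraces (Ω : Set E) (n : E → E) (F : E → E → ℝ) : Prop :=
  ∀ᵐ p ∂(phaseBoundary Ω),
    (⟪n p.1, p.2⟫_ℝ < 0 →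
      Tendsto (fun s : ℝ => F (p.1 + s • p.2) p.2) (𝓝[>] 0) (𝓝 (F p.1 p.2))) ∧
    (0 < ⟪n p.1, p.2⟫_ℝ →
      Tendsto (fun s : ℝ => F (p.1 - s • p.2) p.2) (𝓝[>] 0) (𝓝 (F p.1 p.2)))

/-- The diffuse reflection operator
`𝒫^w_γ(F)(x,v) = M^w(v) ∫_{n(x)·w > 0} F(x,w) (n(x)·w) dw`. -/
def diffuse (n : E → E) (F : E → E → ℝ) (x v : E) : ℝ :=
  wallMaxwellian v * ∫ w in {w : E | 0 < ⟪n x, w⟫_ℝ}, F x w * ⟪n x, w⟫_ℝ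

/-- `F = G` on `γ₋`. -/
def InflowEq (Ω : Set E) (n : E → E) (F G : E → E → ℝ) : Prop :=
  ∀ᵐ p ∂(phaseBoundary Ω), ⟪n p.1, p.2⟫_ℝ < 0 → F p.1 p.2 = G p.1 p.2

/-- `F(x,v) = √M(v) · O(1)` almost everywhere in the gas: `M^{-1/2} F ∈ L^∞(Ω^c × ℝ³)`. -/
def BoundedRelTo (Ω : Set E) (M : E → ℝ) (F : E → E → ℝ) : Prop :=
  ∃ C : ℝ, ∀ᵐ p : E × E, p.1 ∈ gas Ω → |F p.1 p.2| ≤ C * √(M p.2)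

/-- `F → M` as `|x| → ∞`: the function `x ↦ ‖F(x,·) - M‖_{L¹(ℝ³)}` vanishes at infinity, in the
sense that its superlevel sets in the gas region have finite measure. For `F` and `M` both
`O(√M)` with `M` Gaussian, this follows from the pointwise limit `F(x,v) → M(v)` for almost every
`v`, and also from `M^{-1/2} (F - M) ∈ L^p(Ω^c × ℝ³)` for some `p < ∞`. -/
def TendsToAtInfinity (Ω : Set E) (F : E → E → ℝ) (M : E → ℝ) : Prop :=
  ∀ δ : ℝ≥0∞, 0 < δ → volume {x : E | x ∈ gas Ω ∧ δ < ∫⁻ v : E, ‖F x v - M v‖ₑ} < ∞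

/-- `F` (a measurable representative, whose values on `∂Ω` are the traces) solves
`v · ∇F = S` in `Ω^c`, `F = 𝒫^w_γ(G)` on `γ₋`, `F → M` as `|x| → ∞`, with
`M^{-1/2} F ∈ L^∞`. -/
structure IsSolution (Ω : Set E) (n : E → E) (M : E → ℝ) (S G F : E → E → ℝ) : Prop where
  measurable : Measurable (Function.uncurry F)
  bounded : BoundedRelTo Ω M F
  transport : SolvesTransport Ω S F
  traces : HasTraces Ω n F
  inflow : InflowEq Ω n F (diffuse n G)
  infinity : TendsToAtInfinity Ω F M

/-- `F` solves the modified problem. -/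
def SolvesModifiedProblem (Ω : Set E) (n : E → E) (B : E → E → ℝ) (ε : ℝ) (c : E)
    (F : E → E → ℝ) : Prop :=
  IsSolution Ω n (maxwellian (ε • c)) (modifiedRHS B ε c F) (posP F) F

/-- `F` solves the Boltzmann problem with diffuse reflection. -/
def SolvesBoltzmannProblem (Ω : Set E) (n : E → E) (B : E → E → ℝ) (ε : ℝ) (c : E)
    (F : E → E → ℝ) : Prop :=
  IsSolution Ω n (maxwellian (ε • c)) (boltzmannRHS B ε F) F F

/-- `F⁻ = 0` almost everywhere in `Ω^c × ℝ³`, and almost everywhere on `γ₊ ∪ γ₋`. -/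
def NegPartVanishes (Ω : Set E) (n : E → E) (F : E → E → ℝ) : Prop :=
  (∀ᵐ p : E × E, p.1 ∈ gas Ω → negP F p.1 p.2 = 0) ∧
  (∀ᵐ p ∂(phaseBoundary Ω), ⟪n p.1, p.2⟫_ℝ ≠ 0 → negP F p.1 p.2 = 0)

end ExteriorBoltzmann

end

open MeasureTheory Set Filter Topology
open scoped InnerProductSpace ENNReal

noncomputable section

namespace ExteriorBoltzmann

/-! Write u = ε𝔠, μ for the Maxwellian centred at u, h = F⁻ and L h = -(Q(μ,h) + Q(h,μ)). Where F <
0 the loss part of Q(F⁺,F⁺) vanishes, since it carries the factor F⁺(v). Hence v·∇F = ε⁻¹(Q⁺(F⁺,F⁺)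
+ L h) there, and on the whole gas v·∇(h²/μ) = -2ε⁻¹ (h/μ)(Q⁺(F⁺,F⁺) + L h). The v-integral of
(h/μ)(Q⁺ + L h), the dissipation D(x), is nonnegative: the gain term is, and 4∫(h/μ) L h is the
integral of the square of g + g_* - g' - g_*', g = h/μ, against B μ μ_* dv dv_* dω. At the wall F =
𝒫(F⁺) ≥ 0 on γ₋, so no h enters the gas. Formally the energy balance then forces D = 0 and leaves
h²/μ transported freely without inflow. Testing with a bounded weight that strictly decreases along
the free flow gives h = 0 (`DecayingSolution.ae_negP_eq_zero`).

Two integrability questions make this more than formal. First, F = O(√μ) only bounds h²/μ, so its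
v-integral may diverge. For large |v - u| the gain part of L is dominated by half of the collision
frequency (`exists_gainKernel_le`), even with a polynomial weight in the velocity displacement. A
maximum principle along characteristics (`neg_le_of_production`) therefore halves any bound of the
form A √μ / weight at large velocities; iterated, it gives h ≤ A √μ (1+|v-u|²)⁻³ (`exists_negP_le`).

Second, nothing is known about integrability in x. Near equilibrium D is coercive
(`exists_integral_sq_le_dissipation`): L controls ∫ν h²/μ, ν being the collision frequency, up to ∫h
over bounded velocities (`lintegral_freq_sq_le`), and that remainder is controlled by (h/μ)
Q⁺(F⁺,F⁺), because Q⁺(F⁺,F⁺) is bounded below on bounded velocities when F⁺ is close to μ in L¹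
(`exists_le_gain`). By the condition at infinity this applies outside a set of finite measure.
Inserted into the energy inequality with a cutoff on balls of radius ρ² = 4^(j+1)
(`DecayingSolution.integral_gasBall_le`), it yields, for the dissipation a_j in the ball of radius
4^j, the recursion a_j ≤ C 2^(-j) (a_(j+1) + 1). As a_j grows at most like volume, repeated use of
the recursion makes it tend to 0, and monotonicity forces a_j = 0. Then D = 0, and the energy h²/μ
is globally integrable because it lives over a set of finite measure.

The energy balance is derived by Fubini on characteristics rather than by a divergence theorem
(`integral_nonneg_of_transport`). It needs the boundary condition at almost every exit point of a
backward flight (`ae_exit`), which follows from comparing surface measure with Lebesgue measure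
through the projection along v. Once h = 0 in the gas, passing to traces gives h = 0 on the
boundary, and the modified and the Boltzmann right-hand sides agree almost everywhere, hence along
almost every line. -/

/-- The unit sphere of `ℝ³`. -/
abbrev Sph : Type := Metric.sphere (0 : E) 1

/-! ### Integration on the sphere and in adapted coordinates. -/

instance : IsFiniteMeasure sphereMeasure := by unfold sphereMeasure; infer_instance

lemma norm_sph (ω : Sph) : ‖(ω : E)‖ = 1 := by simp

theorem lintegral_polar (Φ : E → ℝ≥0∞) (hΦ : Measurable Φ) :
    ∫⁻ x, Φ x = ∫⁻ ω : Sph, (∫⁻ r in Ioi (0 : ℝ), ENNReal.ofReal (r ^ 2) * Φ (r • (ω : E)))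
      ∂sphereMeasure := by
  have h1 : ∫⁻ x, Φ x = ∫⁻ x : ({0}ᶜ : Set E), Φ x ∂(Measure.comap Subtype.val volume) := by
    rw [lintegral_subtype_comap (measurableSet_singleton 0).compl]
    rw [Measure.restrict_eq_self_of_ae_mem (by simp [ae_iff])]
  rw [h1, ← (Measure.measurePreserving_homeomorphUnitSphereProd
    (volume : Measure E)).symm (homeomorphUnitSphereProd E).toMeasurableEquiv |>.lintegral_comp_emb
    (homeomorphUnitSphereProd E).symm.measurableEmbedding]
  have hm : Measurable fun p : Sph × Ioi (0 : ℝ) =>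
      Φ ((homeomorphUnitSphereProd E).symm p : E) :=
    hΦ.comp (measurable_subtype_coe.comp (homeomorphUnitSphereProd E).symm.continuous.measurable)
  erw [lintegral_prod _ hm.aemeasurable]
  refine lintegral_congr fun ω => ?_
  have hd : Module.finrank ℝ E - 1 = 2 := by simp
  rw [hd, Measure.volumeIoiPow]
  have hm' : Measurable fun r : Ioi (0 : ℝ) => Φ ((homeomorphUnitSphereProd E).symm (ω, r) : E) :=
    hm.comp measurable_prodMk_left
  refine (lintegral_withDensity_eq_lintegral_mul _ (by fun_prop) hm').trans ?_
  rw [← lintegral_subtype_comap measurableSet_Ioi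
    (fun r : ℝ => ENNReal.ofReal (r ^ 2) * Φ (r • (ω : E)))]
  refine lintegral_congr fun r => ?_
  simp [homeomorphUnitSphereProd]

/-- Completing e to an orthonormal basis gives an isometry with ℝ × ℝ², which preserves volume. -/
theorem exists_frame (e : E) (he : ‖e‖ = 1) : ∃ e₁ e₂ : E, ‖e₁‖ = 1 ∧ ‖e₂‖ = 1 ∧
    ⟪e, e₁⟫_ℝ = 0 ∧ ⟪e, e₂⟫_ℝ = 0 ∧ ⟪e₁, e₂⟫_ℝ = 0 ∧
    ∀ Φ : E → ℝ≥0∞, Measurable Φ →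
      ∫⁻ x, Φ x = ∫⁻ z : ℝ, ∫⁻ p : ℝ × ℝ, Φ (z • e + (p.1 • e₁ + p.2 • e₂)) := by
  obtain ⟨b, hb⟩ := Orthonormal.exists_orthonormalBasis_extension_of_card_eq (𝕜 := ℝ) (E := E)
    (ι := Fin 3) (by simp) (v := fun _ => e) (s := {0}) (by
      constructor
      · intro i; simpa using he
      · intro i j hij; exact absurd (Subsingleton.elim i j) hij)
  have hb0 : b 0 = e := hb 0 rfl
  refine ⟨b 1, b 2, b.orthonormal.1 1, b.orthonormal.1 2, ?_, ?_, ?_, ?_⟩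
  · rw [← hb0]; exact b.orthonormal.2 (by decide)
  · rw [← hb0]; exact b.orthonormal.2 (by decide)
  · exact b.orthonormal.2 (by decide)
  intro Φ hΦ
  have m1 := b.measurePreserving_repr_symm
  have m2 := PiLp.volume_preserving_toLp (Fin 3)
  have m3 := (volume_preserving_piFinSuccAbove (fun _ : Fin 3 => ℝ) 0).symm
  have m4 : MeasurePreserving (Prod.map (id : ℝ → ℝ) (MeasurableEquiv.finTwoArrow (α := ℝ)).symm)
      volume volume := (MeasurePreserving.id volume).prod (volume_preserving_finTwoArrow ℝ).symm
  have m := m1.comp (m2.comp (m3.comp m4))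
  rw [← m.lintegral_comp hΦ]
  refine (lintegral_prod _ (hΦ.comp m.measurable).aemeasurable).trans ?_
  refine lintegral_congr fun z => lintegral_congr fun p => ?_
  refine congrArg Φ ?_
  change b.repr.symm _ = _
  rw [← b.sum_repr_symm, Fin.sum_univ_three, hb0]
  simp [MeasurableEquiv.piFinSuccAbove, add_assoc, MeasurableEquiv.finTwoArrow]

/-- Spherical coordinates with the axis `e`. -/
theorem exists_sphere_coordinates (e : E) (he : ‖e‖ = 1) : ∃ e₁ e₂ : E, ‖e₁‖ = 1 ∧ ‖e₂‖ = 1 ∧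
    ⟪e, e₁⟫_ℝ = 0 ∧ ⟪e, e₂⟫_ℝ = 0 ∧ ⟪e₁, e₂⟫_ℝ = 0 ∧
    ∀ Φ : E → ℝ≥0∞, Measurable Φ → ∫⁻ ω : Sph, Φ ω ∂sphereMeasure =
      ∫⁻ t in Ioo 0 Real.pi, ENNReal.ofReal (Real.sin t) * ∫⁻ s in Ioo (-Real.pi) Real.pi,
        Φ (Real.cos t • e + Real.sin t • (Real.cos s • e₁ + Real.sin s • e₂)) := by
  obtain ⟨e₁, e₂, h1, h2, h01, h02, h12, hfr⟩ := exists_frame e he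
  refine ⟨e₁, e₂, h1, h2, h01, h02, h12, fun Φ hΦ => ?_⟩
  let d : ℝ → ℝ → E := fun t s =>
    Real.cos t • e + Real.sin t • (Real.cos s • e₁ + Real.sin s • e₂)
  have hd : ∀ t s, ‖d t s‖ = 1 := by
    intro t s
    have : ‖d t s‖ ^ 2 = 1 := by
      rw [← real_inner_self_eq_norm_sq]
      simp only [d, inner_add_left, inner_add_right, inner_smul_left, inner_smul_right,
        real_inner_self_eq_norm_sq, real_inner_comm, he, h1, h2, h01, h02, h12, RCLike.conj_to_real]
      linear_combination (Real.sin t) ^ 2 * Real.sin_sq_add_cos_sq s + Real.sin_sq_add_cos_sq t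
    nlinarith [norm_nonneg (d t s)]
  have hdm : Measurable (fun p : ℝ × ℝ => d p.1 p.2) := by fun_prop
  -- The homogeneous extension of Φ of degree zero, cut to the unit ball, is integrated twice: in
  -- polar coordinates of space, and in coordinates (z, plane) with polar coordinates first in the
  -- plane orthogonal to e, then in the half-plane (z, r). Both results carry the same factor I =
  -- ∫₀¹ r² dr, which cancels.
  let Ψ : E → ℝ≥0∞ := fun x => (Metric.ball (0 : E) 1).indicator (fun x => Φ (‖x‖⁻¹ • x)) x
  have hΨ : Measurable Ψ := (hΦ.comp (by fun_prop)).indicator Metric.isOpen_ball.measurableSet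
  have hΨr : ∀ y : E, ‖y‖ = 1 → ∀ r : ℝ, 0 < r → Ψ (r • y) = (Ioo (0 : ℝ) 1).indicator
      (fun _ => Φ y) r := by
    intro y hy r hr
    have hn : ‖r • y‖ = r := by rw [norm_smul, hy, mul_one, Real.norm_of_nonneg hr.le]
    simp only [Ψ, indicator, Metric.mem_ball, dist_zero_right, hn, mem_Ioo, hr, true_and, smul_smul,
      inv_mul_cancel₀ hr.ne', one_smul]
  have hI : ∀ a : ℝ≥0∞, ∫⁻ r in Ioi (0 : ℝ), ENNReal.ofReal (r ^ 2) *
      (Ioo (0 : ℝ) 1).indicator (fun _ => a) r =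
      (∫⁻ r in Ioo (0 : ℝ) 1, ENNReal.ofReal (r ^ 2)) * a := by
    intro a
    have : ∀ r : ℝ, ENNReal.ofReal (r ^ 2) * (Ioo (0 : ℝ) 1).indicator (fun _ => a) r =
        (Ioo (0 : ℝ) 1).indicator (fun r => ENNReal.ofReal (r ^ 2) * a) r := by
      intro r; by_cases h : r ∈ Ioo (0 : ℝ) 1 <;> simp [h]
    simp_rw [this]
    rw [setLIntegral_indicator measurableSet_Ioo, lintegral_mul_const _ (by fun_prop),
      inter_eq_left.2 (fun x hx => hx.1)]
  set I : ℝ≥0∞ := ∫⁻ r in Ioo (0 : ℝ) 1, ENNReal.ofReal (r ^ 2) with hIdef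
  have hI0 : I ≠ 0 := by
    rw [hIdef, ← ofReal_integral_eq_lintegral_ofReal]
    · rw [← integral_Ioc_eq_integral_Ioo, ← intervalIntegral.integral_of_le (by norm_num)]
      simp only [integral_pow]
      norm_num
    · exact (ContinuousOn.integrableOn_Icc (by fun_prop)).mono_set Ioo_subset_Icc_self
    · exact Eventually.of_forall fun r => by positivity
  have hIt : I ≠ ∞ := by
    rw [hIdef, ← ofReal_integral_eq_lintegral_ofReal]
    · exact ENNReal.ofReal_ne_top
    · exact (ContinuousOn.integrableOn_Icc (by fun_prop)).mono_set Ioo_subset_Icc_self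
    · exact Eventually.of_forall fun r => by positivity
  have hA : ∫⁻ x, Ψ x = I * ∫⁻ ω : Sph, Φ ω ∂sphereMeasure := by
    have hm : Measurable fun ω : Sph => Φ ω := hΦ.comp measurable_subtype_coe
    rw [lintegral_polar Ψ hΨ, ← lintegral_const_mul _ hm]
    refine lintegral_congr fun ω => ?_
    rw [← hI]
    refine setLIntegral_congr_fun measurableSet_Ioi fun r hr => ?_
    rw [hΨr _ (norm_sph ω) r hr]
  have hB : ∫⁻ x, Ψ x = I * ∫⁻ t in Ioo 0 Real.pi, ENNReal.ofReal (Real.sin t) *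
      ∫⁻ s in Ioo (-Real.pi) Real.pi, Φ (d t s) := by
    rw [hfr Ψ hΨ]
    let c : ℝ → E := fun s => Real.cos s • e₁ + Real.sin s • e₂
    have hm3 : Measurable fun q : (ℝ × ℝ) × ℝ => Ψ (q.1.1 • e + q.1.2 • c q.2) :=
      hΨ.comp (by fun_prop)
    calc ∫⁻ z : ℝ, ∫⁻ p : ℝ × ℝ, Ψ (z • e + (p.1 • e₁ + p.2 • e₂))
        = ∫⁻ z : ℝ, ∫⁻ r in Ioi (0 : ℝ), ENNReal.ofReal r *
            ∫⁻ s in Ioo (-Real.pi) Real.pi, Ψ (z • e + r • c s) := by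
          refine lintegral_congr fun z => ?_
          rw [← lintegral_comp_polarCoord_symm]
          have : polarCoord.target = Ioi (0 : ℝ) ×ˢ Ioo (-Real.pi) Real.pi := rfl
          rw [this, Measure.volume_eq_prod, ← Measure.prod_restrict, lintegral_prod]
          · refine lintegral_congr fun r => ?_
            have hm : Measurable fun s : ℝ => Ψ (z • e + r • c s) := hΨ.comp (by fun_prop)
            rw [← lintegral_const_mul _ hm]
            refine lintegral_congr fun s => ?_
            simp [polarCoord, c, smul_smul]
          · refine Measurable.aemeasurable ?_
            have : Measurable fun x : ℝ × ℝ => ENNReal.ofReal x.1 *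
                Ψ (z • e + (x.1 * Real.cos x.2) • e₁ + (x.1 * Real.sin x.2) • e₂) :=
              (by fun_prop : Measurable fun x : ℝ × ℝ => ENNReal.ofReal x.1).mul
                (hΨ.comp (by fun_prop))
            convert this using 2 with x
            simp [polarCoord, add_assoc]
      _ = ∫⁻ p : ℝ × ℝ, (Ioi (0 : ℝ)).indicator (fun r => ENNReal.ofReal r *
            ∫⁻ s in Ioo (-Real.pi) Real.pi, Ψ (p.1 • e + r • c s)) p.2 := by
          rw [Measure.volume_eq_prod, lintegral_prod]
          · refine lintegral_congr fun z => ?_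
            rw [← lintegral_indicator measurableSet_Ioi]
          · refine Measurable.aemeasurable ?_
            have h1 : Measurable fun p : ℝ × ℝ => ENNReal.ofReal p.2 *
                ∫⁻ s in Ioo (-Real.pi) Real.pi, Ψ (p.1 • e + p.2 • c s) :=
              (by fun_prop : Measurable fun x : ℝ × ℝ => ENNReal.ofReal x.2).mul
                (hm3.lintegral_prod_right')
            exact h1.indicator (measurable_snd measurableSet_Ioi)
      _ = ∫⁻ r in Ioi (0 : ℝ), ∫⁻ t in Ioo (-Real.pi) Real.pi, ENNReal.ofReal r *
            (Ioi (0 : ℝ)).indicator (fun r' => ENNReal.ofReal r' *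
            ∫⁻ s in Ioo (-Real.pi) Real.pi, Ψ ((r * Real.cos t) • e + r' • c s))
              (r * Real.sin t) := by
          rw [← lintegral_comp_polarCoord_symm]
          have : polarCoord.target = Ioi (0 : ℝ) ×ˢ Ioo (-Real.pi) Real.pi := rfl
          rw [this, Measure.volume_eq_prod, ← Measure.prod_restrict, lintegral_prod]
          · simp [polarCoord]
          · refine Measurable.aemeasurable ?_
            have h1 : Measurable fun p : ℝ × ℝ => ENNReal.ofReal p.2 *
                ∫⁻ s in Ioo (-Real.pi) Real.pi, Ψ (p.1 • e + p.2 • c s) :=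
              (by fun_prop : Measurable fun x : ℝ × ℝ => ENNReal.ofReal x.2).mul
                (hm3.lintegral_prod_right')
            have h2 := h1.indicator (measurable_snd (measurableSet_Ioi (a := (0 : ℝ))))
            exact (by fun_prop : Measurable fun x : ℝ × ℝ => ENNReal.ofReal x.1).mul
              (h2.comp continuous_polarCoord_symm.measurable)
      _ = ∫⁻ r in Ioi (0 : ℝ), ENNReal.ofReal (r ^ 2) * (Ioo (0 : ℝ) 1).indicator (fun _ =>
            ∫⁻ t in Ioo 0 Real.pi, ENNReal.ofReal (Real.sin t) *
              ∫⁻ s in Ioo (-Real.pi) Real.pi, Φ (d t s)) r := by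
          refine setLIntegral_congr_fun measurableSet_Ioi fun r hr => ?_
          have hr : 0 < r := hr
          have hpi := Real.pi_pos
          have hms : Measurable fun t => ∫⁻ s in Ioo (-Real.pi) Real.pi, Φ (d t s) :=
            (hΦ.comp hdm).lintegral_prod_right'
          have e1 : ∀ t ∈ Ioo (-Real.pi) Real.pi, ENNReal.ofReal r *
            (Ioi (0 : ℝ)).indicator (fun r' => ENNReal.ofReal r' *
            ∫⁻ s in Ioo (-Real.pi) Real.pi, Ψ ((r * Real.cos t) • e + r' • c s))
              (r * Real.sin t) = (Ioo 0 Real.pi).indicator (fun t => ENNReal.ofReal (r ^ 2) *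
                (ENNReal.ofReal (Real.sin t) * (Ioo (0 : ℝ) 1).indicator (fun _ =>
                  ∫⁻ s in Ioo (-Real.pi) Real.pi, Φ (d t s)) r)) t := by
            intro t ht
            by_cases h0 : 0 < t
            · have hs : 0 < Real.sin t := Real.sin_pos_of_pos_of_lt_pi h0 ht.2
              rw [indicator_of_mem (show r * Real.sin t ∈ Ioi (0 : ℝ) from mul_pos hr hs),
                indicator_of_mem (show t ∈ Ioo 0 Real.pi from ⟨h0, ht.2⟩)]
              have : ∀ s, Ψ ((r * Real.cos t) • e + (r * Real.sin t) • c s) =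
                  (Ioo (0 : ℝ) 1).indicator (fun _ => Φ (d t s)) r := by
                intro s
                rw [← hΨr _ (hd t s) r hr]
                simp only [d, c, smul_add, smul_smul, mul_assoc]
              simp_rw [this]
              rw [ENNReal.ofReal_mul hr.le, pow_two, ENNReal.ofReal_mul hr.le]
              by_cases h : r ∈ Ioo (0 : ℝ) 1 <;> simp [h, mul_assoc]
            · have hs : Real.sin t ≤ 0 := by
                have := Real.sin_nonneg_of_nonneg_of_le_pi (x := -t) (by linarith)
                  (by linarith [ht.1])
                rw [Real.sin_neg] at this; linarith
              rw [indicator_of_notMem (by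
                  simp only [mem_Ioi, not_lt]; exact mul_nonpos_of_nonneg_of_nonpos hr.le hs),
                indicator_of_notMem (fun h => h0 h.1), mul_zero]
          rw [setLIntegral_congr_fun measurableSet_Ioo e1, setLIntegral_indicator measurableSet_Ioo,
            show Ioo 0 Real.pi ∩ Ioo (-Real.pi) Real.pi = Ioo 0 Real.pi from
              inter_eq_left.2 (fun x hx => ⟨by linarith [hx.1], hx.2⟩), lintegral_const_mul]
          · by_cases h : r ∈ Ioo (0 : ℝ) 1 <;> simp [h]
          · by_cases h : r ∈ Ioo (0 : ℝ) 1
            · simp only [indicator_of_mem h]; fun_prop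
            · simp only [indicator_of_notMem h]; fun_prop
      _ = _ := hI _
  exact (ENNReal.mul_right_inj hI0 hIt).1 (hA.symm.trans hB)

/-- Archimedes: in spherical coordinates with axis e the height cos t is uniformly distributed. The
factor 4π is 2π for the longitude times 2 for the two signs of the height. -/
theorem lintegral_sphere_abs_inner (Ψ : ℝ → ℝ≥0∞) (hΨ : Measurable Ψ) (e : E) (he : ‖e‖ = 1) :
    ∫⁻ ω : Sph, Ψ |⟪(ω : E), e⟫_ℝ| ∂sphereMeasure =
      ENNReal.ofReal (4 * Real.pi) * ∫⁻ z in Icc (0 : ℝ) 1, Ψ z := by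
  obtain ⟨e₁, e₂, h1, h2, h01, h02, h12, hs⟩ := exists_sphere_coordinates e he
  have hpi := Real.pi_pos
  rw [hs (fun x => Ψ |⟪x, e⟫_ℝ|) (by fun_prop)]
  have hin : ∀ t s : ℝ, ⟪Real.cos t • e + Real.sin t • (Real.cos s • e₁ + Real.sin s • e₂), e⟫_ℝ
      = Real.cos t := by
    intro t s
    rw [real_inner_comm]
    simp only [inner_add_right, inner_smul_right, real_inner_self_eq_norm_sq, he, h01, h02]
    ring
  simp only [hin, lintegral_const, Measure.restrict_apply MeasurableSet.univ, univ_inter,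
    Real.volume_Ioo]
  have hcov : ∫⁻ z in Real.cos '' Ioo 0 Real.pi, Ψ |z| =
      ∫⁻ t in Ioo 0 Real.pi, ENNReal.ofReal |(-Real.sin t)| * Ψ |Real.cos t| :=
    lintegral_image_eq_lintegral_abs_deriv_mul measurableSet_Ioo
      (fun t _ => (Real.hasDerivAt_cos t).hasDerivWithinAt)
      (Real.injOn_cos.mono Ioo_subset_Icc_self) (fun z => Ψ |z|)
  have himg : Real.cos '' Ioo 0 Real.pi = Ioo (-1) 1 := by
    ext z
    constructor
    · rintro ⟨t, ht, rfl⟩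
      constructor
      · rw [← Real.cos_pi]
        exact Real.strictAntiOn_cos ⟨ht.1.le, ht.2.le⟩ ⟨hpi.le, le_rfl⟩ ht.2
      · rw [← Real.cos_zero]
        exact Real.strictAntiOn_cos ⟨le_rfl, hpi.le⟩ ⟨ht.1.le, ht.2.le⟩ ht.1
    · rintro ⟨ha, hb⟩
      refine ⟨Real.arccos z, ⟨Real.arccos_pos.2 hb, ?_⟩, Real.cos_arccos ha.le hb.le⟩
      refine lt_of_le_of_ne (Real.arccos_le_pi z) fun h => ?_
      rw [Real.arccos_eq_pi] at h; linarith
  have hsplit : ∫⁻ z in Ioo (-1 : ℝ) 1, Ψ |z| = 2 * ∫⁻ z in Icc (0 : ℝ) 1, Ψ z := by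
    have hu : Ioo (-1 : ℝ) 1 = Ioo (-1) 0 ∪ Ico 0 1 := by
      rw [Ioo_union_Ico_eq_Ioo] <;> norm_num
    rw [hu, lintegral_union measurableSet_Ico (by
      rw [Set.disjoint_left]; intro x hx hx'; exact absurd hx.2 (not_lt.2 hx'.1)), two_mul]
    congr 1
    · rw [setLIntegral_congr (Ioo_ae_eq_Icc (a := (0 : ℝ)) (b := 1)).symm]
      have := (Measure.measurePreserving_neg (volume : Measure ℝ)).setLIntegral_comp_preimage
        (measurableSet_Ioo (a := (0 : ℝ)) (b := 1)) hΨ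
      rw [← this]
      have : (fun x : ℝ => -x) ⁻¹' Ioo 0 1 = Ioo (-1) 0 := by
        ext x; simp [and_comm, neg_lt]
      rw [show (Neg.neg : ℝ → ℝ) ⁻¹' Ioo 0 1 = Ioo (-1) 0 from this]
      exact setLIntegral_congr_fun measurableSet_Ioo fun x hx => by rw [abs_of_neg hx.2]
    · rw [setLIntegral_congr (Ico_ae_eq_Icc (a := (0 : ℝ)) (b := 1)).symm]
      exact setLIntegral_congr_fun measurableSet_Ico fun x hx => by rw [abs_of_nonneg hx.1]
  have h4 : ENNReal.ofReal (4 * Real.pi) = ENNReal.ofReal (Real.pi - -Real.pi) * 2 := by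
    rw [show (2 : ℝ≥0∞) = ENNReal.ofReal 2 by simp, ← ENNReal.ofReal_mul (by linarith)]
    congr 1; ring
  rw [h4, mul_assoc, ← hsplit, ← himg, hcov, ← lintegral_const_mul _ (by fun_prop)]
  refine setLIntegral_congr_fun measurableSet_Ioo fun t ht => ?_
  rw [abs_neg, abs_of_pos (Real.sin_pos_of_pos_of_lt_pi ht.1 ht.2)]
  ring

/-- Exchanging the components of `V` along `ω` and orthogonal to `ω`. -/
theorem lintegral_sphere_orthogonal_le {η : ℝ} (hη : 0 < η) (β : ℝ → ℝ≥0∞) (hβm : Measurable β)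
    (hβ1 : ∀ z, β z ≤ 1) (hβs : ∀ z, β z ≠ 0 → η ≤ z ∧ z ^ 2 ≤ 1 - η ^ 2) (Φ : E → ℝ≥0∞)
    (hΦ : Measurable Φ) (V : E) (hV : V ≠ 0) :
    ∫⁻ ω : Sph, β (|⟪(ω : E), V⟫_ℝ| / ‖V‖) * Φ (V - ⟪(ω : E), V⟫_ℝ • (ω : E)) ∂sphereMeasure ≤
      ENNReal.ofReal (2 / η) * ∫⁻ ω : Sph, (if η * ‖V‖ ≤ |⟪(ω : E), V⟫_ℝ| then 1 else 0) *
        Φ (⟪(ω : E), V⟫_ℝ • (ω : E)) ∂sphereMeasure := by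
  have hρ : 0 < ‖V‖ := norm_pos_iff.2 hV
  set ρ := ‖V‖
  set e : E := ρ⁻¹ • V with he'
  have he : ‖e‖ = 1 := by rw [he', norm_smul, norm_inv, norm_norm, inv_mul_cancel₀ hρ.ne']
  have hVe : V = ρ • e := by rw [he', smul_smul, mul_inv_cancel₀ hρ.ne', one_smul]
  obtain ⟨e₁, e₂, h1, h2, h01, h02, h12, hs⟩ := exists_sphere_coordinates e he
  have hpi := Real.pi_pos
  have hm1 : Measurable fun x : E => β (|⟪x, V⟫_ℝ| / ρ) * Φ (V - ⟪x, V⟫_ℝ • x) :=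
    (hβm.comp (by fun_prop)).mul (hΦ.comp (by fun_prop))
  have hset : MeasurableSet {x : E | η * ρ ≤ |⟪x, V⟫_ℝ|} :=
    measurableSet_le (by fun_prop) (by fun_prop)
  have hm2 : Measurable fun x : E => (if η * ρ ≤ |⟪x, V⟫_ℝ| then (1 : ℝ≥0∞) else 0) *
      Φ (⟪x, V⟫_ℝ • x) :=
    (Measurable.ite hset measurable_const measurable_const).mul (hΦ.comp (by fun_prop))
  rw [hs _ hm1, hs _ hm2]
  let d : ℝ → ℝ → E := fun t s =>
    Real.cos t • e + Real.sin t • (Real.cos s • e₁ + Real.sin s • e₂)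
  have hdm : Measurable (fun p : ℝ × ℝ => d p.1 p.2) := by fun_prop
  have hin : ∀ t s : ℝ, ⟪d t s, V⟫_ℝ = ρ * Real.cos t := by
    intro t s
    rw [hVe, real_inner_smul_right, real_inner_comm]
    simp only [d, inner_add_right, inner_smul_right, real_inner_self_eq_norm_sq, he, h01, h02]
    ring
  change ∫⁻ t in Ioo 0 Real.pi, ENNReal.ofReal (Real.sin t) * ∫⁻ s in Ioo (-Real.pi) Real.pi,
      β (|⟪d t s, V⟫_ℝ| / ρ) * Φ (V - ⟪d t s, V⟫_ℝ • d t s) ≤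
    ENNReal.ofReal (2 / η) * ∫⁻ t in Ioo 0 Real.pi, ENNReal.ofReal (Real.sin t) *
      ∫⁻ s in Ioo (-Real.pi) Real.pi, (if η * ρ ≤ |⟪d t s, V⟫_ℝ| then (1 : ℝ≥0∞) else 0) *
        Φ (⟪d t s, V⟫_ℝ • d t s)
  simp only [hin]
  have hc : ∀ t, |ρ * Real.cos t| / ρ = |Real.cos t| := fun t => by
    rw [abs_mul, abs_of_pos hρ]; field_simp
  have hc' : ∀ t, (η * ρ ≤ |ρ * Real.cos t|) ↔ η ≤ |Real.cos t| := fun t => by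
    rw [abs_mul, abs_of_pos hρ, mul_comm η, mul_le_mul_iff_right₀ hρ]
  simp only [hc, hc']
  let K : ℝ → ℝ≥0∞ := fun t => ∫⁻ s in Ioo (-Real.pi) Real.pi, Φ ((ρ * Real.cos t) • d t s)
  have hKm : Measurable K := by
    have : Measurable fun p : ℝ × ℝ => Φ ((ρ * Real.cos p.1) • d p.1 p.2) := hΦ.comp (by fun_prop)
    exact this.lintegral_prod_right'
  let G : ℝ → ℝ≥0∞ := (Ioo 0 Real.pi).indicator fun t => ENNReal.ofReal (Real.sin t) *
      ((if η ≤ |Real.cos t| then (1 : ℝ≥0∞) else 0) * K t)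
  have hGm : Measurable G := by
    refine Measurable.indicator ?_ measurableSet_Ioo
    exact (by fun_prop : Measurable fun t => ENNReal.ofReal (Real.sin t)).mul
      ((Measurable.ite (measurableSet_le (by fun_prop) (by fun_prop)) measurable_const
        measurable_const).mul hKm)
  have hRHS : ∫⁻ t in Ioo 0 Real.pi, ENNReal.ofReal (Real.sin t) *
      ∫⁻ s in Ioo (-Real.pi) Real.pi, (if η ≤ |Real.cos t| then (1 : ℝ≥0∞) else 0) *
        Φ ((ρ * Real.cos t) • d t s) = ∫⁻ t, G t := by
    rw [lintegral_indicator measurableSet_Ioo]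
    refine setLIntegral_congr_fun measurableSet_Ioo fun t _ => ?_
    have : Measurable fun s : ℝ => Φ ((ρ * Real.cos t) • d t s) := hΦ.comp (by fun_prop)
    rw [lintegral_const_mul _ this]
  rw [hRHS]
  -- A quarter turn of the polar angle replaces ω by its orthogonal partner in the plane of V and ω,
  -- and so exchanges the two components of V. The densities sin t and sin t' = |cos t| are
  -- comparable because the profile lives where |cos t| ≥ η.
  have key : ∀ t t' : ℝ, (t' = t + Real.pi / 2 ∨ t' = t - Real.pi / 2) → t ∈ Ioo 0 Real.pi →
      t' ∈ Ioo 0 Real.pi → ENNReal.ofReal (Real.sin t) * ∫⁻ s in Ioo (-Real.pi) Real.pi,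
        β |Real.cos t| * Φ (V - (ρ * Real.cos t) • d t s) ≤ ENNReal.ofReal (1 / η) * G t' := by
    intro t t' htt' ht ht'
    have hst := Real.sin_pos_of_pos_of_lt_pi ht.1 ht.2
    have hst' := Real.sin_pos_of_pos_of_lt_pi ht'.1 ht'.2
    have hvec : ∀ s, V - (ρ * Real.cos t) • d t s = (ρ * Real.cos t') • d t' s := by
      intro s
      rw [hVe]
      have hone := Real.sin_sq_add_cos_sq t
      rcases htt' with rfl | rfl
      · simp only [d, Real.cos_add_pi_div_two, Real.sin_add_pi_div_two]
        have : ρ • e = (ρ * (Real.sin t ^ 2 + Real.cos t ^ 2)) • e := by rw [hone, mul_one]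
        rw [this]; module
      · simp only [d, Real.cos_sub_pi_div_two, Real.sin_sub_pi_div_two]
        have : ρ • e = (ρ * (Real.sin t ^ 2 + Real.cos t ^ 2)) • e := by rw [hone, mul_one]
        rw [this]; module
    have habs : |Real.cos t| = Real.sin t' ∧ |Real.cos t'| = Real.sin t := by
      rcases htt' with rfl | rfl
      · rw [Real.cos_add_pi_div_two, Real.sin_add_pi_div_two] at *
        exact ⟨abs_of_pos hst', by rw [abs_neg, abs_of_pos hst]⟩
      · rw [Real.cos_sub_pi_div_two, Real.sin_sub_pi_div_two] at *
        exact ⟨by rw [← abs_neg, abs_of_pos hst'], abs_of_pos hst⟩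
    simp only [hvec]
    have hm : Measurable fun s : ℝ => Φ ((ρ * Real.cos t') • d t' s) := hΦ.comp (by fun_prop)
    rw [lintegral_const_mul _ hm]
    change _ * (_ * K t') ≤ _
    by_cases hb : β |Real.cos t| = 0
    · rw [hb]; simp
    obtain ⟨hb1, hb2⟩ := hβs _ hb
    have hη' : η ≤ |Real.cos t'| := by
      rw [habs.2]
      rw [sq_abs] at hb2
      have := Real.sin_sq_add_cos_sq t
      exact (sq_le_sq₀ hη.le hst.le).1 (by linarith)
    simp only [G]
    rw [indicator_of_mem ht', if_pos hη', one_mul, ← mul_assoc, ← mul_assoc]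
    refine mul_le_mul' ?_ le_rfl
    calc ENNReal.ofReal (Real.sin t) * β |Real.cos t| ≤ (1 : ℝ≥0∞) * 1 := by
          gcongr
          · exact ENNReal.ofReal_le_one.2 (Real.sin_le_one t)
          · exact hβ1 _
      _ ≤ ENNReal.ofReal (1 / η) * ENNReal.ofReal (Real.sin t') := by
          rw [one_mul, ← ENNReal.ofReal_mul (by positivity)]
          rw [ENNReal.one_le_ofReal, ← habs.1, one_div, ← div_eq_inv_mul, one_le_div hη]
          exact hb1
  -- For t ≠ π/2 exactly one of the shifts by ±π/2 stays in (0, π); at t = π/2 the profile vanishes.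
  -- Adding both shifts accounts for the constant 2/η.
  calc _ ≤ ∫⁻ t, (ENNReal.ofReal (1 / η) * G (t + Real.pi / 2) +
        ENNReal.ofReal (1 / η) * G (t - Real.pi / 2)) := by
        rw [← lintegral_indicator measurableSet_Ioo]
        refine lintegral_mono fun t => ?_
        by_cases ht : t ∈ Ioo 0 Real.pi
        · rw [indicator_of_mem ht]
          rcases lt_trichotomy t (Real.pi / 2) with h | h | h
          · exact (key t _ (Or.inl rfl) ht ⟨by linarith [ht.1], by linarith⟩).trans le_self_add
          · rw [h, Real.cos_pi_div_two]
            have : β |(0 : ℝ)| = 0 := by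
              by_contra h0; have := (hβs _ h0).1; rw [abs_zero] at this; linarith
            simp only [this, zero_mul, lintegral_zero, mul_zero]
            exact zero_le
          · exact (key t _ (Or.inr rfl) ht ⟨by linarith, by linarith [ht.2]⟩).trans le_add_self
        · rw [indicator_of_notMem ht]; exact zero_le
    _ = ENNReal.ofReal (2 / η) * ∫⁻ t, G t := by
        have g1 : Measurable fun t => G (t + Real.pi / 2) := hGm.comp (by fun_prop)
        have g2 : Measurable fun t => G (t - Real.pi / 2) := hGm.comp (by fun_prop)
        rw [lintegral_add_left (g1.const_mul _), lintegral_const_mul _ g1,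
          lintegral_const_mul _ g2, lintegral_add_right_eq_self, lintegral_sub_right_eq_self,
          ← add_mul, ← ENNReal.ofReal_add (by positivity) (by positivity)]
        congr 2; ring

/-- Sections of the ball orthogonal to e fit in a square of side 2R. -/
theorem lintegral_ball_inner_le (ψ : ℝ → ℝ≥0∞) (hψ : Measurable ψ) (e : E) (he : ‖e‖ = 1) {R : ℝ}
    (hR : 0 ≤ R) : ∫⁻ V : E, (if ‖V‖ ≤ R then 1 else 0) * ψ ⟪e, V⟫_ℝ ≤
      ENNReal.ofReal (4 * R ^ 2) * ∫⁻ r, ψ r := by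
  obtain ⟨e₁, e₂, h1, h2, h01, h02, h12, hs⟩ := exists_frame e he
  have hm : Measurable fun V : E => (if ‖V‖ ≤ R then (1 : ℝ≥0∞) else 0) * ψ ⟪e, V⟫_ℝ :=
    (Measurable.ite (measurableSet_le (by fun_prop) (by fun_prop)) measurable_const
        measurable_const).mul (hψ.comp (by fun_prop))
  rw [hs _ hm, ← lintegral_const_mul _ hψ]
  refine lintegral_mono fun z => ?_
  have hin : ∀ p : ℝ × ℝ, ⟪e, z • e + (p.1 • e₁ + p.2 • e₂)⟫_ℝ = z := by
    intro p
    simp only [inner_add_right, inner_smul_right, real_inner_self_eq_norm_sq, he, h01, h02]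
    ring
  simp only [hin]
  calc _ ≤ ∫⁻ p : ℝ × ℝ, (Icc (-R) R ×ˢ Icc (-R) R).indicator (fun _ => ψ z) p := by
        refine lintegral_mono fun p => ?_
        by_cases hp : ‖z • e + (p.1 • e₁ + p.2 • e₂)‖ ≤ R
        · rw [if_pos hp, one_mul, indicator_of_mem]
          have a1 : ⟪e₁, z • e + (p.1 • e₁ + p.2 • e₂)⟫_ℝ = p.1 := by
            simp only [inner_add_right, inner_smul_right, real_inner_self_eq_norm_sq, h1,
              real_inner_comm e, h01, h12]
            ring
          have a2 : ⟪e₂, z • e + (p.1 • e₁ + p.2 • e₂)⟫_ℝ = p.2 := by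
            simp only [inner_add_right, inner_smul_right, real_inner_self_eq_norm_sq, h2,
              real_inner_comm e, h02, real_inner_comm e₁, h12]
            ring
          have b1 := abs_real_inner_le_norm e₁ (z • e + (p.1 • e₁ + p.2 • e₂))
          have b2 := abs_real_inner_le_norm e₂ (z • e + (p.1 • e₁ + p.2 • e₂))
          rw [a1, h1, one_mul] at b1
          rw [a2, h2, one_mul] at b2
          exact ⟨abs_le.1 (b1.trans hp), abs_le.1 (b2.trans hp)⟩
        · rw [if_neg hp, zero_mul]; exact zero_le
    _ = _ := by
        rw [lintegral_indicator (measurableSet_Icc.prod measurableSet_Icc), lintegral_const,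
          Measure.restrict_apply MeasurableSet.univ, univ_inter, Measure.volume_eq_prod,
          Measure.prod_prod, Real.volume_Icc, ← ENNReal.ofReal_mul (by linarith), mul_comm]
        congr 2; ring

/-- For fixed ω the integrand sees V only through r = ω·V, so integrating V over the ball leaves dr
up to the area 4R². What remains, dr dω on |r| ≥ η, is at most η⁻² r² dr dω, polar coordinates up to
a constant; both signs of r occur, hence the 2. -/
theorem lintegral_ball_sphere_parallel_le {η R : ℝ} (hη : 0 < η) (hR : 0 ≤ R) (Φ : E → ℝ≥0∞)
    (hΦ : Measurable Φ) :
    ∫⁻ V : E, (if ‖V‖ ≤ R then 1 else 0) * ∫⁻ ω : Sph,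
      (if η ≤ |⟪(ω : E), V⟫_ℝ| then 1 else 0) * Φ (⟪(ω : E), V⟫_ℝ • (ω : E)) ∂sphereMeasure ≤
    ENNReal.ofReal (4 * R ^ 2) * (ENNReal.ofReal (2 / η ^ 2) * ∫⁻ x, Φ x) := by
  have hψm : Measurable fun q : Sph × ℝ => (if η ≤ |q.2| then (1 : ℝ≥0∞) else 0) *
      Φ (q.2 • (q.1 : E)) :=
    (Measurable.ite (measurableSet_le (by fun_prop) (by fun_prop)) measurable_const
      measurable_const).mul (hΦ.comp (by fun_prop))
  have hm : Measurable fun q : E × Sph => (if ‖q.1‖ ≤ R then (1 : ℝ≥0∞) else 0) *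
      ((if η ≤ |⟪(q.2 : E), q.1⟫_ℝ| then 1 else 0) * Φ (⟪(q.2 : E), q.1⟫_ℝ • (q.2 : E))) :=
    (Measurable.ite (measurableSet_le (by fun_prop) (by fun_prop)) measurable_const
      measurable_const).mul (hψm.comp (by fun_prop : Measurable fun q : E × Sph =>
        (q.2, ⟪(q.2 : E), q.1⟫_ℝ)))
  calc _ = ∫⁻ V : E, (∫⁻ ω : Sph, (if ‖V‖ ≤ R then 1 else 0) *
      ((if η ≤ |⟪(ω : E), V⟫_ℝ| then 1 else 0) * Φ (⟪(ω : E), V⟫_ℝ • (ω : E))) ∂sphereMeasure) := by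
        refine lintegral_congr fun V => ?_
        rw [lintegral_const_mul]
        exact hψm.comp (by fun_prop : Measurable fun ω : Sph => (ω, ⟪(ω : E), V⟫_ℝ))
    _ = ∫⁻ ω : Sph, (∫⁻ V : E, (if ‖V‖ ≤ R then 1 else 0) *
      ((if η ≤ |⟪(ω : E), V⟫_ℝ| then 1 else 0) * Φ (⟪(ω : E), V⟫_ℝ • (ω : E)))) ∂sphereMeasure :=
        lintegral_lintegral_swap hm.aemeasurable
    _ ≤ ∫⁻ ω : Sph, ENNReal.ofReal (4 * R ^ 2) * (∫⁻ r : ℝ,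
      ((if η ≤ |r| then 1 else 0) * Φ (r • (ω : E)))) ∂sphereMeasure := by
        refine lintegral_mono fun ω => ?_
        exact lintegral_ball_inner_le _ (hψm.comp measurable_prodMk_left) _ (norm_sph ω) hR
    _ = ENNReal.ofReal (4 * R ^ 2) * ∫⁻ ω : Sph, (∫⁻ r : ℝ,
      ((if η ≤ |r| then 1 else 0) * Φ (r • (ω : E)))) ∂sphereMeasure :=
        lintegral_const_mul _ hψm.lintegral_prod_right'
    _ ≤ _ := by
        gcongr
        have hΦ' : Measurable fun x => Φ x + Φ (-x) := hΦ.add (hΦ.comp measurable_neg)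
        have h2 : ENNReal.ofReal (2 / η ^ 2) * ∫⁻ x, Φ x =
            ENNReal.ofReal (1 / η ^ 2) * ∫⁻ x, (Φ x + Φ (-x)) := by
          have h3 : ENNReal.ofReal (2 / η ^ 2) = ENNReal.ofReal (1 / η ^ 2) +
              ENNReal.ofReal (1 / η ^ 2) := by
            rw [← ENNReal.ofReal_add (by positivity) (by positivity)]
            congr 1; ring
          rw [lintegral_add_left hΦ, (Measure.measurePreserving_neg
            (volume : Measure E)).lintegral_comp hΦ, h3, add_mul, mul_add]
        have hm4 : Measurable fun ω : Sph => ∫⁻ r in Ioi (0 : ℝ), ENNReal.ofReal (r ^ 2) *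
            (Φ (r • (ω : E)) + Φ (-(r • (ω : E)))) := by
          have : Measurable fun q : Sph × ℝ => ENNReal.ofReal (q.2 ^ 2) *
            (Φ (q.2 • (q.1 : E)) + Φ (-(q.2 • (q.1 : E)))) :=
            (by fun_prop : Measurable fun q : Sph × ℝ => ENNReal.ofReal (q.2 ^ 2)).mul
              (hΦ'.comp (by fun_prop : Measurable fun q : Sph × ℝ => q.2 • (q.1 : E)))
          exact this.lintegral_prod_right'
        rw [h2, lintegral_polar _ hΦ', ← lintegral_const_mul _ hm4]
        refine lintegral_mono fun ω => ?_
        have hm5 : Measurable fun r : ℝ => ENNReal.ofReal (r ^ 2) *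
            (Φ (r • (ω : E)) + Φ (-(r • (ω : E)))) :=
          (by fun_prop : Measurable fun r : ℝ => ENNReal.ofReal (r ^ 2)).mul
              (hΦ'.comp (by fun_prop : Measurable fun r : ℝ => r • (ω : E)))
        have hψω : Measurable fun r : ℝ => (if η ≤ |r| then (1 : ℝ≥0∞) else 0) *
            Φ (r • (ω : E)) := hψm.comp measurable_prodMk_left
        rw [← lintegral_const_mul _ hm5,
          ← lintegral_add_compl _ (measurableSet_Ioi (a := (0 : ℝ))), compl_Ioi]
        have : ∫⁻ r in Iic (0 : ℝ), (if η ≤ |r| then (1 : ℝ≥0∞) else 0) * Φ (r • (ω : E)) =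
            ∫⁻ r in Ioi (0 : ℝ), (if η ≤ |r| then (1 : ℝ≥0∞) else 0) * Φ (-(r • (ω : E))) := by
          rw [setLIntegral_congr (Iio_ae_eq_Iic (a := (0 : ℝ))).symm]
          have := (Measure.measurePreserving_neg (volume : Measure ℝ)).setLIntegral_comp_preimage
            (measurableSet_Iio (a := (0 : ℝ))) hψω
          rw [← this]
          have h3 : (Neg.neg : ℝ → ℝ) ⁻¹' Iio 0 = Ioi 0 := by ext x; simp
          rw [h3]
          refine setLIntegral_congr_fun measurableSet_Ioi fun r _ => ?_
          simp
        rw [this, ← lintegral_add_left hψω]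
        refine setLIntegral_mono (hm5.const_mul _) fun r hr => ?_
        by_cases h : η ≤ |r|
        · rw [if_pos h, one_mul, one_mul, ← mul_assoc, ← ENNReal.ofReal_mul (by positivity)]
          refine le_mul_of_one_le_left zero_le ?_
          rw [ENNReal.one_le_ofReal, one_div, ← div_eq_inv_mul, one_le_div (by positivity),
            ← sq_abs r]
          gcongr
        · simp [h]

/-! ### Collision geometry and Maxwellians. -/

/-- The kernel of a cutoff hard potential. -/
def kern (θ : ℝ) (b : ℝ → ℝ) (ω V : E) : ℝ := ‖V‖ ^ θ * b (|⟪ω, V⟫_ℝ| / ‖V‖)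

/-- The space of collisions `(v, v_*, ω)`. -/
abbrev Coll : Type := E × (E × Sph)

/-- `dv_* dω`. -/
def pairMeasure : Measure (E × Sph) := (volume : Measure E).prod sphereMeasure

instance : SigmaFinite pairMeasure := by unfold pairMeasure; infer_instance

/-- `dv dv_* dω`. -/
def collMeasure : Measure Coll := (volume : Measure E).prod pairMeasure

/-- `(v, v_*, ω) ↦ (v', v_*', ω)`. -/
def collide (q : Coll) : Coll := (vPrime q.2.2 q.1 q.2.1, (vsPrime q.2.2 q.1 q.2.1, q.2.2))

/-- `(v, v_*, ω) ↦ (v_*, v, ω)`. -/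
def exchange (q : Coll) : Coll := (q.2.1, (q.1, q.2.2))

@[fun_prop] lemma Measurable.vPrime {α : Type*} [MeasurableSpace α] {f g h : α → E}
    (hf : Measurable f) (hg : Measurable g) (hh : Measurable h) :
    Measurable fun a => vPrime (f a) (g a) (h a) := by
  unfold ExteriorBoltzmann.vPrime; fun_prop

@[fun_prop] lemma Measurable.vsPrime {α : Type*} [MeasurableSpace α] {f g h : α → E}
    (hf : Measurable f) (hg : Measurable g) (hh : Measurable h) :
    Measurable fun a => vsPrime (f a) (g a) (h a) := by
  unfold ExteriorBoltzmann.vsPrime; fun_prop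

@[fun_prop] lemma measurable_collide : Measurable collide := by
  unfold collide vPrime vsPrime; fun_prop

@[fun_prop] lemma measurable_exchange : Measurable exchange := by
  unfold exchange; fun_prop

lemma vPrime_sub_vsPrime (ω v vs : E) :
    vPrime ω v vs - vsPrime ω v vs = (v - vs) - (2 * ⟪v - vs, ω⟫_ℝ) • ω := by
  unfold vPrime vsPrime; module

lemma vPrime_vPrime (ω v vs : E) (hω : ‖ω‖ = 1) :
    vPrime ω (vPrime ω v vs) (vsPrime ω v vs) = v := by
  have h : ⟪vPrime ω v vs - vsPrime ω v vs, ω⟫_ℝ = -⟪v - vs, ω⟫_ℝ := by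
    rw [vPrime_sub_vsPrime, inner_sub_left, inner_smul_left, real_inner_self_eq_norm_sq, hω,
      RCLike.conj_to_real]; ring
  rw [vPrime, h, vPrime]; module

lemma vsPrime_vPrime (ω v vs : E) (hω : ‖ω‖ = 1) :
    vsPrime ω (vPrime ω v vs) (vsPrime ω v vs) = vs := by
  have h : ⟪vPrime ω v vs - vsPrime ω v vs, ω⟫_ℝ = -⟪v - vs, ω⟫_ℝ := by
    rw [vPrime_sub_vsPrime, inner_sub_left, inner_smul_left, real_inner_self_eq_norm_sq, hω,
      RCLike.conj_to_real]; ring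
  rw [vsPrime, h, vsPrime]; module

lemma collide_collide (q : Coll) : collide (collide q) = q := by
  simp only [collide, vPrime_vPrime _ _ _ (norm_sph q.2.2), vsPrime_vPrime _ _ _ (norm_sph q.2.2)]

lemma vPrime_swap (ω v vs : E) : vPrime ω vs v = vsPrime ω v vs := by
  rw [vPrime, vsPrime, ← neg_sub v vs, inner_neg_left]; module

lemma vsPrime_swap (ω v vs : E) : vsPrime ω vs v = vPrime ω v vs := by
  rw [← vPrime_swap]

lemma norm_vPrime_sub (ω v vs : E) (hω : ‖ω‖ = 1) :
    ‖vPrime ω v vs - vsPrime ω v vs‖ = ‖v - vs‖ := by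
  rw [vPrime_sub_vsPrime]
  refine (sq_eq_sq₀ (norm_nonneg _) (norm_nonneg _)).1 ?_
  rw [norm_sub_sq_real, norm_smul, inner_smul_right, hω, Real.norm_eq_abs, mul_one, sq_abs]
  ring

/-- Microreversibility: a collision only reverses the ω-component of the relative velocity, and the
kernel sees that component through its modulus. -/
lemma kern_collide (θ : ℝ) (b : ℝ → ℝ) (ω v vs : E) (hω : ‖ω‖ = 1) :
    kern θ b ω (vPrime ω v vs - vsPrime ω v vs) = kern θ b ω (v - vs) := by
  have h : ⟪ω, vPrime ω v vs - vsPrime ω v vs⟫_ℝ = -⟪ω, v - vs⟫_ℝ := by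
    rw [vPrime_sub_vsPrime, inner_sub_right, inner_smul_right, real_inner_self_eq_norm_sq, hω,
      real_inner_comm]; ring
  rw [kern, kern, norm_vPrime_sub _ _ _ hω, h, abs_neg]

lemma kern_neg (θ : ℝ) (b : ℝ → ℝ) (ω V : E) : kern θ b ω (-V) = kern θ b ω V := by
  rw [kern, kern, norm_neg, inner_neg_right, abs_neg]

lemma kern_swap (θ : ℝ) (b : ℝ → ℝ) (ω v vs : E) : kern θ b ω (vs - v) = kern θ b ω (v - vs) := by
  rw [← kern_neg, neg_sub]

lemma kern_nonneg {θ : ℝ} {b : ℝ → ℝ} (hb : ∀ z, 0 ≤ b z) (ω V : E) : 0 ≤ kern θ b ω V :=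
  mul_nonneg (Real.rpow_nonneg (norm_nonneg _) _) (hb _)

@[fun_prop] lemma Measurable.kern {α : Type*} [MeasurableSpace α] {θ : ℝ} {b : ℝ → ℝ}
    (hb : Measurable b) {f g : α → E} (hf : Measurable f) (hg : Measurable g) :
    Measurable fun a => kern θ b (f a) (g a) := by
  unfold ExteriorBoltzmann.kern
  exact ((hg.norm).pow_const _).mul (hb.comp (by fun_prop))

/-- Conservation of energy. -/
lemma energy_collide (u ω v vs : E) (hω : ‖ω‖ = 1) :
    ‖vPrime ω v vs - u‖ ^ 2 + ‖vsPrime ω v vs - u‖ ^ 2 = ‖v - u‖ ^ 2 + ‖vs - u‖ ^ 2 := by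
  have h1 : vPrime ω v vs - u = (v - u) - ⟪v - vs, ω⟫_ℝ • ω := by rw [vPrime]; abel
  have h2 : vsPrime ω v vs - u = (vs - u) + ⟪v - vs, ω⟫_ℝ • ω := by rw [vsPrime]; abel
  rw [h1, h2, norm_sub_sq_real, norm_add_sq_real, norm_smul, inner_smul_right, inner_smul_right, hω,
    Real.norm_eq_abs, mul_one, sq_abs]
  have h3 : ⟪v - vs, ω⟫_ℝ = ⟪v - u, ω⟫_ℝ - ⟪vs - u, ω⟫_ℝ := by
    rw [← inner_sub_left]; congr 1; abel
  rw [h3]; ring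

lemma maxwellian_pos (u v : E) : 0 < maxwellian u v := by
  unfold maxwellian; have := Real.pi_pos; positivity

@[fun_prop] lemma continuous_maxwellian (u : E) : Continuous (maxwellian u) := by
  unfold maxwellian; fun_prop

lemma maxwellian_collide (u ω v vs : E) (hω : ‖ω‖ = 1) :
    maxwellian u (vPrime ω v vs) * maxwellian u (vsPrime ω v vs) =
      maxwellian u v * maxwellian u vs := by
  unfold maxwellian
  rw [mul_mul_mul_comm, mul_mul_mul_comm _ _ _ (Real.exp (-‖vs - u‖ ^ 2 / 2)), ← Real.exp_add,
    ← Real.exp_add]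
  congr 2
  linear_combination -(1 / 2) * energy_collide u ω v vs hω

/-- The square root of the Maxwellian. -/
def sqrtM (u v : E) : ℝ := √(maxwellian u v)

lemma sqrtM_pos (u v : E) : 0 < sqrtM u v := Real.sqrt_pos.2 (maxwellian_pos u v)

lemma sqrtM_sq (u v : E) : sqrtM u v * sqrtM u v = maxwellian u v :=
  Real.mul_self_sqrt (maxwellian_pos u v).le

@[fun_prop] lemma continuous_sqrtM (u : E) : Continuous (sqrtM u) := by
  unfold sqrtM; fun_prop

lemma sqrtM_collide (u ω v vs : E) (hω : ‖ω‖ = 1) :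
    sqrtM u (vPrime ω v vs) * sqrtM u (vsPrime ω v vs) = sqrtM u v * sqrtM u vs := by
  unfold sqrtM
  rw [← Real.sqrt_mul (maxwellian_pos _ _).le, ← Real.sqrt_mul (maxwellian_pos _ _).le,
    maxwellian_collide _ _ _ _ hω]

lemma sqrtM_eq (u v : E) : sqrtM u v = √((2 * Real.pi) ^ (-(3 / 2) : ℝ)) *
    Real.exp (-‖v - u‖ ^ 2 / 4) := by
  have := Real.pi_pos
  rw [sqrtM, maxwellian, Real.sqrt_mul (by positivity), Real.sqrt_eq_rpow (Real.exp _),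
    ← Real.exp_mul]
  congr 2; ring

lemma maxwell_const_le_one : (2 * Real.pi) ^ (-(3 / 2) : ℝ) ≤ 1 := by
  have := Real.pi_gt_three
  exact Real.rpow_le_one_of_one_le_of_nonpos (by linarith) (by norm_num)

lemma sqrtM_le (u v : E) : sqrtM u v ≤ Real.exp (-‖v - u‖ ^ 2 / 4) := by
  rw [sqrtM_eq]
  exact mul_le_of_le_one_left (Real.exp_pos _).le (Real.sqrt_le_one.2 maxwell_const_le_one)

lemma sqrtM_le_one (u v : E) : sqrtM u v ≤ 1 :=
  (sqrtM_le u v).trans (Real.exp_le_one_iff.2 (by have := sq_nonneg ‖v - u‖; linarith))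

lemma maxwellian_le_sqrtM (u v : E) : maxwellian u v ≤ sqrtM u v := by
  rw [← sqrtM_sq]; exact mul_le_of_le_one_left (sqrtM_pos u v).le (sqrtM_le_one u v)

/-! ### Invariance of the collision measure. -/

/-- A linear involution has determinant ±1. -/
theorem measurePreserving_collide_fixed (ω : E) (hω : ‖ω‖ = 1) :
    MeasurePreserving (fun p : E × E => (vPrime ω p.1 p.2, vsPrime ω p.1 p.2)) volume volume := by
  let L : E × E →ₗ[ℝ] E × E :=
    { toFun := fun p => (vPrime ω p.1 p.2, vsPrime ω p.1 p.2)
      map_add' := by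
        intro p q
        simp only [vPrime, vsPrime, Prod.fst_add, Prod.snd_add, add_sub_add_comm, inner_add_left,
          Prod.mk_add_mk]
        congr 1 <;> module
      map_smul' := by
        intro a p
        simp only [vPrime, vsPrime, Prod.smul_fst, Prod.smul_snd, ← smul_sub, inner_smul_left,
          RCLike.conj_to_real, RingHom.id_apply, Prod.smul_mk]
        congr 1 <;> module }
  have hL : L ∘ₗ L = LinearMap.id := by
    refine LinearMap.ext fun p => ?_
    · change ((vPrime ω (vPrime ω _ _) (vsPrime ω _ _), vsPrime ω (vPrime ω _ _) (vsPrime ω _ _)) :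
        E × E) = _
      rw [vPrime_vPrime _ _ _ hω, vsPrime_vPrime _ _ _ hω]
      rfl
  have hdet : LinearMap.det L * LinearMap.det L = 1 := by
    rw [← LinearMap.det_comp, hL, LinearMap.det_id]
  have hdet0 : LinearMap.det L ≠ 0 := fun h => by rw [h] at hdet; simp at hdet
  have habs : |(LinearMap.det L)⁻¹| = 1 := by
    rw [abs_inv]
    have : |LinearMap.det L| = 1 := by
      rw [← abs_one]; exact (sq_eq_sq_iff_abs_eq_abs _ _).1 (by rw [pow_two, hdet, one_pow])
    rw [this, inv_one]
  refine ⟨by unfold vPrime vsPrime; fun_prop, ?_⟩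
  have := Measure.map_linearMap_addHaar_eq_smul_addHaar ((volume : Measure E).prod (volume : Measure E)) hdet0
  rw [habs, ENNReal.ofReal_one, one_smul] at this
  exact this

theorem measurePreserving_collide : MeasurePreserving collide collMeasure collMeasure := by
  have h1 : MeasurePreserving (fun p : Sph × (E × E) =>
      (p.1, (vPrime p.1 p.2.1 p.2.2, vsPrime p.1 p.2.1 p.2.2)))
      (sphereMeasure.prod volume) (sphereMeasure.prod volume) := by
    refine MeasurePreserving.skew_product (MeasurePreserving.id _)
      (g := fun (ω : Sph) (p : E × E) => (vPrime ω p.1 p.2, vsPrime ω p.1 p.2)) ?_ ?_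
    · unfold vPrime vsPrime; unfold Function.uncurry; fun_prop
    · exact Eventually.of_forall fun ω => (measurePreserving_collide_fixed ω (norm_sph ω)).map_eq
  have h2 : MeasurePreserving (fun q : Coll => (q.2.2, (q.1, q.2.1))) collMeasure
      (sphereMeasure.prod volume) := by
    have ha : MeasurePreserving (MeasurableEquiv.prodAssoc.symm : Coll ≃ᵐ (E × E) × Sph)
        collMeasure ((volume : Measure (E × E)).prod sphereMeasure) :=
      (measurePreserving_prodAssoc volume volume sphereMeasure).symm
    exact Measure.measurePreserving_swap.comp ha
  have h3 : MeasurePreserving (fun p : Sph × (E × E) => ((p.2.1, (p.2.2, p.1)) : Coll))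
      (sphereMeasure.prod volume) collMeasure := by
    have ha : MeasurePreserving (MeasurableEquiv.prodAssoc : (E × E) × Sph ≃ᵐ Coll)
        ((volume : Measure (E × E)).prod sphereMeasure) collMeasure :=
      measurePreserving_prodAssoc volume volume sphereMeasure
    exact ha.comp Measure.measurePreserving_swap
  exact h3.comp (h1.comp h2)

theorem measurePreserving_exchange : MeasurePreserving exchange collMeasure collMeasure := by
  have ha : MeasurePreserving (MeasurableEquiv.prodAssoc : (E × E) × Sph ≃ᵐ Coll)
      (((volume : Measure E).prod volume).prod sphereMeasure) collMeasure :=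
    measurePreserving_prodAssoc volume volume sphereMeasure
  exact ha.comp ((Measure.measurePreserving_swap.prod (MeasurePreserving.id sphereMeasure)).comp
    (measurePreserving_prodAssoc volume volume sphereMeasure).symm)

theorem ae_coll_fst {P : E → Prop} (h : ∀ᵐ v, P v) : ∀ᵐ q ∂collMeasure, P q.1 :=
  Measure.quasiMeasurePreserving_fst.ae h

/-- Bounds on F hold only almost everywhere, while the gain term samples them at v' and v_*';
invariance under collisions and exchange transfers them to all four velocities. -/
theorem ae_coll {P : E → Prop} (h : ∀ᵐ v, P v) : ∀ᵐ q ∂collMeasure,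
    P q.1 ∧ P q.2.1 ∧ P (vPrime q.2.2 q.1 q.2.1) ∧ P (vsPrime q.2.2 q.1 q.2.1) := by
  have h0 := ae_coll_fst h
  have h1 := measurePreserving_exchange.quasiMeasurePreserving.ae h0
  have h2 := measurePreserving_collide.quasiMeasurePreserving.ae h0
  have h3 := measurePreserving_collide.quasiMeasurePreserving.ae h1
  filter_upwards [h0, h1, h2, h3] with q a b c d using ⟨a, b, c, d⟩

theorem ae_ae_coll {P : E → Prop} (h : ∀ᵐ v, P v) : ∀ᵐ v : E, ∀ᵐ q : E × Sph
    ∂pairMeasure,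
    P v ∧ P q.1 ∧ P (vPrime q.2 v q.1) ∧ P (vsPrime q.2 v q.1) :=
  Measure.ae_ae_of_ae_prod (ae_coll h)

/-! ### Collision frequency and kernel integrals. -/

/-- The assumptions on the exponent and on the angular part of a cutoff hard potential. -/
structure AngularCutoff (θ : ℝ) (b : ℝ → ℝ) : Prop where
  theta_nonneg : 0 ≤ θ
  theta_le_one : θ ≤ 1
  meas : Measurable b
  nonneg : ∀ z, 0 ≤ b z
  integrable : IntegrableOn b (Icc 0 1)
  ne_zero : ¬ (b =ᵐ[volume.restrict (Icc 0 1)] 0)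

/-- The cubic term of the exponential series at (1+r²)/8 gives the constant 3 · 8 · 3072 = 73728,
rounded up. -/
lemma exp_neg_sq_le {r : ℝ} (hr : 0 ≤ r) :
    Real.exp (-r ^ 2 / 8) ≤ 100000 * ((1 + r) ^ 6)⁻¹ := by
  have h1 := Real.pow_div_factorial_le_exp (x := (1 + r ^ 2) / 8) (by positivity) 3
  have h2 : Real.exp ((1 + r ^ 2) / 8) = Real.exp (1 / 8) * Real.exp (r ^ 2 / 8) := by
    rw [← Real.exp_add]; congr 1; ring
  have h3 : Real.exp (1 / 8) ≤ 3 := by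
    refine (Real.exp_le_exp.2 (by norm_num : (1 / 8 : ℝ) ≤ 1)).trans Real.exp_one_lt_three.le
  have h4 : (1 + r) ^ 6 ≤ 8 * (1 + r ^ 2) ^ 3 := by
    have : (1 + r) ^ 2 ≤ 2 * (1 + r ^ 2) := by nlinarith [sq_nonneg (r - 1)]
    calc (1 + r) ^ 6 = ((1 + r) ^ 2) ^ 3 := by ring
      _ ≤ (2 * (1 + r ^ 2)) ^ 3 := by gcongr
      _ = _ := by ring
  rw [neg_div, Real.exp_neg, ← div_eq_mul_inv, inv_eq_one_div,
    div_le_div_iff₀ (Real.exp_pos _) (by positivity)]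
  have h5 : ((1 + r ^ 2) / 8) ^ 3 / (Nat.factorial 3) = (1 + r ^ 2) ^ 3 / 3072 := by
    simp [Nat.factorial]; ring
  rw [h5, h2] at h1
  have h6 : Real.exp (1 / 8) * Real.exp (r ^ 2 / 8) ≤ 3 * Real.exp (r ^ 2 / 8) := by gcongr
  linarith [Real.exp_pos (r ^ 2 / 8)]

lemma lintegral_one_add_norm_lt_top (u : E) :
    ∫⁻ y : E, ENNReal.ofReal (((1 + ‖y - u‖) ^ 4)⁻¹) < ∞ := by
  rw [lintegral_sub_right_eq_self (fun y : E => ENNReal.ofReal (((1 + ‖y‖) ^ 4)⁻¹))]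
  have := finite_integral_one_add_norm (E := E) (μ := volume) (r := 4) (by simp; norm_num)
  refine lt_of_eq_of_lt (lintegral_congr fun y => ?_) this
  rw [Real.rpow_neg (by positivity)]
  norm_cast

lemma lintegral_one_add_norm_mul_exp_lt_top (u : E) :
    ∫⁻ y : E, ENNReal.ofReal ((1 + ‖y - u‖) * Real.exp (-‖y - u‖ ^ 2 / 8)) < ∞ := by
  refine lt_of_le_of_lt (lintegral_mono (g := fun y => ENNReal.ofReal 100000 *
    ENNReal.ofReal (((1 + ‖y - u‖) ^ 4)⁻¹)) fun y => ?_) ?_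
  · simp only
    rw [← ENNReal.ofReal_mul (by norm_num)]
    refine ENNReal.ofReal_le_ofReal ?_
    set r := ‖y - u‖
    have hr : 0 ≤ r := norm_nonneg _
    calc (1 + r) * Real.exp (-r ^ 2 / 8) ≤ (1 + r) * (100000 * ((1 + r) ^ 6)⁻¹) := by
          gcongr; exact exp_neg_sq_le hr
      _ = 100000 * ((1 + r) ^ 5)⁻¹ := by field_simp
      _ ≤ 100000 * ((1 + r) ^ 4)⁻¹ := by
          gcongr
          · linarith
          · norm_num
  · rw [lintegral_const_mul _ (by fun_prop)]
    exact ENNReal.mul_lt_top ENNReal.ofReal_lt_top (lintegral_one_add_norm_lt_top u)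

lemma lintegral_sphere_ratio (Ψ : ℝ → ℝ≥0∞) (hΨ : Measurable Ψ) {V : E} (hV : V ≠ 0) :
    ∫⁻ ω : Sph, Ψ (|⟪(ω : E), V⟫_ℝ| / ‖V‖) ∂sphereMeasure =
      ENNReal.ofReal (4 * Real.pi) * ∫⁻ z in Icc (0 : ℝ) 1, Ψ z := by
  have hρ : 0 < ‖V‖ := norm_pos_iff.2 hV
  rw [← lintegral_sphere_abs_inner Ψ hΨ (‖V‖⁻¹ • V)
    (by rw [norm_smul, norm_inv, norm_norm, inv_mul_cancel₀ hρ.ne'])]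
  refine lintegral_congr fun ω => ?_
  rw [inner_smul_right, abs_mul, abs_inv, abs_norm, inv_mul_eq_div]

/-- `∫ b(|ω·e|) dω`. -/
def angularMass (b : ℝ → ℝ) : ℝ≥0∞ :=
  ENNReal.ofReal (4 * Real.pi) * ∫⁻ z in Icc (0 : ℝ) 1, ENNReal.ofReal (b z)

lemma AngularCutoff.lintegral_lt_top {θ : ℝ} {b : ℝ → ℝ} (hb : AngularCutoff θ b) :
    ∫⁻ z in Icc (0 : ℝ) 1, ENNReal.ofReal (b z) < ∞ :=
  hb.integrable.lintegral_lt_top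

lemma AngularCutoff.angularMass_lt_top {θ : ℝ} {b : ℝ → ℝ} (hb : AngularCutoff θ b) :
    angularMass b < ∞ := ENNReal.mul_lt_top ENNReal.ofReal_lt_top hb.lintegral_lt_top

lemma AngularCutoff.angularMass_ne_zero {θ : ℝ} {b : ℝ → ℝ} (hb : AngularCutoff θ b) :
    angularMass b ≠ 0 := by
  refine mul_ne_zero ?_ ?_
  · have := Real.pi_pos
    simpa using this
  · rw [Ne, lintegral_eq_zero_iff (hb.meas.ennreal_ofReal)]
    intro h
    refine hb.ne_zero ?_
    filter_upwards [h] with z hz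
    exact le_antisymm (ENNReal.ofReal_eq_zero.1 hz) (hb.nonneg z)

/-- The integrand depends on ω only through the angle with v - v_*, so the sphere integral reduces
to one over [0,1]. The diagonal v_* = v, where the angle is undefined, is null. -/
theorem lintegral_kern_mul {θ : ℝ} {b : ℝ → ℝ} (hb : AngularCutoff θ b) (Ψ : ℝ → ℝ → ℝ)
    (hΨ : Measurable (Function.uncurry Ψ)) (G : E → ℝ)
    (hG : ∀ w, 0 ≤ G w) (hGm : Measurable G) (v : E) :
    ∫⁻ q, ENNReal.ofReal (kern θ b q.2 (v - q.1) * (G q.1 *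
      Ψ ‖v - q.1‖ (|⟪(q.2 : E), v - q.1⟫_ℝ| / ‖v - q.1‖))) ∂pairMeasure =
    ∫⁻ w, ENNReal.ofReal (‖v - w‖ ^ θ * G w) * (ENNReal.ofReal (4 * Real.pi) *
      ∫⁻ z in Icc (0 : ℝ) 1, ENNReal.ofReal (b z * Ψ ‖v - w‖ z)) := by
  have hbm := hb.meas
  have hm : Measurable fun q : E × Sph => ENNReal.ofReal (kern θ b q.2 (v - q.1) * (G q.1 *
      Ψ ‖v - q.1‖ (|⟪(q.2 : E), v - q.1⟫_ℝ| / ‖v - q.1‖))) := by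
    have : Measurable fun q : E × Sph => Ψ ‖v - q.1‖ (|⟪(q.2 : E), v - q.1⟫_ℝ| / ‖v - q.1‖) :=
      hΨ.comp (by fun_prop : Measurable fun q : E × Sph =>
        (‖v - q.1‖, |⟪(q.2 : E), v - q.1⟫_ℝ| / ‖v - q.1‖))
    fun_prop
  rw [pairMeasure, lintegral_prod _ hm.aemeasurable]
  have hne : ∀ᵐ w : E, w ≠ v := by simp [ae_iff]
  refine lintegral_congr_ae ?_
  filter_upwards [hne] with w hw
  have hV : v - w ≠ 0 := sub_ne_zero.2 hw.symm
  have hΨw : Measurable fun z => b z * Ψ ‖v - w‖ z :=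
    hbm.mul (hΨ.comp measurable_prodMk_left)
  rw [← lintegral_sphere_ratio (fun z => ENNReal.ofReal (b z * Ψ ‖v - w‖ z)) hΨw.ennreal_ofReal hV,
    ← lintegral_const_mul]
  · refine lintegral_congr fun ω => ?_
    rw [← ENNReal.ofReal_mul (mul_nonneg (Real.rpow_nonneg (norm_nonneg _) _) (hG w)), kern]
    congr 1; ring
  · exact hΨw.ennreal_ofReal.comp (by fun_prop)

theorem lintegral_kern_mul_fst {θ : ℝ} {b : ℝ → ℝ} (hb : AngularCutoff θ b) (G : E → ℝ)
    (hG : ∀ w, 0 ≤ G w) (hGm : Measurable G) (v : E) :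
    ∫⁻ q, ENNReal.ofReal (kern θ b q.2 (v - q.1) * G q.1) ∂pairMeasure =
    (∫⁻ w, ENNReal.ofReal (‖v - w‖ ^ θ * G w)) * angularMass b := by
  have := lintegral_kern_mul hb (fun _ _ => 1) (by fun_prop) G hG hGm v
  simp only [mul_one] at this
  rw [this]
  exact lintegral_mul_const _ (by fun_prop)

lemma norm_sub_rpow_le {θ : ℝ} (h0 : 0 ≤ θ) (h1 : θ ≤ 1) (u v w : E) :
    ‖v - w‖ ^ θ ≤ (1 + ‖v - u‖) ^ θ * (1 + ‖w - u‖) := by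
  calc ‖v - w‖ ^ θ ≤ ((1 + ‖v - u‖) * (1 + ‖w - u‖)) ^ θ := by
        refine Real.rpow_le_rpow (norm_nonneg _) ?_ h0
        have : ‖v - w‖ ≤ ‖v - u‖ + ‖w - u‖ := by
          rw [← norm_neg (w - u)]
          refine le_trans (le_of_eq ?_) (norm_add_le _ _); congr 1; abel
        nlinarith [norm_nonneg (v - u), norm_nonneg (w - u)]
    _ = (1 + ‖v - u‖) ^ θ * (1 + ‖w - u‖) ^ θ := Real.mul_rpow (by positivity) (by positivity)
    _ ≤ _ := by
        gcongr
        calc (1 + ‖w - u‖) ^ θ ≤ (1 + ‖w - u‖) ^ (1 : ℝ) :=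
              Real.rpow_le_rpow_of_exponent_le (by linarith [norm_nonneg (w - u)]) h1
          _ = _ := Real.rpow_one _

/-- `∫ B(ω, v - v_*) √M(v_*) dω dv_* ≤ C (1 + |v - u|)`. -/
theorem exists_lintegral_kern_sqrtM_le {θ : ℝ} {b : ℝ → ℝ} (hb : AngularCutoff θ b) (u : E) :
    ∃ C : ℝ, 0 < C ∧ ∀ v, ∫⁻ q, ENNReal.ofReal (kern θ b q.2 (v - q.1) * sqrtM u q.1) ∂pairMeasure ≤
      ENNReal.ofReal (C * (1 + ‖v - u‖)) := by
  set A := (∫⁻ y : E, ENNReal.ofReal ((1 + ‖y - u‖) * Real.exp (-‖y - u‖ ^ 2 / 8))) * angularMass b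
    with hA
  have hAt : A ≠ ∞ :=
    (ENNReal.mul_lt_top (lintegral_one_add_norm_mul_exp_lt_top u) hb.angularMass_lt_top).ne
  refine ⟨A.toReal + 1, by positivity, fun v => ?_⟩
  rw [lintegral_kern_mul_fst hb _ (fun w => (sqrtM_pos u w).le) (by fun_prop)]
  calc _ ≤ (∫⁻ y : E, ENNReal.ofReal (1 + ‖v - u‖) *
        ENNReal.ofReal ((1 + ‖y - u‖) * Real.exp (-‖y - u‖ ^ 2 / 8))) * angularMass b := by
        gcongr with w
        rw [← ENNReal.ofReal_mul (by positivity)]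
        refine ENNReal.ofReal_le_ofReal ?_
        rw [← mul_assoc]
        refine mul_le_mul ((norm_sub_rpow_le hb.theta_nonneg hb.theta_le_one u v w).trans ?_)
          ((sqrtM_le u w).trans ?_) (sqrtM_pos _ _).le (by positivity)
        · gcongr
          calc (1 + ‖v - u‖) ^ θ ≤ (1 + ‖v - u‖) ^ (1 : ℝ) :=
              Real.rpow_le_rpow_of_exponent_le (by linarith [norm_nonneg (v - u)]) hb.theta_le_one
            _ = _ := Real.rpow_one _
        · refine Real.exp_le_exp.2 ?_
          have := sq_nonneg ‖w - u‖; linarith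
    _ = ENNReal.ofReal (1 + ‖v - u‖) * A := by
        rw [lintegral_const_mul _ (by fun_prop), hA, mul_assoc]
    _ ≤ _ := by
        rw [mul_comm (A.toReal + 1), ENNReal.ofReal_mul (by positivity)]
        gcongr
        rw [ENNReal.ofReal_add ENNReal.toReal_nonneg zero_le_one, ENNReal.ofReal_toReal hAt]
        exact le_self_add

/-- The collision frequency `∫ B(ω, v - v_*) M(v_*) dω dv_*`. -/
def freq (θ : ℝ) (b : ℝ → ℝ) (u v : E) : ℝ≥0∞ :=
  ∫⁻ q, ENNReal.ofReal (kern θ b q.2 (v - q.1) * maxwellian u q.1) ∂pairMeasure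

/-- The Maxwellian is symmetric about u, so w may be paired with its reflection 2u - w. The larger
of the two distances to v is at least max(|v-u|, |w-u|), hence at least (1+|v-u|)/2 when |w-u| ≥ 1.
This growth of order θ matches the upper bound for the gain. -/
theorem exists_le_freq {θ : ℝ} {b : ℝ → ℝ} (hb : AngularCutoff θ b) (u : E) :
    ∃ c : ℝ, 0 < c ∧ ∀ v, ENNReal.ofReal (c * (1 + ‖v - u‖) ^ θ) ≤ freq θ b u v := by
  set S : Set E := {w | 1 ≤ ‖w - u‖}
  have hS : MeasurableSet S := measurableSet_le measurable_const (by fun_prop)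
  set m := ∫⁻ w in S, ENNReal.ofReal (maxwellian u w) with hm
  have hm0 : m ≠ 0 := by
    rw [hm, Ne, setLIntegral_eq_zero_iff hS (by fun_prop)]
    intro h
    have h0 : volume S = 0 := by
      refine measure_mono_null (fun w hw => ?_) (ae_iff.1 h)
      simp only [mem_ofPred_eq, not_forall]
      exact ⟨hw, by simpa using maxwellian_pos u w⟩
    have hopen : IsOpen {w : E | 1 < ‖w - u‖} := isOpen_lt continuous_const (by fun_prop)
    obtain ⟨w₀, hw₀⟩ : ∃ w₀ : E, ‖w₀‖ = 2 := exists_norm_eq E (by norm_num)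
    have hne : ({w : E | 1 < ‖w - u‖}).Nonempty :=
      ⟨u + w₀, by simp only [mem_ofPred_eq, add_sub_cancel_left, hw₀]; norm_num⟩
    exact (hopen.measure_pos volume hne).ne'
      (measure_mono_null (fun w hw => (le_of_lt hw : (1 : ℝ) ≤ ‖w - u‖)) h0)
  have hm1 : m * angularMass b ≠ 0 := mul_ne_zero hm0 hb.angularMass_ne_zero
  obtain ⟨c, hc0, hc⟩ : ∃ c : ℝ, 0 < c ∧ ENNReal.ofReal c ≤ m * angularMass b := by
    rcases eq_or_ne (m * angularMass b) ∞ with h | h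
    · exact ⟨1, one_pos, by simp [h]⟩
    · exact ⟨(m * angularMass b).toReal, ENNReal.toReal_pos hm1 h,
        (ENNReal.ofReal_toReal h).le⟩
  refine ⟨c / 4, by positivity, fun v => ?_⟩
  rw [freq, lintegral_kern_mul_fst hb _ (fun w => (maxwellian_pos u w).le) (by fun_prop)]
  set I := ∫⁻ w, ENNReal.ofReal (‖v - w‖ ^ θ * maxwellian u w) with hI
  have hI2 : I = ∫⁻ w, ENNReal.ofReal (‖v - (u + u - w)‖ ^ θ * maxwellian u w) := by
    rw [hI, ← lintegral_sub_left_eq_self _ (u + u)]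
    refine lintegral_congr fun w => ?_
    congr 2
    unfold maxwellian
    rw [show u + u - w - u = -(w - u) by abel, norm_neg]
  have key : ENNReal.ofReal ((1 + ‖v - u‖) ^ θ / 2) * m ≤ I + I := by
    nth_rewrite 1 [hI]
    rw [hI2, ← lintegral_add_left (by fun_prop), hm, ← lintegral_const_mul _ (by fun_prop)]
    refine (setLIntegral_mono' hS fun w hw => ?_).trans (setLIntegral_le_lintegral S _)
    have hw : 1 ≤ ‖w - u‖ := hw
    rw [← ENNReal.ofReal_mul (by positivity), ← ENNReal.ofReal_add
      (mul_nonneg (by positivity) (maxwellian_pos _ _).le)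
      (mul_nonneg (by positivity) (maxwellian_pos _ _).le), ← add_mul]
    refine ENNReal.ofReal_le_ofReal (mul_le_mul_of_nonneg_right ?_ (maxwellian_pos _ _).le)
    have h1 : 2 * ‖v - u‖ ≤ ‖v - w‖ + ‖v - (u + u - w)‖ := by
      have : (2 : ℝ) • (v - u) = (v - w) + (v - (u + u - w)) := by module
      rw [← Real.norm_of_nonneg (zero_le_two (α := ℝ)), ← norm_smul, this]
      exact norm_add_le _ _
    have h2 : 2 * ‖w - u‖ ≤ ‖v - w‖ + ‖v - (u + u - w)‖ := by
      have : (2 : ℝ) • (w - u) = (v - (u + u - w)) - (v - w) := by module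
      rw [← Real.norm_of_nonneg (zero_le_two (α := ℝ)), ← norm_smul, this]
      exact (norm_sub_le _ _).trans_eq (add_comm _ _)
    have h3 : (1 + ‖v - u‖) ^ θ / 2 ≤ ((1 + ‖v - u‖) / 2) ^ θ := by
      rw [Real.div_rpow (by positivity) (by norm_num)]
      gcongr
      calc (2 : ℝ) ^ θ ≤ 2 ^ (1 : ℝ) :=
            Real.rpow_le_rpow_of_exponent_le (by norm_num) hb.theta_le_one
        _ = 2 := Real.rpow_one _
    refine h3.trans ?_
    rcases le_total ‖v - w‖ ‖v - (u + u - w)‖ with h | h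
    · refine (Real.rpow_le_rpow (by positivity) (?_ : _ ≤ ‖v - (u + u - w)‖)
        hb.theta_nonneg).trans (le_add_of_nonneg_left (by positivity))
      linarith
    · refine (Real.rpow_le_rpow (by positivity) (?_ : _ ≤ ‖v - w‖)
        hb.theta_nonneg).trans (le_add_of_nonneg_right (by positivity))
      linarith
  have h5 : ENNReal.ofReal (c / 4 * (1 + ‖v - u‖) ^ θ) * ENNReal.ofReal 2 ≤ (I * angularMass b) * ENNReal.ofReal 2 := by
    calc ENNReal.ofReal (c / 4 * (1 + ‖v - u‖) ^ θ) * ENNReal.ofReal 2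
        = ENNReal.ofReal ((1 + ‖v - u‖) ^ θ / 2) * ENNReal.ofReal c := by
          rw [← ENNReal.ofReal_mul (by positivity), ← ENNReal.ofReal_mul (by positivity)]
          congr 1; ring
      _ ≤ ENNReal.ofReal ((1 + ‖v - u‖) ^ θ / 2) * (m * angularMass b) := by gcongr
      _ = (ENNReal.ofReal ((1 + ‖v - u‖) ^ θ / 2) * m) * angularMass b := by ring
      _ ≤ (I + I) * angularMass b := by gcongr
      _ = _ := by rw [ENNReal.ofReal_ofNat]; ring
  exact (ENNReal.mul_le_mul_iff_left (by simp) (by simp)).1 h5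

/-! ### Smallness of the gain kernel at large velocities. -/

/-- The part of the gain kernel in which the first factor is evaluated at `v'` or `v_*'`, with a
polynomial weight in the displacement. -/
def gainKernel (θ : ℝ) (b : ℝ → ℝ) (u v : E) (q : E × Sph) : ℝ :=
  kern θ b q.2 (v - q.1) * (sqrtM u q.1 *
    (sqrtM u (vsPrime q.2 v q.1) * (2 * (1 + ‖vsPrime q.2 v q.1 - q.1‖ ^ 2)) ^ 3 +
      sqrtM u (vPrime q.2 v q.1) * (2 * (1 + ‖vPrime q.2 v q.1 - q.1‖ ^ 2)) ^ 3))

lemma sq_norm_vsPrime_sub (ω v w : E) (hω : ‖ω‖ = 1) (hvw : v ≠ w) :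
    ‖vsPrime ω v w - w‖ ^ 2 = ‖v - w‖ ^ 2 * (|⟪ω, v - w⟫_ℝ| / ‖v - w‖) ^ 2 := by
  have hρ : ‖v - w‖ ≠ 0 := norm_ne_zero_iff.2 (sub_ne_zero.2 hvw)
  rw [vsPrime, add_sub_cancel_left, norm_smul, hω, mul_one, Real.norm_eq_abs, sq_abs, div_pow,
    sq_abs, real_inner_comm]
  field_simp

lemma sq_norm_vPrime_sub (ω v w : E) (hω : ‖ω‖ = 1) (hvw : v ≠ w) :
    ‖vPrime ω v w - w‖ ^ 2 = ‖v - w‖ ^ 2 * (1 - (|⟪ω, v - w⟫_ℝ| / ‖v - w‖) ^ 2) := by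
  have hρ : ‖v - w‖ ≠ 0 := norm_ne_zero_iff.2 (sub_ne_zero.2 hvw)
  have : vPrime ω v w - w = (v - w) - ⟪v - w, ω⟫_ℝ • ω := by rw [vPrime]; abel
  rw [this, norm_sub_sq_real, norm_smul, hω, mul_one, Real.norm_eq_abs, sq_abs, div_pow,
    sq_abs, inner_smul_right, real_inner_comm (v - w)]
  field_simp
  ring

/-- Half of the Gaussian is spent on the polynomial weight; the constant rounds up 3 · 8 · 196608.
-/
lemma weight_mul_exp_le {s : ℝ} (hs : 0 ≤ s) :
    (2 * (1 + s)) ^ 3 * Real.exp (-s / 16) ≤ 10000000 * Real.exp (-s / 32) := by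
  have h1 := Real.pow_div_factorial_le_exp (x := (1 + s) / 32) (by positivity) 3
  have h5 : ((1 + s) / 32) ^ 3 / (Nat.factorial 3) = (1 + s) ^ 3 / 196608 := by
    simp [Nat.factorial]; ring
  rw [h5] at h1
  have h2 : Real.exp ((1 + s) / 32) = Real.exp (1 / 32) * Real.exp (s / 32) := by
    rw [← Real.exp_add]; congr 1; ring
  have h3 : Real.exp (1 / 32) ≤ 3 := by
    refine (Real.exp_le_exp.2 (by norm_num : (1 / 32 : ℝ) ≤ 1)).trans Real.exp_one_lt_three.le
  have h4 : Real.exp (-s / 16) = Real.exp (-s / 32) * Real.exp (-s / 32) := by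
    rw [← Real.exp_add]; congr 1; ring
  have h6 : Real.exp (s / 32) * Real.exp (-s / 32) = 1 := by
    rw [← Real.exp_add]; simp [neg_div]
  have h7 : (2 * (1 + s)) ^ 3 ≤ 10000000 * Real.exp (s / 32) := by
    rw [h2] at h1
    have : Real.exp (1 / 32) * Real.exp (s / 32) ≤ 3 * Real.exp (s / 32) := by gcongr
    calc (2 * (1 + s)) ^ 3 = 8 * (1 + s) ^ 3 := by ring
      _ ≤ _ := by nlinarith [Real.exp_pos (s / 32)]
  calc _ ≤ 10000000 * Real.exp (s / 32) * Real.exp (-s / 16) := by gcongr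
    _ = _ := by rw [h4]; linear_combination 10000000 * Real.exp (-s / 32) * h6

/-- Since |p-w|² ≤ 2|p-u|² + 2|w-u|², part of the two Gaussians becomes decay in the distance p - w.
With w = v_* and p one of v_*', v', that distance is |v-v_*| times the cosine or the sine of the
collision angle. -/
lemma sqrtM_mul_sqrtM_mul_weight_le (u w p : E) :
    sqrtM u w * (sqrtM u p * (2 * (1 + ‖p - w‖ ^ 2)) ^ 3) ≤
      10000000 * Real.exp (-‖w - u‖ ^ 2 / 8) * Real.exp (-‖p - w‖ ^ 2 / 32) := by
  have h1 : ‖p - w‖ ≤ ‖p - u‖ + ‖w - u‖ := by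
    refine le_trans (le_of_eq ?_) (norm_sub_le _ _); congr 1; abel
  have h2 : ‖p - w‖ ^ 2 ≤ 2 * (‖p - u‖ ^ 2 + ‖w - u‖ ^ 2) := by
    nlinarith [norm_nonneg (p - w), sq_nonneg (‖p - u‖ - ‖w - u‖)]
  have h3 : sqrtM u w * sqrtM u p ≤ Real.exp (-‖w - u‖ ^ 2 / 8) * Real.exp (-‖p - w‖ ^ 2 / 16) := by
    calc _ ≤ Real.exp (-‖w - u‖ ^ 2 / 4) * Real.exp (-‖p - u‖ ^ 2 / 4) :=
          mul_le_mul (sqrtM_le _ _) (sqrtM_le _ _) (sqrtM_pos _ _).le (Real.exp_pos _).le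
      _ ≤ _ := by
          rw [← Real.exp_add, ← Real.exp_add]
          refine Real.exp_le_exp.2 ?_
          nlinarith [sq_nonneg ‖p - u‖]
  calc _ = (sqrtM u w * sqrtM u p) * (2 * (1 + ‖p - w‖ ^ 2)) ^ 3 := by ring
    _ ≤ (Real.exp (-‖w - u‖ ^ 2 / 8) * Real.exp (-‖p - w‖ ^ 2 / 16)) *
        (2 * (1 + ‖p - w‖ ^ 2)) ^ 3 := by gcongr
    _ = Real.exp (-‖w - u‖ ^ 2 / 8) *
        ((2 * (1 + ‖p - w‖ ^ 2)) ^ 3 * Real.exp (-‖p - w‖ ^ 2 / 16)) := by ring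
    _ ≤ Real.exp (-‖w - u‖ ^ 2 / 8) * (10000000 * Real.exp (-‖p - w‖ ^ 2 / 32)) := by
        exact mul_le_mul_of_nonneg_left (weight_mul_exp_le (sq_nonneg ‖p - w‖)) (Real.exp_pos _).le
    _ = _ := by ring

/-- The angular profile which governs the decay of the gain kernel. -/
def gainProfile (b : ℝ → ℝ) (ρ : ℝ) : ℝ≥0∞ :=
  ENNReal.ofReal (4 * Real.pi) * ∫⁻ z in Icc (0 : ℝ) 1, ENNReal.ofReal (b z *
    (Real.exp (-(ρ ^ 2 * z ^ 2) / 32) + Real.exp (-(ρ ^ 2 * (1 - z ^ 2)) / 32)))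

lemma measurable_gainProfile {θ : ℝ} {b : ℝ → ℝ} (hb : AngularCutoff θ b) :
    Measurable (gainProfile b) := by
  have hbm := hb.meas
  have : Measurable fun p : ℝ × ℝ => ENNReal.ofReal (b p.2 *
    (Real.exp (-(p.1 ^ 2 * p.2 ^ 2) / 32) + Real.exp (-(p.1 ^ 2 * (1 - p.2 ^ 2)) / 32))) := by
    fun_prop
  exact this.lintegral_prod_right'.const_mul _

lemma gainProfile_integrand_le {b : ℝ → ℝ} (hb : ∀ z, 0 ≤ b z) {z : ℝ} (hz : z ∈ Icc (0 : ℝ) 1)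
    (ρ : ℝ) : b z * (Real.exp (-(ρ ^ 2 * z ^ 2) / 32) + Real.exp (-(ρ ^ 2 * (1 - z ^ 2)) / 32)) ≤
      2 * b z := by
  have hz2 : 0 ≤ 1 - z ^ 2 := by nlinarith [hz.1, hz.2]
  have h1 : Real.exp (-(ρ ^ 2 * z ^ 2) / 32) ≤ 1 :=
    Real.exp_le_one_iff.2 (by have : 0 ≤ ρ ^ 2 * z ^ 2 := by positivity
                              linarith)
  have h2 : Real.exp (-(ρ ^ 2 * (1 - z ^ 2)) / 32) ≤ 1 :=
    Real.exp_le_one_iff.2 (by have : 0 ≤ ρ ^ 2 * (1 - z ^ 2) := mul_nonneg (sq_nonneg ρ) hz2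
                              linarith)
  nlinarith [hb z]

lemma gainProfile_le {b : ℝ → ℝ} (hb : ∀ z, 0 ≤ b z) (ρ : ℝ) :
    gainProfile b ρ ≤ 2 * angularMass b := by
  rw [gainProfile, angularMass, mul_left_comm]
  gcongr
  rw [← lintegral_const_mul' _ _ (by simp)]
  refine setLIntegral_mono' measurableSet_Icc fun z hz => ?_
  refine (ENNReal.ofReal_le_ofReal (gainProfile_integrand_le hb hz ρ)).trans ?_
  rw [ENNReal.ofReal_mul zero_le_two, ENNReal.ofReal_ofNat]

/-- Dominated convergence: both exponentials tend to zero except at z = 0 and z = 1, which are null.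
No rate is available for a merely integrable b, and none is needed. -/
lemma tendsto_gainProfile {θ : ℝ} {b : ℝ → ℝ} (hb : AngularCutoff θ b) :
    Tendsto (gainProfile b) atTop (𝓝 0) := by
  have hbm := hb.meas
  have key : Tendsto (fun ρ : ℝ => ∫⁻ z in Icc (0 : ℝ) 1, ENNReal.ofReal (b z *
    (Real.exp (-(ρ ^ 2 * z ^ 2) / 32) + Real.exp (-(ρ ^ 2 * (1 - z ^ 2)) / 32)))) atTop
      (𝓝 (∫⁻ _ in Icc (0 : ℝ) 1, 0)) := by
    refine tendsto_lintegral_filter_of_dominated_convergence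
      (fun z => ENNReal.ofReal (2 * b z)) ?_ ?_ ?_ ?_
    · exact Eventually.of_forall fun ρ => by fun_prop
    · refine Eventually.of_forall fun ρ => (ae_restrict_iff' measurableSet_Icc).2
        (Eventually.of_forall fun z hz => ?_)
      exact ENNReal.ofReal_le_ofReal (gainProfile_integrand_le hb.nonneg hz ρ)
    · exact (hb.integrable.const_mul 2).lintegral_lt_top.ne
    · refine (ae_restrict_iff' measurableSet_Icc).2 ?_
      have h0 : ∀ᵐ z : ℝ, z ≠ 0 := by simp [ae_iff]
      have h1 : ∀ᵐ z : ℝ, z ≠ 1 := by simp [ae_iff]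
      filter_upwards [h0, h1] with z hz0 hz1 hz
      have hp0 : 0 < z ^ 2 := by positivity
      have hp1 : 0 < 1 - z ^ 2 := by
        have : z < 1 := lt_of_le_of_ne hz.2 hz1
        nlinarith [hz.1]
      have e : ∀ a : ℝ, 0 < a → Tendsto (fun ρ : ℝ => Real.exp (-(ρ ^ 2 * a) / 32)) atTop (𝓝 0) := by
        intro a ha
        refine Real.tendsto_exp_atBot.comp ?_
        have h3 : Tendsto (fun ρ : ℝ => (a / 32) * ρ ^ 2) atTop atTop :=
          (tendsto_pow_atTop two_ne_zero).const_mul_atTop (by positivity)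
        refine (tendsto_neg_atTop_atBot.comp h3).congr fun ρ => ?_
        simp only [Function.comp_apply]; ring
      have h4 := ((e _ hp0).add (e _ hp1)).const_mul (b z)
      rw [add_zero, mul_zero] at h4
      simpa using ENNReal.tendsto_ofReal h4
  rw [lintegral_zero] at key
  have := ENNReal.Tendsto.const_mul (a := ENNReal.ofReal (4 * Real.pi)) key
    (Or.inr ENNReal.ofReal_ne_top)
  rw [mul_zero] at this
  exact this

/-- After removal of (1+|v-u|)^θ the gain is a convolution of an integrable function with the
vanishing angular profile, hence tends to zero at infinity, whereas the frequency stays above c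
(1+|v-u|)^θ. -/
theorem exists_gainKernel_le {θ : ℝ} {b : ℝ → ℝ} (hb : AngularCutoff θ b) (u : E) :
    ∃ N : ℝ, 0 < N ∧ ∀ v, N < ‖v - u‖ →
      2 * ∫⁻ q, ENNReal.ofReal (gainKernel θ b u v q) ∂pairMeasure ≤ freq θ b u v := by
  have hbm := hb.meas
  obtain ⟨c, hc, hfreq⟩ := exists_le_freq hb u
  let D : E → ℝ := fun y => 10000000 * ((1 + ‖y‖) * Real.exp (-‖y‖ ^ 2 / 8))
  have hD0 : ∀ y, 0 ≤ D y := fun y => by positivity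
  have hDt : ∫⁻ y, ENNReal.ofReal (D y) < ∞ := by
    have := lintegral_one_add_norm_mul_exp_lt_top 0
    simp only [sub_zero] at this
    simp only [D]
    have h2 : ∀ y : E, ENNReal.ofReal (10000000 * ((1 + ‖y‖) * Real.exp (-‖y‖ ^ 2 / 8))) =
        ENNReal.ofReal 10000000 * ENNReal.ofReal ((1 + ‖y‖) * Real.exp (-‖y‖ ^ 2 / 8)) :=
      fun y => ENNReal.ofReal_mul (by norm_num)
    simp_rw [h2]
    rw [lintegral_const_mul _ (by fun_prop)]
    exact ENNReal.mul_lt_top ENNReal.ofReal_lt_top this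
  let H : E → ℝ≥0∞ := fun w => ∫⁻ y, ENNReal.ofReal (D y) * gainProfile b ‖w - y‖
  have hgm := measurable_gainProfile hb
  have hH : Tendsto H (comap norm atTop) (𝓝 0) := by
    have : Tendsto H (comap norm atTop) (𝓝 (∫⁻ _ : E, 0)) := by
      refine tendsto_lintegral_filter_of_dominated_convergence
        (fun y => ENNReal.ofReal (D y) * (2 * angularMass b)) ?_ ?_ ?_ ?_
      · refine Eventually.of_forall fun w => ?_
        exact (by fun_prop : Measurable fun y => ENNReal.ofReal (D y)).mul (hgm.comp (by fun_prop))
      · refine Eventually.of_forall fun w => Eventually.of_forall fun y => ?_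
        gcongr
        exact gainProfile_le hb.nonneg _
      · rw [lintegral_mul_const _ (by fun_prop)]
        exact (ENNReal.mul_lt_top hDt (ENNReal.mul_lt_top (by simp) hb.angularMass_lt_top)).ne
      · refine Eventually.of_forall fun y => ?_
        have h1 : Tendsto (fun w : E => ‖w - y‖) (comap norm atTop) atTop := by
          refine tendsto_atTop_mono (fun w => ?_ : ∀ w : E, ‖w‖ + -‖y‖ ≤ ‖w - y‖)
            (tendsto_atTop_add_const_right _ _ tendsto_comap)
          have := norm_sub_norm_le w y; linarith
        have h2 := ENNReal.Tendsto.const_mul (a := ENNReal.ofReal (D y))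
          ((tendsto_gainProfile hb).comp h1) (Or.inr ENNReal.ofReal_ne_top)
        simpa using h2
    simpa using this
  have hev : ∀ᶠ w in comap norm atTop, H w ≤ ENNReal.ofReal (c / 2) :=
    hH.eventually (Iic_mem_nhds (ENNReal.ofReal_pos.2 (by positivity)))
  rw [eventually_comap] at hev
  obtain ⟨N, hN⟩ := eventually_atTop.1 hev
  refine ⟨max N 1, by positivity, fun v hv => ?_⟩
  have hHv : H (v - u) ≤ ENNReal.ofReal (c / 2) :=
    hN _ ((le_max_left _ _).trans hv.le) _ rfl
  refine le_trans ?_ (hfreq v)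
  have hmain : ∫⁻ q, ENNReal.ofReal (gainKernel θ b u v q) ∂pairMeasure ≤
      ENNReal.ofReal ((1 + ‖v - u‖) ^ θ) * H (v - u) := by
    let G : E → ℝ := fun w => 10000000 * Real.exp (-‖w - u‖ ^ 2 / 8)
    let Ψ : ℝ → ℝ → ℝ := fun ρ z =>
      Real.exp (-(ρ ^ 2 * z ^ 2) / 32) + Real.exp (-(ρ ^ 2 * (1 - z ^ 2)) / 32)
    have hne : ∀ᵐ q ∂pairMeasure, q.1 ≠ v :=
      Measure.quasiMeasurePreserving_fst.ae (by simp [ae_iff] : ∀ᵐ w : E, w ≠ v)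
    calc _ ≤ ∫⁻ q, ENNReal.ofReal (kern θ b q.2 (v - q.1) * (G q.1 *
          Ψ ‖v - q.1‖ (|⟪(q.2 : E), v - q.1⟫_ℝ| / ‖v - q.1‖))) ∂pairMeasure := by
          refine lintegral_mono_ae ?_
          filter_upwards [hne] with q hq
          refine ENNReal.ofReal_le_ofReal ?_
          unfold gainKernel
          refine mul_le_mul_of_nonneg_left ?_ (kern_nonneg hb.nonneg _ _)
          rw [mul_add]
          refine (add_le_add (sqrtM_mul_sqrtM_mul_weight_le u q.1 _)
            (sqrtM_mul_sqrtM_mul_weight_le u q.1 _)).trans (le_of_eq ?_)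
          rw [sq_norm_vsPrime_sub _ _ _ (norm_sph q.2) hq.symm,
            sq_norm_vPrime_sub _ _ _ (norm_sph q.2) hq.symm]
          simp only [G, Ψ]; ring
      _ = ∫⁻ w, ENNReal.ofReal (‖v - w‖ ^ θ * G w) * gainProfile b ‖v - w‖ :=
          lintegral_kern_mul hb Ψ (by unfold Function.uncurry; fun_prop) G
            (fun w => by positivity) (by fun_prop) v
      _ ≤ ∫⁻ w, ENNReal.ofReal ((1 + ‖v - u‖) ^ θ) * (ENNReal.ofReal (D (w - u)) *
            gainProfile b ‖v - u - (w - u)‖) := by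
          refine lintegral_mono fun w => ?_
          rw [sub_sub_sub_cancel_right, ← mul_assoc (ENNReal.ofReal ((1 + ‖v - u‖) ^ θ))]
          refine mul_le_mul' ?_ le_rfl
          rw [← ENNReal.ofReal_mul (by positivity)]
          refine ENNReal.ofReal_le_ofReal ?_
          have h1 := norm_sub_rpow_le hb.theta_nonneg hb.theta_le_one u v w
          calc ‖v - w‖ ^ θ * G w ≤ ((1 + ‖v - u‖) ^ θ * (1 + ‖w - u‖)) * G w :=
                mul_le_mul_of_nonneg_right h1 (by positivity)
            _ = _ := by simp only [G, D]; ring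
      _ = _ := by
          have hm : Measurable fun w => ENNReal.ofReal (D (w - u)) *
              gainProfile b ‖v - u - (w - u)‖ :=
            (by fun_prop : Measurable fun w => ENNReal.ofReal (D (w - u))).mul
              (hgm.comp (by fun_prop))
          rw [lintegral_const_mul _ hm, lintegral_sub_right_eq_self (fun w => ENNReal.ofReal (D w) *
              gainProfile b ‖v - u - w‖)]
  calc _ ≤ ENNReal.ofReal 2 * (ENNReal.ofReal ((1 + ‖v - u‖) ^ θ) * ENNReal.ofReal (c / 2)) := by
        rw [ENNReal.ofReal_ofNat]; gcongr
        exact hmain.trans (by gcongr)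
    _ = _ := by
        rw [← ENNReal.ofReal_mul (by positivity), ← ENNReal.ofReal_mul (by positivity)]
        congr 1; ring

/-! ### Lower bound for the gain term near equilibrium. -/

/-- A bounded angular profile below `b`, supported away from grazing and frontal collisions. -/
def truncProfile (b : ℝ → ℝ) (η z : ℝ) : ℝ := if η ≤ z ∧ z ^ 2 ≤ 1 - η ^ 2 then min (b z) 1 else 0

lemma measurable_truncProfile {b : ℝ → ℝ} (hb : Measurable b) (η : ℝ) :
    Measurable (truncProfile b η) := by
  refine Measurable.ite ?_ (hb.min measurable_const) measurable_const
  exact (measurableSet_le measurable_const measurable_id).inter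
    (measurableSet_le (measurable_id.pow_const 2) measurable_const)

lemma truncProfile_le {b : ℝ → ℝ} (hb : ∀ z, 0 ≤ b z) (η z : ℝ) : truncProfile b η z ≤ b z := by
  unfold truncProfile; split_ifs
  · exact min_le_left _ _
  · exact hb z

/-- The truncations with η = 1/(n+1) eventually see every z in (0,1), so if all of them vanished
almost everywhere, b would too. -/
lemma AngularCutoff.exists_truncProfile {θ : ℝ} {b : ℝ → ℝ} (hb : AngularCutoff θ b) :
    ∃ η : ℝ, 0 < η ∧ ∫⁻ z in Icc (0 : ℝ) 1, ENNReal.ofReal (truncProfile b η z) ≠ 0 := by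
  by_contra hcon
  push Not at hcon
  refine hb.ne_zero ?_
  have hall : ∀ n : ℕ, ∀ᵐ z ∂(volume.restrict (Icc (0 : ℝ) 1)),
      ENNReal.ofReal (truncProfile b (1 / ((n : ℝ) + 1)) z) = 0 := by
    intro n
    have := hcon (1 / ((n : ℝ) + 1)) (by positivity)
    rwa [lintegral_eq_zero_iff ((measurable_truncProfile hb.meas _).ennreal_ofReal)] at this
  have h0 : ∀ᵐ z : ℝ, z ≠ 0 := by simp [ae_iff]
  have h1 : ∀ᵐ z : ℝ, z ≠ 1 := by simp [ae_iff]
  filter_upwards [ae_all_iff.2 hall, ae_restrict_mem measurableSet_Icc, ae_restrict_of_ae h0,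
    ae_restrict_of_ae h1] with z hz hmem hz0 hz1
  have hp0 : 0 < z := lt_of_le_of_ne hmem.1 hz0.symm
  have hp1 : z < 1 := lt_of_le_of_ne hmem.2 hz1
  obtain ⟨n, hn⟩ := exists_nat_one_div_lt (show 0 < min z (1 - z) from lt_min hp0 (by linarith))
  have hn1 := hn.trans_le (min_le_left _ _)
  have hn2 := hn.trans_le (min_le_right _ _)
  have hpos : (0 : ℝ) < 1 / ((n : ℝ) + 1) := by positivity
  have := hz n
  rw [ENNReal.ofReal_eq_zero, truncProfile, if_pos ⟨hn1.le, by nlinarith⟩] at this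
  rcases min_le_iff.1 this with h | h
  · exact le_antisymm h (hb.nonneg z)
  · norm_num at h

/-- `∫ B(ω, v - v_*) f(v') g(v_*') dω dv_*`, for nonnegative functions. -/
def gain (θ : ℝ) (b : ℝ → ℝ) (f g : E → ℝ) (v : E) : ℝ≥0∞ :=
  ∫⁻ q, ENNReal.ofReal (kern θ b q.2 (v - q.1) * f (vPrime q.2 v q.1) * g (vsPrime q.2 v q.1))
    ∂pairMeasure

lemma exists_le_maxwellian (u : E) (R : ℝ) : ∃ c : ℝ, 0 < c ∧ ∀ v, ‖v - u‖ ≤ R →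
    c ≤ maxwellian u v := by
  have hpi := Real.pi_pos
  refine ⟨(2 * Real.pi) ^ (-(3 / 2) : ℝ) * Real.exp (-R ^ 2 / 2), by positivity, fun v hv => ?_⟩
  unfold maxwellian
  gcongr

lemma maxwellian_le_one (u v : E) : maxwellian u v ≤ 1 :=
  (maxwellian_le_sqrtM u v).trans (sqrtM_le_one u v)

/-- No upper bound on p and q is needed. If q ≥ b, replace q by b first; if q ≤ b, then q itself is
at most 1. -/
lemma mul_sub_le_of_abs {a b p q : ℝ} (hb : 0 ≤ b) (ha1 : a ≤ 1) (hb1 : b ≤ 1)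
    (hp : 0 ≤ p) (hq : 0 ≤ q) : a * b ≤ p * q + |p - a| + |q - b| := by
  rcases le_total q b with h | h
  · have h1 := neg_abs_le (p - a)
    have h2 := neg_abs_le (q - b)
    nlinarith [abs_nonneg (p - a), abs_nonneg (q - b)]
  · have h1 := neg_abs_le (p - a)
    nlinarith [abs_nonneg (p - a), abs_nonneg (q - b)]

/-- If `P` is close to the Maxwellian in `L¹`, then its gain term is bounded below on bounded sets
of velocities. -/
theorem exists_le_gain {θ : ℝ} {b : ℝ → ℝ} (hb : AngularCutoff θ b) (u : E) (N : ℝ) :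
    ∃ δ : ℝ≥0∞, 0 < δ ∧ ∃ c : ℝ, 0 < c ∧ ∀ P : E → ℝ, Measurable P → (∀ v, 0 ≤ P v) →
      ∫⁻ v, ‖P v - maxwellian u v‖ₑ ≤ δ → ∀ v, ‖v - u‖ ≤ N → ENNReal.ofReal c ≤ gain θ b P P v := by
  obtain ⟨η, hη, hη0⟩ := hb.exists_truncProfile
  obtain ⟨κ, hκ, hκM⟩ := exists_le_maxwellian u (N + 2)
  set β := truncProfile b η with hβ
  have hβm : Measurable β := measurable_truncProfile hb.meas η
  have hβE : Measurable fun z => ENNReal.ofReal (β z) := hβm.ennreal_ofReal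
  have hβs : ∀ z, ENNReal.ofReal (β z) ≠ 0 → η ≤ z ∧ z ^ 2 ≤ 1 - η ^ 2 := by
    intro z hz
    by_contra h
    exact hz (by rw [hβ, truncProfile, if_neg h, ENNReal.ofReal_zero])
  have hβ1 : ∀ z, ENNReal.ofReal (β z) ≤ 1 := by
    intro z
    refine ENNReal.ofReal_le_one.2 ?_
    rw [hβ, truncProfile]; split_ifs
    · exact min_le_right _ _
    · exact zero_le_one
  let χ : E → ℝ≥0∞ := {V : E | 1 ≤ ‖V‖ ∧ ‖V‖ ≤ 2}.indicator 1
  have hχs : MeasurableSet {V : E | 1 ≤ ‖V‖ ∧ ‖V‖ ≤ 2} :=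
    (measurableSet_le measurable_const measurable_norm).inter
      (measurableSet_le measurable_norm measurable_const)
  have hχm : Measurable χ := measurable_one.indicator hχs
  have hχle : ∀ V, χ V ≤ (if ‖V‖ ≤ 2 then 1 else 0) := by
    intro V
    by_cases h : 1 ≤ ‖V‖ ∧ ‖V‖ ≤ 2
    · simp [χ, h]
    · simp [χ, h]
  let r : E → E × Sph → ℝ≥0∞ := fun v q =>
    χ (v - q.1) * ENNReal.ofReal (β (|⟪(q.2 : E), v - q.1⟫_ℝ| / ‖v - q.1‖))
  have hrm : ∀ v, Measurable (r v) := fun v =>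
    (hχm.comp (by fun_prop : Measurable fun q : E × Sph => v - q.1)).mul
      (hβE.comp (by fun_prop : Measurable fun q : E × Sph =>
        |⟪(q.2 : E), v - q.1⟫_ℝ| / ‖v - q.1‖))
  have hr_le : ∀ v q, r v q ≤ ENNReal.ofReal (kern θ b q.2 (v - q.1)) := by
    intro v q
    by_cases h : 1 ≤ ‖v - q.1‖ ∧ ‖v - q.1‖ ≤ 2
    · simp only [r, χ, indicator, mem_ofPred_eq, h, and_self, if_true, Pi.one_apply, one_mul]
      refine ENNReal.ofReal_le_ofReal ?_
      refine (truncProfile_le hb.nonneg η _).trans ?_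
      rw [kern]
      exact le_mul_of_one_le_left (hb.nonneg _) (Real.one_le_rpow h.1 hb.theta_nonneg)
    · simp [r, χ, h]
  -- the two error terms
  set K₁ := ENNReal.ofReal (4 * 2 ^ 2) * ENNReal.ofReal (2 / η ^ 2) with hK₁
  have hT : ∀ Φ : E → ℝ≥0∞, Measurable Φ → ∀ v : E,
      ∫⁻ V : E, (if ‖V‖ ≤ 2 then 1 else 0) * ∫⁻ ω : Sph,
      (if η ≤ |⟪(ω : E), V⟫_ℝ| then 1 else 0) * Φ (v - ⟪(ω : E), V⟫_ℝ • (ω : E)) ∂sphereMeasure ≤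
      K₁ * ∫⁻ x, Φ x := by
    intro Φ hΦ v
    have h1 := lintegral_ball_sphere_parallel_le hη (zero_le_two (α := ℝ)) (fun x => Φ (v - x))
      (hΦ.comp (by fun_prop))
    rw [lintegral_sub_left_eq_self Φ v] at h1
    rw [hK₁, mul_assoc]
    exact h1
  -- The errors must be bounded uniformly in v by the L¹ norm of Φ. For v' the displacement from v
  -- is the component of v - v_* along ω, and |ω·(v-v_*)| ≥ η on the support, so polar coordinates
  -- apply.
  have hT1 : ∀ Φ : E → ℝ≥0∞, Measurable Φ → ∀ v : E,
      ∫⁻ q, r v q * Φ (vPrime q.2 v q.1) ∂pairMeasure ≤ K₁ * ∫⁻ x, Φ x := by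
    intro Φ hΦ v
    refine le_trans ?_ (hT Φ hΦ v)
    have hm : Measurable fun q : E × Sph => r v q * Φ (vPrime q.2 v q.1) :=
      (hrm v).mul (hΦ.comp (by fun_prop))
    rw [pairMeasure, lintegral_prod _ hm.aemeasurable,
      ← lintegral_sub_left_eq_self (fun V : E => (if ‖V‖ ≤ 2 then (1 : ℝ≥0∞) else 0) * ∫⁻ ω : Sph,
      (if η ≤ |⟪(ω : E), V⟫_ℝ| then 1 else 0) * Φ (v - ⟪(ω : E), V⟫_ℝ • (ω : E)) ∂sphereMeasure) v]
    refine lintegral_mono fun w => ?_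
    simp only
    rw [← lintegral_const_mul' _ _ (by split_ifs <;> simp)]
    refine lintegral_mono fun ω => ?_
    simp only [r]
    rw [vPrime, real_inner_comm (ω : E) (v - w), mul_assoc]
    by_cases h : 1 ≤ ‖v - w‖ ∧ ‖v - w‖ ≤ 2
    · refine mul_le_mul' (hχle _) (mul_le_mul' ?_ le_rfl)
      by_cases hz : ENNReal.ofReal (β (|⟪(ω : E), v - w⟫_ℝ| / ‖v - w‖)) = 0
      · rw [hz]; exact zero_le
      · have h2 := (hβs _ hz).1
        rw [le_div_iff₀ (by linarith)] at h2
        rw [if_pos (by nlinarith)]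
        exact hβ1 _
    · simp only [χ, indicator, mem_ofPred_eq, h, if_false, zero_mul]
      exact zero_le
  -- For v_*' the displacement from v is the orthogonal component, which the quarter-turn estimate
  -- converts into the parallel one.
  have hT2 : ∀ Φ : E → ℝ≥0∞, Measurable Φ → ∀ v : E,
      ∫⁻ q, r v q * Φ (vsPrime q.2 v q.1) ∂pairMeasure ≤
        ENNReal.ofReal (2 / η) * (K₁ * ∫⁻ x, Φ x) := by
    intro Φ hΦ v
    refine le_trans ?_ (mul_le_mul' le_rfl (hT Φ hΦ v))
    have hm : Measurable fun q : E × Sph => r v q * Φ (vsPrime q.2 v q.1) :=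
      (hrm v).mul (hΦ.comp (by fun_prop))
    rw [pairMeasure, lintegral_prod _ hm.aemeasurable,
      ← lintegral_sub_left_eq_self (fun V : E => (if ‖V‖ ≤ 2 then (1 : ℝ≥0∞) else 0) * ∫⁻ ω : Sph,
      (if η ≤ |⟪(ω : E), V⟫_ℝ| then 1 else 0) * Φ (v - ⟪(ω : E), V⟫_ℝ • (ω : E)) ∂sphereMeasure) v,
      ← lintegral_const_mul' _ _ ENNReal.ofReal_ne_top]
    refine lintegral_mono fun w => ?_
    simp only [r]
    by_cases h : 1 ≤ ‖v - w‖ ∧ ‖v - w‖ ≤ 2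
    · have h1 := lintegral_sphere_orthogonal_le hη (fun z => ENNReal.ofReal (β z)) hβE hβ1 hβs
        (fun x => Φ (v - x)) (hΦ.comp (by fun_prop)) (v - w)
        (norm_pos_iff.1 (by linarith))
      have hχ1 : χ (v - w) = 1 := by simp [χ, h]
      rw [hχ1, if_pos h.2, one_mul]
      simp only [one_mul]
      refine le_trans (le_of_eq (lintegral_congr fun ω => ?_)) (h1.trans ?_)
      · rw [vsPrime, real_inner_comm (ω : E) (v - w)]
        congr 2; abel
      · gcongr with ω
        by_cases h3 : η * ‖v - w‖ ≤ |⟪(ω : E), v - w⟫_ℝ|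
        · rw [if_pos h3, if_pos (by nlinarith)]
        · rw [if_neg h3]; exact zero_le
    · simp only [χ, indicator, mem_ofPred_eq, h, if_false, zero_mul, lintegral_zero]
      exact zero_le
  -- the main term
  have hm0 : ∀ v, ∫⁻ q, r v q ∂pairMeasure = volume {V : E | 1 ≤ ‖V‖ ∧ ‖V‖ ≤ 2} *
      angularMass β := by
    intro v
    rw [pairMeasure, lintegral_prod _ (hrm v).aemeasurable]
    have : ∀ w, ∫⁻ ω : Sph, r v (w, ω) ∂sphereMeasure = χ (v - w) * angularMass β := by
      intro w
      simp only [r]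
      by_cases h : 1 ≤ ‖v - w‖ ∧ ‖v - w‖ ≤ 2
      · have hm3 : Measurable fun ω : Sph =>
            ENNReal.ofReal (β (|⟪(ω : E), v - w⟫_ℝ| / ‖v - w‖)) :=
          hβE.comp (by fun_prop : Measurable fun ω : Sph => |⟪(ω : E), v - w⟫_ℝ| / ‖v - w‖)
        rw [lintegral_const_mul _ hm3, lintegral_sphere_ratio (fun z => ENNReal.ofReal (β z)) hβE
          (norm_pos_iff.1 (by linarith)), angularMass]
      · simp [χ, h]
    simp_rw [this]
    have hχm' : Measurable fun w : E => χ (v - w) := hχm.comp (by fun_prop)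
    rw [lintegral_mul_const _ hχm', lintegral_sub_left_eq_self χ v,
      lintegral_indicator_one hχs]
  set m := volume {V : E | 1 ≤ ‖V‖ ∧ ‖V‖ ≤ 2} * angularMass β with hm
  have hm_ne : m ≠ 0 := by
    refine mul_ne_zero ?_ (mul_ne_zero (by simpa using Real.pi_pos) hη0)
    have hopen : IsOpen {V : E | 1 < ‖V‖ ∧ ‖V‖ < 2} :=
      (isOpen_lt continuous_const continuous_norm).inter (isOpen_lt continuous_norm continuous_const)
    obtain ⟨w₀, hw₀⟩ : ∃ w₀ : E, ‖w₀‖ = 3 / 2 := exists_norm_eq E (by norm_num)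
    have hne : ({V : E | 1 < ‖V‖ ∧ ‖V‖ < 2}).Nonempty :=
      ⟨w₀, by rw [mem_ofPred_eq, hw₀]; norm_num⟩
    intro h0
    exact (hopen.measure_pos volume hne).ne'
      (measure_mono_null (t := {V : E | 1 ≤ ‖V‖ ∧ ‖V‖ ≤ 2})
        (fun w hw => And.intro (le_of_lt hw.1) (le_of_lt hw.2)) h0)
  -- The main term is at least 2c. With δ = c/K the two errors together cost at most c, and c
  -- remains.
  obtain ⟨c, hc, hcm⟩ : ∃ c : ℝ, 0 < c ∧ ENNReal.ofReal (2 * c) ≤ ENNReal.ofReal (κ ^ 2) * m := by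
    have h1 : ENNReal.ofReal (κ ^ 2) * m ≠ 0 :=
      mul_ne_zero (by simpa using hκ.ne') hm_ne
    rcases eq_or_ne (ENNReal.ofReal (κ ^ 2) * m) ∞ with h | h
    · exact ⟨1, one_pos, by simp [h]⟩
    · refine ⟨(ENNReal.ofReal (κ ^ 2) * m).toReal / 2, half_pos (ENNReal.toReal_pos h1 h), ?_⟩
      rw [mul_div_cancel₀ _ (two_ne_zero), ENNReal.ofReal_toReal h]
  set K := K₁ + ENNReal.ofReal (2 / η) * K₁ with hK
  have hKt : K ≠ ∞ := by
    have : K₁ ≠ ∞ := ENNReal.mul_ne_top ENNReal.ofReal_ne_top ENNReal.ofReal_ne_top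
    exact ENNReal.add_ne_top.2 ⟨this, ENNReal.mul_ne_top ENNReal.ofReal_ne_top this⟩
  have hc0 : ENNReal.ofReal c ≠ 0 := by simpa using hc
  refine ⟨ENNReal.ofReal c / K, ENNReal.div_pos hc0 hKt, c, hc, fun P hP hP0 hPd v hv => ?_⟩
  set Φ : E → ℝ≥0∞ := fun v => ‖P v - maxwellian u v‖ₑ with hΦdef
  have hΦ : Measurable Φ := (hP.sub (continuous_maxwellian u).measurable).enorm
  have hA : ∫⁻ q, r v q * ENNReal.ofReal (κ ^ 2) ∂pairMeasure ≤
      gain θ b P P v + ENNReal.ofReal c := by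
    calc _ ≤ ∫⁻ q, (ENNReal.ofReal (kern θ b q.2 (v - q.1) * P (vPrime q.2 v q.1) *
            P (vsPrime q.2 v q.1)) +
            (r v q * Φ (vPrime q.2 v q.1) + r v q * Φ (vsPrime q.2 v q.1))) ∂pairMeasure := by
          refine lintegral_mono fun q => ?_
          by_cases h : 1 ≤ ‖v - q.1‖ ∧ ‖v - q.1‖ ≤ 2
          · have e1 : κ ^ 2 ≤ maxwellian u (vPrime q.2 v q.1) *
                maxwellian u (vsPrime q.2 v q.1) := by
              rw [maxwellian_collide _ _ _ _ (norm_sph q.2), pow_two]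
              refine mul_le_mul (hκM v (by linarith)) (hκM _ ?_) hκ.le (maxwellian_pos _ _).le
              have : q.1 - u = (v - u) - (v - q.1) := by abel
              rw [this]
              exact (norm_sub_le _ _).trans (by linarith [h.2])
            have e2 := e1.trans (mul_sub_le_of_abs (maxwellian_pos _ _).le
              (maxwellian_le_one _ _) (maxwellian_le_one _ _)
              (hP0 (vPrime q.2 v q.1)) (hP0 (vsPrime q.2 v q.1)))
            have e3 : ENNReal.ofReal (κ ^ 2) ≤ ENNReal.ofReal (P (vPrime q.2 v q.1) *
                P (vsPrime q.2 v q.1)) + Φ (vPrime q.2 v q.1) + Φ (vsPrime q.2 v q.1) := by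
              refine (ENNReal.ofReal_le_ofReal e2).trans ?_
              rw [ENNReal.ofReal_add (add_nonneg (mul_nonneg (hP0 _) (hP0 _)) (abs_nonneg _))
                (abs_nonneg _), ENNReal.ofReal_add (mul_nonneg (hP0 _) (hP0 _)) (abs_nonneg _)]
              simp only [hΦdef, Real.enorm_eq_ofReal_abs, le_refl]
            calc r v q * ENNReal.ofReal (κ ^ 2) ≤ r v q * (ENNReal.ofReal (P (vPrime q.2 v q.1) *
                P (vsPrime q.2 v q.1)) + Φ (vPrime q.2 v q.1) + Φ (vsPrime q.2 v q.1)) := by gcongr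
              _ = r v q * ENNReal.ofReal (P (vPrime q.2 v q.1) * P (vsPrime q.2 v q.1)) +
                  (r v q * Φ (vPrime q.2 v q.1) + r v q * Φ (vsPrime q.2 v q.1)) := by ring
              _ ≤ _ := by
                gcongr
                rw [mul_assoc (kern θ b _ _), ENNReal.ofReal_mul (kern_nonneg hb.nonneg _ _)]
                gcongr
                exact hr_le v q
          · have : r v q = 0 := by simp [r, χ, h]
            rw [this, zero_mul]; exact zero_le
      _ = gain θ b P P v + (∫⁻ q, r v q * Φ (vPrime q.2 v q.1) ∂pairMeasure +
            ∫⁻ q, r v q * Φ (vsPrime q.2 v q.1) ∂pairMeasure) := by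
          have hbm := hb.meas
          have m1 : Measurable fun q : E × Sph => ENNReal.ofReal (kern θ b q.2 (v - q.1) *
              P (vPrime q.2 v q.1) * P (vsPrime q.2 v q.1)) := by
            fun_prop
          have m2 : Measurable fun q : E × Sph => r v q * Φ (vPrime q.2 v q.1) :=
            (hrm v).mul (hΦ.comp (by fun_prop))
          rw [lintegral_add_left m1, lintegral_add_left m2, gain]
      _ ≤ gain θ b P P v + ((K₁ * ∫⁻ x, Φ x) + ENNReal.ofReal (2 / η) * (K₁ * ∫⁻ x, Φ x)) := by
          exact add_le_add le_rfl (add_le_add (hT1 Φ hΦ v) (hT2 Φ hΦ v))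
      _ = gain θ b P P v + K * ∫⁻ x, Φ x := by rw [hK]; ring
      _ ≤ gain θ b P P v + K * (ENNReal.ofReal c / K) := by gcongr
      _ ≤ _ := by gcongr; exact ENNReal.mul_div_le
  rw [lintegral_mul_const _ (hrm v), hm0 v, mul_comm m] at hA
  have h2 : ENNReal.ofReal c + ENNReal.ofReal c ≤ gain θ b P P v + ENNReal.ofReal c := by
    rw [← ENNReal.ofReal_add hc.le hc.le, ← two_mul]
    exact hcm.trans hA
  exact (ENNReal.add_le_add_iff_right ENNReal.ofReal_ne_top).1 h2

/-! ### Measurability and pointwise bounds of the collision operator. -/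

theorem IsCutoffHardPotential.exists_kern {θ : ℝ} {B : E → E → ℝ} (hB : IsCutoffHardPotential θ B) :
    ∃ b, AngularCutoff θ b ∧ ∀ ω V : E, ‖ω‖ = 1 → B ω V = kern θ b ω V := by
  obtain ⟨b, h1, h2, h3, h4, h5⟩ := hB.exists_angular
  exact ⟨b, ⟨hB.theta_nonneg, hB.theta_le_one, h1, h2, h3, h4⟩, h5⟩

/-- The kernel is prescribed only for unit ω, and the collision operator uses no other ω. -/
lemma Q_congr_kernel {B B' : E → E → ℝ} (h : ∀ ω V : E, ‖ω‖ = 1 → B ω V = B' ω V) : Q B = Q B' := by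
  funext f g v
  have h1 : ∀ (ω : Sph) V, B ω V = B' ω V := fun ω V => h ω V (norm_sph ω)
  simp only [Q, Qplus, Qminus, h1]

lemma measurable_Qplus {θ : ℝ} {b : ℝ → ℝ} (hb : Measurable b) {f g : E → E → ℝ}
    (hf : Measurable (Function.uncurry f)) (hg : Measurable (Function.uncurry g)) :
    Measurable fun p : E × E => Qplus (kern θ b) (f p.1) (g p.1) p.2 := by
  unfold Qplus
  have h1 : Measurable fun q : ((E × E) × E) × Sph =>
      kern θ b q.2 (q.1.1.2 - q.1.2) * f q.1.1.1 (vPrime q.2 q.1.1.2 q.1.2) *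
        g q.1.1.1 (vsPrime q.2 q.1.1.2 q.1.2) := by
    refine ((Measurable.kern hb (by fun_prop) (by fun_prop)).mul ?_).mul ?_
    · exact hf.comp (f := fun q : ((E × E) × E) × Sph => (q.1.1.1, vPrime q.2 q.1.1.2 q.1.2))
        (by fun_prop)
    · exact hg.comp (f := fun q : ((E × E) × E) × Sph => (q.1.1.1, vsPrime q.2 q.1.1.2 q.1.2))
        (by fun_prop)
  have h2 := (h1.stronglyMeasurable.integral_prod_right' (ν := sphereMeasure))
  exact (h2.integral_prod_right' (ν := (volume : Measure E))).measurable

lemma measurable_Qminus {θ : ℝ} {b : ℝ → ℝ} (hb : Measurable b) {f g : E → E → ℝ}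
    (hf : Measurable (Function.uncurry f)) (hg : Measurable (Function.uncurry g)) :
    Measurable fun p : E × E => Qminus (kern θ b) (f p.1) (g p.1) p.2 := by
  unfold Qminus
  have h1 : Measurable fun q : ((E × E) × E) × Sph =>
      kern θ b q.2 (q.1.1.2 - q.1.2) * g q.1.1.1 q.1.2 := by
    refine (Measurable.kern hb (by fun_prop) (by fun_prop)).mul ?_
    exact hg.comp (f := fun q : ((E × E) × E) × Sph => (q.1.1.1, q.1.2)) (by fun_prop)
  have h2 := (h1.stronglyMeasurable.integral_prod_right' (ν := sphereMeasure))
  exact hf.mul (h2.integral_prod_right' (ν := (volume : Measure E))).measurable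

lemma measurable_Q {θ : ℝ} {b : ℝ → ℝ} (hb : Measurable b) {f g : E → E → ℝ}
    (hf : Measurable (Function.uncurry f)) (hg : Measurable (Function.uncurry g)) :
    Measurable fun p : E × E => Q (kern θ b) (f p.1) (g p.1) p.2 :=
  (measurable_Qplus hb hf hg).sub (measurable_Qminus hb hf hg)

section Bounds

variable {θ : ℝ} {b : ℝ → ℝ} {u : E} {f g : E → ℝ} {C D K : ℝ}

/-- By conservation of energy √μ(v') √μ(v_*') = √μ(v) √μ(v_*), so the factor √μ(v) comes out and the
kernel integral against √μ(v_*) remains. Integrability allows the iterated Bochner integral in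
`Qplus` to be treated as one integral. -/
lemma Qplus_integrable (hb : AngularCutoff θ b)
    (hK : ∀ v : E, ∫⁻ q, ENNReal.ofReal (kern θ b q.2 (v - q.1) * sqrtM u q.1) ∂pairMeasure ≤
      ENNReal.ofReal (K * (1 + ‖v - u‖)))
    (hf : Measurable f) (hg : Measurable g) (hC : 0 ≤ C)
    (hfC : ∀ᵐ v, |f v| ≤ C * sqrtM u v) (hgD : ∀ᵐ v, |g v| ≤ D * sqrtM u v) :
    ∀ᵐ v : E, (∫⁻ q, ‖kern θ b q.2 (v - q.1) * f (vPrime q.2 v q.1) * g (vsPrime q.2 v q.1)‖ₑ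
        ∂pairMeasure) ≤ ENNReal.ofReal (C * D * (K * (1 + ‖v - u‖)) * sqrtM u v) ∧
      Integrable (fun q : E × Sph => kern θ b q.2 (v - q.1) * f (vPrime q.2 v q.1) *
        g (vsPrime q.2 v q.1)) pairMeasure := by
  have hD : 0 ≤ D := by
    obtain ⟨v, hv⟩ := hgD.exists
    exact nonneg_of_mul_nonneg_left ((abs_nonneg _).trans hv) (sqrtM_pos u v)
  filter_upwards [ae_ae_coll (hfC.and hgD)] with v hv
  have key : (∫⁻ q, ‖kern θ b q.2 (v - q.1) * f (vPrime q.2 v q.1) * g (vsPrime q.2 v q.1)‖ₑ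
        ∂pairMeasure) ≤ ENNReal.ofReal (C * D * (K * (1 + ‖v - u‖)) * sqrtM u v) := by
    have hm : Measurable fun q : E × Sph =>
        ENNReal.ofReal (kern θ b q.2 (v - q.1) * sqrtM u q.1) := by
      have := Measurable.kern (θ := θ) hb.meas (f := fun q : E × Sph => (q.2 : E))
        (g := fun q => v - q.1) (by fun_prop) (by fun_prop)
      fun_prop
    calc _ ≤ ∫⁻ q, ENNReal.ofReal (C * D * sqrtM u v) *
          ENNReal.ofReal (kern θ b q.2 (v - q.1) * sqrtM u q.1) ∂pairMeasure := by
          refine lintegral_mono_ae ?_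
          filter_upwards [hv] with q hq
          have hk := kern_nonneg (θ := θ) hb.nonneg q.2 (v - q.1)
          have := sqrtM_pos u v
          rw [← ENNReal.ofReal_mul (by positivity), ← ofReal_norm, norm_mul, norm_mul,
            Real.norm_eq_abs, Real.norm_eq_abs, Real.norm_eq_abs, abs_of_nonneg hk]
          refine ENNReal.ofReal_le_ofReal ?_
          have h1 := hq.2.2.1.1
          have h2 := hq.2.2.2.2
          calc _ ≤ kern θ b q.2 (v - q.1) * (C * sqrtM u (vPrime q.2 v q.1)) *
                (D * sqrtM u (vsPrime q.2 v q.1)) := by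
                gcongr
                exact mul_nonneg hk (mul_nonneg hC (sqrtM_pos _ _).le)
            _ = kern θ b q.2 (v - q.1) * (C * D) * (sqrtM u (vPrime q.2 v q.1) *
                sqrtM u (vsPrime q.2 v q.1)) := by ring
            _ = _ := by rw [sqrtM_collide _ _ _ _ (norm_sph q.2)]; ring
      _ ≤ ENNReal.ofReal (C * D * sqrtM u v) * ENNReal.ofReal (K * (1 + ‖v - u‖)) := by
          rw [lintegral_const_mul _ hm]
          exact mul_le_mul' le_rfl (hK v)
      _ = _ := by
          rw [← ENNReal.ofReal_mul (by have := sqrtM_pos u v; positivity)]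
          congr 1; ring
  refine ⟨key, Measurable.aestronglyMeasurable ?_, key.trans_lt ENNReal.ofReal_lt_top⟩
  refine ((Measurable.kern hb.meas (by fun_prop) (by fun_prop)).mul ?_).mul ?_
  · exact hf.comp (by fun_prop)
  · exact hg.comp (by fun_prop)

lemma Qminus_integrable (hb : AngularCutoff θ b)
    (hK : ∀ v : E, ∫⁻ q, ENNReal.ofReal (kern θ b q.2 (v - q.1) * sqrtM u q.1) ∂pairMeasure ≤
      ENNReal.ofReal (K * (1 + ‖v - u‖)))
    (hg : Measurable g) (hgD : ∀ᵐ v, |g v| ≤ D * sqrtM u v) (v : E) :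
    (∫⁻ q, ‖kern θ b q.2 (v - q.1) * g q.1‖ₑ
        ∂pairMeasure) ≤ ENNReal.ofReal (D * (K * (1 + ‖v - u‖))) ∧
      Integrable (fun q : E × Sph => kern θ b q.2 (v - q.1) * g q.1) pairMeasure := by
  have hD : 0 ≤ D := by
    obtain ⟨v, hv⟩ := hgD.exists
    exact nonneg_of_mul_nonneg_left ((abs_nonneg _).trans hv) (sqrtM_pos u v)
  have hq : ∀ᵐ q : E × Sph ∂pairMeasure, |g q.1| ≤ D * sqrtM u q.1 :=
    Measure.quasiMeasurePreserving_fst.ae hgD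
  have key : (∫⁻ q, ‖kern θ b q.2 (v - q.1) * g q.1‖ₑ
        ∂pairMeasure) ≤ ENNReal.ofReal (D * (K * (1 + ‖v - u‖))) := by
    have hm : Measurable fun q : E × Sph =>
        ENNReal.ofReal (kern θ b q.2 (v - q.1) * sqrtM u q.1) := by
      have := Measurable.kern (θ := θ) hb.meas (f := fun q : E × Sph => (q.2 : E))
        (g := fun q => v - q.1) (by fun_prop) (by fun_prop)
      fun_prop
    calc _ ≤ ∫⁻ q, ENNReal.ofReal D *
          ENNReal.ofReal (kern θ b q.2 (v - q.1) * sqrtM u q.1) ∂pairMeasure := by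
          refine lintegral_mono_ae ?_
          filter_upwards [hq] with q hq
          have hk := kern_nonneg (θ := θ) hb.nonneg q.2 (v - q.1)
          rw [← ENNReal.ofReal_mul hD, ← ofReal_norm, norm_mul,
            Real.norm_eq_abs, Real.norm_eq_abs, abs_of_nonneg hk]
          refine ENNReal.ofReal_le_ofReal ?_
          nlinarith [mul_le_mul_of_nonneg_left hq hk]
      _ ≤ ENNReal.ofReal D * ENNReal.ofReal (K * (1 + ‖v - u‖)) := by
          rw [lintegral_const_mul _ hm]
          exact mul_le_mul' le_rfl (hK v)
      _ = _ := (ENNReal.ofReal_mul hD).symm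
  refine ⟨key, Measurable.aestronglyMeasurable ?_, key.trans_lt ENNReal.ofReal_lt_top⟩
  refine (Measurable.kern hb.meas (by fun_prop) (by fun_prop)).mul ?_
  exact hg.comp (by fun_prop)

lemma Qplus_eq_integral {v : E}
    (h : Integrable (fun q : E × Sph => kern θ b q.2 (v - q.1) * f (vPrime q.2 v q.1) *
        g (vsPrime q.2 v q.1)) pairMeasure) :
    Qplus (kern θ b) f g v = ∫ q, kern θ b q.2 (v - q.1) * f (vPrime q.2 v q.1) *
        g (vsPrime q.2 v q.1) ∂pairMeasure := by
  unfold pairMeasure at h ⊢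
  rw [integral_prod _ h]
  rfl

lemma Qminus_eq_integral {v : E}
    (h : Integrable (fun q : E × Sph => kern θ b q.2 (v - q.1) * g q.1) pairMeasure) :
    Qminus (kern θ b) f g v = f v * ∫ q, kern θ b q.2 (v - q.1) * g q.1 ∂pairMeasure := by
  unfold pairMeasure at h ⊢
  rw [integral_prod _ h]
  rfl

lemma abs_Qplus_le (hb : AngularCutoff θ b)
    (hK : ∀ v : E, ∫⁻ q, ENNReal.ofReal (kern θ b q.2 (v - q.1) * sqrtM u q.1) ∂pairMeasure ≤
      ENNReal.ofReal (K * (1 + ‖v - u‖))) (hK0 : 0 ≤ K)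
    (hf : Measurable f) (hg : Measurable g)
    (hfC : ∀ᵐ v, |f v| ≤ C * sqrtM u v) (hgD : ∀ᵐ v, |g v| ≤ D * sqrtM u v) :
    ∀ᵐ v : E, |Qplus (kern θ b) f g v| ≤ C * D * (K * (1 + ‖v - u‖)) * sqrtM u v := by
  have hD : 0 ≤ D := by
    obtain ⟨v, hv⟩ := hgD.exists
    exact nonneg_of_mul_nonneg_left ((abs_nonneg _).trans hv) (sqrtM_pos u v)
  have hC : 0 ≤ C := by
    obtain ⟨v, hv⟩ := hfC.exists
    exact nonneg_of_mul_nonneg_left ((abs_nonneg _).trans hv) (sqrtM_pos u v)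
  filter_upwards [Qplus_integrable hb hK hf hg hC hfC hgD] with v hv
  rw [Qplus_eq_integral hv.2, ← Real.norm_eq_abs]
  have := (enorm_integral_le_lintegral_enorm _).trans hv.1
  rwa [← ofReal_norm, ENNReal.ofReal_le_ofReal_iff] at this
  have := sqrtM_pos u v
  positivity

lemma abs_Qminus_le (hb : AngularCutoff θ b)
    (hK : ∀ v : E, ∫⁻ q, ENNReal.ofReal (kern θ b q.2 (v - q.1) * sqrtM u q.1) ∂pairMeasure ≤
      ENNReal.ofReal (K * (1 + ‖v - u‖))) (hK0 : 0 ≤ K) (hg : Measurable g)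
    (hfC : ∀ᵐ v, |f v| ≤ C * sqrtM u v) (hgD : ∀ᵐ v, |g v| ≤ D * sqrtM u v) :
    ∀ᵐ v : E, |Qminus (kern θ b) f g v| ≤ C * D * (K * (1 + ‖v - u‖)) * sqrtM u v := by
  have hD : 0 ≤ D := by
    obtain ⟨v, hv⟩ := hgD.exists
    exact nonneg_of_mul_nonneg_left ((abs_nonneg _).trans hv) (sqrtM_pos u v)
  have hC : 0 ≤ C := by
    obtain ⟨v, hv⟩ := hfC.exists
    exact nonneg_of_mul_nonneg_left ((abs_nonneg _).trans hv) (sqrtM_pos u v)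
  filter_upwards [hfC] with v hfv
  have hv := Qminus_integrable hb hK hg hgD v
  rw [Qminus_eq_integral hv.2, abs_mul, ← Real.norm_eq_abs (∫ q, _ ∂_)]
  have := (enorm_integral_le_lintegral_enorm _).trans hv.1
  rw [← ofReal_norm, ENNReal.ofReal_le_ofReal_iff (by positivity)] at this
  calc _ ≤ (C * sqrtM u v) * (D * (K * (1 + ‖v - u‖))) := by
        gcongr
        exact mul_nonneg hC (sqrtM_pos u v).le
    _ = _ := by ring

lemma abs_Q_le (hb : AngularCutoff θ b)
    (hK : ∀ v : E, ∫⁻ q, ENNReal.ofReal (kern θ b q.2 (v - q.1) * sqrtM u q.1) ∂pairMeasure ≤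
      ENNReal.ofReal (K * (1 + ‖v - u‖))) (hK0 : 0 ≤ K)
    (hf : Measurable f) (hg : Measurable g)
    (hfC : ∀ᵐ v, |f v| ≤ C * sqrtM u v) (hgD : ∀ᵐ v, |g v| ≤ D * sqrtM u v) :
    ∀ᵐ v : E, |Q (kern θ b) f g v| ≤ 2 * (C * D * (K * (1 + ‖v - u‖)) * sqrtM u v) := by
  filter_upwards [abs_Qplus_le hb hK hK0 hf hg hfC hgD, abs_Qminus_le hb hK hK0 hg hfC hgD]
    with v h1 h2
  rw [Q, two_mul]
  exact (abs_sub _ _).trans (add_le_add h1 h2)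

/-- The collision operator does not see null sets. -/
lemma Q_congr_ae {f' g' : E → ℝ} (hff : f =ᵐ[volume] f') (hgg : g =ᵐ[volume] g')
    (hb : AngularCutoff θ b)
    (hK : ∀ v : E, ∫⁻ q, ENNReal.ofReal (kern θ b q.2 (v - q.1) * sqrtM u q.1) ∂pairMeasure ≤
      ENNReal.ofReal (K * (1 + ‖v - u‖)))
    (hf : Measurable f) (hg : Measurable g) (hf' : Measurable f') (hg' : Measurable g')
    (hfC : ∀ᵐ v, |f v| ≤ C * sqrtM u v) (hgD : ∀ᵐ v, |g v| ≤ D * sqrtM u v) :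
    ∀ᵐ v, Q (kern θ b) f g v = Q (kern θ b) f' g' v := by
  have hC : 0 ≤ C := by
    obtain ⟨v, hv⟩ := hfC.exists
    exact nonneg_of_mul_nonneg_left ((abs_nonneg _).trans hv) (sqrtM_pos u v)
  have hfC' : ∀ᵐ v, |f' v| ≤ C * sqrtM u v := by
    filter_upwards [hfC, hff] with v h1 h2 using h2 ▸ h1
  have hgD' : ∀ᵐ v, |g' v| ≤ D * sqrtM u v := by
    filter_upwards [hgD, hgg] with v h1 h2 using h2 ▸ h1
  filter_upwards [Qplus_integrable hb hK hf hg hC hfC hgD,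
    Qplus_integrable hb hK hf' hg' hC hfC' hgD', hff, ae_ae_coll (hff.and hgg)] with v h1 h2 h3 h4
  have h5 := Qminus_integrable hb hK hg hgD v
  have h6 := Qminus_integrable hb hK hg' hgD' v
  rw [Q, Q, Qplus_eq_integral h1.2, Qplus_eq_integral h2.2, Qminus_eq_integral h5.2,
    Qminus_eq_integral h6.2, h3]
  congr 1
  · refine integral_congr_ae ?_
    filter_upwards [h4] with q hq
    rw [hq.2.2.1.1, hq.2.2.2.2]
  · congr 1
    refine integral_congr_ae ?_
    filter_upwards [h4] with q hq
    rw [hq.2.1.2]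

/-- For nonnegative densities, the gain term is the `lintegral` gain. -/
lemma ofReal_Qplus (hb : AngularCutoff θ b)
    (hK : ∀ v : E, ∫⁻ q, ENNReal.ofReal (kern θ b q.2 (v - q.1) * sqrtM u q.1) ∂pairMeasure ≤
      ENNReal.ofReal (K * (1 + ‖v - u‖)))
    (hf : Measurable f) (hg : Measurable g) (hf0 : 0 ≤ f) (hg0 : 0 ≤ g)
    (hfC : ∀ᵐ v, |f v| ≤ C * sqrtM u v) (hgD : ∀ᵐ v, |g v| ≤ D * sqrtM u v) :
    ∀ᵐ v, ENNReal.ofReal (Qplus (kern θ b) f g v) = gain θ b f g v := by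
  have hC : 0 ≤ C := by
    obtain ⟨v, hv⟩ := hfC.exists
    exact nonneg_of_mul_nonneg_left ((abs_nonneg _).trans hv) (sqrtM_pos u v)
  filter_upwards [Qplus_integrable hb hK hf hg hC hfC hgD] with v h1
  rw [Qplus_eq_integral h1.2, ofReal_integral_eq_lintegral_ofReal h1.2]
  · rfl
  · exact Eventually.of_forall fun q => mul_nonneg (mul_nonneg (kern_nonneg hb.nonneg _ _) (hf0 _))
      (hg0 _)

lemma Qplus_nonneg (hb : AngularCutoff θ b) (hf0 : 0 ≤ f) (hg0 : 0 ≤ g) (v : E) :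
    0 ≤ Qplus (kern θ b) f g v :=
  integral_nonneg fun _ => integral_nonneg fun _ =>
    mul_nonneg (mul_nonneg (kern_nonneg hb.nonneg _ _) (hf0 _)) (hg0 _)

end Bounds

/-! ### The linearized operator as a quadratic form. -/

/-- The collision weight `B μ μ_*`. -/
def collWeight (θ : ℝ) (b : ℝ → ℝ) (u : E) (q : Coll) : ℝ :=
  kern θ b q.2.2 (q.1 - q.2.1) * (maxwellian u q.1 * maxwellian u q.2.1)

/-- The collision measure `B μ μ_* dv dv_* dω`. -/
def invMeasure (θ : ℝ) (b : ℝ → ℝ) (u : E) : Measure Coll :=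
  collMeasure.withDensity fun q => ENNReal.ofReal (collWeight θ b u q)

/-- The linearized collision operator, applied to the density `h`. -/
def lin (θ : ℝ) (b : ℝ → ℝ) (u : E) (h : E → ℝ) (v : E) : ℝ :=
  -(Q (kern θ b) (maxwellian u) h v + Q (kern θ b) h (maxwellian u) v)

/-- `g + g_* - g' - g_*'` for `g = h / μ`. -/
def collDiff (u : E) (h : E → ℝ) (q : Coll) : ℝ :=
  h q.1 / maxwellian u q.1 + h q.2.1 / maxwellian u q.2.1
    - h (collide q).1 / maxwellian u (collide q).1
    - h (collide q).2.1 / maxwellian u (collide q).2.1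

section

variable {θ : ℝ} {b : ℝ → ℝ} {u : E} {h : E → ℝ} {C K : ℝ}

lemma measurable_collWeight (hb : Measurable b) : Measurable (collWeight θ b u) := by
  unfold collWeight
  exact (Measurable.kern hb (by fun_prop) (by fun_prop)).mul (by fun_prop)

lemma collWeight_nonneg (hb : ∀ z, 0 ≤ b z) (q : Coll) : 0 ≤ collWeight θ b u q :=
  mul_nonneg (kern_nonneg hb _ _) (mul_pos (maxwellian_pos _ _) (maxwellian_pos _ _)).le

lemma collWeight_collide (q : Coll) : collWeight θ b u (collide q) = collWeight θ b u q := by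
  simp only [collWeight, collide, kern_collide _ _ _ _ _ (norm_sph q.2.2),
    maxwellian_collide _ _ _ _ (norm_sph q.2.2)]

lemma collWeight_exchange (q : Coll) : collWeight θ b u (exchange q) = collWeight θ b u q := by
  simp only [collWeight, exchange, kern_swap θ b _ q.1 q.2.1, mul_comm (maxwellian u q.2.1)]

lemma MeasurePreserving.withDensity_self {α : Type*} [MeasurableSpace α] {m : Measure α} {T : α → α}
    (hT : MeasurePreserving T m m) {w : α → ℝ≥0∞} (hw : Measurable w) (hwT : ∀ a, w (T a) = w a) :
    MeasurePreserving T (m.withDensity w) (m.withDensity w) := by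
  refine ⟨hT.measurable, Measure.ext fun s hs => ?_⟩
  rw [Measure.map_apply hT.measurable hs, withDensity_apply _ hs,
    withDensity_apply _ (hT.measurable hs), ← hT.setLIntegral_comp_preimage hs hw]
  simp only [hwT]

lemma measurePreserving_collide_inv (hb : Measurable b) :
    MeasurePreserving collide (invMeasure θ b u) (invMeasure θ b u) :=
  MeasurePreserving.withDensity_self measurePreserving_collide (measurable_collWeight hb).ennreal_ofReal
    fun q => by rw [collWeight_collide]

lemma measurePreserving_exchange_inv (hb : Measurable b) :
    MeasurePreserving exchange (invMeasure θ b u) (invMeasure θ b u) :=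
  MeasurePreserving.withDensity_self measurePreserving_exchange
    (measurable_collWeight hb).ennreal_ofReal fun q => by rw [collWeight_exchange]

lemma measurable_freq (hb : Measurable b) : Measurable (freq θ b u) := by
  unfold freq
  refine Measurable.lintegral_prod_right' (f := fun p : E × (E × Sph) =>
    ENNReal.ofReal (kern θ b p.2.2 (p.1 - p.2.1) * maxwellian u p.2.1)) ?_
  exact ((Measurable.kern hb (by fun_prop) (by fun_prop)).mul (by fun_prop)).ennreal_ofReal

lemma lintegral_invMeasure_fst (hb : AngularCutoff θ b) {φ : E → ℝ≥0∞} (hφ : Measurable φ) :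
    ∫⁻ q, φ q.1 ∂(invMeasure θ b u) =
      ∫⁻ v, freq θ b u v * (ENNReal.ofReal (maxwellian u v) * φ v) := by
  have hw := (measurable_collWeight (θ := θ) (u := u) hb.meas).ennreal_ofReal
  rw [invMeasure, lintegral_withDensity_eq_lintegral_mul _ hw (by fun_prop), collMeasure,
    lintegral_prod _ (by simp only [Pi.mul_def]; fun_prop)]
  refine lintegral_congr fun v => ?_
  have hm : Measurable fun q : E × Sph =>
      ENNReal.ofReal (kern θ b q.2 (v - q.1) * maxwellian u q.1) := by
    have := Measurable.kern (θ := θ) hb.meas (f := fun q : E × Sph => (q.2 : E))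
      (g := fun q => v - q.1) (by fun_prop) (by fun_prop)
    fun_prop
  rw [freq, ← lintegral_mul_const _ hm]
  refine lintegral_congr fun q => ?_
  simp only [Pi.mul_apply, collWeight]
  conv_rhs => rw [← mul_assoc, ← ENNReal.ofReal_mul (mul_nonneg (kern_nonneg hb.nonneg _ _)
    (maxwellian_pos _ _).le)]
  congr 2; ring

lemma freq_le (hb : AngularCutoff θ b)
    (hK : ∀ v : E, ∫⁻ q, ENNReal.ofReal (kern θ b q.2 (v - q.1) * sqrtM u q.1) ∂pairMeasure ≤
      ENNReal.ofReal (K * (1 + ‖v - u‖))) (v : E) :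
    freq θ b u v ≤ ENNReal.ofReal (K * (1 + ‖v - u‖)) := by
  refine le_trans (lintegral_mono fun q => ?_) (hK v)
  exact ENNReal.ofReal_le_ofReal (mul_le_mul_of_nonneg_left
    (maxwellian_le_sqrtM u q.1) (kern_nonneg hb.nonneg _ _))

/-- The assumed decay makes h²/μ of order (1+|v-u|)⁻¹², and the frequency costs one power.
Finiteness puts h/μ in L² of the collision measure and permits a cancellation in the coercivity
estimate. -/
lemma lintegral_freq_sq_lt_top (hb : AngularCutoff θ b)
    (hK : ∀ v : E, ∫⁻ q, ENNReal.ofReal (kern θ b q.2 (v - q.1) * sqrtM u q.1) ∂pairMeasure ≤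
      ENNReal.ofReal (K * (1 + ‖v - u‖))) (hK0 : 0 ≤ K) (h0 : 0 ≤ h)
    (hC : ∀ᵐ v, h v ≤ C * sqrtM u v * ((1 + ‖v - u‖ ^ 2) ^ 3)⁻¹) :
    ∫⁻ v, freq θ b u v * ENNReal.ofReal (h v ^ 2 / maxwellian u v) < ∞ := by
  have hfin := lintegral_one_add_norm_lt_top u
  have hm : Measurable fun y : E => ENNReal.ofReal (((1 + ‖y - u‖) ^ 4)⁻¹) := by fun_prop
  calc _ ≤ ∫⁻ v, ENNReal.ofReal (K * C ^ 2 * 64) * ENNReal.ofReal (((1 + ‖v - u‖) ^ 4)⁻¹) := by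
        refine lintegral_mono_ae ?_
        filter_upwards [hC] with v hv
        refine (mul_le_mul' (freq_le hb hK v) le_rfl).trans ?_
        rw [← ENNReal.ofReal_mul (by positivity), ← ENNReal.ofReal_mul (by positivity)]
        refine ENNReal.ofReal_le_ofReal ?_
        have hs := sqrtM_pos u v
        set r := ‖v - u‖
        have hr : 0 ≤ r := norm_nonneg _
        have h1 : h v ^ 2 ≤ (C * sqrtM u v * ((1 + r ^ 2) ^ 3)⁻¹) ^ 2 :=
          pow_le_pow_left₀ (h0 v) hv 2
        have h2 : h v ^ 2 / maxwellian u v ≤ C ^ 2 * ((1 + r ^ 2) ^ 6)⁻¹ := by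
          rw [div_le_iff₀ (maxwellian_pos _ _), ← sqrtM_sq]
          refine h1.trans (le_of_eq ?_)
          field_simp
        have h3 : ((1 + r ^ 2) ^ 6)⁻¹ ≤ 64 * ((1 + r) ^ 12)⁻¹ := by
          have : (1 + r) ^ 2 ≤ 2 * (1 + r ^ 2) := by nlinarith [sq_nonneg (r - 1)]
          rw [← div_eq_mul_inv, inv_eq_one_div, div_le_div_iff₀ (by positivity) (by positivity)]
          calc 1 * (1 + r) ^ 12 = ((1 + r) ^ 2) ^ 6 := by ring
            _ ≤ (2 * (1 + r ^ 2)) ^ 6 := by gcongr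
            _ = _ := by ring
        calc K * (1 + r) * (h v ^ 2 / maxwellian u v)
            ≤ K * (1 + r) * (C ^ 2 * (64 * ((1 + r) ^ 12)⁻¹)) := by
              gcongr
              exact h2.trans (by gcongr)
          _ = K * C ^ 2 * 64 * ((1 + r) ^ 11)⁻¹ := by field_simp
          _ ≤ _ := by
              gcongr
              · linarith
              · norm_num
    _ < ∞ := by
        rw [lintegral_const_mul _ hm]
        exact ENNReal.mul_lt_top ENNReal.ofReal_lt_top hfin

lemma lintegral_quotient_sq (hb : AngularCutoff θ b) (hm : Measurable h) :
    ∫⁻ q, ENNReal.ofReal ((h q.1 / maxwellian u q.1) ^ 2) ∂(invMeasure θ b u) =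
      ∫⁻ v, freq θ b u v * ENNReal.ofReal (h v ^ 2 / maxwellian u v) := by
  rw [lintegral_invMeasure_fst hb (φ := fun v => ENNReal.ofReal ((h v / maxwellian u v) ^ 2))
    (by fun_prop)]
  refine lintegral_congr fun v => ?_
  have := maxwellian_pos u v
  rw [← ENNReal.ofReal_mul this.le]
  congr 2
  field_simp

lemma memLp_quotient (hb : AngularCutoff θ b)
    (hfin : ∫⁻ v, freq θ b u v * ENNReal.ofReal (h v ^ 2 / maxwellian u v) < ∞)
    (hm : Measurable h) :
    MemLp (fun q : Coll => h q.1 / maxwellian u q.1) 2 (invMeasure θ b u) := by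
  have hmq : Measurable fun q : Coll => h q.1 / maxwellian u q.1 := by fun_prop
  rw [memLp_two_iff_integrable_sq hmq.aestronglyMeasurable]
  refine ⟨(hmq.pow_const 2).aestronglyMeasurable, ?_⟩
  rw [hasFiniteIntegral_iff_ofReal (Eventually.of_forall fun q => sq_nonneg _),
    lintegral_quotient_sq hb hm]
  exact hfin

end

section

variable {θ : ℝ} {b : ℝ → ℝ} {u : E} {h : E → ℝ} {C K : ℝ}

lemma MeasurePreserving.integral_comp_measurable {α β : Type*} [MeasurableSpace α]
    [MeasurableSpace β] {m : Measure α} {m' : Measure β}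
    {T : α → β} (hT : MeasurePreserving T m m') {φ : β → ℝ} (hφ : Measurable φ) :
    ∫ a, φ (T a) ∂m = ∫ a, φ a ∂m' := by
  rw [← hT.map_eq, integral_map hT.measurable.aemeasurable hφ.aestronglyMeasurable]

lemma memLp_collDiff (hb : AngularCutoff θ b)
    (hL : MemLp (fun q : Coll => h q.1 / maxwellian u q.1) 2 (invMeasure θ b u)) :
    MemLp (collDiff u h) 2 (invMeasure θ b u) := by
  have hT := measurePreserving_collide_inv (θ := θ) (u := u) hb.meas
  have hX := measurePreserving_exchange_inv (θ := θ) (u := u) hb.meas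
  have h1 := hL.comp_measurePreserving hX
  have h2 := hL.comp_measurePreserving hT
  have h3 := h1.comp_measurePreserving hT
  exact ((hL.add h1).sub h2).sub h3

lemma measurable_collDiff (hm : Measurable h) : Measurable (collDiff u h) := by
  unfold collDiff; fun_prop

/-- Boltzmann's symmetrization: the difference is invariant under exchange and odd under collision,
both of which preserve the measure. The four terms of its square therefore contribute equally. -/
lemma integral_mul_collDiff (hb : AngularCutoff θ b) (hm : Measurable h)
    (hL : MemLp (fun q : Coll => h q.1 / maxwellian u q.1) 2 (invMeasure θ b u)) :
    4 * ∫ q, h q.1 / maxwellian u q.1 * collDiff u h q ∂(invMeasure θ b u) =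
      ∫ q, collDiff u h q ^ 2 ∂(invMeasure θ b u) := by
  have hT := measurePreserving_collide_inv (θ := θ) (u := u) hb.meas
  have hX := measurePreserving_exchange_inv (θ := θ) (u := u) hb.meas
  have hD := memLp_collDiff hb hL
  have hDm := measurable_collDiff (u := u) hm
  have h1 := hL.comp_measurePreserving hX
  have h2 := hL.comp_measurePreserving hT
  have h3 := h1.comp_measurePreserving hT
  set G : Coll → ℝ := fun q => h q.1 / maxwellian u q.1 with hG
  have hGm : Measurable G := by fun_prop
  have hDX : ∀ q, collDiff u h (exchange q) = collDiff u h q := by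
    intro q
    simp only [collDiff, exchange, collide, vPrime_swap q.2.2 q.1 q.2.1,
      vsPrime_swap q.2.2 q.1 q.2.1]
    ring
  have hDT : ∀ q, collDiff u h (collide q) = -collDiff u h q := by
    intro q
    rw [collDiff, collide_collide, collDiff]; ring
  have e1 : ∫ q, (G ∘ exchange) q * collDiff u h q ∂(invMeasure θ b u) =
      ∫ q, G q * collDiff u h q ∂(invMeasure θ b u) := by
    rw [← MeasurePreserving.integral_comp_measurable hX
      (φ := fun q => G q * collDiff u h q) (hGm.mul hDm)]
    simp only [hDX, Function.comp]
  have e2 : ∫ q, (G ∘ collide) q * collDiff u h q ∂(invMeasure θ b u) =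
      -∫ q, G q * collDiff u h q ∂(invMeasure θ b u) := by
    rw [← MeasurePreserving.integral_comp_measurable hT
      (φ := fun q => G q * collDiff u h q) (hGm.mul hDm), ← integral_neg]
    simp only [hDT, Function.comp, mul_neg, neg_neg]
  have e3 : ∫ q, ((G ∘ exchange) ∘ collide) q * collDiff u h q ∂(invMeasure θ b u) =
      -∫ q, (G ∘ exchange) q * collDiff u h q ∂(invMeasure θ b u) := by
    rw [← MeasurePreserving.integral_comp_measurable hT
      (φ := fun q => (G ∘ exchange) q * collDiff u h q)
      ((hGm.comp measurable_exchange).mul hDm), ← integral_neg]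
    simp only [hDT, Function.comp, mul_neg, neg_neg]
  have hsq : ∀ q, collDiff u h q ^ 2 = G q * collDiff u h q + (G ∘ exchange) q * collDiff u h q -
      (G ∘ collide) q * collDiff u h q - ((G ∘ exchange) ∘ collide) q * collDiff u h q := by
    intro q
    rw [pow_two]
    nth_rewrite 1 [collDiff]
    simp only [hG, Function.comp, exchange]
    ring
  have i0 := hL.integrable_mul hD
  have i1 := h1.integrable_mul hD
  have i2 := h2.integrable_mul hD
  have i3 := h3.integrable_mul hD
  simp only [Pi.mul_def] at i0 i1 i2 i3
  have i4 := i0.add i1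
  have i5 := i4.sub i2
  simp only [Pi.add_def, Pi.sub_def] at i4 i5
  simp only [hsq]
  rw [integral_sub i5 i3, integral_sub i4 i2, integral_add i0 i1, e3, e2, e1]
  ring

/-- Since μ' μ_*' = μ μ_*, each of the four terms of L h takes the common weight B μ μ_* times a
quotient h/μ. -/
lemma lin_eq_integral (hb : AngularCutoff θ b)
    (hK : ∀ v : E, ∫⁻ q, ENNReal.ofReal (kern θ b q.2 (v - q.1) * sqrtM u q.1) ∂pairMeasure ≤
      ENNReal.ofReal (K * (1 + ‖v - u‖))) (hm : Measurable h)
    (hC0 : 0 ≤ C) (hC : ∀ᵐ v, |h v| ≤ C * sqrtM u v) :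
    ∀ᵐ v, lin θ b u h v = ∫ q, collWeight θ b u (v, q) * collDiff u h (v, q) ∂pairMeasure := by
  have hμ : ∀ᵐ v, |maxwellian u v| ≤ 1 * sqrtM u v := Eventually.of_forall fun v => by
    rw [one_mul, abs_of_pos (maxwellian_pos _ _)]; exact maxwellian_le_sqrtM _ _
  have hμm : Measurable (maxwellian u) := (continuous_maxwellian u).measurable
  filter_upwards [Qplus_integrable hb hK hμm hm zero_le_one hμ hC,
    Qplus_integrable hb hK hm hμm hC0 hC hμ] with v h1 h2
  have h3 := (Qminus_integrable hb hK hm hC v).2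
  have h4 := (Qminus_integrable hb hK hμm hμ v).2
  have h5 := h1.2.sub (h3.const_mul (maxwellian u v))
  have h6 := h2.2.sub (h4.const_mul (h v))
  simp only [Pi.sub_def] at h5 h6
  rw [lin, Q, Q, Qplus_eq_integral h1.2, Qplus_eq_integral h2.2, Qminus_eq_integral h3,
    Qminus_eq_integral h4, ← integral_const_mul, ← integral_const_mul,
    ← integral_sub h1.2 (h3.const_mul _), ← integral_sub h2.2 (h4.const_mul _),
    ← integral_add h5 h6, ← integral_neg]
  refine integral_congr_ae (Eventually.of_forall fun q => ?_)
  simp only [collWeight, collDiff, collide]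
  have e := maxwellian_collide u q.2 v q.1 (norm_sph q.2)
  have p1 := (maxwellian_pos u v).ne'
  have p2 := (maxwellian_pos u q.1).ne'
  have p3 := (maxwellian_pos u (vPrime q.2 v q.1)).ne'
  have p4 := (maxwellian_pos u (vsPrime q.2 v q.1)).ne'
  set M := maxwellian u v
  set Ms := maxwellian u q.1
  set M' := maxwellian u (vPrime q.2 v q.1)
  set Ms' := maxwellian u (vsPrime q.2 v q.1)
  have s1 : M * Ms * (h v / M + h q.1 / Ms) = h v * Ms + h q.1 * M := by field_simp
  have s2 : M' * Ms' * (h (vPrime q.2 v q.1) / M' + h (vsPrime q.2 v q.1) / Ms') =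
    h (vPrime q.2 v q.1) * Ms' + h (vsPrime q.2 v q.1) * M' := by field_simp
  rw [e] at s2
  linear_combination -(kern θ b q.2 (v - q.1)) * s1 + (kern θ b q.2 (v - q.1)) * s2

/-- The linearized collision operator is symmetric nonnegative. -/
theorem integral_mul_lin (hb : AngularCutoff θ b)
    (hK : ∀ v : E, ∫⁻ q, ENNReal.ofReal (kern θ b q.2 (v - q.1) * sqrtM u q.1) ∂pairMeasure ≤
      ENNReal.ofReal (K * (1 + ‖v - u‖))) (hm : Measurable h) (hC0 : 0 ≤ C)
    (hC : ∀ᵐ v, |h v| ≤ C * sqrtM u v)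
    (hL : MemLp (fun q : Coll => h q.1 / maxwellian u q.1) 2 (invMeasure θ b u)) :
    Integrable (fun v => h v / maxwellian u v * lin θ b u h v) ∧
    ∫ v, h v / maxwellian u v * lin θ b u h v =
      ∫ q, h q.1 / maxwellian u q.1 * collDiff u h q ∂(invMeasure θ b u) := by
  have hi := hL.integrable_mul (memLp_collDiff hb hL)
  simp only [Pi.mul_def] at hi
  have hw := (measurable_collWeight (θ := θ) (u := u) hb.meas)
  have hwt : ∀ᵐ q ∂collMeasure, ENNReal.ofReal (collWeight θ b u q) < ∞ :=
    Eventually.of_forall fun _ => ENNReal.ofReal_lt_top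
  have hr : ∀ q, (ENNReal.ofReal (collWeight θ b u q)).toReal = collWeight θ b u q := fun q =>
    ENNReal.toReal_ofReal (collWeight_nonneg hb.nonneg q)
  rw [invMeasure] at hi ⊢
  rw [integrable_withDensity_iff_integrable_smul' hw.ennreal_ofReal hwt] at hi
  rw [integral_withDensity_eq_integral_toReal_smul hw.ennreal_ofReal hwt]
  simp only [hr, smul_eq_mul] at hi ⊢
  have hae : (fun v => h v / maxwellian u v * lin θ b u h v) =ᵐ[volume] fun v =>
      ∫ q, collWeight θ b u (v, q) * (h v / maxwellian u v * collDiff u h (v, q)) ∂pairMeasure := by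
    filter_upwards [lin_eq_integral hb hK hm hC0 hC] with v hv
    rw [hv, ← integral_const_mul]
    refine integral_congr_ae (Eventually.of_forall fun q => ?_)
    simp only; ring
  rw [collMeasure] at hi ⊢
  exact ⟨hi.integral_prod_left.congr hae.symm, by rw [integral_prod _ hi, integral_congr_ae hae]⟩

theorem integral_mul_lin_nonneg (hb : AngularCutoff θ b)
    (hK : ∀ v : E, ∫⁻ q, ENNReal.ofReal (kern θ b q.2 (v - q.1) * sqrtM u q.1) ∂pairMeasure ≤
      ENNReal.ofReal (K * (1 + ‖v - u‖))) (hm : Measurable h) (hC0 : 0 ≤ C)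
    (hC : ∀ᵐ v, |h v| ≤ C * sqrtM u v)
    (hL : MemLp (fun q : Coll => h q.1 / maxwellian u q.1) 2 (invMeasure θ b u)) :
    0 ≤ ∫ v, h v / maxwellian u v * lin θ b u h v := by
  rw [(integral_mul_lin hb hK hm hC0 hC hL).2]
  have := integral_mul_collDiff hb hm hL
  have h2 : 0 ≤ ∫ q, collDiff u h q ^ 2 ∂(invMeasure θ b u) :=
    integral_nonneg fun _ => sq_nonneg _
  linarith

/-- Equality in the entropy inequality forces the linearized collision operator to vanish. -/
theorem lin_eq_zero_of_integral_eq_zero (hb : AngularCutoff θ b)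
    (hK : ∀ v : E, ∫⁻ q, ENNReal.ofReal (kern θ b q.2 (v - q.1) * sqrtM u q.1) ∂pairMeasure ≤
      ENNReal.ofReal (K * (1 + ‖v - u‖))) (hm : Measurable h) (hC0 : 0 ≤ C)
    (hC : ∀ᵐ v, |h v| ≤ C * sqrtM u v)
    (hL : MemLp (fun q : Coll => h q.1 / maxwellian u q.1) 2 (invMeasure θ b u))
    (h0 : ∫ v, h v / maxwellian u v * lin θ b u h v = 0) :
    ∀ᵐ v, lin θ b u h v = 0 := by
  rw [(integral_mul_lin hb hK hm hC0 hC hL).2] at h0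
  have h1 := integral_mul_collDiff hb hm hL
  rw [h0, mul_zero, eq_comm, integral_eq_zero_iff_of_nonneg (fun _ => sq_nonneg _)
    ((memLp_two_iff_integrable_sq (measurable_collDiff hm).aestronglyMeasurable).1
      (memLp_collDiff hb hL)), Filter.EventuallyEq, invMeasure,
    ae_withDensity_iff (measurable_collWeight hb.meas).ennreal_ofReal] at h1
  rw [collMeasure] at h1
  filter_upwards [lin_eq_integral hb hK hm hC0 hC, Measure.ae_ae_of_ae_prod h1] with v hv h2
  rw [hv]
  refine integral_eq_zero_of_ae ?_
  filter_upwards [h2] with q hq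
  -- The difference is known to vanish only where the weight is positive; elsewhere the weight
  -- itself makes the integrand zero.
  by_cases hw : ENNReal.ofReal (collWeight θ b u (v, q)) = 0
  · rw [le_antisymm (ENNReal.ofReal_eq_zero.1 hw) (collWeight_nonneg hb.nonneg _), zero_mul]; rfl
  · have := hq hw
    rw [Pi.zero_apply, sq_eq_zero_iff] at this
    rw [this, mul_zero]; rfl

end

/-! ### Coercivity up to bounded velocities. -/

section

variable {θ : ℝ} {b : ℝ → ℝ} {u : E} {h : E → ℝ} {C K N : ℝ}

/-- The majorant used to split products of two velocity densities. -/
def splitDensity (u : E) (C N : ℝ) (h : E → ℝ) (v : E) : ℝ :=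
  if ‖v - u‖ ≤ N then C * (h v / sqrtM u v) else (h v / sqrtM u v) ^ 2 / 2

lemma measurable_splitDensity (hm : Measurable h) : Measurable (splitDensity u C N h) := by
  unfold splitDensity
  refine Measurable.ite ?_ (by fun_prop) (by fun_prop)
  exact measurableSet_le (by fun_prop) (by fun_prop)

lemma splitDensity_nonneg (hC : 0 ≤ C) (h0 : 0 ≤ h) (v : E) : 0 ≤ splitDensity u C N h v := by
  have h1 : 0 ≤ h v / sqrtM u v := div_nonneg (h0 v) (sqrtM_pos u v).le
  unfold splitDensity
  split_ifs <;> positivity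

/-- With x, y the two quotients, both at most C: if both velocities are large, xy ≤ x²/2 + y²/2; if
one is small, say that of x, then xy ≤ C x. The linear term keeps the remainder on bounded
velocities of first order in h, as the gain-term estimate requires. -/
lemma mul_le_splitDensity (h0 : 0 ≤ h) {v w : E} (hv : h v ≤ C * sqrtM u v)
    (hw : h w ≤ C * sqrtM u w) :
    h v / sqrtM u v * (h w / sqrtM u w) ≤ splitDensity u C N h v + splitDensity u C N h w := by
  have a0 : 0 ≤ h v / sqrtM u v := div_nonneg (h0 v) (sqrtM_pos u v).le
  have b0 : 0 ≤ h w / sqrtM u w := div_nonneg (h0 w) (sqrtM_pos u w).le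
  have a1 : h v / sqrtM u v ≤ C := (div_le_iff₀ (sqrtM_pos u v)).2 hv
  have b1 : h w / sqrtM u w ≤ C := (div_le_iff₀ (sqrtM_pos u w)).2 hw
  have h1 := splitDensity_nonneg (u := u) (N := N) (a0.trans a1) h0 v
  have h2 := splitDensity_nonneg (u := u) (N := N) (a0.trans a1) h0 w
  unfold splitDensity at *
  set x := h v / sqrtM u v
  set y := h w / sqrtM u w
  split_ifs at * <;> nlinarith [sq_nonneg (x - y), mul_nonneg a0 b0]

lemma collWeight_mul_quotients (q : Coll) :
    collWeight θ b u q * (h q.1 / maxwellian u q.1 *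
      (h (collide q).1 / maxwellian u (collide q).1)) =
    kern θ b q.2.2 (q.1 - q.2.1) * (sqrtM u q.2.1 * sqrtM u (collide q).2.1) *
      (h q.1 / sqrtM u q.1 * (h (collide q).1 / sqrtM u (collide q).1)) := by
  have e := sqrtM_collide u q.2.2 q.1 q.2.1 (norm_sph q.2.2)
  simp only [collWeight, ← sqrtM_sq, collide] at *
  have p1 := (sqrtM_pos u q.1).ne'
  have p3 := (sqrtM_pos u (vPrime q.2.2 q.1 q.2.1)).ne'
  field_simp
  linear_combination -(kern θ b q.2.2 (q.1 - q.2.1) * sqrtM u q.2.1 * h q.1 *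
    h (vPrime q.2.2 q.1 q.2.1)) * e

lemma measurable_splitWeight (hb : AngularCutoff θ b) (hm : Measurable h) {s : Coll → E}
    (hs : Measurable s) : Measurable fun q : Coll =>
    ENNReal.ofReal (kern θ b q.2.2 (q.1 - q.2.1) * (sqrtM u q.2.1 * sqrtM u (s q)) *
      splitDensity u C N h q.1) := by
  have := Measurable.kern (θ := θ) hb.meas (f := fun q : Coll => (q.2.2 : E))
      (g := fun q => q.1 - q.2.1) (by fun_prop) (by fun_prop)
  have h2 : Measurable fun q : Coll => splitDensity u C N h q.1 :=
    (measurable_splitDensity hm).comp measurable_fst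
  fun_prop

/-- The gain part of the quadratic form, before splitting the velocity space. -/
lemma lintegral_gain_form_le (hb : AngularCutoff θ b) (hm : Measurable h) (h0 : 0 ≤ h) (hC0 : 0 ≤ C)
    (hC : ∀ᵐ v, h v ≤ C * sqrtM u v) :
    ∫⁻ q, ENNReal.ofReal (h q.1 / maxwellian u q.1 *
      (h (collide q).1 / maxwellian u (collide q).1) + h q.1 / maxwellian u q.1 *
      (h (collide q).2.1 / maxwellian u (collide q).2.1)) ∂(invMeasure θ b u) ≤
    ENNReal.ofReal 2 * ∫⁻ q : Coll, ENNReal.ofReal (kern θ b q.2.2 (q.1 - q.2.1) * (sqrtM u q.2.1 *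
      (sqrtM u (collide q).2.1 + sqrtM u (collide q).1)) * splitDensity u C N h q.1)
      ∂collMeasure := by
  set Ψ := fun q : Coll => ENNReal.ofReal (kern θ b q.2.2 (q.1 - q.2.1) *
    (sqrtM u q.2.1 * sqrtM u (collide q).2.1) * splitDensity u C N h q.1) with hΨ
  set Φ := fun q : Coll => ENNReal.ofReal (kern θ b q.2.2 (q.1 - q.2.1) *
    (sqrtM u q.2.1 * sqrtM u (collide q).1) * splitDensity u C N h q.1) with hΦ
  have hΨm : Measurable Ψ := measurable_splitWeight hb hm (by fun_prop)
  have hΦm : Measurable Φ := measurable_splitWeight hb hm (by fun_prop)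
  have hT := measurePreserving_collide
  have hX := measurePreserving_exchange.comp hT
  have hw := (measurable_collWeight (θ := θ) (u := u) hb.meas).ennreal_ofReal
  rw [invMeasure, lintegral_withDensity_eq_lintegral_mul _ hw (by fun_prop)]
  -- Splitting a product at v and v' gives one term at each velocity. The term at v' is the term at
  -- v evaluated at the collided configuration and has the same integral; for v_*' the collision is
  -- followed by the exchange.
  calc _ ≤ ∫⁻ q, ((Ψ q + Ψ (collide q)) + (Φ q + Φ ((exchange ∘ collide) q))) ∂collMeasure := by
        refine lintegral_mono_ae ?_
        filter_upwards [ae_coll hC] with q hq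
        have hk := kern_nonneg (θ := θ) hb.nonneg q.2.2 (q.1 - q.2.1)
        have e1 := collWeight_mul_quotients (θ := θ) (b := b) (u := u) (h := h) q
        have e2 : collWeight θ b u q * (h q.1 / maxwellian u q.1 *
            (h (collide q).2.1 / maxwellian u (collide q).2.1)) =
            kern θ b q.2.2 (q.1 - q.2.1) * (sqrtM u q.2.1 * sqrtM u (collide q).1) *
            (h q.1 / sqrtM u q.1 * (h (collide q).2.1 / sqrtM u (collide q).2.1)) := by
          have e := sqrtM_collide u q.2.2 q.1 q.2.1 (norm_sph q.2.2)
          simp only [collWeight, ← sqrtM_sq, collide] at *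
          have p1 := (sqrtM_pos u q.1).ne'
          have p3 := (sqrtM_pos u (vsPrime q.2.2 q.1 q.2.1)).ne'
          field_simp
          linear_combination -(kern θ b q.2.2 (q.1 - q.2.1) * sqrtM u q.2.1 * h q.1 *
            h (vsPrime q.2.2 q.1 q.2.1)) * e
        have m1 := mul_le_splitDensity (N := N) h0 hq.1 hq.2.2.1
        have m2 := mul_le_splitDensity (N := N) h0 hq.1 hq.2.2.2
        have n0 := splitDensity_nonneg (u := u) (N := N) hC0 h0
        have s0 := fun v => (sqrtM_pos u v).le
        have hf : ∀ v, 0 ≤ h v / maxwellian u v := fun v =>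
          div_nonneg (h0 v) (maxwellian_pos _ _).le
        have c1 : Ψ (collide q) = ENNReal.ofReal (kern θ b q.2.2 (q.1 - q.2.1) *
            (sqrtM u q.2.1 * sqrtM u (collide q).2.1) * splitDensity u C N h (collide q).1) := by
          simp only [hΨ, collide_collide]
          simp only [collide, kern_collide _ _ _ _ _ (norm_sph q.2.2)]
          rw [mul_comm (sqrtM u q.2.1)]
        have c2 : Φ ((exchange ∘ collide) q) = ENNReal.ofReal (kern θ b q.2.2 (q.1 - q.2.1) *
            (sqrtM u q.2.1 * sqrtM u (collide q).1) * splitDensity u C N h (collide q).2.1) := by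
          simp only [hΦ, Function.comp, exchange, collide]
          rw [vPrime_swap _ (vPrime q.2.2 q.1 q.2.1) (vsPrime q.2.2 q.1 q.2.1),
            vsPrime_vPrime _ _ _ (norm_sph q.2.2),
            kern_swap _ _ _ (vPrime q.2.2 q.1 q.2.1) (vsPrime q.2.2 q.1 q.2.1),
            kern_collide _ _ _ _ _ (norm_sph q.2.2), mul_comm (sqrtM u q.2.1)]
        rw [c1, c2, Pi.mul_apply, ← ENNReal.ofReal_mul (collWeight_nonneg hb.nonneg q),
          ← ENNReal.ofReal_add (mul_nonneg (mul_nonneg hk (mul_nonneg (s0 _) (s0 _))) (n0 _))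
            (mul_nonneg (mul_nonneg hk (mul_nonneg (s0 _) (s0 _))) (n0 _)),
          ← ENNReal.ofReal_add (mul_nonneg (mul_nonneg hk (mul_nonneg (s0 _) (s0 _))) (n0 _))
            (mul_nonneg (mul_nonneg hk (mul_nonneg (s0 _) (s0 _))) (n0 _)),
          ← ENNReal.ofReal_add (by
            rw [← mul_add]
            exact mul_nonneg (mul_nonneg hk (mul_nonneg (s0 _) (s0 _))) (add_nonneg (n0 _) (n0 _)))
            (by
            rw [← mul_add]
            exact mul_nonneg (mul_nonneg hk (mul_nonneg (s0 _) (s0 _))) (add_nonneg (n0 _) (n0 _)))]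
        refine ENNReal.ofReal_le_ofReal ?_
        rw [mul_add, e1, e2, ← mul_add, ← mul_add]
        exact add_le_add
          (mul_le_mul_of_nonneg_left m1 (mul_nonneg hk (mul_nonneg (s0 _) (s0 _))))
          (mul_le_mul_of_nonneg_left m2 (mul_nonneg hk (mul_nonneg (s0 _) (s0 _))))
    _ = ENNReal.ofReal 2 * ∫⁻ q, (Ψ q + Φ q) ∂collMeasure := by
        have m3 : Measurable fun q => Ψ (collide q) := hΨm.comp measurable_collide
        have m4 : Measurable fun q => Φ ((exchange ∘ collide) q) := hΦm.comp hX.measurable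
        have m5 : Measurable fun q => Ψ q + Ψ (collide q) := hΨm.add m3
        rw [lintegral_add_left m5, lintegral_add_left hΨm, lintegral_add_left hΦm,
          hT.lintegral_comp hΨm, hX.lintegral_comp hΦm, lintegral_add_left hΨm,
          ENNReal.ofReal_ofNat]
        ring
    _ = _ := by
        congr 1
        refine lintegral_congr fun q => ?_
        have hk := kern_nonneg (θ := θ) hb.nonneg q.2.2 (q.1 - q.2.1)
        have n0 := splitDensity_nonneg (u := u) (N := N) hC0 h0
        have s0 := fun v => (sqrtM_pos u v).le
        rw [hΨ, hΦ, ← ENNReal.ofReal_add (mul_nonneg (mul_nonneg hk (mul_nonneg (s0 _) (s0 _))) (n0 _))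
            (mul_nonneg (mul_nonneg hk (mul_nonneg (s0 _) (s0 _))) (n0 _))]
        congr 1; ring

/-- For |v-u| ≤ N the Maxwellian is bounded below and the factor is at most 2K(1+N), which gives the
linear term. For |v-u| > N the gain kernel, whose polynomial weights are at least 1, is at most half
of the frequency, and 4 · (1/2) · (1/2) = 1 leaves a single copy of the left side of the coercivity
estimate. -/
lemma lintegral_gain_form_le_split (hb : AngularCutoff θ b)
    (hK : ∀ v : E, ∫⁻ q, ENNReal.ofReal (kern θ b q.2 (v - q.1) * sqrtM u q.1) ∂pairMeasure ≤
      ENNReal.ofReal (K * (1 + ‖v - u‖))) (hK0 : 0 ≤ K) (hN0 : 0 ≤ N)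
    (hN : ∀ v, N < ‖v - u‖ → 2 * ∫⁻ q, ENNReal.ofReal (gainKernel θ b u v q) ∂pairMeasure ≤
      freq θ b u v) {c : ℝ} (hc0 : 0 < c) (hc : ∀ v, ‖v - u‖ ≤ N → c ≤ maxwellian u v)
    (hm : Measurable h) (h0 : 0 ≤ h) (hC0 : 0 ≤ C) :
    ENNReal.ofReal 4 * ∫⁻ q : Coll, ENNReal.ofReal (kern θ b q.2.2 (q.1 - q.2.1) * (sqrtM u q.2.1 *
      (sqrtM u (collide q).2.1 + sqrtM u (collide q).1)) * splitDensity u C N h q.1)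
      ∂collMeasure ≤
    ENNReal.ofReal (8 * C * K * (1 + N) / c) * (∫⁻ v in {v | ‖v - u‖ ≤ N}, ENNReal.ofReal (h v)) +
      ∫⁻ v, freq θ b u v * ENNReal.ofReal (h v ^ 2 / maxwellian u v) := by
  have hsd := measurable_splitDensity (u := u) (C := C) (N := N) hm
  have hkm : ∀ v, Measurable fun q : E × Sph => kern θ b q.2 (v - q.1) := fun v =>
    Measurable.kern (θ := θ) hb.meas (by fun_prop) (by fun_prop)
  have hS : MeasurableSet {v : E | ‖v - u‖ ≤ N} := measurableSet_le (by fun_prop) (by fun_prop)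
  have hkm' := Measurable.kern (θ := θ) hb.meas (f := fun q : Coll => (q.2.2 : E))
      (g := fun q => q.1 - q.2.1) (by fun_prop) (by fun_prop)
  have h2 : Measurable fun q : Coll => splitDensity u C N h q.1 := hsd.comp measurable_fst
  have hbig : Measurable fun q : Coll => ENNReal.ofReal (kern θ b q.2.2 (q.1 - q.2.1) *
      (sqrtM u q.2.1 * (sqrtM u (collide q).2.1 + sqrtM u (collide q).1)) *
      splitDensity u C N h q.1) := by fun_prop
  rw [collMeasure, lintegral_prod _ hbig.aemeasurable, ← lintegral_indicator hS,
    ← lintegral_const_mul _ hbig.lintegral_prod_right', ← lintegral_const_mul _ ((by fun_prop : Measurable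
      fun v => ENNReal.ofReal (h v)).indicator hS),
    ← lintegral_add_left (((by fun_prop : Measurable
      fun v => ENNReal.ofReal (h v)).indicator hS).const_mul _)]
  refine lintegral_mono fun v => ?_
  have s0 := fun v => (sqrtM_pos u v).le
  have n0 := splitDensity_nonneg (u := u) (N := N) hC0 h0 v
  have hin : ∫⁻ q : E × Sph, ENNReal.ofReal (kern θ b q.2 (v - q.1) * (sqrtM u q.1 *
      (sqrtM u (collide (v, q)).2.1 + sqrtM u (collide (v, q)).1)) * splitDensity u C N h v)
      ∂pairMeasure = (∫⁻ q : E × Sph, ENNReal.ofReal (kern θ b q.2 (v - q.1) * (sqrtM u q.1 *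
      (sqrtM u (vsPrime q.2 v q.1) + sqrtM u (vPrime q.2 v q.1)))) ∂pairMeasure) *
      ENNReal.ofReal (splitDensity u C N h v) := by
    have := hkm v
    rw [← lintegral_mul_const _ (by fun_prop)]
    refine lintegral_congr fun q => ?_
    rw [← ENNReal.ofReal_mul' n0]; rfl
  simp only
  rw [hin]
  by_cases hv : ‖v - u‖ ≤ N
  · refine le_add_right ?_
    rw [indicator_of_mem (by exact hv)]
    have hb1 : ∫⁻ q : E × Sph, ENNReal.ofReal (kern θ b q.2 (v - q.1) * (sqrtM u q.1 *
      (sqrtM u (vsPrime q.2 v q.1) + sqrtM u (vPrime q.2 v q.1)))) ∂pairMeasure ≤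
        ENNReal.ofReal 2 * ENNReal.ofReal (K * (1 + ‖v - u‖)) := by
      have := hkm v
      refine le_trans ?_ (mul_le_mul' le_rfl (hK v))
      rw [← lintegral_const_mul _ (by fun_prop)]
      refine lintegral_mono fun q => ?_
      rw [← ENNReal.ofReal_mul (by norm_num)]
      refine ENNReal.ofReal_le_ofReal ?_
      have := mul_le_mul_of_nonneg_left (add_le_add (sqrtM_le_one u (vsPrime q.2 v q.1))
        (sqrtM_le_one u (vPrime q.2 v q.1))) (mul_nonneg (kern_nonneg (θ := θ) hb.nonneg q.2 (v - q.1))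
          (s0 q.1))
      linarith
    refine (mul_le_mul' le_rfl (mul_le_mul' hb1 le_rfl)).trans ?_
    rw [← ENNReal.ofReal_mul (by norm_num), ← ENNReal.ofReal_mul (by positivity),
      ← ENNReal.ofReal_mul (by positivity), ← ENNReal.ofReal_mul (by positivity)]
    refine ENNReal.ofReal_le_ofReal ?_
    have hq : h v / sqrtM u v ≤ h v / c :=
      div_le_div_of_nonneg_left (h0 v) hc0 ((hc v hv).trans (maxwellian_le_sqrtM u v))
    have hhv : (0 : ℝ) ≤ h v := h0 v
    have hhc : 0 ≤ C * (h v / sqrtM u v) := mul_nonneg hC0 (div_nonneg hhv (s0 v))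
    rw [splitDensity, if_pos hv]
    calc _ ≤ 4 * (2 * (K * (1 + N)) * (C * (h v / c))) := by gcongr
      _ = _ := by ring
  · refine le_add_left ?_
    push Not at hv
    rw [splitDensity, if_neg hv.not_ge]
    have e : ENNReal.ofReal ((h v / sqrtM u v) ^ 2 / 2) =
        ENNReal.ofReal 2⁻¹ * ENNReal.ofReal (h v ^ 2 / maxwellian u v) := by
      rw [← ENNReal.ofReal_mul (by norm_num), div_pow, ← sqrtM_sq]
      congr 1; ring
    have e4 : ENNReal.ofReal 4 * ENNReal.ofReal 2⁻¹ = ENNReal.ofReal 2 := by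
      rw [← ENNReal.ofReal_mul (by norm_num)]; norm_num
    have e5 : ∀ I X : ℝ≥0∞, ENNReal.ofReal 4 * (I * (ENNReal.ofReal 2⁻¹ * X)) =
        ENNReal.ofReal 2 * I * X := fun I X => by rw [← e4]; ring
    rw [e, e5, ENNReal.ofReal_ofNat]
    refine mul_le_mul' (le_trans (mul_le_mul' le_rfl (lintegral_mono fun q => ?_)) (hN v hv)) le_rfl
    refine ENNReal.ofReal_le_ofReal ?_
    unfold gainKernel
    have one_le : ∀ x : ℝ, 1 ≤ (2 * (1 + x ^ 2)) ^ 3 := fun x =>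
      one_le_pow₀ (by nlinarith [sq_nonneg x])
    have hk := kern_nonneg (θ := θ) hb.nonneg q.2 (v - q.1)
    exact mul_le_mul_of_nonneg_left (mul_le_mul_of_nonneg_left (add_le_add
      (le_mul_of_one_le_right (s0 _) (one_le _)) (le_mul_of_one_le_right (s0 _) (one_le _)))
      (s0 _)) hk

/-- Coercivity of the linearized collision operator, up to bounded velocities. -/
theorem lintegral_freq_sq_le (hb : AngularCutoff θ b)
    (hK : ∀ v : E, ∫⁻ q, ENNReal.ofReal (kern θ b q.2 (v - q.1) * sqrtM u q.1) ∂pairMeasure ≤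
      ENNReal.ofReal (K * (1 + ‖v - u‖))) (hK0 : 0 ≤ K) (hN0 : 0 ≤ N)
    (hN : ∀ v, N < ‖v - u‖ → 2 * ∫⁻ q, ENNReal.ofReal (gainKernel θ b u v q) ∂pairMeasure ≤
      freq θ b u v) {c : ℝ} (hc0 : 0 < c) (hc : ∀ v, ‖v - u‖ ≤ N → c ≤ maxwellian u v)
    (hm : Measurable h) (h0 : 0 ≤ h) (hC0 : 0 ≤ C) (hC : ∀ᵐ v, h v ≤ C * sqrtM u v)
    (hfin : ∫⁻ v, freq θ b u v * ENNReal.ofReal (h v ^ 2 / maxwellian u v) < ∞) :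
    ∫⁻ v, freq θ b u v * ENNReal.ofReal (h v ^ 2 / maxwellian u v) ≤
      ENNReal.ofReal (2 * ∫ v, h v / maxwellian u v * lin θ b u h v) +
      ENNReal.ofReal (8 * C * K * (1 + N) / c) *
        (∫⁻ v in {v | ‖v - u‖ ≤ N}, ENNReal.ofReal (h v)) := by
  have hL := memLp_quotient hb hfin hm
  have hC' : ∀ᵐ v, |h v| ≤ C * sqrtM u v := by
    filter_upwards [hC] with v hv
    rwa [abs_of_nonneg (h0 v)]
  rw [(integral_mul_lin hb hK hm hC0 hC' hL).2]
  have hT := measurePreserving_collide_inv (θ := θ) (u := u) hb.meas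
  have hX := measurePreserving_exchange_inv (θ := θ) (u := u) hb.meas
  have i0 : Integrable (fun q : Coll => h q.1 / maxwellian u q.1 * collDiff u h q)
    (invMeasure θ b u) := hL.integrable_mul (memLp_collDiff hb hL)
  have h1 := hL.comp_measurePreserving hX
  have h2 := hL.comp_measurePreserving hT
  have h3 := h1.comp_measurePreserving hT
  have i2 : Integrable (fun q : Coll => h q.1 / maxwellian u q.1 *
      (h (collide q).1 / maxwellian u (collide q).1) + h q.1 / maxwellian u q.1 *
      (h (collide q).2.1 / maxwellian u (collide q).2.1)) (invMeasure θ b u) :=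
    (hL.integrable_mul h2).add (hL.integrable_mul h3)
  have iq := (memLp_two_iff_integrable_sq hL.1).1 hL
  have hq0 : ∀ v, 0 ≤ h v / maxwellian u v := fun v => div_nonneg (h0 v) (maxwellian_pos _ _).le
  set I := ∫⁻ v, freq θ b u v * ENNReal.ofReal (h v ^ 2 / maxwellian u v)
  set P := ENNReal.ofReal (8 * C * K * (1 + N) / c) *
        (∫⁻ v in {v | ‖v - u‖ ≤ N}, ENNReal.ofReal (h v))
  have hI : I = ENNReal.ofReal (∫ q, (h q.1 / maxwellian u q.1) ^ 2 ∂(invMeasure θ b u)) := by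
    rw [ofReal_integral_eq_lintegral_ofReal iq (Eventually.of_forall fun _ => sq_nonneg _),
      lintegral_quotient_sq hb hm]
  set X := ∫ q, h q.1 / maxwellian u q.1 * collDiff u h q ∂(invMeasure θ b u)
  -- With g = h/μ, this is g² ≤ g (g + g_* - g' - g_*') + g g' + g g_*', where the nonnegative term
  -- g g_* is dropped.
  have hle : ∫ q, (h q.1 / maxwellian u q.1) ^ 2 ∂(invMeasure θ b u) ≤
      X + ∫ q, (h q.1 / maxwellian u q.1 *
      (h (collide q).1 / maxwellian u (collide q).1) + h q.1 / maxwellian u q.1 *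
      (h (collide q).2.1 / maxwellian u (collide q).2.1)) ∂(invMeasure θ b u) := by
    rw [← integral_add i0 i2]
    refine integral_mono iq (i0.add i2) fun q => ?_
    have := mul_nonneg (hq0 q.1) (hq0 q.2.1)
    simp only [collDiff]
    nlinarith
  have hY := lintegral_gain_form_le (N := N) hb hm h0 hC0 hC
  have hZ := lintegral_gain_form_le_split hb hK hK0 hN0 hN hc0 hc hm h0 hC0
  have hJ : I ≤ ENNReal.ofReal X + ENNReal.ofReal 2 * ∫⁻ q : Coll,
      ENNReal.ofReal (kern θ b q.2.2 (q.1 - q.2.1) * (sqrtM u q.2.1 *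
      (sqrtM u (collide q).2.1 + sqrtM u (collide q).1)) * splitDensity u C N h q.1)
      ∂collMeasure := by
    rw [hI]
    refine (ENNReal.ofReal_le_ofReal hle).trans (ENNReal.ofReal_add_le.trans ?_)
    refine add_le_add le_rfl (le_trans (le_of_eq ?_) hY)
    exact ofReal_integral_eq_lintegral_ofReal i2 (Eventually.of_forall fun q =>
      add_nonneg (mul_nonneg (hq0 _) (hq0 _)) (mul_nonneg (hq0 _) (hq0 _)))
  set W := ∫⁻ q : Coll,
      ENNReal.ofReal (kern θ b q.2.2 (q.1 - q.2.1) * (sqrtM u q.2.1 *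
      (sqrtM u (collide q).2.1 + sqrtM u (collide q).1)) * splitDensity u C N h q.1)
      ∂collMeasure
  have e4 : ENNReal.ofReal 4 = ENNReal.ofReal 2 * ENNReal.ofReal 2 := by
    rw [← ENNReal.ofReal_mul (by norm_num)]; norm_num
  -- Doubling the inequality absorbs the large-velocity part of the gain into one of the two copies
  -- of I; the finiteness of I allows it to be cancelled.
  have hfinal : I + I ≤ (ENNReal.ofReal (2 * X) + P) + I := by
    calc I + I = ENNReal.ofReal 2 * I := by rw [ENNReal.ofReal_ofNat, two_mul]
      _ ≤ ENNReal.ofReal 2 * (ENNReal.ofReal X + ENNReal.ofReal 2 * W) := mul_le_mul' le_rfl hJ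
      _ = ENNReal.ofReal (2 * X) + ENNReal.ofReal 4 * W := by
        rw [ENNReal.ofReal_mul (by norm_num), e4]; ring
      _ ≤ ENNReal.ofReal (2 * X) + (P + I) := add_le_add le_rfl hZ
      _ = _ := by rw [add_assoc]
  exact (ENNReal.add_le_add_iff_right hfin.ne).1 hfinal

end

/-! ### Lines, projections and null sets. -/

lemma frame_decomposition {e e₁ e₂ : E} (he : ‖e‖ = 1) (h1 : ‖e₁‖ = 1) (h2 : ‖e₂‖ = 1)
    (h01 : ⟪e, e₁⟫_ℝ = 0) (h02 : ⟪e, e₂⟫_ℝ = 0) (h12 : ⟪e₁, e₂⟫_ℝ = 0) (x : E) :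
    x = ⟪e, x⟫_ℝ • e + (⟪e₁, x⟫_ℝ • e₁ + ⟪e₂, x⟫_ℝ • e₂) := by
  have ho : Orthonormal ℝ ![e, e₁, e₂] := by
    constructor
    · intro i; fin_cases i <;> simp [he, h1, h2]
    · intro i j hij
      fin_cases i <;> fin_cases j <;>
        simp_all [real_inner_comm e e₁, real_inner_comm e e₂, real_inner_comm e₁ e₂]
  let b := basisOfOrthonormalOfCardEqFinrank ho (by simp)
  have hb : ⇑b = ![e, e₁, e₂] := coe_basisOfOrthonormalOfCardEqFinrank ho (by simp)
  let b' := b.toOrthonormalBasis (by rw [hb]; exact ho)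
  have hb' : ⇑b' = ![e, e₁, e₂] := by rw [Module.Basis.coe_toOrthonormalBasis, hb]
  have := b'.sum_repr' x
  rw [hb', Fin.sum_univ_three] at this
  rw [← add_assoc]
  exact this.symm

lemma ae_affine {P : ℝ → Prop} (h : ∀ᵐ s : ℝ, P s) (a : ℝ) {c : ℝ} (hc : c ≠ 0) :
    ∀ᵐ s : ℝ, P (a + c * s) := by
  have h1 : ∀ᵐ s : ℝ, P (a + s) := (measurePreserving_add_left volume a).quasiMeasurePreserving.ae h
  rw [ae_iff] at h1 ⊢
  have := Real.volume_preimage_mul_left hc {s | ¬P (a + s)}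
  rw [h1, mul_zero] at this
  exact this

/-- The projection along a direction `v`, and its compatibility with null sets. -/
theorem exists_line_projection (v : E) (hv : v ≠ 0) : ∃ L : E →L[ℝ] ℝ × ℝ,
    (∀ x, L x = 0 → ∃ r : ℝ, x = r • v) ∧ L v = 0 ∧
    (∀ N : Set (ℝ × ℝ), volume N = 0 → volume (L ⁻¹' N) = 0) ∧
    (∀ Z : Set E, volume Z = 0 → ∀ᵐ z : ℝ × ℝ, ∀ x, L x = z → ∀ᵐ s : ℝ, x + s • v ∉ Z) := by
  have hn : ‖v‖ ≠ 0 := norm_ne_zero_iff.2 hv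
  set e : E := ‖v‖⁻¹ • v with hedef
  have he : ‖e‖ = 1 := by rw [hedef, norm_smul, norm_inv, norm_norm, inv_mul_cancel₀ hn]
  have hve : v = ‖v‖ • e := by rw [hedef, smul_smul, mul_inv_cancel₀ hn, one_smul]
  clear_value e
  obtain ⟨e₁, e₂, h1, h2, h01, h02, h12, hfr⟩ := exists_frame e he
  have hdec := frame_decomposition he h1 h2 h01 h02 h12
  let L : E →L[ℝ] ℝ × ℝ := (innerSL ℝ e₁).prod (innerSL ℝ e₂)
  have hL : ∀ x, L x = (⟪e₁, x⟫_ℝ, ⟪e₂, x⟫_ℝ) := fun x => rfl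
  have h10 : ⟪e₁, e⟫_ℝ = 0 := by rw [real_inner_comm]; exact h01
  have h20 : ⟪e₂, e⟫_ℝ = 0 := by rw [real_inner_comm]; exact h02
  have h21 : ⟪e₂, e₁⟫_ℝ = 0 := by rw [real_inner_comm]; exact h12
  have hLc : ∀ (z : ℝ) (p : ℝ × ℝ), L (z • e + (p.1 • e₁ + p.2 • e₂)) = p := by
    intro z p
    rw [hL]
    simp [inner_add_right, inner_smul_right, h10, h20, h21, h12, h1, h2]
  have hmc : Measurable fun q : ℝ × (ℝ × ℝ) => q.1 • e + (q.2.1 • e₁ + q.2.2 • e₂) := by fun_prop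
  refine ⟨L, ?_, ?_, ?_, ?_⟩
  · intro x hx
    rw [hL, Prod.mk_eq_zero] at hx
    refine ⟨⟪e, x⟫_ℝ * ‖v‖⁻¹, ?_⟩
    have := hdec x
    rw [hx.1, hx.2, zero_smul, zero_smul, add_zero, add_zero] at this
    rw [mul_smul, ← hedef]
    exact this
  · have a1 := congrArg (inner ℝ e₁) hve
    have a2 := congrArg (inner ℝ e₂) hve
    rw [inner_smul_right, h10, mul_zero] at a1
    rw [inner_smul_right, h20, mul_zero] at a2
    rw [hL, a1, a2]; rfl
  · intro N hN
    refine measure_mono_null (preimage_mono (subset_toMeasurable volume N)) ?_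
    have hm := measurableSet_toMeasurable volume N
    have h0 : volume (toMeasurable volume N) = 0 := by rw [measure_toMeasurable, hN]
    rw [← lintegral_indicator_one (L.continuous.measurable hm), hfr _ (measurable_one.indicator
      (L.continuous.measurable hm))]
    refine (lintegral_congr fun z => ?_).trans lintegral_zero
    rw [← h0, ← lintegral_indicator_one hm]
    refine lintegral_congr fun p => ?_
    have hiff : z • e + (p.1 • e₁ + p.2 • e₂) ∈ L ⁻¹' (toMeasurable volume N) ↔
        p ∈ toMeasurable volume N := by rw [mem_preimage, hLc]
    by_cases hp : p ∈ toMeasurable volume N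
    · rw [indicator_of_mem hp, indicator_of_mem (hiff.2 hp)]; rfl
    · rw [indicator_of_notMem hp, indicator_of_notMem (fun h => hp (hiff.1 h))]
  · intro Z hZ
    have hm := measurableSet_toMeasurable volume Z
    have h0 : volume (toMeasurable volume Z) = 0 := by rw [measure_toMeasurable, hZ]
    have hi : Measurable ((toMeasurable volume Z).indicator (1 : E → ℝ≥0∞)) :=
      measurable_one.indicator hm
    have hi2 : Measurable (Function.uncurry fun (z : ℝ) (p : ℝ × ℝ) =>
        (toMeasurable volume Z).indicator (1 : E → ℝ≥0∞) (z • e + (p.1 • e₁ + p.2 • e₂))) :=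
      hi.comp hmc
    -- Fubini with the coordinate along v innermost: a null set meets almost every line parallel to
    -- v in a null set. Every point over the same p parametrizes that line by an affine change of s.
    rw [← lintegral_indicator_one hm, hfr _ hi, lintegral_lintegral_swap hi2.aemeasurable]
      at h0
    replace h0 := (lintegral_eq_zero_iff hi2.lintegral_prod_left').1 h0
    filter_upwards [h0] with p hp x hx
    replace hp := (lintegral_eq_zero_iff (hi2.comp (measurable_id.prodMk measurable_const))).1 hp
    filter_upwards [ae_affine hp ⟪e, x⟫_ℝ hn] with s hs hmem
    have hxe : x + s • v = (⟪e, x⟫_ℝ + ‖v‖ * s) • e + (p.1 • e₁ + p.2 • e₂) := by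
      have h3 := hdec x
      rw [hL] at hx
      rw [← hx]
      have hsv : s • v = (‖v‖ * s) • e := by rw [mul_comm, mul_smul, ← hve]
      nth_rewrite 1 [h3]
      rw [hsv]
      module
    change (toMeasurable volume Z).indicator (1 : E → ℝ≥0∞)
      ((⟪e, x⟫_ℝ + ‖v‖ * s) • e + (p.1 • e₁ + p.2 • e₂)) = 0 at hs
    rw [← hxe, indicator_of_mem (subset_toMeasurable _ _ hmem)] at hs
    exact one_ne_zero hs

/-! ### Defining functions and the inner normal. -/

section Boundary

variable {Ω : Set E} {n : E → E} {φ : E → ℝ} {y : E}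

/-- `φ` is a defining function of `Ω` near `y`. -/
structure IsDefining (Ω : Set E) (φ : E → ℝ) (U : Set E) : Prop where
  isOpen : IsOpen U
  contDiffOn : ContDiffOn ℝ 2 φ U
  mem_iff : ∀ y ∈ U, (y ∈ Ω ↔ φ y < 0)

lemma IsDefining.hasStrictFDerivAt {U : Set E} (h : IsDefining Ω φ U) (hy : y ∈ U) :
    HasStrictFDerivAt φ (innerSL ℝ (gradient φ y)) y := by
  have h1 := (h.contDiffOn.contDiffAt (h.isOpen.mem_nhds hy)).hasStrictFDerivAt (by norm_num)
  have h2 : innerSL ℝ (gradient φ y) = fderiv ℝ φ y := by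
    ext w
    rw [innerSL_apply_apply, inner_gradient_left]
  rw [h2]; exact h1

lemma IsDefining.eq_zero {U : Set E} (h : IsDefining Ω φ U) (hΩ : IsOpen Ω) (hy : y ∈ U)
    (hyf : y ∈ frontier Ω) : φ y = 0 := by
  refine le_antisymm ?_ ?_
  · by_contra hlt
    push Not at hlt
    have hc := (h.hasStrictFDerivAt hy).hasFDerivAt.continuousAt
    have := (hc.eventually (lt_mem_nhds hlt)).and (h.isOpen.mem_nhds hy)
    obtain ⟨z, hzΩ, hz⟩ := mem_closure_iff_frequently.1 (frontier_subset_closure hyf) |>.and_eventually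
      this |>.exists
    exact absurd ((h.mem_iff z hz.2).1 hzΩ) hz.1.not_gt
  · by_contra hlt
    push Not at hlt
    have := (h.mem_iff y hy).2 hlt
    rw [hΩ.frontier_eq] at hyf
    exact hyf.2 this

lemma IsDefining.hasDerivAt_line {U : Set E} (h : IsDefining Ω φ U) (hy : y ∈ U) (w : E) :
    HasDerivAt (fun s : ℝ => φ (y + s • w)) ⟪gradient φ y, w⟫_ℝ 0 := by
  have h1 := (h.hasStrictFDerivAt hy).hasFDerivAt
  have hl : HasDerivAt (fun s : ℝ => y + s • w) w 0 := by
    simpa using ((hasDerivAt_id (0 : ℝ)).smul_const w).const_add y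
  exact HasFDerivAt.comp_hasDerivAt (x := (0 : ℝ)) (f := fun s : ℝ => y + s • w) (l := φ)
      (l' := innerSL ℝ (gradient φ y)) (by simpa using h1) hl

lemma eventually_line_mem {U : Set E} (hU : IsOpen U) (hy : y ∈ U) (w : E) :
    ∀ᶠ s : ℝ in 𝓝[>] 0, y + s • w ∈ U := by
  have : ContinuousAt (fun s : ℝ => y + s • w) 0 := by fun_prop
  exact (this.eventually_mem (hU.mem_nhds (by simpa using hy))).filter_mono nhdsWithin_le_nhds

lemma IsDefining.eventually_mem {U : Set E} (h : IsDefining Ω φ U) (hy : y ∈ U) (h0 : φ y = 0)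
    {w : E} (hw : ⟪gradient φ y, w⟫_ℝ < 0) : ∀ᶠ s : ℝ in 𝓝[>] 0, y + s • w ∈ Ω := by
  have h2 := (h.hasDerivAt_line hy w).tendsto_slope_zero_right
  filter_upwards [h2.eventually_lt_const hw, eventually_line_mem h.isOpen hy w,
    self_mem_nhdsWithin] with s h5 h6 h7
  simp only [zero_add, zero_smul, add_zero, h0, sub_zero, smul_eq_mul] at h5
  exact (h.mem_iff _ h6).2 (by
    by_contra hc
    push Not at hc
    exact absurd h5 (mul_nonneg (inv_nonneg.2 (le_of_lt h7)) hc).not_gt)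

lemma IsDefining.mem_gas {U : Set E} (h : IsDefining Ω φ U) (hy : y ∈ U) (h0 : 0 < φ y) :
    y ∈ gas Ω := by
  intro hcl
  have hc := (h.hasStrictFDerivAt hy).hasFDerivAt.continuousAt
  have := (hc.eventually (lt_mem_nhds h0)).and (h.isOpen.mem_nhds hy)
  obtain ⟨z, hzΩ, hz⟩ := ((mem_closure_iff_frequently.1 hcl).and_eventually this).exists
  exact absurd ((h.mem_iff z hz.2).1 hzΩ) hz.1.not_gt

lemma IsDefining.eventually_mem_gas {U : Set E} (h : IsDefining Ω φ U) (hy : y ∈ U) (h0 : φ y = 0)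
    {w : E} (hw : 0 < ⟪gradient φ y, w⟫_ℝ) : ∀ᶠ s : ℝ in 𝓝[>] 0, y + s • w ∈ gas Ω := by
  have h2 := (h.hasDerivAt_line hy w).tendsto_slope_zero_right
  filter_upwards [h2.eventually_const_lt hw, eventually_line_mem h.isOpen hy w,
    self_mem_nhdsWithin] with s h5 h6 h7
  simp only [zero_add, zero_smul, add_zero, h0, sub_zero, smul_eq_mul] at h5
  exact h.mem_gas h6 ((pos_iff_pos_of_mul_pos h5).1 (inv_pos.2 h7))

/-- Two vectors defining the same open half-space are parallel. -/
lemma normalize_eq_of_halfspace {a c : E} (ha : a ≠ 0) (hc : c ≠ 0)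
    (h : ∀ w, ⟪a, w⟫_ℝ < 0 → ⟪c, w⟫_ℝ ≤ 0) : ‖a‖⁻¹ • a = ‖c‖⁻¹ • c := by
  have hna : 0 < ‖a‖ ^ 2 := by have := norm_pos_iff.2 ha; positivity
  have key : ∀ z, ⟪a, z⟫_ℝ = 0 → ⟪c, z⟫_ℝ = 0 := by
    -- A vector orthogonal to a is approximated by z - η a in the open half-space; η is chosen so
    -- that the error η⟪c, a⟫ is at most δ.
    have half : ∀ z, ⟪a, z⟫_ℝ = 0 → ⟪c, z⟫_ℝ ≤ 0 := by
      intro z hz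
      refine le_of_forall_pos_le_add fun δ hδ => ?_
      set η := δ / (|⟪c, a⟫_ℝ| + 1) with hη
      have hη0 : 0 < η := by positivity
      have h1 := h (z - η • a) (by
        rw [inner_sub_right, hz, inner_smul_right, real_inner_self_eq_norm_sq]
        nlinarith [mul_pos hη0 hna])
      rw [inner_sub_right, inner_smul_right] at h1
      have h2 : η * ⟪c, a⟫_ℝ ≤ η * (|⟪c, a⟫_ℝ| + 1) := by
        gcongr
        linarith [le_abs_self ⟪c, a⟫_ℝ]
      rw [hη, div_mul_cancel₀ _ (by positivity)] at h2
      linarith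
    intro z hz
    refine le_antisymm (half z hz) ?_
    have := half (-z) (by rw [inner_neg_right, hz, neg_zero])
    rw [inner_neg_right] at this
    linarith
  set r := ⟪c, a⟫_ℝ / ‖a‖ ^ 2 with hr
  have hz : ⟪a, c - r • a⟫_ℝ = 0 := by
    rw [inner_sub_right, inner_smul_right, real_inner_self_eq_norm_sq, hr, real_inner_comm]
    field_simp
    ring
  have hcr : c = r • a := by
    have h1 := key _ hz
    have h2 : ⟪c - r • a, c - r • a⟫_ℝ = 0 := by
      rw [inner_sub_left, h1, inner_smul_left, hz, mul_zero, sub_zero]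
    exact sub_eq_zero.1 (inner_self_eq_zero.1 h2)
  have hr0 : 0 ≤ r := by
    have := h (-a) (by rw [inner_neg_right, real_inner_self_eq_norm_sq]; linarith)
    rw [inner_neg_right] at this
    exact div_nonneg (by linarith) hna.le
  have hr1 : 0 < r := lt_of_le_of_ne hr0 fun h0 => hc (by rw [hcr, ← h0, zero_smul])
  have hna' := (norm_pos_iff.2 ha).ne'
  rw [hcr, norm_smul, Real.norm_of_nonneg hr0, smul_smul]
  congr 1
  field_simp

lemma exists_isDefining (hn : HasC2BoundaryWithInnerNormal Ω n) (hy : y ∈ frontier Ω) :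
    ∃ φ U, IsDefining Ω φ U ∧ y ∈ U ∧ gradient φ y ≠ 0 ∧
      n y = -(‖gradient φ y‖⁻¹ • gradient φ y) := by
  obtain ⟨φ, U, hU, h1, h2, h3, h4⟩ := hn y hy
  exact ⟨φ, interior U, ⟨isOpen_interior, h1.mono interior_subset,
    fun z hz => h3 z (interior_subset hz)⟩, mem_interior_iff_mem_nhds.2 hU, h2, h4⟩

/-- The inner normal can be computed from any defining function. -/
theorem IsDefining.normal_eq {U : Set E} (h : IsDefining Ω φ U) (hΩ : IsOpen Ω)
    (hn : HasC2BoundaryWithInnerNormal Ω n) (hy : y ∈ U) (hyf : y ∈ frontier Ω)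
    (hg : gradient φ y ≠ 0) : n y = -(‖gradient φ y‖⁻¹ • gradient φ y) := by
  obtain ⟨ψ, V, h1, h2, h3, h4⟩ := exists_isDefining hn hyf
  rw [h4, normalize_eq_of_halfspace h3 hg fun w hw => ?_]
  -- Otherwise the direction w would point into Ω according to one defining function and into the
  -- gas according to the other.
  by_contra hc
  push Not at hc
  obtain ⟨s, hs1, hs2⟩ := ((h1.eventually_mem h2 (h1.eq_zero hΩ h2 hyf) hw).and
    (h.eventually_mem_gas hy (h.eq_zero hΩ hy hyf) hc)).exists
  exact hs2 (subset_closure hs1)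

lemma norm_normal (hn : HasC2BoundaryWithInnerNormal Ω n) (hy : y ∈ frontier Ω) : ‖n y‖ = 1 := by
  obtain ⟨ψ, V, h1, h2, h3, h4⟩ := exists_isDefining hn hy
  rw [h4, norm_neg, norm_smul, norm_inv, norm_norm, inv_mul_cancel₀ (norm_ne_zero_iff.2 h3)]

lemma eventually_mem_of_normal_pos (hΩ : IsOpen Ω) (hn : HasC2BoundaryWithInnerNormal Ω n)
    (hy : y ∈ frontier Ω) {w : E} (hw : 0 < ⟪n y, w⟫_ℝ) : ∀ᶠ s : ℝ in 𝓝[>] 0, y + s • w ∈ Ω := by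
  obtain ⟨ψ, V, h1, h2, h3, h4⟩ := exists_isDefining hn hy
  refine h1.eventually_mem h2 (h1.eq_zero hΩ h2 hy) ?_
  rw [h4, inner_neg_left, inner_smul_left, RCLike.conj_to_real] at hw
  by_contra hc
  push Not at hc
  have := mul_nonneg (inv_nonneg.2 (norm_nonneg (gradient ψ y))) hc
  linarith

lemma eventually_mem_gas_of_normal_pos (hΩ : IsOpen Ω) (hn : HasC2BoundaryWithInnerNormal Ω n)
    (hy : y ∈ frontier Ω) {w : E} (hw : 0 < ⟪n y, w⟫_ℝ) :
    ∀ᶠ s : ℝ in 𝓝[>] 0, y - s • w ∈ gas Ω := by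
  obtain ⟨ψ, V, h1, h2, h3, h4⟩ := exists_isDefining hn hy
  have := h1.eventually_mem_gas h2 (h1.eq_zero hΩ h2 hy) (w := -w) (by
    rw [h4, inner_neg_left, inner_smul_left, RCLike.conj_to_real] at hw
    rw [inner_neg_right]
    by_contra hc
    push Not at hc
    have := mul_nonneg (inv_nonneg.2 (norm_nonneg (gradient ψ y))) (by linarith :
      0 ≤ ⟪gradient ψ y, w⟫_ℝ)
    linarith)
  simpa only [smul_neg, ← sub_eq_add_neg] using this

/-- Near y one and the same defining function computes the normal at every boundary point, and its
gradient is continuous. Independence of the defining function is what makes this possible. -/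
lemma continuousOn_normal (hΩ : IsOpen Ω) (hn : HasC2BoundaryWithInnerNormal Ω n) :
    ContinuousOn n (frontier Ω) := by
  intro y hy
  obtain ⟨φ, U, h1, h2, h3, h4⟩ := exists_isDefining hn hy
  have hgc : ContinuousOn (gradient φ) U := by
    have := h1.contDiffOn.continuousOn_fderiv_of_isOpen h1.isOpen (by norm_num)
    exact (InnerProductSpace.toDual ℝ E).symm.continuous.comp_continuousOn this
  have hc : ContinuousAt (gradient φ) y := hgc.continuousAt (h1.isOpen.mem_nhds h2)
  have hc2 : ContinuousAt (fun z => -(‖gradient φ z‖⁻¹ • gradient φ z)) y :=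
    ((hc.norm.inv₀ (norm_ne_zero_iff.2 h3)).smul hc).neg
  refine hc2.continuousWithinAt.congr_of_eventuallyEq ?_ h4
  filter_upwards [self_mem_nhdsWithin, mem_nhdsWithin_of_mem_nhds (h1.isOpen.mem_nhds h2),
    (hc.eventually_ne h3).filter_mono nhdsWithin_le_nhds] with z hz1 hz2 hz3
  exact h1.normal_eq hΩ hn hz2 hz1 hz3

end Boundary

/-! ### Surface measure and transversal projections. -/

section Boundary

variable {Ω : Set E} {n : E → E} {φ : E → ℝ} {y : E}

lemma euclideanHausdorffMeasure_eq_zero_iff {X : Type*} [EMetricSpace X] [MeasurableSpace X]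
    [BorelSpace X] (s : Set X) : μHE[2] s = 0 ↔ μH[2] s = 0 := by
  rw [Measure.euclideanHausdorffMeasure_def, Measure.smul_apply, ENNReal.smul_def, smul_eq_mul,
    mul_eq_zero, ENNReal.coe_eq_zero]
  simp only [Measure.addHaarScalarFactor_volume_hausdorffMeasure_ne_zero, false_or]
  norm_num

lemma euclideanHausdorffMeasure_lt_top_of {X : Type*} [EMetricSpace X] [MeasurableSpace X]
    [BorelSpace X] {s : Set X} (h : μH[2] s < ∞) : μHE[2] s < ∞ := by
  rw [Measure.euclideanHausdorffMeasure_def, Measure.smul_apply, ENNReal.smul_def, smul_eq_mul]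
  refine ENNReal.mul_lt_top ENNReal.coe_lt_top ?_
  norm_num
  exact h

/-- The sup metric on ℝ × ℝ suits the purpose: its two-dimensional Hausdorff measure is exactly
Lebesgue measure. -/
lemma hausdorffMeasure_le_of_antilipschitz {s : Set E} {L : E → ℝ × ℝ} {K : ℝ} (hK0 : 0 ≤ K)
    (hK : ∀ z ∈ s, ∀ w ∈ s, ‖z - w‖ ≤ K * ‖L z - L w‖) :
    μH[2] s ≤ (K.toNNReal : ℝ≥0∞) ^ (2 : ℝ) * volume (L '' s) := by
  have hf : AntilipschitzWith K.toNNReal fun z : s => L z :=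
    AntilipschitzWith.of_le_mul_dist fun z w => by
      rw [Real.coe_toNNReal _ hK0, dist_eq_norm (L z), Subtype.dist_eq, dist_eq_norm]
      exact hK z z.2 w w.2
  have h1 := hf.le_hausdorffMeasure_image (d := 2) (by norm_num) univ
  have h2 := (isometry_subtype_coe (s := s)).hausdorffMeasure_image (d := 2)
    (Or.inl (by norm_num)) univ
  rw [image_univ, Subtype.range_coe] at h2
  rw [h2]
  refine h1.trans (le_of_eq ?_)
  rw [hausdorffMeasure_prod_real, image_univ, image_eq_range]

/-- Near a boundary point where `v` is transversal, the projection along `v` is antilipschitz. -/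
theorem exists_antilipschitz_projection (hΩ : IsOpen Ω) (hn : HasC2BoundaryWithInnerNormal Ω n)
    (hy : y ∈ frontier Ω) {v : E} (hv : ⟪n y, v⟫_ℝ ≠ 0) {L : E →L[ℝ] ℝ × ℝ}
    (hL : ∀ x, L x = 0 → ∃ r : ℝ, x = r • v) :
    ∃ U, IsOpen U ∧ y ∈ U ∧ ∃ K : ℝ, 0 ≤ K ∧ ∀ z ∈ U ∩ frontier Ω, ∀ w ∈ U ∩ frontier Ω,
      ‖z - w‖ ≤ K * ‖L z - L w‖ := by
  obtain ⟨φ, U, h1, h2, h3, h4⟩ := exists_isDefining hn hy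
  have hgv : ⟪gradient φ y, v⟫_ℝ ≠ 0 := by
    intro h0
    rw [h4, inner_neg_left, inner_smul_left, h0, mul_zero, neg_zero] at hv
    exact hv rfl
  -- Transversality makes (L, ⟪∇φ(y), ·⟫) injective, hence bounded below by 1/K. On the zero set of
  -- φ, strict differentiability makes the second component at most ‖z - w‖/(2K), which cannot
  -- account for ‖z - w‖; so L controls the distance.
  let T : E →L[ℝ] (ℝ × ℝ) × ℝ := L.prod (innerSL ℝ (gradient φ y))
  have hT : LinearMap.ker (T : E →ₗ[ℝ] (ℝ × ℝ) × ℝ) = ⊥ := by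
    rw [LinearMap.ker_eq_bot']
    intro x hx
    have hx' : (L x, ⟪gradient φ y, x⟫_ℝ) = 0 := hx
    rw [Prod.mk_eq_zero] at hx'
    obtain ⟨r, rfl⟩ := hL x hx'.1
    have := hx'.2
    rw [inner_smul_right, mul_eq_zero, or_iff_left hgv] at this
    rw [this, zero_smul]
  obtain ⟨K, hK0, hK⟩ := LinearMap.exists_antilipschitzWith _ hT
  have hK' : ∀ x, ‖x‖ ≤ K * max ‖L x‖ |⟪gradient φ y, x⟫_ℝ| := by
    intro x
    have := hK.le_mul_dist x 0
    rw [dist_zero_right, map_zero, dist_zero_right] at this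
    exact this
  have hc : (0 : ℝ) < 1 / (2 * K) := by have : (0 : ℝ) < K := hK0; positivity
  have hst := (h1.hasStrictFDerivAt h2).isLittleO.def hc
  rw [nhds_prod_eq] at hst
  obtain ⟨V, hV, hVs⟩ := eventually_prod_self_iff'.1 hst
  refine ⟨U ∩ interior V, h1.isOpen.inter isOpen_interior, ⟨h2, mem_interior_iff_mem_nhds.2 hV⟩,
    2 * K, by positivity, fun z hz w hw => ?_⟩
  have h5 := hVs z (interior_subset hz.1.2) w (interior_subset hw.1.2)
  simp only [h1.eq_zero hΩ hz.1.1 hz.2, h1.eq_zero hΩ hw.1.1 hw.2, sub_zero, zero_sub,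
    norm_neg, innerSL_apply_apply, Real.norm_eq_abs] at h5
  have h6 := hK' (z - w)
  have hKp : (0 : ℝ) < K := hK0
  rw [map_sub] at h6
  rcases le_total ‖L z - L w‖ |⟪gradient φ y, z - w⟫_ℝ| with h7 | h7
  · rw [max_eq_right h7] at h6
    have h8 := h6.trans (mul_le_mul_of_nonneg_left h5 hKp.le)
    have h9 : (K : ℝ) * (1 / (2 * K) * ‖z - w‖) = ‖z - w‖ / 2 := by field_simp
    rw [h9] at h8
    have : ‖z - w‖ = 0 := le_antisymm (by linarith) (norm_nonneg _)
    rw [this]; positivity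
  · rw [max_eq_left h7] at h6
    nlinarith [mul_nonneg hKp.le (norm_nonneg (L z - L w))]

/-- Locally the boundary projects antilipschitz along its normal to a bounded plane set, and the
boundary is compact. Finiteness is what makes Fubini available for `phaseBoundary`. -/
theorem measure_frontier_lt_top (hΩ : IsOpen Ω) (hb : Bornology.IsBounded Ω)
    (hn : HasC2BoundaryWithInnerNormal Ω n) : μHE[2] (frontier Ω) < ∞ := by
  have hcomp : IsCompact (frontier Ω) :=
    hb.isCompact_closure.of_isClosed_subset isClosed_frontier frontier_subset_closure
  refine hcomp.measure_lt_top_of_nhdsWithin fun y hy => ?_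
  have hny := norm_normal hn hy
  have hn0 : n y ≠ 0 := fun h => by rw [h, norm_zero] at hny; exact zero_ne_one hny
  obtain ⟨L, hL1, hL2, hL3, hL4⟩ := exists_line_projection (n y) hn0
  obtain ⟨U, hU, hyU, K, hK0, hK⟩ := exists_antilipschitz_projection hΩ hn hy (v := n y)
    (by rw [real_inner_self_eq_norm_sq, hny]; norm_num) hL1
  refine ⟨frontier Ω ∩ (U ∩ Metric.ball y 1), inter_mem_nhdsWithin _
    ((hU.inter Metric.isOpen_ball).mem_nhds ⟨hyU, Metric.mem_ball_self one_pos⟩),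
    euclideanHausdorffMeasure_lt_top_of ?_⟩
  refine (hausdorffMeasure_le_of_antilipschitz (L := L) hK0 fun z hz w hw =>
    hK z ⟨hz.2.1, hz.1⟩ w ⟨hw.2.1, hw.1⟩).trans_lt ?_
  refine ENNReal.mul_lt_top (by finiteness) ?_
  have : Bornology.IsBounded (L '' (frontier Ω ∩ (U ∩ Metric.ball y 1))) :=
    L.lipschitz.isBounded_image (Metric.isBounded_ball.subset fun z hz => hz.2.2)
  exact this.measure_lt_top

/-- Boundary points that project to a null set are negligible, where `v` is transversal. -/
theorem measure_projection_null (hΩ : IsOpen Ω) (hn : HasC2BoundaryWithInnerNormal Ω n)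
    {v : E} {L : E →L[ℝ] ℝ × ℝ} (hL : ∀ x, L x = 0 → ∃ r : ℝ, x = r • v) {N : Set (ℝ × ℝ)}
    (hN : volume N = 0) : μHE[2] {y | y ∈ frontier Ω ∧ ⟪n y, v⟫_ℝ ≠ 0 ∧ L y ∈ N} = 0 := by
  refine measure_null_of_locally_null _ fun y hy => ?_
  obtain ⟨U, hU, hyU, K, hK0, hK⟩ := exists_antilipschitz_projection hΩ hn hy.1 hy.2.1 hL
  refine ⟨_, inter_mem_nhdsWithin _ (hU.mem_nhds hyU), ?_⟩
  rw [euclideanHausdorffMeasure_eq_zero_iff, ← nonpos_iff_eq_zero]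
  refine (hausdorffMeasure_le_of_antilipschitz (L := L) hK0 fun z hz w hw =>
    hK z ⟨hz.2, hz.1.1⟩ w ⟨hw.2, hw.1.1⟩).trans (le_of_eq ?_)
  rw [measure_mono_null _ hN, mul_zero]
  rintro _ ⟨z, hz, rfl⟩
  exact hz.1.2.2

/-- Negligible boundary points have negligible shadows. -/
theorem measure_shadow_null {L : E →L[ℝ] ℝ × ℝ}
    (hL : ∀ N : Set (ℝ × ℝ), volume N = 0 → volume (L ⁻¹' N) = 0) {Z : Set E}
    (hZ : μHE[2] Z = 0) : volume (L ⁻¹' (L '' Z)) = 0 := by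
  refine hL _ ?_
  rw [euclideanHausdorffMeasure_eq_zero_iff] at hZ
  rw [← hausdorffMeasure_prod_real, ← nonpos_iff_eq_zero]
  refine (L.lipschitz.hausdorffMeasure_image_le (by norm_num) Z).trans ?_
  rw [hZ, mul_zero]

end Boundary

/-! ### Free flights, exit times and exceptional sets. -/

/-- Phase points and times such that the gas is not left during the free flight. -/
def freeFlight (Ω : Set E) : Set ((E × E) × ℝ) :=
  {q | ∀ r : unitInterval, q.1.1 + ((r : ℝ) * q.2) • q.1.2 ∈ gas Ω}

/-- The first time at which the backward free flight leaves the gas (`0` if it never does). -/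
def exitTime (Ω : Set E) (p : E × E) : ℝ := sInf {s : ℝ | 0 ≤ s ∧ p.1 - s • p.2 ∉ gas Ω}

/-- The backward free flight from `p` leaves the gas exactly at time `t`. -/
def ExitsAt (Ω : Set E) (p : E × E) (t : ℝ) : Prop :=
  0 < t ∧ (∀ s ∈ Ico 0 t, p.1 - s • p.2 ∈ gas Ω) ∧ p.1 - t • p.2 ∉ gas Ω

section Flight

variable {Ω : Set E} {n : E → E}

lemma isOpen_gas : IsOpen (gas Ω) := isClosed_closure.isOpen_compl

lemma mem_freeFlight_iff {p : E × E} {t : ℝ} :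
    (p, t) ∈ freeFlight Ω ↔ ∀ s ∈ uIcc 0 t, p.1 + s • p.2 ∈ gas Ω := by
  constructor
  · intro h s hs
    rcases eq_or_ne t 0 with rfl | ht
    · have := h 0
      simp only [uIcc_self, mem_singleton_iff] at hs
      simpa [hs] using this
    · have hr : s / t ∈ unitInterval := by
        rcases le_total 0 t with h0 | h0
        · rw [uIcc_of_le h0] at hs
          exact ⟨div_nonneg hs.1 h0, div_le_one_of_le₀ hs.2 h0⟩
        · rw [uIcc_of_ge h0] at hs
          exact ⟨div_nonneg_of_nonpos hs.2 h0, div_le_one_of_ge hs.1 h0⟩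
      have := h ⟨s / t, hr⟩
      simpa [div_mul_cancel₀ _ ht] using this
  · intro h r
    refine h _ ?_
    have h0 := r.2.1
    have h1 := r.2.2
    rw [mem_uIcc]
    rcases le_total 0 t with ht | ht
    · exact Or.inl ⟨mul_nonneg h0 ht, by nlinarith⟩
    · exact Or.inr ⟨by nlinarith, mul_nonpos_of_nonneg_of_nonpos h0 ht⟩

/-- The complement is the projection of a closed set along the compact factor [0,1]; the
parametrization by the unit interval serves this purpose. -/
lemma isOpen_freeFlight : IsOpen (freeFlight Ω) := by
  have hc : Continuous fun z : ((E × E) × ℝ) × unitInterval =>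
      z.1.1.1 + ((z.2 : ℝ) * z.1.2) • z.1.1.2 := by fun_prop
  have h1 : IsClosed {z : ((E × E) × ℝ) × unitInterval |
      z.1.1.1 + ((z.2 : ℝ) * z.1.2) • z.1.1.2 ∉ gas Ω} :=
    (isOpen_gas.preimage hc).isClosed_compl
  have h2 := isClosedMap_fst_of_compactSpace _ h1
  rw [← isClosed_compl_iff]
  convert h2 using 1
  ext q
  simp [freeFlight, and_assoc]

lemma isClosed_exitSet (p : E × E) : IsClosed {s : ℝ | 0 ≤ s ∧ p.1 - s • p.2 ∉ gas Ω} :=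
  (isClosed_le continuous_const continuous_id).inter
    (isOpen_gas.preimage (by fun_prop : Continuous fun s : ℝ => p.1 - s • p.2)).isClosed_compl

lemma bddBelow_exitSet (p : E × E) : BddBelow {s : ℝ | 0 ≤ s ∧ p.1 - s • p.2 ∉ gas Ω} :=
  ⟨0, fun _ h => h.1⟩

lemma mem_freeFlight_neg_iff {p : E × E} {a : ℝ} (ha : 0 ≤ a) :
    (p, -a) ∈ freeFlight Ω ↔ ∀ s ∈ Icc 0 a, p.1 - s • p.2 ∈ gas Ω := by
  rw [mem_freeFlight_iff, uIcc_of_ge (by linarith)]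
  constructor
  · intro h s hs
    have := h (-s) ⟨by linarith [hs.2], by linarith [hs.1]⟩
    rwa [neg_smul, ← sub_eq_add_neg] at this
  · intro h s hs
    have := h (-s) ⟨by linarith [hs.2], by linarith [hs.1]⟩
    rwa [neg_smul, sub_neg_eq_add] at this

/-- For a ≥ 0 a sublevel set consists of the flights that leave by time a together with those that
never leave, which have the value 0 as infimum of the empty set. -/
lemma measurable_exitTime : Measurable (exitTime Ω) := by
  refine measurable_of_Iic fun a => ?_
  rcases lt_or_ge a 0 with ha | ha
  · convert MeasurableSet.empty
    ext p
    simp only [mem_preimage, mem_Iic, mem_empty_iff_false, iff_false, not_le]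
    exact ha.trans_le (Real.sInf_nonneg fun _ h => h.1)
  · have hm : ∀ t : ℝ, MeasurableSet {p : E × E | (p, t) ∈ freeFlight Ω} := fun t =>
      (isOpen_freeFlight.preimage (by fun_prop : Continuous fun p : E × E => (p, t))).measurableSet
    have : exitTime Ω ⁻¹' Iic a = {p | (p, -a) ∈ freeFlight Ω}ᶜ ∪
        ⋂ m : ℕ, {p | (p, -(m : ℝ)) ∈ freeFlight Ω} := by
      ext p
      simp only [mem_preimage, mem_Iic, mem_union, mem_compl_iff, mem_ofPred_eq, mem_iInter]
      rw [mem_freeFlight_neg_iff ha]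
      by_cases hne : {s : ℝ | 0 ≤ s ∧ p.1 - s • p.2 ∉ gas Ω}.Nonempty
      · have hmem := (isClosed_exitSet p).csInf_mem hne (bddBelow_exitSet p)
        constructor
        · intro h
          exact Or.inl fun h' => hmem.2 (h' _ ⟨hmem.1, h⟩)
        · rintro (h | h)
          · push Not at h
            obtain ⟨s, hs, hs'⟩ := h
            exact (csInf_le (bddBelow_exitSet p) ⟨hs.1, hs'⟩).trans hs.2
          · exfalso
            obtain ⟨s, hs, hs'⟩ := hne
            obtain ⟨m, hm⟩ := exists_nat_ge s
            exact hs' ((mem_freeFlight_neg_iff m.cast_nonneg).1 (h m) s ⟨hs, hm⟩)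
      · have h0 : exitTime Ω p = 0 := by
          rw [exitTime, not_nonempty_iff_eq_empty.1 hne, Real.sInf_empty]
        refine ⟨fun _ => Or.inr fun m => (mem_freeFlight_neg_iff m.cast_nonneg).2 fun s hs => ?_,
          fun _ => h0 ▸ ha⟩
        by_contra hc
        exact hne ⟨s, hs.1, hc⟩
    rw [this]
    exact (hm _).compl.union (MeasurableSet.iInter fun m => hm _)

lemma ExitsAt.exitTime_eq {p : E × E} {t : ℝ} (h : ExitsAt Ω p t) : exitTime Ω p = t := by
  refine IsLeast.csInf_eq ⟨⟨h.1.le, h.2.2⟩, fun s hs => ?_⟩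
  by_contra hc
  push Not at hc
  exact hs.2 (h.2.1 s ⟨hs.1, hc⟩)

lemma ExitsAt.mem_frontier {p : E × E} {t : ℝ} (hΩ : IsOpen Ω) (h : ExitsAt Ω p t) :
    p.1 - t • p.2 ∈ frontier Ω := by
  rw [hΩ.frontier_eq]
  refine ⟨by simpa [gas] using h.2.2, fun hmem => ?_⟩
  have hc : ContinuousAt (fun s : ℝ => p.1 - s • p.2) t := by fun_prop
  have h1 : ∀ᶠ s in 𝓝[<] t, p.1 - s • p.2 ∈ Ω :=
    (hc.eventually_mem (hΩ.mem_nhds hmem)).filter_mono nhdsWithin_le_nhds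
  have h2 : ∀ᶠ s in 𝓝[<] t, s ∈ Ico 0 t := Ico_mem_nhdsLT h.1
  obtain ⟨s, hs1, hs2⟩ := (h1.and h2).exists
  exact h.2.1 s hs2 (subset_closure hs1)

lemma ae_prod_symm {μ : Measure E} [SFinite μ] {A : Set (E × E)} (hA : MeasurableSet A) :
    (μ.prod (volume : Measure E)) A = 0 ↔ ∀ᵐ v : E, μ {y | (y, v) ∈ A} = 0 := by
  rw [Measure.prod_apply_symm hA, lintegral_eq_zero_iff (measurable_measure_prodMk_right hA)]
  rfl

lemma ae_ne_zero : ∀ᵐ v : E, v ≠ 0 := by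
  rw [ae_iff]; simp

/-- A property that holds almost everywhere on the boundary holds at almost every exit point. -/
theorem ae_exit (hΩ : IsOpen Ω) (hb : Bornology.IsBounded Ω)
    (hn : HasC2BoundaryWithInnerNormal Ω n) {P : E × E → Prop}
    (h : ∀ᵐ q ∂(phaseBoundary Ω), P q) :
    ∀ᵐ p : E × E, ∀ t, ExitsAt Ω p t → P (p.1 - t • p.2, p.2) := by
  have : IsFiniteMeasure ((μHE[2] : Measure E).restrict (frontier Ω)) :=
    ⟨by rw [Measure.restrict_apply_univ]; exact measure_frontier_lt_top hΩ hb hn⟩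
  set Z := toMeasurable (phaseBoundary Ω) {q | ¬P q} with hZ
  have hZm : MeasurableSet Z := measurableSet_toMeasurable _ _
  have hZ0 : phaseBoundary Ω Z = 0 := by rw [hZ, measure_toMeasurable]; exact h
  have hfm : MeasurableSet (frontier Ω) := isClosed_frontier.measurableSet
  set W := {p : E × E | p.1 - exitTime Ω p • p.2 ∈ frontier Ω ∧
    (p.1 - exitTime Ω p • p.2, p.2) ∈ Z} with hW
  have hWm : MeasurableSet W := by
    have hm := measurable_exitTime (Ω := Ω)
    have h1 : Measurable fun p : E × E => p.1 - exitTime Ω p • p.2 := by fun_prop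
    exact (h1 hfm).inter ((h1.prodMk measurable_snd) hZm)
  have hW0 : (volume : Measure (E × E)) W = 0 := by
    -- For fixed v, a bad x and its exit point have the same projection along v. The bad x thus lie
    -- in the shadow of a null set of the boundary, which is null since the projection is Lipschitz.
    rw [Measure.volume_eq_prod, ae_prod_symm hWm]
    rw [phaseBoundary, ae_prod_symm hZm] at hZ0
    filter_upwards [hZ0, ae_ne_zero] with v hv hv0
    obtain ⟨L, hL1, hL2, hL3, hL4⟩ := exists_line_projection v hv0
    rw [Measure.restrict_apply' hfm] at hv
    refine measure_mono_null ?_ (measure_shadow_null hL3 hv)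
    rintro x ⟨hx1, hx2⟩
    refine ⟨_, ⟨hx2, hx1⟩, ?_⟩
    rw [map_sub, map_smul, hL2, smul_zero, sub_zero]
  filter_upwards [compl_mem_ae_iff.2 hW0] with p hp t ht
  by_contra hc
  refine hp ⟨?_, ?_⟩ <;> rw [ht.exitTime_eq]
  · exact ht.mem_frontier hΩ
  · exact subset_toMeasurable _ _ hc

open Classical in
lemma measurable_normal_inner (hΩ : IsOpen Ω) (hn : HasC2BoundaryWithInnerNormal Ω n) :
    MeasurableSet {q : E × E | q.1 ∈ frontier Ω ∧ ⟪n q.1, q.2⟫_ℝ = 0} := by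
  have hfm : MeasurableSet (frontier Ω) := isClosed_frontier.measurableSet
  have h1 : Measurable ((frontier Ω).piecewise n 0) :=
    (continuousOn_normal hΩ hn).measurable_piecewise continuousOn_const hfm
  have h2 : MeasurableSet {q : E × E | q.1 ∈ frontier Ω ∧
      ⟪(frontier Ω).piecewise n 0 q.1, q.2⟫_ℝ = 0} :=
    (measurable_fst hfm).inter ((by fun_prop : Measurable fun q : E × E =>
      ⟪(frontier Ω).piecewise n 0 q.1, q.2⟫_ℝ) (measurableSet_singleton 0))
  convert h2 using 3 with q
  refine and_congr_right fun hq => ?_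
  rw [piecewise_eq_of_mem _ _ _ hq]

lemma ae_mem_frontier : ∀ᵐ q ∂(phaseBoundary Ω), q.1 ∈ frontier Ω :=
  Measure.quasiMeasurePreserving_fst.ae (ae_restrict_mem isClosed_frontier.measurableSet)

/-- Grazing velocities are negligible. -/
theorem ae_not_grazing (hΩ : IsOpen Ω) (hb : Bornology.IsBounded Ω)
    (hn : HasC2BoundaryWithInnerNormal Ω n) :
    ∀ᵐ q ∂(phaseBoundary Ω), ⟪n q.1, q.2⟫_ℝ ≠ 0 := by
  have : IsFiniteMeasure ((μHE[2] : Measure E).restrict (frontier Ω)) :=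
    ⟨by rw [Measure.restrict_apply_univ]; exact measure_frontier_lt_top hΩ hb hn⟩
  have h0 : phaseBoundary Ω {q : E × E | q.1 ∈ frontier Ω ∧ ⟪n q.1, q.2⟫_ℝ = 0} = 0 := by
    rw [phaseBoundary, Measure.measure_prod_null (measurable_normal_inner hΩ hn)]
    filter_upwards [ae_restrict_mem isClosed_frontier.measurableSet] with y hy
    have hny := norm_normal hn hy
    refine measure_mono_null (t := ((ℝ ∙ n y)ᗮ : Submodule ℝ E)) ?_
      (Measure.addHaar_submodule _ _ ?_)
    · intro v hv
      exact Submodule.mem_orthogonal_singleton_iff_inner_right.2 hv.2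
    · intro htop
      have : n y ∈ (ℝ ∙ n y)ᗮ := by rw [htop]; trivial
      have := Submodule.mem_orthogonal_singleton_iff_inner_right.1 this
      rw [real_inner_self_eq_norm_sq, hny] at this
      norm_num at this
  filter_upwards [compl_mem_ae_iff.2 h0, ae_mem_frontier] with q h1 h2 h3
  exact h1 ⟨h2, h3⟩

/-- A property that holds almost everywhere in phase space holds almost everywhere along the lines
through almost every non-grazing boundary point. -/
theorem ae_boundary_line (hΩ : IsOpen Ω) (hb : Bornology.IsBounded Ω)
    (hn : HasC2BoundaryWithInnerNormal Ω n) {P : E × E → Prop} (h : ∀ᵐ p : E × E, P p) :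
    ∀ᵐ q ∂(phaseBoundary Ω), ∀ᵐ s : ℝ, P (q.1 + s • q.2, q.2) := by
  have : IsFiniteMeasure ((μHE[2] : Measure E).restrict (frontier Ω)) :=
    ⟨by rw [Measure.restrict_apply_univ]; exact measure_frontier_lt_top hΩ hb hn⟩
  set Z := toMeasurable volume {p : E × E | ¬P p} with hZ
  have hZm : MeasurableSet Z := measurableSet_toMeasurable _ _
  have hZ0 : (volume : Measure (E × E)) Z = 0 := by rw [hZ, measure_toMeasurable]; exact h
  -- Grazing points are excluded here, because only at transversal points does the projection return
  -- a null set of lines to a null set of the surface; grazing itself is negligible.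
  set A := {q : E × E | q.1 ∈ frontier Ω ∧ ⟪n q.1, q.2⟫_ℝ ≠ 0 ∧
    volume {s : ℝ | (q.1 + s • q.2, q.2) ∈ Z} ≠ 0} with hA
  have hfm : MeasurableSet (frontier Ω) := isClosed_frontier.measurableSet
  have hAm : MeasurableSet A := by
    have h1 : MeasurableSet {w : (E × E) × ℝ | (w.1.1 + w.2 • w.1.2, w.1.2) ∈ Z} :=
      (by fun_prop : Measurable fun w : (E × E) × ℝ => (w.1.1 + w.2 • w.1.2, w.1.2)) hZm
    have h2 : Measurable fun q : E × E => volume {s : ℝ | (q.1 + s • q.2, q.2) ∈ Z} :=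
      measurable_measure_prodMk_left h1
    have h3 : A = (Prod.fst ⁻¹' frontier Ω \ {q : E × E | q.1 ∈ frontier Ω ∧ ⟪n q.1, q.2⟫_ℝ = 0}) ∩
        {q | volume {s : ℝ | (q.1 + s • q.2, q.2) ∈ Z} = 0}ᶜ := by
      ext q
      simp only [hA, mem_ofPred_eq, mem_inter_iff, Set.mem_sdiff, mem_preimage, mem_compl_iff]
      tauto
    rw [h3]
    exact ((measurable_fst hfm).diff (measurable_normal_inner hΩ hn)).inter
      (h2 (measurableSet_singleton 0)).compl
  have hA0 : phaseBoundary Ω A = 0 := by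
    rw [phaseBoundary, ae_prod_symm hAm]
    rw [Measure.volume_eq_prod, ae_prod_symm hZm] at hZ0
    filter_upwards [hZ0, ae_ne_zero] with v hv hv0
    obtain ⟨L, hL1, hL2, hL3, hL4⟩ := exists_line_projection v hv0
    refine measure_mono_null ?_ (nonpos_iff_eq_zero.1 ((Measure.restrict_apply_le _ _).trans
      (measure_projection_null hΩ hn hL1 (hL4 _ hv)).le))
    rintro y ⟨hy1, hy2, hy3⟩
    exact ⟨hy1, hy2, fun hc => hy3 (by
      have := hc y rfl
      rw [ae_iff] at this
      simp only [not_not] at this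
      exact this)⟩
  filter_upwards [compl_mem_ae_iff.2 hA0, ae_mem_frontier, ae_not_grazing hΩ hb hn]
    with q h1 h2 h3
  have h4 : volume {s : ℝ | (q.1 + s • q.2, q.2) ∈ Z} = 0 := by
    by_contra hc
    exact h1 ⟨h2, h3, hc⟩
  filter_upwards [compl_mem_ae_iff.2 h4] with s hs
  by_contra hc
  exact hs (subset_toMeasurable _ _ hc)

end Flight

/-! ### The free flow and the energy balance. -/

/-- The free flow. -/
def flow (s : ℝ) (p : E × E) : E × E := (p.1 + s • p.2, p.2)

lemma measurePreserving_flow (s : ℝ) : MeasurePreserving (flow s) volume volume := by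
  have h1 : MeasurePreserving (fun p : E × E => (p.1, p.2 + s • p.1))
      ((volume : Measure E).prod volume) ((volume : Measure E).prod volume) :=
    MeasurePreserving.skew_product (MeasurePreserving.id _) (g := fun v x => x + s • v)
      (by unfold Function.uncurry; fun_prop)
      (Eventually.of_forall fun v => (measurePreserving_add_right volume (s • v)).map_eq)
  exact Measure.measurePreserving_swap.comp (h1.comp Measure.measurePreserving_swap)

/-- The space-time flow. -/
lemma measurePreserving_flow_prod (m : Measure ℝ) [SFinite m] (σ : ℝ) :
    MeasurePreserving (fun q : ℝ × (E × E) => (q.1, flow (σ * q.1) q.2)) (m.prod volume)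
      (m.prod volume) := by
  refine MeasurePreserving.skew_product (MeasurePreserving.id _) (g := fun s p => flow (σ * s) p)
    ?_ (Eventually.of_forall fun s => (measurePreserving_flow (σ * s)).map_eq)
  unfold Function.uncurry flow; fun_prop

/-- A property that holds almost everywhere holds almost everywhere on almost every line. -/
theorem ae_flow {P : E × E → Prop} (h : ∀ᵐ p, P p) : ∀ᵐ p : E × E, ∀ᵐ s : ℝ, P (flow s p) := by
  have h1 : ∀ᵐ q : ℝ × (E × E), P q.2 := Measure.quasiMeasurePreserving_snd.ae h
  have h2 := (measurePreserving_flow_prod volume 1).quasiMeasurePreserving.ae h1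
  have h3 := (Measure.measurePreserving_swap (μ := (volume : Measure (E × E)))
    (ν := (volume : Measure ℝ))).quasiMeasurePreserving.ae h2
  simpa only [Prod.swap, one_mul] using Measure.ae_ae_of_ae_prod h3

lemma freeFlight_flow {Ω : Set E} {p : E × E} {s : ℝ} :
    (flow (-s) p, s) ∈ freeFlight Ω ↔ (p, -s) ∈ freeFlight Ω := by
  rw [mem_freeFlight_iff, mem_freeFlight_iff]
  have hmem : ∀ r, r ∈ uIcc 0 s ↔ r - s ∈ uIcc 0 (-s) := by
    intro r; simp only [mem_uIcc]; constructor <;> rintro (h | h)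
    · exact Or.inr ⟨by linarith, by linarith⟩
    · exact Or.inl ⟨by linarith, by linarith⟩
    · exact Or.inr ⟨by linarith, by linarith⟩
    · exact Or.inl ⟨by linarith, by linarith⟩
  constructor
  · intro h r hr
    have := h (r + s) ((hmem _).2 (by simpa using hr))
    have e : (flow (-s) p).1 + (r + s) • (flow (-s) p).2 = p.1 + r • p.2 := by
      simp only [flow]; module
    rwa [e] at this
  · intro h r hr
    have := h (r - s) ((hmem _).1 hr)
    have e : (flow (-s) p).1 + r • (flow (-s) p).2 = p.1 + (r - s) • p.2 := by
      simp only [flow]; module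
    rwa [e]

lemma freeFlight_zero {Ω : Set E} {p : E × E} : (p, (0 : ℝ)) ∈ freeFlight Ω ↔ p.1 ∈ gas Ω := by
  rw [mem_freeFlight_iff]; simp

lemma freeFlight_mem_gas {Ω : Set E} {p : E × E} {t : ℝ} (h : (p, t) ∈ freeFlight Ω) :
    p.1 ∈ gas Ω := by
  have := mem_freeFlight_iff.1 h 0 left_mem_uIcc
  simpa using this

/-- If the backward flight leaves the gas before `τ`, it does so at a well-defined time. -/
lemma exists_exitsAt {Ω : Set E} {p : E × E} {τ : ℝ} (hp : p.1 ∈ gas Ω) (hτ : 0 ≤ τ)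
    (h : (p, -τ) ∉ freeFlight Ω) : ∃ t, ExitsAt Ω p t ∧ t ≤ τ := by
  rw [mem_freeFlight_neg_iff hτ] at h
  push Not at h
  obtain ⟨s, hs, hs'⟩ := h
  have hne : {s : ℝ | 0 ≤ s ∧ p.1 - s • p.2 ∉ gas Ω}.Nonempty := ⟨s, hs.1, hs'⟩
  have hmem := (isClosed_exitSet p).csInf_mem hne (bddBelow_exitSet p)
  refine ⟨_, ⟨lt_of_le_of_ne hmem.1 fun h0 => hmem.2 ?_, fun r hr => ?_, hmem.2⟩,
    (csInf_le (bddBelow_exitSet p) ⟨hs.1, hs'⟩).trans hs.2⟩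
  · rw [← h0]; simpa using hp
  · by_contra hc
    exact (csInf_le (bddBelow_exitSet p) ⟨hr.1, hc⟩).not_gt hr.2

lemma ExitsAt.freeFlight_iff {Ω : Set E} {p : E × E} {t : ℝ} (h : ExitsAt Ω p t) {s : ℝ}
    (hs : 0 ≤ s) : (p, -s) ∈ freeFlight Ω ↔ s < t := by
  rw [mem_freeFlight_neg_iff hs]
  constructor
  · intro h1
    by_contra hc
    push Not at hc
    exact h.2.2 (h1 t ⟨h.1.le, hc⟩)
  · exact fun h1 r hr => h.2.1 r ⟨hr.1, hr.2.trans_lt h1⟩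

section Energy

variable {Ω : Set E} {U g : E × E → ℝ}

/-- The values along a line, in terms of the integral of `g` along the backward flight. -/
lemma sub_eq_integral_backward {p : E × E} (hp : p.1 ∈ gas Ω) {τ : ℝ} (hτ : 0 < τ)
    (hT : ∀ t, (p, t) ∈ freeFlight Ω → U (flow t p) = U p + ∫ s in (0 : ℝ)..t, g (flow s p))
    (hX : ∀ t, ExitsAt Ω p t → Tendsto (fun s => U (flow (-s) p)) (𝓝[<] t) (𝓝 0))
    (hi : IntegrableOn (fun s => {s : ℝ | (p, -s) ∈ freeFlight Ω}.indicator
      (fun s => g (flow (-s) p)) s) (Ioc 0 τ)) :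
    U p - {q | (q, -τ) ∈ freeFlight Ω}.indicator (fun q => U (flow (-τ) q)) p =
      ∫ s in Ioc 0 τ, {s : ℝ | (p, -s) ∈ freeFlight Ω}.indicator (fun s => g (flow (-s) p)) s := by
  set G := fun s => {s : ℝ | (p, -s) ∈ freeFlight Ω}.indicator (fun s => g (flow (-s) p)) s with hG
  have hback : ∀ s, 0 ≤ s → (p, -s) ∈ freeFlight Ω →
      U (flow (-s) p) = U p - ∫ r in (0 : ℝ)..s, G r := by
    intro s hs hmem
    rw [hT _ hmem]
    have h1 : ∫ r in (0 : ℝ)..s, G r = ∫ r in (0 : ℝ)..s, g (flow (-r) p) := by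
      refine intervalIntegral.integral_congr fun r hr => ?_
      rw [uIcc_of_le hs] at hr
      refine indicator_of_mem ?_ _
      exact (mem_freeFlight_neg_iff hr.1).2 fun z hz =>
        (mem_freeFlight_neg_iff hs).1 hmem z ⟨hz.1, hz.2.trans hr.2⟩
    rw [h1, intervalIntegral.integral_comp_neg (fun r => g (flow r p)), neg_zero,
      intervalIntegral.integral_symm]
    ring
  rw [← intervalIntegral.integral_of_le hτ.le]
  by_cases hmem : (p, -τ) ∈ freeFlight Ω
  · rw [indicator_of_mem (by exact hmem), hback τ hτ.le hmem]
    ring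
  · rw [indicator_of_notMem (by exact hmem), sub_zero]
    obtain ⟨t, ht, htτ⟩ := exists_exitsAt hp hτ.le hmem
    have hiG : IntegrableOn G (Icc 0 τ) := (integrableOn_Icc_iff_integrableOn_Ioc (by finiteness)).2 hi
    have hcont : ContinuousOn (fun s => ∫ r in (0 : ℝ)..s, G r) (Icc 0 τ) := by
      have := intervalIntegral.continuousOn_primitive_interval (f := G) (μ := volume) (a := 0) (b := τ)
        (by rwa [uIcc_of_le hτ.le])
      rwa [uIcc_of_le hτ.le] at this
    have h1 : Tendsto (fun s => U p - ∫ r in (0 : ℝ)..s, G r) (𝓝[<] t)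
        (𝓝 (U p - ∫ r in (0 : ℝ)..t, G r)) := by
      have h2 := (hcont t ⟨ht.1.le, htτ⟩).tendsto
      have h3 : 𝓝[<] t ≤ 𝓝[Icc 0 τ] t := by
        rw [← nhdsWithin_Ico_eq_nhdsLT ht.1]
        exact nhdsWithin_mono _ fun r hr => ⟨hr.1, hr.2.le.trans htτ⟩
      exact tendsto_const_nhds.sub (h2.mono_left h3)
    -- The flight has left by time τ. At the exit time U tends to 0, so U p is exactly the integral
    -- of g up to the exit, after which the integrand is zero.
    have h4 : Tendsto (fun s => U p - ∫ r in (0 : ℝ)..s, G r) (𝓝[<] t) (𝓝 0) := by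
      refine (hX t ht).congr' ?_
      filter_upwards [Ico_mem_nhdsLT ht.1] with s hs
      exact hback s hs.1 ((ht.freeFlight_iff hs.1).2 hs.2)
    have h5 := tendsto_nhds_unique h1 h4
    have h6 : ∫ r in t..τ, G r = 0 := by
      rw [intervalIntegral.integral_of_le htτ]
      refine setIntegral_eq_zero_of_forall_eq_zero fun r hr => ?_
      refine indicator_of_notMem (fun hc => ?_) _
      exact hr.1.not_gt ((ht.freeFlight_iff (ht.1.le.trans hr.1.le)).1 hc)
    have hii : IntervalIntegrable G volume 0 τ :=
      (intervalIntegrable_iff_integrableOn_Ioc_of_le hτ.le).2 hi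
    rw [← intervalIntegral.integral_add_adjacent_intervals
      (hii.mono_set (by rw [uIcc_of_le ht.1.le, uIcc_of_le hτ.le]; exact Icc_subset_Icc le_rfl htτ))
      (hii.mono_set (by rw [uIcc_of_le htτ, uIcc_of_le hτ.le]; exact Icc_subset_Icc ht.1.le le_rfl)),
      h6]
    linarith

/-- Nothing enters the gas, so the production of a nonnegative density is nonnegative. -/
theorem integral_nonneg_of_transport (hUm : Measurable U) (hgm : Measurable g) (hU0 : ∀ p, 0 ≤ U p)
    (hUi : IntegrableOn U {p | p.1 ∈ gas Ω}) (hgi : IntegrableOn g {p | p.1 ∈ gas Ω})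
    (hT : ∀ᵐ p : E × E, p.1 ∈ gas Ω → ∀ t, (p, t) ∈ freeFlight Ω →
      U (flow t p) = U p + ∫ s in (0 : ℝ)..t, g (flow s p))
    (hX : ∀ᵐ p : E × E, p.1 ∈ gas Ω → ∀ t, ExitsAt Ω p t →
      Tendsto (fun s => U (flow (-s) p)) (𝓝[<] t) (𝓝 0)) :
    0 ≤ ∫ p in {p | p.1 ∈ gas Ω}, g p := by
  have hD : MeasurableSet {p : E × E | p.1 ∈ gas Ω} := measurable_fst isOpen_gas.measurableSet
  have hFF : ∀ t : ℝ, MeasurableSet {p : E × E | (p, t) ∈ freeFlight Ω} := fun t =>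
    (isOpen_freeFlight.preimage (by fun_prop : Continuous fun p : E × E => (p, t))).measurableSet
  have hFF' : MeasurableSet {q : ℝ × (E × E) | (q.2, q.1) ∈ freeFlight Ω} :=
    (isOpen_freeFlight.preimage continuous_swap).measurableSet
  -- I(s) is the production at the points that fly freely for time s. It tends to the total
  -- production as s ↓ 0, so it is enough to show that its averages over (0, τ] are nonnegative.
  set I : ℝ → ℝ := fun s => ∫ p in {p | (p, s) ∈ freeFlight Ω}, g p with hI
  have hI0 : Tendsto I (𝓝[>] 0) (𝓝 (∫ p in {p | p.1 ∈ gas Ω}, g p)) := by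
    have : ∀ s, I s = ∫ p, {p | (p, s) ∈ freeFlight Ω}.indicator g p := fun s =>
      (integral_indicator (hFF s)).symm
    rw [funext this, ← integral_indicator hD]
    refine tendsto_integral_filter_of_dominated_convergence
      (fun p => {p | p.1 ∈ gas Ω}.indicator (fun p => ‖g p‖) p) ?_ ?_ ?_ ?_
    · exact Eventually.of_forall fun s => (hgm.indicator (hFF s)).aestronglyMeasurable
    · refine Eventually.of_forall fun s => Eventually.of_forall fun p => ?_
      by_cases h : (p, s) ∈ freeFlight Ω
      · rw [indicator_of_mem (by exact h), indicator_of_mem (by exact freeFlight_mem_gas h)]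
      · rw [indicator_of_notMem (by exact h), norm_zero]
        exact indicator_nonneg (fun _ _ => norm_nonneg _) _
    · exact (integrable_indicator_iff hD).2 hgi.norm
    · refine Eventually.of_forall fun p => ?_
      by_cases h : p.1 ∈ gas Ω
      · refine tendsto_const_nhds.congr' ?_
        have hc : ContinuousAt (fun s : ℝ => (p, s)) 0 := by fun_prop
        have := (hc.eventually_mem (isOpen_freeFlight.mem_nhds (freeFlight_zero.2 h))).filter_mono
          (nhdsWithin_le_nhds (s := Ioi 0))
        filter_upwards [this] with s hs
        rw [indicator_of_mem (by exact h), indicator_of_mem (by exact hs)]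
      · refine tendsto_const_nhds.congr' (Eventually.of_forall fun s => ?_)
        rw [indicator_of_notMem (by exact h)]
        exact (indicator_of_notMem (show p ∉ {p | (p, s) ∈ freeFlight Ω} from
          fun hc => h (freeFlight_mem_gas hc)) _).symm
  have hmain : ∀ τ, 0 < τ → IntegrableOn I (Ioc 0 τ) ∧ 0 ≤ ∫ s in Ioc 0 τ, I s := by
    intro τ hτ
    set m := (volume : Measure ℝ).restrict (Ioc 0 τ) with hm
    set K : ℝ × (E × E) → ℝ := {q | (q.2, q.1) ∈ freeFlight Ω}.indicator fun q => g q.2 with hK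
    have hKi : Integrable K (m.prod volume) := by
      have h1 : Integrable (fun q : ℝ × (E × E) => {p : E × E | p.1 ∈ gas Ω}.indicator g q.2)
          (m.prod volume) := ((integrable_indicator_iff hD).2 hgi).comp_snd m
      refine h1.mono ((hgm.comp measurable_snd).indicator hFF').aestronglyMeasurable
        (Eventually.of_forall fun q => ?_)
      by_cases h : (q.2, q.1) ∈ freeFlight Ω
      · rw [hK, indicator_of_mem (by exact h), indicator_of_mem (by exact freeFlight_mem_gas h)]
      · rw [hK, indicator_of_notMem (by exact h), norm_zero]
        exact norm_nonneg _
    have hflow := measurePreserving_flow_prod m (-1)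
    have hHi : Integrable (fun q : ℝ × (E × E) => K (q.1, flow (-1 * q.1) q.2)) (m.prod volume) :=
      hflow.integrable_comp_of_integrable hKi
    have hKe : ∀ (s : ℝ) (p : E × E), K (s, flow (-1 * s) p) =
        {s : ℝ | (p, -s) ∈ freeFlight Ω}.indicator (fun s => g (flow (-s) p)) s := by
      intro s p
      rw [neg_one_mul]
      by_cases h : (p, -s) ∈ freeFlight Ω
      · rw [hK, indicator_of_mem (by exact freeFlight_flow.2 h), indicator_of_mem (by exact h)]
      · rw [indicator_of_notMem (a := s) (by exact h), hK, indicator_of_notMem]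
        exact fun hc => h (freeFlight_flow.1 hc)
    have hIe : ∀ s, I s = ∫ p, K (s, p) := fun s => (integral_indicator (hFF s)).symm
    have hIi : IntegrableOn I (Ioc 0 τ) :=
      hKi.integral_prod_left.congr (Eventually.of_forall fun s => (hIe s).symm)
    refine ⟨hIi, ?_⟩
    -- The volume-preserving flow moves each starting point to the end of its flight of length s.
    -- For fixed p the s-integral is then the gain of U along the backward flight from p.
    have e1 : ∫ s in Ioc 0 τ, I s = ∫ p : E × E, ∫ s in Ioc 0 τ, K (s, flow (-1 * s) p) := by
      rw [← integral_prod_symm _ hHi,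
        MeasurePreserving.integral_comp_measurable hflow (φ := K)
          (((hgm.comp measurable_snd).indicator hFF')), integral_prod _ hKi]
      exact integral_congr_ae (Eventually.of_forall hIe)
    have hUi' := (integrable_indicator_iff hD).2 hUi
    have hUf : Integrable fun p => {p | p.1 ∈ gas Ω}.indicator U (flow (-τ) p) :=
      (measurePreserving_flow (-τ)).integrable_comp_of_integrable hUi'
    have hpt : ∀ᵐ p : E × E, {p | p.1 ∈ gas Ω}.indicator U p -
        {p | p.1 ∈ gas Ω}.indicator U (flow (-τ) p) ≤ ∫ s in Ioc 0 τ, K (s, flow (-1 * s) p) := by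
      filter_upwards [hT, hX, hHi.prod_left_ae] with p h1 h2 h3
      simp only [hKe] at h3 ⊢
      by_cases hp : p.1 ∈ gas Ω
      · rw [indicator_of_mem (by exact hp),
          ← sub_eq_integral_backward hp hτ (h1 hp) (h2 hp) h3]
        refine sub_le_sub_left ?_ _
        by_cases h : (p, -τ) ∈ freeFlight Ω
        · rw [indicator_of_mem (by exact h), indicator_of_mem]
          exact freeFlight_mem_gas (freeFlight_flow.2 h)
        · rw [indicator_of_notMem (by exact h)]
          exact indicator_nonneg (fun _ _ => hU0 _) _
      · rw [indicator_of_notMem (by exact hp)]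
        have : ∫ s in Ioc 0 τ, {s : ℝ | (p, -s) ∈ freeFlight Ω}.indicator
            (fun s => g (flow (-s) p)) s = 0 :=
          setIntegral_eq_zero_of_forall_eq_zero fun s _ =>
            indicator_of_notMem (show s ∉ {s : ℝ | (p, -s) ∈ freeFlight Ω} from
              fun hc => hp (freeFlight_mem_gas hc)) _
        rw [this, zero_sub]
        exact neg_nonpos.2 (indicator_nonneg (fun _ _ => hU0 _) _)
    rw [e1]
    have e2 : ∫ p, ({p | p.1 ∈ gas Ω}.indicator U p -
        {p | p.1 ∈ gas Ω}.indicator U (flow (-τ) p)) = 0 := by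
      rw [integral_sub hUi' hUf, MeasurePreserving.integral_comp_measurable
        (measurePreserving_flow (-τ)) (hUm.indicator hD), sub_self]
    refine le_of_eq_of_le e2.symm ?_
    exact integral_mono_ae (hUi'.sub hUf) hHi.integral_prod_right hpt
  -- If the limit c were negative, I would stay below c/2 near 0 and have a negative integral.
  by_contra hneg
  push Not at hneg
  set c := ∫ p in {p | p.1 ∈ gas Ω}, g p
  have h1 := hI0.eventually_lt_const (by linarith : c < c / 2)
  obtain ⟨τ, hτ, hsub⟩ := (mem_nhdsGT_iff_exists_Ioc_subset).1 h1
  have h2 := hmain τ hτ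
  have h3 : ∫ s in Ioc 0 τ, I s ≤ ∫ s in Ioc 0 τ, c / 2 :=
    setIntegral_mono_on h2.1 (by simp) measurableSet_Ioc fun s hs => (hsub hs).le
  have hτ' : (0 : ℝ) < τ := hτ
  simp only [integral_const, MeasurableSet.univ, measureReal_restrict_apply, univ_inter,
    Real.volume_real_Ioc_of_le hτ'.le, smul_eq_mul] at h3
  nlinarith [h2.2]

end Energy

/-! ### Calculus along a line. -/

section OneDimensional

/-- The negative part is not differentiable at 0 but its square is, so the chain rule along
characteristics needs no separate treatment of the zeros of F. -/
lemma hasDerivAt_sq_negPart (z : ℝ) :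
    HasDerivAt (fun z : ℝ => max (-z) 0 ^ 2) (-2 * max (-z) 0) z := by
  rcases lt_trichotomy z 0 with hz | rfl | hz
  · have h1 : HasDerivAt (fun z : ℝ => z ^ 2) (-2 * max (-z) 0) z := by
      rw [max_eq_left (by linarith)]
      simpa using hasDerivAt_pow 2 z
    refine h1.congr_of_eventuallyEq ?_
    filter_upwards [gt_mem_nhds hz] with y hy
    rw [max_eq_left (by linarith)]; ring
  · rw [hasDerivAt_iff_isLittleO_nhds_zero]
    have h2 : (fun x : ℝ => x ^ 2) =o[𝓝 0] fun x => x := by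
      simpa using Asymptotics.isLittleO_pow_id (𝕜 := ℝ) (n := 2) (by norm_num)
    refine Asymptotics.IsBigO.trans_isLittleO (Asymptotics.IsBigO.of_bound 1 ?_) h2
    refine Eventually.of_forall fun x => ?_
    simp only [zero_add, neg_zero, max_self, mul_zero, smul_zero, sub_zero, one_mul, ne_eq,
      OfNat.ofNat_ne_zero, not_false_eq_true, zero_pow]
    rw [Real.norm_of_nonneg (sq_nonneg _), Real.norm_of_nonneg (sq_nonneg _)]
    rcases le_total (-x) 0 with h | h
    · rw [max_eq_right h]; nlinarith [sq_nonneg x]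
    · rw [max_eq_left h]; nlinarith
  · have h1 : HasDerivAt (fun _ : ℝ => (0 : ℝ)) (-2 * max (-z) 0) z := by
      rw [max_eq_right (by linarith), mul_zero]
      exact hasDerivAt_const z 0
    refine h1.congr_of_eventuallyEq ?_
    filter_upwards [lt_mem_nhds hz] with y hy
    rw [max_eq_right (by linarith)]; ring

lemma AbsolutelyContinuousOnInterval.negPart {f : ℝ → ℝ} {a b : ℝ}
    (hf : AbsolutelyContinuousOnInterval f a b) :
    AbsolutelyContinuousOnInterval (fun s => max (-f s) 0) a b := by
  unfold AbsolutelyContinuousOnInterval at hf ⊢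
  refine squeeze_zero (fun E => Finset.sum_nonneg fun i _ => dist_nonneg) (fun E => ?_) hf
  refine Finset.sum_le_sum fun i _ => ?_
  rw [Real.dist_eq, Real.dist_eq]
  refine (abs_max_sub_max_le_abs _ _ _).trans (le_of_eq ?_)
  rw [← abs_neg]; congr 1; ring

/-- The fundamental theorem of calculus for the weighted square of a negative part. -/
theorem sq_negPart_eq_integral {f S ψ ψ' : ℝ → ℝ} {t : ℝ} (hS : IntervalIntegrable S volume 0 t)
    (hf : ∀ s ∈ uIcc 0 t, f s = f 0 + ∫ r in (0 : ℝ)..s, S r)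
    (hψ : ∀ s, HasDerivAt ψ (ψ' s) s) (hψc : Continuous ψ') :
    max (-f t) 0 ^ 2 * ψ t = max (-f 0) 0 ^ 2 * ψ 0 +
      ∫ s in (0 : ℝ)..t, (-2 * max (-f s) 0 * S s * ψ s + max (-f s) 0 ^ 2 * ψ' s) := by
  set f' : ℝ → ℝ := fun s => f 0 + ∫ r in (0 : ℝ)..s, S r with hf'
  have hac : AbsolutelyContinuousOnInterval f' 0 t := by
    have h1 := hS.absolutelyContinuousOnInterval_intervalIntegral (c := 0) left_mem_uIcc
    have h2 : AbsolutelyContinuousOnInterval (fun _ : ℝ => f 0) 0 t :=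
      (contDiff_const.contDiffOn (n := 1)).absolutelyContinuousOnInterval
    exact h2.add h1
  have hψd : ContDiff ℝ 1 ψ := by
    rw [contDiff_one_iff_deriv]
    refine ⟨fun s => (hψ s).differentiableAt, ?_⟩
    rwa [show deriv ψ = ψ' from funext fun s => (hψ s).deriv]
  have hU : AbsolutelyContinuousOnInterval (fun s => max (-f' s) 0 ^ 2 * ψ s) 0 t := by
    have h1 := (AbsolutelyContinuousOnInterval.negPart hac)
    have h2 := (h1.mul h1).mul (hψd.contDiffOn.absolutelyContinuousOnInterval)
    convert h2 using 1
    funext s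
    simp only [Pi.mul_apply, pow_two]
  have hint := hU.integral_deriv_eq_sub
  rw [hf t right_mem_uIcc]
  have hf0 : f' 0 = f 0 := by simp [hf']
  change max (-f' t) 0 ^ 2 * ψ t = _
  rw [← hf0]
  have heq : ∫ s in (0 : ℝ)..t, deriv (fun s => max (-f' s) 0 ^ 2 * ψ s) s =
      ∫ s in (0 : ℝ)..t, (-2 * max (-f s) 0 * S s * ψ s + max (-f s) 0 ^ 2 * ψ' s) := by
    refine intervalIntegral.integral_congr_ae ?_
    filter_upwards [hS.ae_hasDerivAt_integral] with s hs hmem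
    have hm := uIoc_subset_uIcc hmem
    have h1 : HasDerivAt f' (S s) s := (hs hm 0 left_mem_uIcc).const_add (f 0)
    have h2 := ((hasDerivAt_sq_negPart (f' s)).comp s h1).mul (hψ s)
    have h3 := h2.deriv
    rw [hf s hm]
    refine Eq.trans ?_ h3
    rfl
  rw [← heq, hint]
  ring

/-- A function that decreases below a level stays below that level. -/
lemma le_sub_of_barrier {f S : ℝ → ℝ} {σ κ c : ℝ} (hσ : 0 ≤ σ) (hc : 0 ≤ c)
    (hS : IntervalIntegrable S volume 0 σ)
    (hf : ∀ s ∈ Icc 0 σ, f s = f 0 - ∫ r in (0 : ℝ)..s, S r) (h0 : f 0 < κ)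
    (hb : ∀ᵐ r : ℝ, r ∈ Icc 0 σ → f r < κ → c ≤ S r) :
    ∀ s ∈ Icc 0 σ, f s ≤ f 0 - c * s := by
  have hmono : ∀ s ∈ Icc 0 σ, (∀ r ∈ Ico 0 s, f r < κ) → f s ≤ f 0 - c * s := by
    intro s hs hlt
    rw [hf s hs]
    have hi : IntervalIntegrable S volume 0 s := hS.mono_set (by
      rw [uIcc_of_le hs.1, uIcc_of_le hσ]; exact Icc_subset_Icc le_rfl hs.2)
    have h1 : ∫ r in (0 : ℝ)..s, c ≤ ∫ r in (0 : ℝ)..s, S r := by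
      rw [intervalIntegral.integral_of_le hs.1, intervalIntegral.integral_of_le hs.1,
        integral_Ioc_eq_integral_Ioo, integral_Ioc_eq_integral_Ioo]
      refine setIntegral_mono_on_ae (integrableOn_const (by simp))
        (((intervalIntegrable_iff_integrableOn_Ioc_of_le hs.1).1 hi).mono_set Ioo_subset_Ioc_self)
        measurableSet_Ioo ?_
      filter_upwards [hb] with r hr hmem
      exact hr ⟨hmem.1.le, hmem.2.le.trans hs.2⟩ (hlt r ⟨hmem.1.le, hmem.2⟩)
    rw [intervalIntegral.integral_const, smul_eq_mul, sub_zero] at h1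
    linarith
  have hcont : ContinuousOn f (Icc 0 σ) := by
    have h1 := intervalIntegral.continuousOn_primitive_interval' hS (left_mem_uIcc)
    rw [uIcc_of_le hσ] at h1
    exact (continuousOn_const.sub h1).congr hf
  have hlt : ∀ s ∈ Icc 0 σ, f s < κ := by
    by_contra hcon
    push Not at hcon
    obtain ⟨s, hs, hsκ⟩ := hcon
    have hcl : IsCompact (Icc 0 σ ∩ f ⁻¹' Ici κ) :=
      isCompact_Icc.of_isClosed_subset (hcont.preimage_isClosed_of_isClosed isClosed_Icc isClosed_Ici)
        inter_subset_left
    obtain ⟨r, hr⟩ := hcl.exists_isLeast ⟨s, hs, hsκ⟩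
    have h1 := hmono r hr.1.1 fun z hz => by
      by_contra hz'
      push Not at hz'
      exact (hr.2 ⟨⟨hz.1, hz.2.le.trans hr.1.1.2⟩, hz'⟩).not_gt hz.2
    have h2 : κ ≤ f r := hr.1.2
    nlinarith [mul_nonneg hc hr.1.1.1]
  exact fun s hs => hmono s hs fun r hr => hlt r ⟨hr.1, hr.2.le.trans hs.2⟩

end OneDimensional

/-! ### Solutions along characteristics and the maximum principle. -/

section Lines

variable {Ω : Set E} {n : E → E} {F G S : E → E → ℝ}

lemma diffuse_nonneg (hG : ∀ x v, 0 ≤ G x v) (x v : E) : 0 ≤ diffuse n G x v := by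
  refine mul_nonneg (by unfold wallMaxwellian; positivity) ?_
  refine setIntegral_nonneg ?_ fun w hw => mul_nonneg (hG x w) (le_of_lt hw)
  exact (isOpen_lt continuous_const (by fun_prop)).measurableSet

/-- At the exit points of the backward flight the limit of a solution is nonnegative. -/
theorem ae_exit_trace_nonneg (hΩ : IsOpen Ω) (hb : Bornology.IsBounded Ω)
    (hn : HasC2BoundaryWithInnerNormal Ω n) (hG : ∀ x v, 0 ≤ G x v) (htr : HasTraces Ω n F)
    (hin : InflowEq Ω n F (diffuse n G)) :
    ∀ᵐ p : E × E, p.1 ∈ gas Ω → ∀ t, ExitsAt Ω p t →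
      ∃ L, 0 ≤ L ∧ Tendsto (fun s => F (flow (-s) p).1 (flow (-s) p).2) (𝓝[<] t) (𝓝 L) := by
  have h := ae_exit hΩ hb hn (htr.and (hin.and (ae_not_grazing hΩ hb hn)))
  filter_upwards [h] with p hp _ t ht
  obtain ⟨⟨h1, -⟩, h2, h3⟩ := hp t ht
  have hfr := ht.mem_frontier hΩ
  -- If n·v were positive at the exit point, points of the flight just on the gas side in the
  -- parameter, p - (t - s)v with small s > 0, would lie in Ω.
  have hneg : ⟪n (p.1 - t • p.2), p.2⟫_ℝ < 0 := by
    refine lt_of_le_of_ne (not_lt.1 fun hpos => ?_) h3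
    have h4 := eventually_mem_of_normal_pos hΩ hn hfr hpos
    obtain ⟨s, hs, hs'⟩ := (h4.and (Ioo_mem_nhdsGT ht.1)).exists
    have h5 := ht.2.1 (t - s) ⟨by linarith [hs'.2], by linarith [hs'.1]⟩
    refine h5 (subset_closure ?_)
    convert hs using 1
    module
  refine ⟨F (p.1 - t • p.2) p.2, ?_, ?_⟩
  · rw [h2 hneg]; exact diffuse_nonneg hG _ _
  · have h4 : Tendsto (fun s => t - s) (𝓝[<] t) (𝓝[>] 0) := by
      refine tendsto_nhdsWithin_iff.2 ⟨?_, ?_⟩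
      · have : Tendsto (fun s : ℝ => t - s) (𝓝 t) (𝓝 (t - t)) :=
          (continuous_const.sub continuous_id).tendsto t
        rw [sub_self] at this
        exact this.mono_left nhdsWithin_le_nhds
      · filter_upwards [self_mem_nhdsWithin] with s hs
        exact sub_pos.2 (mem_Iio.1 hs)
    refine ((h1 hneg).comp h4).congr fun s => ?_
    simp only [Function.comp_apply, flow]
    congr 1
    module

lemma continuous_flow (p : E × E) : Continuous fun s => flow s p := by
  unfold flow; fun_prop

lemma SolvesTransport.ae_freeFlight (h : SolvesTransport Ω S F) :
    ∀ᵐ p : E × E, p.1 ∈ gas Ω → ∀ t, (p, t) ∈ freeFlight Ω →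
      IntervalIntegrable (fun s => S (flow s p).1 (flow s p).2) volume 0 t ∧
      F (flow t p).1 (flow t p).2 = F p.1 p.2 + ∫ s in (0 : ℝ)..t, S (flow s p).1 (flow s p).2 := by
  filter_upwards [h] with p hp hg t ht
  exact hp hg t (mem_freeFlight_iff.1 ht)

lemma freeFlight_of_mem_uIcc {p : E × E} {s t : ℝ} (h : (p, t) ∈ freeFlight Ω)
    (hs : s ∈ uIcc 0 t) : (p, s) ∈ freeFlight Ω :=
  mem_freeFlight_iff.2 fun r hr => mem_freeFlight_iff.1 h r (uIcc_subset_uIcc_left hs hr)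

/-- The production of the weighted square of the negative part of a solution is nonnegative. -/
theorem integral_production_nonneg {χ χ' : E × E → ℝ} (hΩ : IsOpen Ω) (hb : Bornology.IsBounded Ω)
    (hn : HasC2BoundaryWithInnerNormal Ω n) (hG : ∀ x v, 0 ≤ G x v) (htr : HasTraces Ω n F)
    (hin : InflowEq Ω n F (diffuse n G)) (hT : SolvesTransport Ω S F)
    (hFm : Measurable (Function.uncurry F)) (hSm : Measurable (Function.uncurry S))
    (hχm : Measurable χ) (hχm' : Measurable χ') (hχ0 : ∀ p, 0 ≤ χ p)
    (hχ : ∀ p s, HasDerivAt (fun s => χ (flow s p)) (χ' (flow s p)) s)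
    (hχc : ∀ p, Continuous fun s => χ' (flow s p))
    (hUi : IntegrableOn (fun p => negP F p.1 p.2 ^ 2 * χ p) {p | p.1 ∈ gas Ω})
    (hgi : IntegrableOn (fun p => -2 * negP F p.1 p.2 * S p.1 p.2 * χ p + negP F p.1 p.2 ^ 2 * χ' p)
      {p | p.1 ∈ gas Ω}) :
    0 ≤ ∫ p in {p : E × E | p.1 ∈ gas Ω},
      (-2 * negP F p.1 p.2 * S p.1 p.2 * χ p + negP F p.1 p.2 ^ 2 * χ' p) := by
  have hFm' : Measurable fun p : E × E => F p.1 p.2 := hFm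
  have hSm' : Measurable fun p : E × E => S p.1 p.2 := hSm
  have hnm : Measurable fun p : E × E => negP F p.1 p.2 := hFm'.neg.max measurable_const
  refine integral_nonneg_of_transport (U := fun p => negP F p.1 p.2 ^ 2 * χ p)
    ((hnm.pow_const 2).mul hχm)
    ((((measurable_const.mul hnm).mul hSm').mul hχm).add ((hnm.pow_const 2).mul hχm'))
    (fun p => mul_nonneg (sq_nonneg _) (hχ0 p)) hUi hgi ?_ ?_
  · filter_upwards [hT.ae_freeFlight] with p hp hg t ht
    have h1 := hp hg t ht
    have h0 : flow 0 p = p := by simp [flow]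
    have := sq_negPart_eq_integral (f := fun s => F (flow s p).1 (flow s p).2) h1.1
      (fun s hs => by
        simp only [h0]
        exact (hp hg s (freeFlight_of_mem_uIcc ht hs)).2) (hχ p) (hχc p)
    simp only [h0] at this
    exact this
  · filter_upwards [ae_exit_trace_nonneg hΩ hb hn hG htr hin] with p hp hg t ht
    obtain ⟨L, hL, hlim⟩ := hp hg t ht
    have h1 : Tendsto (fun s => max (-F (flow (-s) p).1 (flow (-s) p).2) 0) (𝓝[<] t) (𝓝 0) := by
      have := hlim.neg.max (tendsto_const_nhds (x := (0 : ℝ)))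
      rwa [max_eq_right (by linarith)] at this
    have h2 : Tendsto (fun s => χ (flow (-s) p)) (𝓝[<] t) (𝓝 (χ (flow (-t) p))) := by
      have h3 : Continuous fun s => χ (flow s p) :=
        continuous_iff_continuousAt.2 fun s => (hχ p s).continuousAt
      exact ((h3.comp continuous_neg).tendsto t).mono_left nhdsWithin_le_nhds
    have h3 := (h1.pow 2).mul h2
    simpa [negP] using h3

/-- A maximum principle: for almost every velocity in `V`, the production pushes a solution above
`-β`. -/
theorem neg_le_of_production {V : Set E} {β κ M : E → ℝ} (hT : SolvesTransport Ω S F)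
    (hX : ∀ᵐ p : E × E, p.1 ∈ gas Ω → ∀ t, ExitsAt Ω p t →
      ∃ L, 0 ≤ L ∧ Tendsto (fun s => F (flow (-s) p).1 (flow (-s) p).2) (𝓝[<] t) (𝓝 L))
    (hM : ∀ᵐ p : E × E, p.1 ∈ gas Ω → |F p.1 p.2| ≤ M p.2) (hβ : ∀ v ∈ V, 0 ≤ β v)
    (hκ : ∀ v ∈ V, 0 < κ v)
    (hS : ∀ᵐ p : E × E, p.1 ∈ gas Ω → p.2 ∈ V → F p.1 p.2 < 0 →
      κ p.2 * (-F p.1 p.2 - β p.2) ≤ S p.1 p.2) :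
    ∀ᵐ p : E × E, p.1 ∈ gas Ω → p.2 ∈ V → -β p.2 ≤ F p.1 p.2 := by
  filter_upwards [hT.ae_freeFlight, hX, ae_flow hM, ae_flow hS] with p h1 h2 h3 h4 hg hv
  by_contra hc
  push Not at hc
  set f : ℝ → ℝ := fun s => F (flow (-s) p).1 (flow (-s) p).2 with hf
  set S' : ℝ → ℝ := fun s => S (flow (-s) p).1 (flow (-s) p).2 with hS'
  have hf0 : f 0 = F p.1 p.2 := by simp [hf, flow]
  have hη : 0 < -β p.2 - F p.1 p.2 := by linarith
  have hβ' := hβ _ hv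
  have hκ' := hκ _ hv
  set η := -β p.2 - F p.1 p.2 with hηd
  have hc0 : 0 < κ p.2 * (η / 2) := by positivity
  have hneg : ∀ {P : ℝ → Prop}, (∀ᵐ s : ℝ, P s) → ∀ᵐ s : ℝ, P (-s) := fun {P} h =>
    (Measure.measurePreserving_neg (volume : Measure ℝ)).quasiMeasurePreserving.ae h
  -- Backward in time F can only decrease further: below the level -β - η/2, half of the initial gap
  -- η still remains, so the production is at least κη/2.
  have hmain : ∀ σ, 0 ≤ σ → (p, -σ) ∈ freeFlight Ω → f σ ≤ f 0 - κ p.2 * (η / 2) * σ := by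
    intro σ hσ hmem
    have hsub : ∀ s ∈ Icc 0 σ, (p, -s) ∈ freeFlight Ω := fun s hs =>
      freeFlight_of_mem_uIcc hmem (by rw [uIcc_of_ge (by linarith)]; exact ⟨by linarith [hs.2], by linarith [hs.1]⟩)
    refine le_sub_of_barrier (S := S') (κ := -β p.2 - η / 2) hσ hc0.le ?_ ?_ (by rw [hf0]; linarith) ?_ σ
      ⟨hσ, le_rfl⟩
    · have := (h1 hg _ hmem).1
      rw [IntervalIntegrable.iff_comp_neg] at this
      simpa using this
    · intro s hs
      have e := (h1 hg _ (hsub s hs)).2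
      have e2 : ∫ r in (0 : ℝ)..s, S' r = ∫ r in (-s)..0, S (flow r p).1 (flow r p).2 := by
        have := intervalIntegral.integral_comp_neg (a := 0) (b := s)
          (fun r => S (flow r p).1 (flow r p).2)
        rwa [neg_zero] at this
      rw [e2, intervalIntegral.integral_symm, sub_neg_eq_add, hf0]
      exact e
    · filter_upwards [hneg h4] with r hr hmem' hlt
      have hgr : (flow (-r) p).1 ∈ gas Ω := mem_freeFlight_iff.1 (hsub r hmem') _ right_mem_uIcc
      refine le_trans ?_ (hr hgr hv (lt_trans hlt (by linarith)))
      have hlt' : F (flow (-r) p).1 (flow (-r) p).2 < -β p.2 - η / 2 := hlt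
      refine mul_le_mul_of_nonneg_left ?_ hκ'.le
      simp only [flow] at hlt' ⊢
      linarith
  by_cases hex : ∃ t, ExitsAt Ω p t
  · obtain ⟨t, ht⟩ := hex
    obtain ⟨L, hL, hlim⟩ := h2 hg t ht
    have h5 : L ≤ f 0 := by
      refine le_of_tendsto hlim ?_
      filter_upwards [Ico_mem_nhdsLT ht.1] with s hs
      have := hmain s hs.1 ((ht.freeFlight_iff hs.1).2 hs.2)
      nlinarith [mul_nonneg hc0.le hs.1]
    linarith
  -- A flight that exits would end with a trace below F p < 0, against the boundary condition. A
  -- flight that never exits would make F unbounded, although v, and hence the bound M v, is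
  -- constant along it.
  · have hall : ∀ τ, 0 ≤ τ → (p, -τ) ∈ freeFlight Ω := by
      intro τ hτ
      by_contra hc'
      obtain ⟨t, ht, -⟩ := exists_exitsAt hg hτ hc'
      exact hex ⟨t, ht⟩
    -- Beyond K the linear decrease has passed -M. The bound on F holds for almost every s only, and
    -- Ioi K is not null.
    set K := max 0 ((f 0 + M p.2) / (κ p.2 * (η / 2))) with hK
    have hpos : (volume (Ioi K)) ≠ 0 := by simp
    obtain ⟨s, hs, hs'⟩ : ∃ s ∈ Ioi K, (flow (-s) p).1 ∈ gas Ω →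
        |F (flow (-s) p).1 (flow (-s) p).2| ≤ M (flow (-s) p).2 := by
      by_contra hc'
      push Not at hc'
      refine hpos (measure_mono_null (fun s hs => ?_) (ae_iff.1 (hneg h3)))
      intro hh
      exact (hc' s hs).2.not_ge (hh (hc' s hs).1)
    have hs0 : 0 ≤ s := (le_max_left _ _).trans (le_of_lt hs)
    have hgr : (flow (-s) p).1 ∈ gas Ω := mem_freeFlight_iff.1 (hall s hs0) _ right_mem_uIcc
    have h6 := (abs_le.1 (hs' hgr)).1
    have h7 := hmain s hs0 (hall s hs0)
    have h8 : (f 0 + M p.2) / (κ p.2 * (η / 2)) < s := (le_max_right _ _).trans_lt hs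
    rw [div_lt_iff₀ hc0] at h8
    have h9 : -M p.2 ≤ f s := h6
    nlinarith

end Lines

/-! ### Domination of the gain at large velocities. -/

section VelocityDecay

variable {θ : ℝ} {b : ℝ → ℝ} {u : E} {h w : E → ℝ} {A K N : ℝ}

lemma freq_lt_top (hb : AngularCutoff θ b) (u v : E) : freq θ b u v < ∞ := by
  obtain ⟨K, -, hK⟩ := exists_lintegral_kern_sqrtM_le hb u
  exact (freq_le hb hK v).trans_lt ENNReal.ofReal_lt_top

lemma toReal_freq_pos (hb : AngularCutoff θ b) (u v : E) : 0 < (freq θ b u v).toReal := by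
  obtain ⟨c, hc, hcf⟩ := exists_le_freq hb u
  refine ENNReal.toReal_pos (ne_of_gt (lt_of_lt_of_le ?_ (hcf v))) (freq_lt_top hb u v).ne
  rw [ENNReal.ofReal_pos]
  positivity

lemma integral_kern_maxwellian (hb : AngularCutoff θ b) (u v : E) :
    ∫ q, kern θ b q.2 (v - q.1) * maxwellian u q.1 ∂pairMeasure = (freq θ b u v).toReal := by
  rw [freq, integral_eq_lintegral_of_nonneg_ae]
  · exact Eventually.of_forall fun q => mul_nonneg (kern_nonneg hb.nonneg _ _) (maxwellian_pos _ _).le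
  · have hμ := (continuous_maxwellian u).measurable
    exact ((Measurable.kern hb.meas (by fun_prop) (by fun_prop)).mul
      (hμ.comp measurable_fst)).aestronglyMeasurable

lemma gainKernel_nonneg (hb : ∀ z, 0 ≤ b z) (u v : E) (q : E × Sph) : 0 ≤ gainKernel θ b u v q := by
  have h1 := kern_nonneg (θ := θ) hb q.2 (v - q.1)
  have h2 := (sqrtM_pos u q.1).le
  have h3 := (sqrtM_pos u (vsPrime q.2 v q.1)).le
  have h4 := (sqrtM_pos u (vPrime q.2 v q.1)).le
  unfold gainKernel
  positivity

lemma measurable_gainKernel (hb : Measurable b) (u v : E) : Measurable (gainKernel θ b u v) := by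
  have hs : Measurable (sqrtM u) := (continuous_sqrtM u).measurable
  have h1 : Measurable fun q : E × Sph => vPrime q.2 v q.1 :=
    Measurable.vPrime (by fun_prop) (by fun_prop) (by fun_prop)
  have h2 : Measurable fun q : E × Sph => vsPrime q.2 v q.1 :=
    Measurable.vsPrime (by fun_prop) (by fun_prop) (by fun_prop)
  have h3 : Measurable fun q : E × Sph => kern θ b q.2 (v - q.1) :=
    Measurable.kern hb (by fun_prop) (by fun_prop)
  have h4 := hs.comp h1
  have h5 := hs.comp h2
  have h6 : Measurable fun q : E × Sph => sqrtM u q.1 := hs.comp measurable_fst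
  unfold gainKernel
  exact h3.mul (h6.mul ((h5.mul (by fun_prop)).add (h4.mul (by fun_prop))))

/-- At large velocities the linearized operator controls the excess over a decaying barrier. -/
theorem freq_mul_sub_le_lin (hb : AngularCutoff θ b)
    (hK : ∀ v : E, ∫⁻ q, ENNReal.ofReal (kern θ b q.2 (v - q.1) * sqrtM u q.1) ∂pairMeasure ≤
      ENNReal.ofReal (K * (1 + ‖v - u‖)))
    (hN : ∀ v, N < ‖v - u‖ → 2 * ∫⁻ q, ENNReal.ofReal (gainKernel θ b u v q) ∂pairMeasure ≤
      freq θ b u v)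
    (hw0 : ∀ v, 1 ≤ w v) (hw : ∀ v z, w v ≤ (2 * (1 + ‖v - z‖ ^ 2)) ^ 3 * w z)
    (hm : Measurable h) (h0 : 0 ≤ h) (hA0 : 0 ≤ A) (hA : ∀ᵐ v, h v ≤ A * sqrtM u v / w v) :
    ∀ᵐ v, N < ‖v - u‖ →
      (freq θ b u v).toReal * (h v - A / 2 * sqrtM u v / w v) ≤ lin θ b u h v := by
  have hwp : ∀ v, 0 < w v := fun v => one_pos.trans_le (hw0 v)
  have hμ : ∀ᵐ v, |maxwellian u v| ≤ 1 * sqrtM u v := Eventually.of_forall fun v => by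
    rw [one_mul, abs_of_pos (maxwellian_pos _ _)]; exact maxwellian_le_sqrtM _ _
  have hμm : Measurable (maxwellian u) := (continuous_maxwellian u).measurable
  have hC : ∀ᵐ v, |h v| ≤ A * sqrtM u v := by
    filter_upwards [hA] with v hv
    rw [abs_of_nonneg (h0 v)]
    exact hv.trans (div_le_self (mul_nonneg hA0 (sqrtM_pos u v).le) (hw0 v))
  filter_upwards [Qplus_integrable hb hK hμm hm zero_le_one hμ hC,
    Qplus_integrable hb hK hm hμm hA0 hC hμ, ae_ae_coll hA] with v h1 h2 h3 hv
  have h4 := (Qminus_integrable hb hK hm hC v).2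
  have h5 := (Qminus_integrable hb hK hμm hμ v).2
  have hfin : ∫⁻ q, ENNReal.ofReal (gainKernel θ b u v q) ∂pairMeasure < ∞ := by
    have := (hN v hv).trans_lt (freq_lt_top hb u v)
    rw [two_mul] at this
    exact (ENNReal.add_lt_top.1 this).1
  have hgk0 : 0 ≤ᵐ[pairMeasure] gainKernel θ b u v :=
    Eventually.of_forall fun q => gainKernel_nonneg hb.nonneg u v q
  have hgki : Integrable (gainKernel θ b u v) pairMeasure :=
    (lintegral_ofReal_ne_top_iff_integrable (measurable_gainKernel hb.meas u v).aestronglyMeasurable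
      hgk0).1 hfin.ne
  have hgk : ∫ q, gainKernel θ b u v q ∂pairMeasure ≤ (freq θ b u v).toReal / 2 := by
    rw [integral_eq_lintegral_of_nonneg_ae hgk0
      (measurable_gainKernel hb.meas u v).aestronglyMeasurable]
    have := ENNReal.toReal_mono (freq_lt_top hb u v).ne (hN v hv)
    rw [ENNReal.toReal_mul, ENNReal.toReal_ofNat] at this
    linarith
  have hgain : Qplus (kern θ b) (maxwellian u) h v + Qplus (kern θ b) h (maxwellian u) v ≤
      A * sqrtM u v / w v * ((freq θ b u v).toReal / 2) := by
    rw [Qplus_eq_integral h1.2, Qplus_eq_integral h2.2, ← integral_add h1.2 h2.2]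
    refine le_trans ?_ (mul_le_mul_of_nonneg_left hgk
      (div_nonneg (mul_nonneg hA0 (sqrtM_pos u v).le) (hwp v).le))
    rw [← integral_const_mul]
    refine integral_mono_ae (h1.2.add h2.2) (hgki.const_mul _) ?_
    filter_upwards [h3] with q hq
    obtain ⟨-, -, hq1, hq2⟩ := hq
    have hk := kern_nonneg (θ := θ) hb.nonneg q.2 (v - q.1)
    have hω := norm_sph q.2
    have hcol := sqrtM_collide u q.2 v q.1 hω
    -- The displacement in `gainKernel` equals the distance from v to the velocity at which h is
    -- evaluated. This is what the comparison of the weights of w at the two points needs.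
    have hd1 : vsPrime q.2 v q.1 - q.1 = v - vPrime q.2 v q.1 := by
      simp [vPrime, vsPrime]
    have hd2 : vPrime q.2 v q.1 - q.1 = v - vsPrime q.2 v q.1 := by
      simp only [vPrime, vsPrime]; abel
    have hw1 := hw v (vPrime q.2 v q.1)
    have hw2 := hw v (vsPrime q.2 v q.1)
    simp only [gainKernel, hd1, hd2]
    rw [← sqrtM_sq u (vPrime q.2 v q.1), ← sqrtM_sq u (vsPrime q.2 v q.1)]
    set a := sqrtM u (vPrime q.2 v q.1) with ha
    set s := sqrtM u (vsPrime q.2 v q.1) with hs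
    have ha0 : 0 < a := sqrtM_pos _ _
    have hs0 : 0 < s := sqrtM_pos _ _
    have hv0 := sqrtM_pos u v
    have hq0 := sqrtM_pos u q.1
    have e1 : ∀ z, w v ≤ (2 * (1 + ‖v - z‖ ^ 2)) ^ 3 * w z →
        (w z)⁻¹ ≤ (2 * (1 + ‖v - z‖ ^ 2)) ^ 3 / w v := by
      intro z hz
      rw [inv_eq_one_div, div_le_div_iff₀ (hwp z) (hwp v)]
      linarith
    have e2 := e1 _ hw1
    have e3 := e1 _ hw2
    have e4 : a * a * h (vsPrime q.2 v q.1) ≤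
        A * (sqrtM u v * sqrtM u q.1) * (a * ((2 * (1 + ‖v - vsPrime q.2 v q.1‖ ^ 2)) ^ 3 / w v)) := by
      calc a * a * h (vsPrime q.2 v q.1) ≤ a * a * (A * s * (w (vsPrime q.2 v q.1))⁻¹) := by
            gcongr; exact hq2
        _ = A * (a * s) * (a * (w (vsPrime q.2 v q.1))⁻¹) := by ring
        _ ≤ _ := by rw [hcol]; gcongr
    have e5 : h (vPrime q.2 v q.1) * (s * s) ≤
        A * (sqrtM u v * sqrtM u q.1) * (s * ((2 * (1 + ‖v - vPrime q.2 v q.1‖ ^ 2)) ^ 3 / w v)) := by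
      calc h (vPrime q.2 v q.1) * (s * s) ≤ (A * a * (w (vPrime q.2 v q.1))⁻¹) * (s * s) := by
            gcongr; exact hq1
        _ = A * (a * s) * (s * (w (vPrime q.2 v q.1))⁻¹) := by ring
        _ ≤ _ := by rw [hcol]; gcongr
    calc _ = kern θ b q.2 (v - q.1) * (a * a * h (vsPrime q.2 v q.1) +
          h (vPrime q.2 v q.1) * (s * s)) := by ring
      _ ≤ kern θ b q.2 (v - q.1) *
        (A * (sqrtM u v * sqrtM u q.1) * (a * ((2 * (1 + ‖v - vsPrime q.2 v q.1‖ ^ 2)) ^ 3 / w v)) +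
        A * (sqrtM u v * sqrtM u q.1) * (s * ((2 * (1 + ‖v - vPrime q.2 v q.1‖ ^ 2)) ^ 3 / w v))) :=
          mul_le_mul_of_nonneg_left (add_le_add e4 e5) hk
      _ = _ := by ring
  have hloss1 : 0 ≤ Qminus (kern θ b) (maxwellian u) h v := by
    rw [Qminus_eq_integral h4]
    exact mul_nonneg (maxwellian_pos _ _).le
      (integral_nonneg fun q => mul_nonneg (kern_nonneg hb.nonneg _ _) (h0 _))
  have hloss2 : Qminus (kern θ b) h (maxwellian u) v = h v * (freq θ b u v).toReal := by
    rw [Qminus_eq_integral h5, integral_kern_maxwellian hb]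
  have e : A / 2 * sqrtM u v / w v * (freq θ b u v).toReal =
    A * sqrtM u v / w v * ((freq θ b u v).toReal / 2) := by ring
  simp only [lin, Q, hloss2]
  linarith

/-- The truncated polynomial weight. -/
def truncWeight (u : E) (m : ℕ) (v : E) : ℝ := min (1 + ‖v - u‖ ^ 2) ((m : ℝ) + 1) ^ 3

lemma one_le_truncWeight (u : E) (m : ℕ) (v : E) : 1 ≤ truncWeight u m v :=
  one_le_pow₀ (le_min (by nlinarith [sq_nonneg ‖v - u‖]) (by simp))

/-- The weight is moderate with constants independent of the truncation m. Truncation keeps it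
bounded, so the starting estimate h ≤ D √μ is already a weighted one, with a constant depending on
m. -/
lemma truncWeight_le (u : E) (m : ℕ) (v z : E) :
    truncWeight u m v ≤ (2 * (1 + ‖v - z‖ ^ 2)) ^ 3 * truncWeight u m z := by
  have hm : (0 : ℝ) ≤ m := m.cast_nonneg
  rw [truncWeight, truncWeight, ← mul_pow]
  have h1 : ‖v - u‖ ^ 2 ≤ 2 * ‖v - z‖ ^ 2 + 2 * ‖z - u‖ ^ 2 := by
    have : ‖v - u‖ ≤ ‖v - z‖ + ‖z - u‖ := norm_sub_le_norm_sub_add_norm_sub _ _ _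
    nlinarith [norm_nonneg (v - u), sq_nonneg (‖v - z‖ - ‖z - u‖)]
  refine pow_le_pow_left₀ (le_min (by positivity) (by positivity)) ?_ 3
  rcases le_total (1 + ‖z - u‖ ^ 2) ((m : ℝ) + 1) with hc | hc
  · rw [min_eq_left hc]
    refine (min_le_left _ _).trans ?_
    nlinarith [mul_nonneg (sq_nonneg ‖v - z‖) (sq_nonneg ‖z - u‖)]
  · rw [min_eq_right hc]
    refine (min_le_right _ _).trans ?_
    nlinarith [mul_nonneg (sq_nonneg ‖v - z‖) hm, sq_nonneg ‖v - z‖]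

lemma measurable_truncWeight (u : E) (m : ℕ) : Measurable (truncWeight u m) := by
  unfold truncWeight; fun_prop

end VelocityDecay

/-! ### Almost-everywhere statements on slices. -/

section Slices

variable {Ω : Set E} {P : E × E → Prop}

lemma ae_slice (h : ∀ᵐ p : E × E, p.1 ∈ gas Ω → P p) :
    ∀ᵐ x : E, x ∈ gas Ω → ∀ᵐ v : E, P (x, v) := by
  filter_upwards [Measure.ae_ae_of_ae_prod h] with x hx hg
  filter_upwards [hx] with v hv
  exact hv hg

lemma ae_of_slice (hP : MeasurableSet {p | P p}) (h : ∀ᵐ x : E, x ∈ gas Ω → ∀ᵐ v : E, P (x, v)) :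
    ∀ᵐ p : E × E, p.1 ∈ gas Ω → P p := by
  have hm : MeasurableSet {p : E × E | p.1 ∈ gas Ω → P p} := by
    have : {p : E × E | p.1 ∈ gas Ω → P p} = {p : E × E | p.1 ∈ gas Ω}ᶜ ∪ {p | P p} := by
      ext p; simp [imp_iff_not_or]
    rw [this]
    exact (measurable_fst isOpen_gas.measurableSet).compl.union hP
  refine (Measure.ae_prod_iff_ae_ae hm).2 ?_
  filter_upwards [h] with x hx
  by_cases hg : x ∈ gas Ω
  · filter_upwards [hx hg] with v hv _
    exact hv
  · exact Eventually.of_forall fun v hc => absurd hc hg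

end Slices

/-! ### Polynomial decay of the negative part. -/

section SolutionDecay

variable {Ω : Set E} {n : E → E} {θ : ℝ} {b : ℝ → ℝ} {ε : ℝ} {c : E} {F : E → E → ℝ} {C N : ℝ}

lemma negP_nonneg (F : E → E → ℝ) (x : E) : 0 ≤ negP F x := fun _ => le_max_right _ _

lemma posP_nonneg (F : E → E → ℝ) (x : E) : 0 ≤ posP F x := fun _ => le_max_right _ _

lemma measurable_negP (h : Measurable (Function.uncurry F)) :
    Measurable (Function.uncurry (negP F)) := h.neg.max measurable_const

lemma measurable_posP (h : Measurable (Function.uncurry F)) :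
    Measurable (Function.uncurry (posP F)) := h.max measurable_const

lemma measurable_section (h : Measurable (Function.uncurry F)) (x : E) : Measurable (F x) :=
  h.comp measurable_prodMk_left

lemma abs_negP_le (F : E → E → ℝ) (x v : E) : |negP F x v| ≤ |F x v| := by
  rw [negP, abs_of_nonneg (le_max_right _ _)]
  exact max_le (neg_le_abs _) (abs_nonneg _)

lemma abs_posP_le (F : E → E → ℝ) (x v : E) : |posP F x v| ≤ |F x v| := by
  rw [posP, abs_of_nonneg (le_max_right _ _)]
  exact max_le (le_abs_self _) (abs_nonneg _)

lemma modifiedRHS_eq (θ : ℝ) (b : ℝ → ℝ) (ε : ℝ) (c : E) (F : E → E → ℝ) (x v : E) :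
    modifiedRHS (kern θ b) ε c F x v = ε⁻¹ * (Q (kern θ b) (posP F x) (posP F x) v +
      lin θ b (ε • c) (negP F x) v) := by
  rw [modifiedRHS, lin]; ring

/-- The loss term carries the factor F⁺(v), which vanishes here; only contributions with a
favourable sign accompany L F⁻. -/
lemma modifiedRHS_of_neg (θ : ℝ) (b : ℝ → ℝ) (ε : ℝ) (c : E) {x v : E} (h : F x v ≤ 0) :
    modifiedRHS (kern θ b) ε c F x v = ε⁻¹ * (Qplus (kern θ b) (posP F x) (posP F x) v +
      lin θ b (ε • c) (negP F x) v) := by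
  have h0 : posP F x v = 0 := max_eq_right h
  rw [modifiedRHS_eq, Q, Qminus, h0, zero_mul, sub_zero]

lemma measurable_lin (hb : Measurable b) (u : E) {h : E → E → ℝ}
    (hm : Measurable (Function.uncurry h)) :
    Measurable fun p : E × E => lin θ b u (h p.1) p.2 := by
  have hμ : Measurable (Function.uncurry fun _ : E => maxwellian u) :=
    (continuous_maxwellian u).measurable.comp measurable_snd
  exact ((measurable_Q hb hμ hm).add (measurable_Q hb hm hμ)).neg

lemma measurable_modifiedRHS (hb : Measurable b) (hm : Measurable (Function.uncurry F)) :
    Measurable (Function.uncurry (modifiedRHS (kern θ b) ε c F)) := by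
  have h := ((measurable_Q (θ := θ) hb (measurable_posP hm) (measurable_posP hm)).add
    (measurable_lin (θ := θ) hb (ε • c) (measurable_negP hm))).const_mul ε⁻¹
  have e : Function.uncurry (modifiedRHS (kern θ b) ε c F) = fun p : E × E =>
      ε⁻¹ * (Q (kern θ b) (posP F p.1) (posP F p.1) p.2 + lin θ b (ε • c) (negP F p.1) p.2) :=
    funext fun p => modifiedRHS_eq θ b ε c F p.1 p.2
  rw [e]
  exact h

/-- One step of the iteration improving the decay of the negative part at large velocities. -/
theorem negP_le_half (hb : AngularCutoff θ b) (hε : 0 < ε)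
    (hN : ∀ v, N < ‖v - ε • c‖ →
      2 * ∫⁻ q, ENNReal.ofReal (gainKernel θ b (ε • c) v q) ∂pairMeasure ≤ freq θ b (ε • c) v)
    (hm : Measurable (Function.uncurry F))
    (hT : SolvesTransport Ω (modifiedRHS (kern θ b) ε c F) F)
    (hX : ∀ᵐ p : E × E, p.1 ∈ gas Ω → ∀ t, ExitsAt Ω p t →
      ∃ L, 0 ≤ L ∧ Tendsto (fun s => F (flow (-s) p).1 (flow (-s) p).2) (𝓝[<] t) (𝓝 L))
    (hC : ∀ᵐ p : E × E, p.1 ∈ gas Ω → |F p.1 p.2| ≤ C * sqrtM (ε • c) p.2) {m : ℕ} {A : ℝ}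
    (hA0 : 0 ≤ A) (hA : ∀ᵐ p : E × E, p.1 ∈ gas Ω →
      negP F p.1 p.2 ≤ A * sqrtM (ε • c) p.2 / truncWeight (ε • c) m p.2) :
    ∀ᵐ p : E × E, p.1 ∈ gas Ω → N < ‖p.2 - ε • c‖ →
      negP F p.1 p.2 ≤ A / 2 * sqrtM (ε • c) p.2 / truncWeight (ε • c) m p.2 := by
  set u := ε • c with hu
  obtain ⟨K, hK0, hK⟩ := exists_lintegral_kern_sqrtM_le hb u
  have hfm : Measurable (freq θ b u) := measurable_freq hb.meas
  have hsm : Measurable (sqrtM u) := (continuous_sqrtM u).measurable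
  have hwm := measurable_truncWeight u m
  have hnm : Measurable fun p : E × E => negP F p.1 p.2 := measurable_negP hm
  set β : E → ℝ := fun v => A / 2 * sqrtM u v / truncWeight u m v with hβ
  have hβm : Measurable β := (hsm.const_mul _).div hwm
  have hβ0 : ∀ v, 0 ≤ β v := fun v => div_nonneg (mul_nonneg (by linarith) (sqrtM_pos u v).le)
    (zero_le_one.trans (one_le_truncWeight u m v))
  have hlin : ∀ᵐ p : E × E, p.1 ∈ gas Ω → (N < ‖p.2 - u‖ →
      (freq θ b u p.2).toReal * (negP F p.1 p.2 - β p.2) ≤ lin θ b u (negP F p.1) p.2) := by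
    refine ae_of_slice ?_ ?_
    · have h1 : MeasurableSet {p : E × E | N < ‖p.2 - u‖} :=
        measurableSet_lt measurable_const (by fun_prop)
      have h2 : MeasurableSet {p : E × E | (freq θ b u p.2).toReal * (negP F p.1 p.2 - β p.2) ≤
          lin θ b u (negP F p.1) p.2} :=
        measurableSet_le ((hfm.comp measurable_snd).ennreal_toReal.mul
          (hnm.sub (hβm.comp measurable_snd))) (measurable_lin hb.meas u (measurable_negP hm))
      convert h1.compl.union h2 using 1
      ext p; simp [imp_iff_not_or]
    · filter_upwards [ae_slice hA] with x hx hg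
      exact freq_mul_sub_le_lin hb hK hN (one_le_truncWeight u m) (truncWeight_le u m)
        (measurable_section (measurable_negP hm) x) (negP_nonneg F x) hA0 (hx hg)
  -- The nonnegative gain Q⁺(F⁺,F⁺) is discarded: L F⁻ alone exceeds ν (F⁻ - β), with ν the
  -- collision frequency and β half of the assumed bound.
  have hmain := neg_le_of_production (V := {v | N < ‖v - u‖}) (β := β)
    (κ := fun v => ε⁻¹ * (freq θ b u v).toReal) (M := fun v => C * sqrtM u v) hT hX hC
    (fun v _ => hβ0 v) (fun v _ => mul_pos (inv_pos.2 hε) (toReal_freq_pos hb u v)) (by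
      filter_upwards [hlin] with p hp hg hv hneg
      have h1 := hp hg hv
      have h2 : negP F p.1 p.2 = -F p.1 p.2 := max_eq_left (by linarith)
      rw [h2] at h1
      rw [modifiedRHS_of_neg θ b ε c hneg.le, mul_assoc]
      refine mul_le_mul_of_nonneg_left (h1.trans ?_) (inv_pos.2 hε).le
      have := Qplus_nonneg hb (posP_nonneg F p.1) (posP_nonneg F p.1) p.2
      linarith)
  filter_upwards [hmain] with p hp hg hv
  have h1 := hp hg hv
  exact max_le (by linarith) (hβ0 _)

/-- The negative part decays polynomially relative to `√μ`. -/
theorem exists_negP_le (hb : AngularCutoff θ b) (hε : 0 < ε)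
    (hm : Measurable (Function.uncurry F))
    (hT : SolvesTransport Ω (modifiedRHS (kern θ b) ε c F) F)
    (hX : ∀ᵐ p : E × E, p.1 ∈ gas Ω → ∀ t, ExitsAt Ω p t →
      ∃ L, 0 ≤ L ∧ Tendsto (fun s => F (flow (-s) p).1 (flow (-s) p).2) (𝓝[<] t) (𝓝 L))
    (hC : ∀ᵐ p : E × E, p.1 ∈ gas Ω → |F p.1 p.2| ≤ C * sqrtM (ε • c) p.2) :
    ∃ A : ℝ, 0 < A ∧ ∀ᵐ p : E × E, p.1 ∈ gas Ω →
      negP F p.1 p.2 ≤ A * sqrtM (ε • c) p.2 * ((1 + ‖p.2 - ε • c‖ ^ 2) ^ 3)⁻¹ := by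
  obtain ⟨N, hN0, hN⟩ := exists_gainKernel_le hb (ε • c)
  set u := ε • c with hu
  set D := |C| + 1 with hD
  have hD0 : 0 < D := by positivity
  -- For |v-u| ≤ N the weight is at most (1+N²)³, so this constant suffices there and bounds the
  -- iteration from below, uniformly in m.
  set A₀ := D * (1 + N ^ 2) ^ 3 with hA₀
  have hA₀0 : 0 < A₀ := by positivity
  have hn : ∀ᵐ p : E × E, p.1 ∈ gas Ω → negP F p.1 p.2 ≤ D * sqrtM u p.2 := by
    filter_upwards [hC] with p hp hg
    have h1 := hp hg
    refine ((le_abs_self _).trans (abs_negP_le F _ _)).trans (h1.trans ?_)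
    refine mul_le_mul_of_nonneg_right ?_ (sqrtM_pos u _).le
    linarith [le_abs_self C]
  have hw1 : ∀ (m : ℕ) v, truncWeight u m v ≤ ((m : ℝ) + 1) ^ 3 := fun m v =>
    pow_le_pow_left₀ (le_min (by positivity) (by positivity)) (min_le_right _ _) 3
  have hw2 : ∀ (m : ℕ) v, truncWeight u m v ≤ (1 + ‖v - u‖ ^ 2) ^ 3 := fun m v =>
    pow_le_pow_left₀ (le_min (by positivity) (by positivity)) (min_le_left _ _) 3
  have hwp : ∀ (m : ℕ) v, 0 < truncWeight u m v := fun m v =>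
    one_pos.trans_le (one_le_truncWeight u m v)
  -- The large initial constant, of order (m+1)³, is halved at each step until it falls below A₀.
  have hiter : ∀ m k : ℕ, ∀ᵐ p : E × E, p.1 ∈ gas Ω → negP F p.1 p.2 ≤
      max (D * ((m : ℝ) + 1) ^ 3 / 2 ^ k) A₀ * sqrtM u p.2 / truncWeight u m p.2 := by
    intro m k
    induction k with
    | zero =>
      filter_upwards [hn] with p hp hg
      rw [le_div_iff₀ (hwp m _), pow_zero, div_one]
      have h2 := (sqrtM_pos u p.2).le
      calc negP F p.1 p.2 * truncWeight u m p.2 ≤ D * sqrtM u p.2 * ((m : ℝ) + 1) ^ 3 :=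
            mul_le_mul (hp hg) (hw1 m _) (hwp m _).le (by positivity)
        _ = D * ((m : ℝ) + 1) ^ 3 * sqrtM u p.2 := by ring
        _ ≤ _ := mul_le_mul_of_nonneg_right (le_max_left _ _) h2
    | succ k ih =>
      filter_upwards [negP_le_half hb hε hN hm hT hX hC
        (hA₀0.le.trans (le_max_right _ _)) ih, hn] with p h1 h2 hg
      have hs := (sqrtM_pos u p.2).le
      rcases lt_or_ge N ‖p.2 - u‖ with hv | hv
      · refine (h1 hg hv).trans ?_
        have e : max (D * ((m : ℝ) + 1) ^ 3 / 2 ^ k) A₀ / 2 ≤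
            max (D * ((m : ℝ) + 1) ^ 3 / 2 ^ (k + 1)) A₀ := by
          rw [div_le_iff₀ two_pos]
          refine max_le ?_ ?_
          · refine le_trans (le_of_eq ?_) (mul_le_mul_of_nonneg_right (le_max_left _ _) two_pos.le)
            field_simp; ring
          · refine le_trans ?_ (mul_le_mul_of_nonneg_right (le_max_right _ _) two_pos.le)
            linarith
        exact div_le_div_of_nonneg_right (mul_le_mul_of_nonneg_right e hs) (hwp m _).le
      · rw [le_div_iff₀ (hwp m _)]
        have e : truncWeight u m p.2 ≤ (1 + N ^ 2) ^ 3 := (hw2 m _).trans (by gcongr)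
        calc negP F p.1 p.2 * truncWeight u m p.2 ≤ D * sqrtM u p.2 * (1 + N ^ 2) ^ 3 :=
              mul_le_mul (h2 hg) e (hwp m _).le (by positivity)
          _ = A₀ * sqrtM u p.2 := by rw [hA₀]; ring
          _ ≤ _ := mul_le_mul_of_nonneg_right (le_max_right _ _) hs
  have hall : ∀ m : ℕ, ∀ᵐ p : E × E, p.1 ∈ gas Ω →
      negP F p.1 p.2 ≤ A₀ * sqrtM u p.2 / truncWeight u m p.2 := by
    intro m
    -- The number of steps depends on m but the resulting constant does not, so the truncation can
    -- be removed afterwards.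
    obtain ⟨k, hk⟩ := pow_unbounded_of_one_lt (D * ((m : ℝ) + 1) ^ 3 / A₀) one_lt_two
    have e : D * ((m : ℝ) + 1) ^ 3 / 2 ^ k ≤ A₀ := by
      rw [div_le_iff₀ (by positivity)]
      rw [div_lt_iff₀ hA₀0] at hk
      linarith
    have := hiter m k
    rwa [max_eq_right e] at this
  refine ⟨A₀, hA₀0, ?_⟩
  filter_upwards [ae_all_iff.2 hall] with p hp hg
  obtain ⟨m, hm'⟩ := exists_nat_ge (‖p.2 - u‖ ^ 2)
  have h1 := hp m hg
  have e : truncWeight u m p.2 = (1 + ‖p.2 - u‖ ^ 2) ^ 3 := by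
    rw [truncWeight, min_eq_left (by linarith)]
  rwa [e, div_eq_mul_inv] at h1

end SolutionDecay

/-! ### The dissipation in the velocity variable. -/

section Dissipation

variable {θ : ℝ} {b : ℝ → ℝ} {u : E} {p h : E → ℝ} {A C K : ℝ}

/-- The entropy dissipation density of the modified equation. -/
def dissipation (θ : ℝ) (b : ℝ → ℝ) (u : E) (p h : E → ℝ) (v : E) : ℝ :=
  h v / maxwellian u v * (Qplus (kern θ b) p p v + lin θ b u h v)

lemma one_add_sq_le (r : ℝ) : (1 + r) ^ 2 ≤ 2 * (1 + r ^ 2) := by nlinarith [sq_nonneg (r - 1)]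

lemma integrable_inv_sq (u : E) : Integrable fun v : E => ((1 + ‖v - u‖ ^ 2) ^ 2)⁻¹ := by
  have h0 : 0 ≤ᵐ[volume] fun v : E => ((1 + ‖v - u‖) ^ 4)⁻¹ :=
    Eventually.of_forall fun v => by positivity
  have h1 : Integrable fun v : E => ((1 + ‖v - u‖) ^ 4)⁻¹ :=
    (lintegral_ofReal_ne_top_iff_integrable (Measurable.aestronglyMeasurable (by fun_prop)) h0).1
      (lintegral_one_add_norm_lt_top u).ne
  refine (h1.const_mul 4).mono' (Measurable.aestronglyMeasurable (by fun_prop))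
    (Eventually.of_forall fun v => ?_)
  have h2 := one_add_sq_le ‖v - u‖
  have h3 : (1 + ‖v - u‖) ^ 4 ≤ 4 * (1 + ‖v - u‖ ^ 2) ^ 2 := by
    have := pow_le_pow_left₀ (sq_nonneg (1 + ‖v - u‖)) h2 2
    nlinarith
  rw [Real.norm_of_nonneg (by positivity), inv_eq_one_div, ← div_eq_mul_inv,
    div_le_div_iff₀ (by positivity) (by positivity)]
  linarith

lemma abs_le_of_decay (hA0 : 0 ≤ A) (hh : ∀ᵐ v, |h v| ≤ A * sqrtM u v * ((1 + ‖v - u‖ ^ 2) ^ 3)⁻¹) :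
    ∀ᵐ v, |h v| ≤ A * sqrtM u v := by
  filter_upwards [hh] with v hv
  refine hv.trans (mul_le_of_le_one_right (mul_nonneg hA0 (sqrtM_pos u v).le) ?_)
  exact inv_le_one_of_one_le₀ (one_le_pow₀ (by nlinarith [sq_nonneg ‖v - u‖]))

/-- The collision terms are O((1+r)√μ) and h/μ is O((1+r²)⁻³/√μ), where r = |v-u|. The product is
O((1+r²)⁻²), which is integrable in three dimensions. -/
lemma abs_dissipation_le (hb : AngularCutoff θ b)
    (hK : ∀ v : E, ∫⁻ q, ENNReal.ofReal (kern θ b q.2 (v - q.1) * sqrtM u q.1) ∂pairMeasure ≤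
      ENNReal.ofReal (K * (1 + ‖v - u‖))) (hK0 : 0 ≤ K) (hp : Measurable p) (hm : Measurable h)
    (hA0 : 0 ≤ A) (hpC : ∀ᵐ v, |p v| ≤ C * sqrtM u v)
    (hh : ∀ᵐ v, |h v| ≤ A * sqrtM u v * ((1 + ‖v - u‖ ^ 2) ^ 3)⁻¹) :
    ∀ᵐ v, |h v / maxwellian u v * Qplus (kern θ b) p p v| + |h v / maxwellian u v * lin θ b u h v| ≤
      2 * A * K * (C ^ 2 + 4 * A) * ((1 + ‖v - u‖ ^ 2) ^ 2)⁻¹ := by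
  have hμ : ∀ᵐ v, |maxwellian u v| ≤ 1 * sqrtM u v := Eventually.of_forall fun v => by
    rw [one_mul, abs_of_pos (maxwellian_pos _ _)]; exact maxwellian_le_sqrtM _ _
  have hμm : Measurable (maxwellian u) := (continuous_maxwellian u).measurable
  have hC := abs_le_of_decay hA0 hh
  filter_upwards [abs_Qplus_le hb hK hK0 hp hp hpC hpC, abs_Q_le hb hK hK0 hμm hm hμ hC,
    abs_Q_le hb hK hK0 hm hμm hC hμ, hh] with v h1 h2 h3 h4
  have hlin : |lin θ b u h v| ≤ 4 * (A * (K * (1 + ‖v - u‖)) * sqrtM u v) := by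
    rw [lin, abs_neg]
    refine (abs_add_le _ _).trans ((add_le_add h2 h3).trans (le_of_eq ?_))
    ring
  have hs := sqrtM_pos u v
  have hM : maxwellian u v = sqrtM u v * sqrtM u v := (sqrtM_sq u v).symm
  rw [abs_mul, abs_mul, ← mul_add, abs_div, abs_of_pos (maxwellian_pos u v), hM]
  set r := ‖v - u‖
  set s := sqrtM u v
  have hr : 0 ≤ r := norm_nonneg _
  have h5 : |h v| / (s * s) ≤ A * ((1 + r ^ 2) ^ 3)⁻¹ / s := by
    rw [div_le_div_iff₀ (by positivity) hs]
    calc |h v| * s ≤ A * s * ((1 + r ^ 2) ^ 3)⁻¹ * s := by gcongr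
      _ = _ := by ring
  calc |h v| / (s * s) * (|Qplus (kern θ b) p p v| + |lin θ b u h v|)
      ≤ A * ((1 + r ^ 2) ^ 3)⁻¹ / s * (C * C * (K * (1 + r)) * s + 4 * (A * (K * (1 + r)) * s)) := by
        gcongr
    _ = A * K * (C ^ 2 + 4 * A) * ((1 + r) * ((1 + r ^ 2) ^ 3)⁻¹) := by
        field_simp
    _ ≤ A * K * (C ^ 2 + 4 * A) * (2 * ((1 + r ^ 2) ^ 2)⁻¹) := by
        refine mul_le_mul_of_nonneg_left ?_ (by positivity)
        rw [← div_eq_mul_inv, ← div_eq_mul_inv, div_le_div_iff₀ (by positivity) (by positivity)]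
        have : 1 + r ≤ 2 * (1 + r ^ 2) := by nlinarith [sq_nonneg (r - 1)]
        calc (1 + r) * (1 + r ^ 2) ^ 2 ≤ 2 * (1 + r ^ 2) * (1 + r ^ 2) ^ 2 := by gcongr
          _ = _ := by ring
    _ = _ := by ring

lemma measurable_Qplus_section (hb : Measurable b) (hp : Measurable p) :
    Measurable (Qplus (kern θ b) p p) := by
  have h1 : Measurable (Function.uncurry fun _ : E => p) := hp.comp measurable_snd
  obtain ⟨x⟩ : Nonempty E := inferInstance
  have h2 := measurable_Qplus (θ := θ) (f := fun _ => p) (g := fun _ => p) hb h1 h1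
  exact Measurable.of_uncurry_left (f := fun _ : E => Qplus (kern θ b) p p) h2 (x := x)

lemma measurable_lin_section (hb : Measurable b) (hm : Measurable h) :
    Measurable (lin θ b u h) := by
  have h1 : Measurable (Function.uncurry fun _ : E => h) := hm.comp measurable_snd
  obtain ⟨x⟩ : Nonempty E := inferInstance
  have h2 := measurable_lin (θ := θ) (h := fun _ => h) hb u h1
  exact Measurable.of_uncurry_left (f := fun _ : E => lin θ b u h) h2 (x := x)

lemma integrable_dissipation (hb : AngularCutoff θ b) (hp : Measurable p) (hm : Measurable h)
    (hA0 : 0 ≤ A) (hpC : ∀ᵐ v, |p v| ≤ C * sqrtM u v)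
    (hh : ∀ᵐ v, |h v| ≤ A * sqrtM u v * ((1 + ‖v - u‖ ^ 2) ^ 3)⁻¹) :
    Integrable (fun v => h v / maxwellian u v * Qplus (kern θ b) p p v) ∧
      Integrable (fun v => h v / maxwellian u v * lin θ b u h v) := by
  obtain ⟨K, hK0, hK⟩ := exists_lintegral_kern_sqrtM_le hb u
  have hμm : Measurable (maxwellian u) := (continuous_maxwellian u).measurable
  have hi := (integrable_inv_sq u).const_mul (2 * A * K * (C ^ 2 + 4 * A))
  have hle := abs_dissipation_le hb hK hK0.le hp hm hA0 hpC hh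
  constructor
  · refine hi.mono' ((hm.div hμm).mul (measurable_Qplus_section hb.meas hp)).aestronglyMeasurable ?_
    filter_upwards [hle] with v hv
    rw [Real.norm_eq_abs]
    linarith [abs_nonneg (h v / maxwellian u v * lin θ b u h v)]
  · refine hi.mono' ((hm.div hμm).mul (measurable_lin_section hb.meas hm)).aestronglyMeasurable ?_
    filter_upwards [hle] with v hv
    rw [Real.norm_eq_abs]
    linarith [abs_nonneg (h v / maxwellian u v * Qplus (kern θ b) p p v)]

lemma dissipation_facts (hb : AngularCutoff θ b) (hp : Measurable p) (hm : Measurable h)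
    (hp0 : 0 ≤ p) (h0 : 0 ≤ h) (hA0 : 0 ≤ A) (hpC : ∀ᵐ v, |p v| ≤ C * sqrtM u v)
    (hh : ∀ᵐ v, |h v| ≤ A * sqrtM u v * ((1 + ‖v - u‖ ^ 2) ^ 3)⁻¹) :
    (∫ v, dissipation θ b u p h v = (∫ v, h v / maxwellian u v * Qplus (kern θ b) p p v) +
      ∫ v, h v / maxwellian u v * lin θ b u h v) ∧
    0 ≤ (∫ v, h v / maxwellian u v * Qplus (kern θ b) p p v) ∧
    0 ≤ (∫ v, h v / maxwellian u v * lin θ b u h v) ∧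
    ((∫ v, h v / maxwellian u v * lin θ b u h v) = 0 → ∀ᵐ v, lin θ b u h v = 0) ∧
    ∫⁻ v, freq θ b u v * ENNReal.ofReal (h v ^ 2 / maxwellian u v) < ∞ := by
  obtain ⟨K, hK0, hK⟩ := exists_lintegral_kern_sqrtM_le hb u
  have hC := abs_le_of_decay hA0 hh
  obtain ⟨i1, i2⟩ := integrable_dissipation hb hp hm hA0 hpC hh
  have hfin : ∫⁻ v, freq θ b u v * ENNReal.ofReal (h v ^ 2 / maxwellian u v) < ∞ :=
    lintegral_freq_sq_lt_top hb hK hK0.le h0 (hh.mono fun v hv => (le_abs_self _).trans hv)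
  have hL := memLp_quotient hb hfin hm
  refine ⟨?_, integral_nonneg fun v => mul_nonneg (div_nonneg (h0 v) (maxwellian_pos u v).le)
    (Qplus_nonneg hb hp0 hp0 v), integral_mul_lin_nonneg hb hK hm hA0 hC hL,
    lin_eq_zero_of_integral_eq_zero hb hK hm hA0 hC hL, hfin⟩
  rw [← integral_add i1 i2]
  exact integral_congr_ae (Eventually.of_forall fun v => mul_add _ _ _)

/-- If the dissipation vanishes, so does the production. -/
theorem mul_eq_zero_of_dissipation_eq_zero (hb : AngularCutoff θ b) (hp : Measurable p)
    (hm : Measurable h) (hp0 : 0 ≤ p) (h0 : 0 ≤ h) (hA0 : 0 ≤ A)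
    (hpC : ∀ᵐ v, |p v| ≤ C * sqrtM u v)
    (hh : ∀ᵐ v, |h v| ≤ A * sqrtM u v * ((1 + ‖v - u‖ ^ 2) ^ 3)⁻¹)
    (hD : ∫ v, dissipation θ b u p h v = 0) :
    ∀ᵐ v, h v * (Qplus (kern θ b) p p v + lin θ b u h v) = 0 := by
  obtain ⟨e, h1, h2, h3, -⟩ := dissipation_facts hb hp hm hp0 h0 hA0 hpC hh
  have e1 : ∫ v, h v / maxwellian u v * Qplus (kern θ b) p p v = 0 := by linarith
  have e2 : ∀ᵐ v, h v / maxwellian u v * Qplus (kern θ b) p p v = 0 :=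
    (integral_eq_zero_iff_of_nonneg (fun v => mul_nonneg (div_nonneg (h0 v) (maxwellian_pos u v).le)
      (Qplus_nonneg hb hp0 hp0 v)) (integrable_dissipation hb hp hm hA0 hpC hh).1).1 e1
  filter_upwards [e2, h3 (by linarith)] with v hv hl
  rw [hl, add_zero]
  have hμ := (maxwellian_pos u v).ne'
  rw [div_mul_eq_mul_div, div_eq_zero_iff] at hv
  exact hv.resolve_right hμ

/-- Near equilibrium the dissipation controls the weighted norm of the negative part. -/
theorem exists_integral_sq_le_dissipation (hb : AngularCutoff θ b) (u : E) (hA0 : 0 ≤ A) :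
    ∃ δ : ℝ≥0∞, 0 < δ ∧ ∃ C₁ : ℝ, 0 ≤ C₁ ∧ ∀ p h : E → ℝ, Measurable p → Measurable h → 0 ≤ p →
      0 ≤ h → (∀ᵐ v, |p v| ≤ C * sqrtM u v) →
      (∀ᵐ v, |h v| ≤ A * sqrtM u v * ((1 + ‖v - u‖ ^ 2) ^ 3)⁻¹) →
      ∫⁻ v, ‖p v - maxwellian u v‖ₑ ≤ δ →
      ∫ v, h v ^ 2 / maxwellian u v ≤ C₁ * ∫ v, dissipation θ b u p h v := by
  obtain ⟨K, hK0, hK⟩ := exists_lintegral_kern_sqrtM_le hb u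
  obtain ⟨N, hN0, hN⟩ := exists_gainKernel_le hb u
  obtain ⟨c, hc0, hc⟩ := exists_le_maxwellian u N
  obtain ⟨δ, hδ, c₁, hc₁, hgain⟩ := exists_le_gain hb u N
  obtain ⟨c₀, hc₀, hfreq⟩ := exists_le_freq hb u
  set C₂ := 8 * A * K * (1 + N) / c with hC₂
  have hC₂0 : 0 ≤ C₂ := by positivity
  -- The frequency is at least c₀. Coercivity contributes twice the L part and C₂ times the integral
  -- of h over bounded velocities; there Q⁺ ≥ c₁ and μ ≤ 1, so that integral is at most c₁⁻¹ times
  -- the gain part.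
  refine ⟨δ, hδ, c₀⁻¹ * (2 + C₂ * c₁⁻¹), by positivity, fun p h hp hm hp0 h0 hpC hh hclose => ?_⟩
  have hC := abs_le_of_decay hA0 hh
  have hμm : Measurable (maxwellian u) := (continuous_maxwellian u).measurable
  obtain ⟨i1, i2⟩ := integrable_dissipation hb hp hm hA0 hpC hh
  obtain ⟨e, h1, h2, -, hfin⟩ := dissipation_facts hb hp hm hp0 h0 hA0 hpC hh
  have hcoer := lintegral_freq_sq_le hb hK hK0.le hN0.le hN hc0 hc hm h0 hA0
    (hC.mono fun v hv => (le_abs_self _).trans hv) hfin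
  set Il := ∫ v, h v / maxwellian u v * lin θ b u h v
  set Ia := ∫ v, h v / maxwellian u v * Qplus (kern θ b) p p v with hIa
  have hloc : (∫⁻ v in {v | ‖v - u‖ ≤ N}, ENNReal.ofReal (h v)) ≤ ENNReal.ofReal (c₁⁻¹ * Ia) := by
    rw [hIa, ← integral_const_mul, ofReal_integral_eq_lintegral_ofReal (i1.const_mul _)
      (Eventually.of_forall fun v => mul_nonneg (inv_pos.2 hc₁).le (mul_nonneg
        (div_nonneg (h0 v) (maxwellian_pos u v).le) (Qplus_nonneg hb hp0 hp0 v)))]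
    refine le_trans (lintegral_mono_ae ?_) (setLIntegral_le_lintegral {v | ‖v - u‖ ≤ N} _)
    rw [ae_restrict_iff' (measurableSet_le (by fun_prop) measurable_const)]
    filter_upwards [ofReal_Qplus hb hK hp hp hp0 hp0 hpC hpC] with v hv hmem
    have h3 := hgain p hp hp0 hclose v hmem
    rw [← hv, ENNReal.ofReal_le_ofReal_iff (Qplus_nonneg hb hp0 hp0 v)] at h3
    refine ENNReal.ofReal_le_ofReal ?_
    have h4 : h v ≤ h v / maxwellian u v :=
      le_div_self (h0 v) (maxwellian_pos u v) (maxwellian_le_one u v)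
    calc h v = c₁⁻¹ * (h v * c₁) := by field_simp
      _ ≤ c₁⁻¹ * (h v / maxwellian u v * Qplus (kern θ b) p p v) := by
        have h5 : 0 ≤ h v / maxwellian u v := div_nonneg (h0 v) (maxwellian_pos u v).le
        gcongr
  have hsq0 : ∀ v, 0 ≤ h v ^ 2 / maxwellian u v := fun v =>
    div_nonneg (sq_nonneg _) (maxwellian_pos u v).le
  have hsqm : Measurable fun v => h v ^ 2 / maxwellian u v := (hm.pow_const 2).div hμm
  have hlow : ENNReal.ofReal c₀ * (∫⁻ v, ENNReal.ofReal (h v ^ 2 / maxwellian u v)) ≤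
      ENNReal.ofReal (2 * Il + C₂ * (c₁⁻¹ * Ia)) := by
    rw [← lintegral_const_mul _ hsqm.ennreal_ofReal,
      ENNReal.ofReal_add (by positivity) (by positivity), ENNReal.ofReal_mul hC₂0]
    refine le_trans (lintegral_mono fun v => ?_) (hcoer.trans
      (add_le_add le_rfl (mul_le_mul_right hloc _)))
    refine mul_le_mul_left ((ENNReal.ofReal_le_ofReal ?_).trans (hfreq v)) _
    exact le_mul_of_one_le_right hc₀.le
      (Real.one_le_rpow (by linarith [norm_nonneg (v - u)]) hb.theta_nonneg)
  rw [integral_eq_lintegral_of_nonneg_ae (Eventually.of_forall hsq0) hsqm.aestronglyMeasurable]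
  have h5 := ENNReal.toReal_mono ENNReal.ofReal_ne_top hlow
  rw [ENNReal.toReal_mul, ENNReal.toReal_ofReal hc₀.le, ENNReal.toReal_ofReal (by positivity)] at h5
  rw [e, mul_assoc]
  rw [← le_inv_mul_iff₀ hc₀] at h5
  refine h5.trans (mul_le_mul_of_nonneg_left ?_ (inv_pos.2 hc₀).le)
  have h6 : 0 ≤ C₂ * c₁⁻¹ := by positivity
  nlinarith [mul_nonneg h6 h2]

lemma sq_div_maxwellian_le {v : E}
    (hh : |h v| ≤ A * sqrtM u v * ((1 + ‖v - u‖ ^ 2) ^ 3)⁻¹) :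
    h v ^ 2 / maxwellian u v ≤ A ^ 2 * ((1 + ‖v - u‖ ^ 2) ^ 6)⁻¹ := by
  rw [div_le_iff₀ (maxwellian_pos u v), ← sqrtM_sq, ← sq_abs]
  have := sqrtM_pos u v
  calc |h v| ^ 2 ≤ (A * sqrtM u v * ((1 + ‖v - u‖ ^ 2) ^ 3)⁻¹) ^ 2 := by gcongr
    _ = _ := by rw [← inv_pow, ← inv_pow]; ring

/-- The weighted bound used for large velocities. -/
lemma pow_mul_sq_div_maxwellian_le {v : E}
    (hh : |h v| ≤ A * sqrtM u v * ((1 + ‖v - u‖ ^ 2) ^ 3)⁻¹) :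
    (1 + ‖v‖) ^ 8 * (h v ^ 2 / maxwellian u v) ≤
      16 * (1 + ‖u‖) ^ 8 * A ^ 2 * ((1 + ‖v - u‖ ^ 2) ^ 2)⁻¹ := by
  have h1 : 1 + ‖v‖ ≤ (1 + ‖u‖) * (1 + ‖v - u‖) := by
    have : ‖v‖ ≤ ‖v - u‖ + ‖u‖ := by simpa using norm_add_le (v - u) u
    nlinarith [mul_nonneg (norm_nonneg u) (norm_nonneg (v - u))]
  have h2 : (1 + ‖v - u‖) ^ 8 ≤ 16 * (1 + ‖v - u‖ ^ 2) ^ 4 := by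
    have := pow_le_pow_left₀ (sq_nonneg (1 + ‖v - u‖)) (one_add_sq_le ‖v - u‖) 4
    nlinarith
  calc (1 + ‖v‖) ^ 8 * (h v ^ 2 / maxwellian u v)
      ≤ ((1 + ‖u‖) * (1 + ‖v - u‖)) ^ 8 * (A ^ 2 * ((1 + ‖v - u‖ ^ 2) ^ 6)⁻¹) := by
        have h3 := sq_div_maxwellian_le hh
        have h4 : 0 ≤ h v ^ 2 / maxwellian u v := div_nonneg (sq_nonneg _) (maxwellian_pos u v).le
        gcongr
    _ = (1 + ‖u‖) ^ 8 * A ^ 2 * ((1 + ‖v - u‖) ^ 8 * ((1 + ‖v - u‖ ^ 2) ^ 6)⁻¹) := by ring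
    _ ≤ (1 + ‖u‖) ^ 8 * A ^ 2 * (16 * (1 + ‖v - u‖ ^ 2) ^ 4 * ((1 + ‖v - u‖ ^ 2) ^ 6)⁻¹) := by gcongr
    _ = _ := by field_simp

end Dissipation

/-! ### The weighted energy inequality in phase space. -/

/-- A solution of the modified problem whose negative part decays at large velocities. -/
structure DecayingSolution (Ω : Set E) (n : E → E) (θ : ℝ) (b : ℝ → ℝ) (ε : ℝ) (c : E)
    (F : E → E → ℝ) (A C : ℝ) : Prop where
  isOpen : IsOpen Ω
  isBounded : Bornology.IsBounded Ω
  normal : HasC2BoundaryWithInnerNormal Ω n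
  cutoff : AngularCutoff θ b
  eps_pos : 0 < ε
  solves : SolvesModifiedProblem Ω n (kern θ b) ε c F
  decay_nonneg : 0 ≤ A
  bound : ∀ᵐ p : E × E, p.1 ∈ gas Ω → |F p.1 p.2| ≤ C * sqrtM (ε • c) p.2
  decay : ∀ᵐ p : E × E, p.1 ∈ gas Ω →
    negP F p.1 p.2 ≤ A * sqrtM (ε • c) p.2 * ((1 + ‖p.2 - ε • c‖ ^ 2) ^ 3)⁻¹

/-- Lebesgue measure on the phase space of the gas. -/
def gasPhase (Ω : Set E) : Measure (E × E) := (volume.restrict (gas Ω)).prod volume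

section

variable {Ω : Set E} {n : E → E} {θ : ℝ} {b : ℝ → ℝ} {ε : ℝ} {c : E} {F : E → E → ℝ} {A C : ℝ}

lemma gasPhase_eq : gasPhase Ω = volume.restrict {p : E × E | p.1 ∈ gas Ω} := by
  have : {p : E × E | p.1 ∈ gas Ω} = gas Ω ×ˢ univ := by ext p; simp
  rw [this, gasPhase, Measure.volume_eq_prod, ← Measure.prod_restrict, Measure.restrict_univ]

lemma ae_gasPhase_iff {P : E × E → Prop} :
    (∀ᵐ p ∂(gasPhase Ω), P p) ↔ ∀ᵐ p : E × E, p.1 ∈ gas Ω → P p := by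
  have hD : MeasurableSet {p : E × E | p.1 ∈ gas Ω} := measurable_fst isOpen_gas.measurableSet
  rw [gasPhase_eq, ae_restrict_iff' hD]
  rfl


/-- The density of the weighted norm of the negative part. -/
def energyDensity (u : E) (F : E → E → ℝ) (p : E × E) : ℝ := negP F p.1 p.2 ^ 2 / maxwellian u p.2

/-- The dissipation density in phase space. -/
def phaseDissipation (θ : ℝ) (b : ℝ → ℝ) (u : E) (F : E → E → ℝ) (p : E × E) : ℝ :=
  dissipation θ b u (posP F p.1) (negP F p.1) p.2

lemma energyDensity_nonneg (u : E) (F : E → E → ℝ) (p : E × E) : 0 ≤ energyDensity u F p :=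
  div_nonneg (sq_nonneg _) (maxwellian_pos _ _).le

lemma measurable_energyDensity (u : E) (hm : Measurable (Function.uncurry F)) :
    Measurable (energyDensity u F) := by
  have h1 : Measurable fun p : E × E => negP F p.1 p.2 := measurable_negP hm
  exact (h1.pow_const 2).div ((continuous_maxwellian u).measurable.comp measurable_snd)

lemma measurable_phaseDissipation (hb : Measurable b) (u : E) (hm : Measurable (Function.uncurry F)) :
    Measurable (phaseDissipation θ b u F) := by
  have h1 : Measurable fun p : E × E => negP F p.1 p.2 := measurable_negP hm
  exact (h1.div ((continuous_maxwellian u).measurable.comp measurable_snd)).mul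
    ((measurable_Qplus hb (measurable_posP hm) (measurable_posP hm)).add
      (measurable_lin hb u (measurable_negP hm)))

/-- Where F ≥ 0 both sides vanish with F⁻; where F ≤ 0 the loss term is absent. The dissipation
therefore represents the production everywhere. -/
lemma negP_mul_modifiedRHS (θ : ℝ) (b : ℝ → ℝ) (ε : ℝ) (c : E) (F : E → E → ℝ) (p : E × E) :
    negP F p.1 p.2 * modifiedRHS (kern θ b) ε c F p.1 p.2 / maxwellian (ε • c) p.2 =
      ε⁻¹ * phaseDissipation θ b (ε • c) F p := by
  rw [phaseDissipation, dissipation]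
  rcases le_total (F p.1 p.2) 0 with h | h
  · rw [modifiedRHS_of_neg θ b ε c h]; ring
  · have h0 : negP F p.1 p.2 = 0 := max_eq_right (by linarith)
    rw [h0]; ring

lemma ae_restrict_gas {P : E → Prop} (h : ∀ᵐ x : E, x ∈ gas Ω → P x) :
    ∀ᵐ x ∂((volume : Measure E).restrict (gas Ω)), P x :=
  (ae_restrict_iff' isOpen_gas.measurableSet).2 h

namespace DecayingSolution

lemma abs_negP_le_decay (H : DecayingSolution Ω n θ b ε c F A C) : ∀ᵐ p : E × E, p.1 ∈ gas Ω →
    |negP F p.1 p.2| ≤ A * sqrtM (ε • c) p.2 * ((1 + ‖p.2 - ε • c‖ ^ 2) ^ 3)⁻¹ := by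
  filter_upwards [H.decay] with p hp hg
  rw [abs_of_nonneg (negP_nonneg F p.1 p.2)]
  exact hp hg

/-- The bounds hold in almost every slice. -/
lemma ae_bounds (H : DecayingSolution Ω n θ b ε c F A C) :
    ∀ᵐ x ∂((volume : Measure E).restrict (gas Ω)),
      (∀ᵐ v, |posP F x v| ≤ C * sqrtM (ε • c) v) ∧
      ∀ᵐ v, |negP F x v| ≤ A * sqrtM (ε • c) v * ((1 + ‖v - ε • c‖ ^ 2) ^ 3)⁻¹ := by
  refine ae_restrict_gas ?_
  filter_upwards [ae_slice H.bound, ae_slice H.abs_negP_le_decay] with x h1 h2 hg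
  exact ⟨(h1 hg).mono fun v hv => (abs_posP_le F x v).trans hv, h2 hg⟩

lemma energyDensity_le (H : DecayingSolution Ω n θ b ε c F A C) :
    ∀ᵐ p ∂(gasPhase Ω), (1 + ‖p.2‖) ^ 8 * energyDensity (ε • c) F p ≤
      16 * (1 + ‖ε • c‖) ^ 8 * A ^ 2 * ((1 + ‖p.2 - ε • c‖ ^ 2) ^ 2)⁻¹ := by
  rw [ae_gasPhase_iff]
  filter_upwards [H.abs_negP_le_decay] with p hp hg
  exact pow_mul_sq_div_maxwellian_le (h := negP F p.1) (hp hg)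

lemma exists_abs_phaseDissipation_le (H : DecayingSolution Ω n θ b ε c F A C) :
    ∃ k : ℝ, 0 ≤ k ∧ ∀ᵐ p ∂(gasPhase Ω), |phaseDissipation θ b (ε • c) F p| ≤
      k * ((1 + ‖p.2 - ε • c‖ ^ 2) ^ 2)⁻¹ := by
  obtain ⟨K, hK0, hK⟩ := exists_lintegral_kern_sqrtM_le H.cutoff (ε • c)
  have hA0 := H.decay_nonneg
  refine ⟨2 * A * K * (C ^ 2 + 4 * A), by positivity, ?_⟩
  have hm := H.solves.measurable
  rw [ae_gasPhase_iff]
  refine ae_of_slice (measurableSet_le (measurable_phaseDissipation H.cutoff.meas _ hm).abs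
    (by fun_prop)) ?_
  have := H.ae_bounds
  rw [ae_restrict_iff' isOpen_gas.measurableSet] at this
  filter_upwards [this] with x hx hg
  filter_upwards [abs_dissipation_le H.cutoff hK hK0.le (measurable_section (measurable_posP hm) x)
    (measurable_section (measurable_negP hm) x) hA0 (hx hg).1 (hx hg).2] with v hv
  refine le_trans ?_ hv
  rw [phaseDissipation, dissipation, mul_add]
  exact abs_add_le _ _

/-- The energy inequality for the weighted norm of the negative part. -/
theorem production_le (H : DecayingSolution Ω n θ b ε c F A C) {ψ ψ' : E × E → ℝ}
    (hψm : Measurable ψ) (hψm' : Measurable ψ') (hψ0 : ∀ p, 0 ≤ ψ p)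
    (hψ : ∀ p s, HasDerivAt (fun s => ψ (flow s p)) (ψ' (flow s p)) s)
    (hψc : ∀ p, Continuous fun s => ψ' (flow s p))
    (hU : Integrable (fun p => energyDensity (ε • c) F p * ψ p) (gasPhase Ω))
    (hU' : Integrable (fun p => energyDensity (ε • c) F p * ψ' p) (gasPhase Ω))
    (hD : Integrable (fun p => phaseDissipation θ b (ε • c) F p * ψ p) (gasPhase Ω)) :
    2 * ε⁻¹ * ∫ p, phaseDissipation θ b (ε • c) F p * ψ p ∂(gasPhase Ω) ≤
      ∫ p, energyDensity (ε • c) F p * ψ' p ∂(gasPhase Ω) := by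
  have hμm : Measurable fun p : E × E => maxwellian (ε • c) p.2 :=
    (continuous_maxwellian _).measurable.comp measurable_snd
  have hm := H.solves.measurable
  have e1 : ∀ p : E × E, negP F p.1 p.2 ^ 2 * (ψ p / maxwellian (ε • c) p.2) =
      energyDensity (ε • c) F p * ψ p := fun p => by rw [energyDensity]; ring
  have e2 : ∀ p : E × E, -2 * negP F p.1 p.2 * modifiedRHS (kern θ b) ε c F p.1 p.2 *
      (ψ p / maxwellian (ε • c) p.2) + negP F p.1 p.2 ^ 2 * (ψ' p / maxwellian (ε • c) p.2) =
      -(2 * ε⁻¹) * (phaseDissipation θ b (ε • c) F p * ψ p) + energyDensity (ε • c) F p * ψ' p := by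
    intro p
    have := negP_mul_modifiedRHS θ b ε c F p
    rw [energyDensity]
    linear_combination (-2 * ψ p) * this
  have hi : Integrable (fun p => -(2 * ε⁻¹) * (phaseDissipation θ b (ε • c) F p * ψ p) +
      energyDensity (ε • c) F p * ψ' p) (gasPhase Ω) := (hD.const_mul _).add hU'
  have h := integral_production_nonneg (χ := fun p => ψ p / maxwellian (ε • c) p.2)
    (χ' := fun p => ψ' p / maxwellian (ε • c) p.2) H.isOpen H.isBounded H.normal
    (fun x => posP_nonneg F x) H.solves.traces H.solves.inflow H.solves.transport hm
    (measurable_modifiedRHS H.cutoff.meas hm) (hψm.div hμm) (hψm'.div hμm)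
    (fun p => div_nonneg (hψ0 p) (maxwellian_pos _ _).le) (fun p s => (hψ p s).div_const (maxwellian (ε • c) p.2))
    (fun p => (hψc p).div_const (maxwellian (ε • c) p.2)) (by
      simp only [e1]; rw [IntegrableOn, ← gasPhase_eq]; exact hU) (by
      simp only [e2]; rw [IntegrableOn, ← gasPhase_eq]; exact hi)
  simp only [e2] at h
  rw [← gasPhase_eq, integral_add (hD.const_mul _) hU', integral_const_mul] at h
  linarith

end DecayingSolution

end

/-! ### Spatial cutoff. -/

section Cutoff

/-- A `C¹` cutoff supported in the ball of radius `R`. -/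
def cutoffBall (R : ℝ) (x : E) : ℝ := max (-(‖x‖ ^ 2 / R ^ 2 - 1)) 0 ^ 2

/-- The derivative of `cutoffBall` along the free flow. -/
def cutoffBallDeriv (R : ℝ) (p : E × E) : ℝ :=
  -2 * max (-(‖p.1‖ ^ 2 / R ^ 2 - 1)) 0 * (2 * ⟪p.1, p.2⟫_ℝ / R ^ 2)

lemma hasDerivAt_cutoffBall (R : ℝ) (p : E × E) (s : ℝ) :
    HasDerivAt (fun s => cutoffBall R (flow s p).1) (cutoffBallDeriv R (flow s p)) s := by
  have h1 : HasDerivAt (fun s : ℝ => p.1 + s • p.2) p.2 s := by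
    simpa using ((hasDerivAt_id s).smul_const p.2).const_add p.1
  have h2 := (h1.norm_sq.div_const (R ^ 2)).sub_const 1
  exact (hasDerivAt_sq_negPart _).comp s h2

lemma cutoffBall_nonneg (R : ℝ) (x : E) : 0 ≤ cutoffBall R x := sq_nonneg _

lemma cutoffBall_factor_le_one (R : ℝ) (x : E) : max (-(‖x‖ ^ 2 / R ^ 2 - 1)) 0 ≤ 1 :=
  max_le (by have : 0 ≤ ‖x‖ ^ 2 / R ^ 2 := by positivity
             linarith) zero_le_one

lemma cutoffBall_factor_eq_zero {R : ℝ} (hR : 0 < R) {x : E} (hx : x ∉ Metric.closedBall (0 : E) R) :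
    max (-(‖x‖ ^ 2 / R ^ 2 - 1)) 0 = 0 := by
  rw [mem_closedBall_zero_iff, not_le] at hx
  refine max_eq_right ?_
  have : 1 ≤ ‖x‖ ^ 2 / R ^ 2 := by
    rw [le_div_iff₀ (by positivity), one_mul]
    gcongr
  linarith

lemma cutoffBall_eq_zero {R : ℝ} (hR : 0 < R) {x : E} (hx : x ∉ Metric.closedBall (0 : E) R) :
    cutoffBall R x = 0 := by
  rw [cutoffBall, cutoffBall_factor_eq_zero hR hx]; simp

lemma cutoffBall_le_one (R : ℝ) (x : E) : cutoffBall R x ≤ 1 :=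
  pow_le_one₀ (le_max_right _ _) (cutoffBall_factor_le_one R x)

lemma half_le_cutoffBall {R : ℝ} (hR : 0 < R) {x : E} (hx : x ∈ Metric.closedBall (0 : E) (R / 4)) :
    1 / 2 ≤ cutoffBall R x := by
  rw [mem_closedBall_zero_iff] at hx
  have h1 : ‖x‖ ^ 2 / R ^ 2 ≤ 1 / 16 := by
    rw [div_le_iff₀ (by positivity)]
    calc ‖x‖ ^ 2 ≤ (R / 4) ^ 2 := by gcongr
      _ = _ := by ring
  have h2 : 15 / 16 ≤ max (-(‖x‖ ^ 2 / R ^ 2 - 1)) 0 := le_trans (by linarith) (le_max_left _ _)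
  rw [cutoffBall]
  nlinarith

lemma abs_cutoffBallDeriv_le {R : ℝ} (hR : 0 < R) (p : E × E) :
    |cutoffBallDeriv R p| ≤
      (Metric.closedBall (0 : E) R).indicator (fun _ => 4 * ‖p.2‖ / R) p.1 := by
  by_cases hx : p.1 ∈ Metric.closedBall (0 : E) R
  · rw [indicator_of_mem hx]
    rw [mem_closedBall_zero_iff] at hx
    have h1 := cutoffBall_factor_le_one R p.1
    have h0 : 0 ≤ max (-(‖p.1‖ ^ 2 / R ^ 2 - 1)) 0 := le_max_right _ _
    rw [cutoffBallDeriv, abs_mul, abs_mul, abs_div, abs_mul, abs_of_nonneg h0,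
      abs_of_nonneg (sq_nonneg R)]
    have h2 : |⟪p.1, p.2⟫_ℝ| ≤ R * ‖p.2‖ := (abs_real_inner_le_norm _ _).trans (by gcongr)
    norm_num
    calc 2 * max (1 - ‖p.1‖ ^ 2 / R ^ 2) 0 * (2 * |⟪p.1, p.2⟫_ℝ| / R ^ 2)
        ≤ 2 * 1 * (2 * (R * ‖p.2‖) / R ^ 2) := by
          rw [neg_sub] at h1
          gcongr
      _ = 4 * ‖p.2‖ / R := by field_simp; ring
  · rw [indicator_of_notMem hx, cutoffBallDeriv, cutoffBall_factor_eq_zero hR hx]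
    simp

/-- Splitting of the transport term into small and large velocities. -/
lemma four_mul_div_sq_le {ρ r : ℝ} (hρ : 0 < ρ) (hr : 0 ≤ r) :
    4 * r / ρ ^ 2 ≤ 4 / ρ + 4 / ρ ^ 8 * (1 + r) ^ 8 := by
  rcases le_total r ρ with h | h
  · have h1 : 4 * r / ρ ^ 2 ≤ 4 / ρ := by
      rw [div_le_div_iff₀ (by positivity) hρ]
      nlinarith [mul_le_mul_of_nonneg_right h hρ.le]
    have h2 : 0 ≤ 4 / ρ ^ 8 * (1 + r) ^ 8 := by positivity
    linarith
  · have h1 : 4 * r / ρ ^ 2 ≤ 4 / ρ ^ 8 * (1 + r) ^ 8 := by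
      rw [div_mul_eq_mul_div, div_le_div_iff₀ (by positivity) (by positivity)]
      have h2 : ρ ^ 6 ≤ (1 + r) ^ 6 := pow_le_pow_left₀ hρ.le (by linarith) 6
      have h3 : r ≤ (1 + r) ^ 2 := by nlinarith
      calc 4 * r * ρ ^ 8 = 4 * (r * ρ ^ 6) * ρ ^ 2 := by ring
        _ ≤ 4 * ((1 + r) ^ 2 * (1 + r) ^ 6) * ρ ^ 2 := by gcongr
        _ = _ := by ring
    have h2 : 0 ≤ 4 / ρ := by positivity
    linarith

end Cutoff

/-! ### The energy inequality on balls. -/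

section

variable {Ω : Set E} {n : E → E} {θ : ℝ} {b : ℝ → ℝ} {ε : ℝ} {c : E} {F : E → E → ℝ} {A C : ℝ}

/-- Lebesgue measure on the part of the gas in a ball. -/
def gasBall (Ω : Set E) (R : ℝ) : Measure E :=
  (volume.restrict (gas Ω)).restrict (Metric.closedBall 0 R)

instance (Ω : Set E) (R : ℝ) : IsFiniteMeasure (gasBall Ω R) := by
  refine ⟨?_⟩
  rw [gasBall, Measure.restrict_apply_univ]
  exact (Measure.restrict_apply_le _ _).trans_lt measure_closedBall_lt_top

lemma gasBall_prod (R : ℝ) : (gasBall Ω R).prod (volume : Measure E) =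
    (gasPhase Ω).restrict (Metric.closedBall 0 R ×ˢ univ) := by
  rw [gasBall, gasPhase, ← Measure.prod_restrict, Measure.restrict_univ]

lemma integrable_gasBall_prod {f : E × E → ℝ} {k R : ℝ} (u : E) (hf : Measurable f)
    (hle : ∀ᵐ p ∂(gasPhase Ω), |f p| ≤ k * ((1 + ‖p.2 - u‖ ^ 2) ^ 2)⁻¹) :
    Integrable f ((gasBall Ω R).prod volume) := by
  refine ((integrable_const (μ := gasBall Ω R) k).mul_prod (integrable_inv_sq u)).mono'
    hf.aestronglyMeasurable ?_
  rw [gasBall_prod]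
  exact ae_restrict_of_ae hle

lemma integral_gasPhase_eq_gasBall {f : E × E → ℝ} {R : ℝ}
    (h0 : ∀ p : E × E, p.1 ∉ Metric.closedBall (0 : E) R → f p = 0) :
    ∫ p, f p ∂(gasPhase Ω) = ∫ p, f p ∂((gasBall Ω R).prod volume) := by
  rw [gasBall_prod]
  refine (setIntegral_eq_integral_of_forall_compl_eq_zero fun p hp => h0 p fun hc => hp ?_).symm
  exact ⟨hc, mem_univ _⟩

lemma integrable_gasPhase_of_gasBall {f : E × E → ℝ} {R : ℝ}
    (h0 : ∀ p : E × E, p.1 ∉ Metric.closedBall (0 : E) R → f p = 0)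
    (hi : Integrable f ((gasBall Ω R).prod volume)) : Integrable f (gasPhase Ω) := by
  rw [gasBall_prod] at hi
  refine (integrableOn_iff_integrable_of_support_subset (s := Metric.closedBall (0 : E) R ×ˢ univ)
    fun p hp => ?_).1 hi
  by_contra hc
  exact hp (h0 p fun h => hc ⟨h, mem_univ _⟩)

namespace DecayingSolution

/-- The dissipation at a point. -/
def totalDissipation (θ : ℝ) (b : ℝ → ℝ) (u : E) (F : E → E → ℝ) (x : E) : ℝ :=
  ∫ v, phaseDissipation θ b u F (x, v)

/-- The weighted norm of the negative part at a point. -/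
def totalEnergy (u : E) (F : E → E → ℝ) (x : E) : ℝ := ∫ v, energyDensity u F (x, v)

lemma ae_totalDissipation_nonneg (H : DecayingSolution Ω n θ b ε c F A C) :
    ∀ᵐ x ∂((volume : Measure E).restrict (gas Ω)), 0 ≤ totalDissipation θ b (ε • c) F x := by
  filter_upwards [H.ae_bounds] with x hx
  have hm := H.solves.measurable
  obtain ⟨e, h1, h2, -⟩ := dissipation_facts H.cutoff (measurable_section (measurable_posP hm) x)
    (measurable_section (measurable_negP hm) x) (posP_nonneg F x) (negP_nonneg F x) H.decay_nonneg
    hx.1 hx.2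
  change 0 ≤ ∫ v, dissipation θ b (ε • c) (posP F x) (negP F x) v
  rw [e]
  exact add_nonneg h1 h2

lemma energyDensity_le' (H : DecayingSolution Ω n θ b ε c F A C) :
    ∀ᵐ p ∂(gasPhase Ω), energyDensity (ε • c) F p ≤
      16 * (1 + ‖ε • c‖) ^ 8 * A ^ 2 * ((1 + ‖p.2 - ε • c‖ ^ 2) ^ 2)⁻¹ := by
  filter_upwards [H.energyDensity_le] with p hp
  refine le_trans (le_mul_of_one_le_left (energyDensity_nonneg _ _ _) ?_) hp
  exact one_le_pow₀ (by linarith [norm_nonneg p.2])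

/-- The localized energy inequality. -/
theorem integral_gasBall_le (H : DecayingSolution Ω n θ b ε c F A C) :
    ∃ k : ℝ, 0 ≤ k ∧ ∀ ρ : ℝ, 0 < ρ →
      ε⁻¹ * ∫ x, totalDissipation θ b (ε • c) F x ∂(gasBall Ω (ρ ^ 2 / 4)) ≤
        ∫ x, (4 / ρ * totalEnergy (ε • c) F x + k / ρ ^ 8) ∂(gasBall Ω (ρ ^ 2)) := by
  set u := ε • c with hu
  set k₀ := 16 * (1 + ‖u‖) ^ 8 * A ^ 2 with hk₀
  have hk₀0 : 0 ≤ k₀ := by positivity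
  set J := ∫ v : E, ((1 + ‖v - u‖ ^ 2) ^ 2)⁻¹ with hJ
  have hJ0 : 0 ≤ J := integral_nonneg fun v => by positivity
  refine ⟨4 * k₀ * J, by positivity, fun ρ hρ => ?_⟩
  have hR : 0 < ρ ^ 2 := by positivity
  have hm := H.solves.measurable
  have heε := inv_pos.2 H.eps_pos
  obtain ⟨kd, hkd0, hkd⟩ := H.exists_abs_phaseDissipation_le
  have hem : Measurable (energyDensity u F) := measurable_energyDensity u hm
  have hdm : Measurable (phaseDissipation θ b u F) := measurable_phaseDissipation H.cutoff.meas u hm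
  have hei : Integrable (energyDensity u F) ((gasBall Ω (ρ ^ 2)).prod volume) := by
    refine integrable_gasBall_prod u hem (k := k₀) ?_
    filter_upwards [H.energyDensity_le'] with p hp
    rwa [abs_of_nonneg (energyDensity_nonneg _ _ _)]
  have hdi : Integrable (phaseDissipation θ b u F) ((gasBall Ω (ρ ^ 2)).prod volume) :=
    integrable_gasBall_prod u hdm hkd
  have hwi : Integrable (fun p : E × E => (1 + ‖p.2‖) ^ 8 * energyDensity u F p)
      ((gasBall Ω (ρ ^ 2)).prod volume) := by
    refine integrable_gasBall_prod u (Measurable.mul (by fun_prop) hem) (k := k₀) ?_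
    filter_upwards [H.energyDensity_le] with p hp
    rwa [abs_of_nonneg (mul_nonneg (by positivity) (energyDensity_nonneg _ _ _))]
  have hcm : Measurable fun p : E × E => cutoffBall (ρ ^ 2) p.1 := by unfold cutoffBall; fun_prop
  have hcm' : Measurable (cutoffBallDeriv (ρ ^ 2)) := by unfold cutoffBallDeriv; fun_prop
  have hbig : Integrable (fun p : E × E => 4 / ρ * energyDensity u F p +
      4 / ρ ^ 8 * ((1 + ‖p.2‖) ^ 8 * energyDensity u F p)) ((gasBall Ω (ρ ^ 2)).prod volume) :=
    (hei.const_mul _).add (hwi.const_mul _)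
  -- A cutoff at radius ρ² has derivative at most 4|v|/ρ² along the flow: at most 4/ρ for |v| ≤ ρ,
  -- while larger velocities are paid for by the moment of order 8. The resulting ρ⁻⁸ beats the
  -- volume ρ⁶ of the ball.
  have hptw : ∀ p : E × E, |energyDensity u F p * cutoffBallDeriv (ρ ^ 2) p| ≤
      4 / ρ * energyDensity u F p + 4 / ρ ^ 8 * ((1 + ‖p.2‖) ^ 8 * energyDensity u F p) := by
    intro p
    have h0 := energyDensity_nonneg u F p
    have h1 : |cutoffBallDeriv (ρ ^ 2) p| ≤ 4 / ρ + 4 / ρ ^ 8 * (1 + ‖p.2‖) ^ 8 := by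
      refine (abs_cutoffBallDeriv_le hR p).trans ((indicator_le_self' (fun _ _ => ?_) _).trans
        (four_mul_div_sq_le hρ (norm_nonneg _)))
      positivity
    rw [abs_mul, abs_of_nonneg h0]
    calc _ ≤ energyDensity u F p * (4 / ρ + 4 / ρ ^ 8 * (1 + ‖p.2‖) ^ 8) := by gcongr
      _ = _ := by ring
  have hsupp : ∀ f : E × E → ℝ, ∀ p : E × E, p.1 ∉ Metric.closedBall (0 : E) (ρ ^ 2) →
      f p * cutoffBall (ρ ^ 2) p.1 = 0 := fun f p hp => by rw [cutoffBall_eq_zero hR hp, mul_zero]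
  have hsupp' : ∀ p : E × E, p.1 ∉ Metric.closedBall (0 : E) (ρ ^ 2) →
      energyDensity u F p * cutoffBallDeriv (ρ ^ 2) p = 0 := fun p hp => by
    rw [cutoffBallDeriv, cutoffBall_factor_eq_zero hR hp]; ring
  have hcut : ∀ f : E × E → ℝ, Measurable f → Integrable f ((gasBall Ω (ρ ^ 2)).prod volume) →
      Integrable (fun p => f p * cutoffBall (ρ ^ 2) p.1) ((gasBall Ω (ρ ^ 2)).prod volume) := by
    intro f hf hfi
    refine hfi.mono (hf.mul hcm).aestronglyMeasurable (Eventually.of_forall fun p => ?_)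
    rw [norm_mul, Real.norm_of_nonneg (cutoffBall_nonneg _ _)]
    exact mul_le_of_le_one_right (norm_nonneg _) (cutoffBall_le_one _ _)
  have hdi' : Integrable (fun p => energyDensity u F p * cutoffBallDeriv (ρ ^ 2) p)
      ((gasBall Ω (ρ ^ 2)).prod volume) :=
    hbig.mono' (hem.mul hcm').aestronglyMeasurable (Eventually.of_forall hptw)
  have hprod := H.production_le (ψ := fun p => cutoffBall (ρ ^ 2) p.1)
    (ψ' := cutoffBallDeriv (ρ ^ 2)) hcm hcm' (fun p => cutoffBall_nonneg _ _)
    (hasDerivAt_cutoffBall _) (fun p => by unfold cutoffBallDeriv flow; fun_prop)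
    (integrable_gasPhase_of_gasBall (hsupp _) (hcut _ hem hei))
    (integrable_gasPhase_of_gasBall hsupp' hdi')
    (integrable_gasPhase_of_gasBall (hsupp _) (hcut _ hdm hdi))
  rw [integral_gasPhase_eq_gasBall (hsupp _), integral_gasPhase_eq_gasBall hsupp',
    integral_prod _ (hcut _ hdm hdi)] at hprod
  have hright : ∫ p, energyDensity u F p * cutoffBallDeriv (ρ ^ 2) p
      ∂((gasBall Ω (ρ ^ 2)).prod volume) ≤
      ∫ x, (4 / ρ * totalEnergy u F x + 4 * k₀ * J / ρ ^ 8) ∂(gasBall Ω (ρ ^ 2)) := by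
    refine (integral_mono hdi' hbig fun p => (le_abs_self _).trans (hptw p)).trans ?_
    rw [integral_prod _ hbig]
    refine integral_mono_ae hbig.integral_prod_left
      ((hei.integral_prod_left.const_mul _).add (integrable_const _)) ?_
    have hle : ∀ᵐ x ∂(gasBall Ω (ρ ^ 2)), ∀ᵐ v : E, (1 + ‖v‖) ^ 8 * energyDensity u F (x, v) ≤
        k₀ * ((1 + ‖v - u‖ ^ 2) ^ 2)⁻¹ :=
      ae_restrict_of_ae (Measure.ae_ae_of_ae_prod H.energyDensity_le)
    filter_upwards [hei.prod_right_ae, hwi.prod_right_ae, hle] with x h1 h2 h3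
    change ∫ v, (4 / ρ * energyDensity u F (x, v) +
      4 / ρ ^ 8 * ((1 + ‖v‖) ^ 8 * energyDensity u F (x, v))) ≤ _
    rw [integral_add (h1.const_mul _) (h2.const_mul _), integral_const_mul, integral_const_mul]
    refine add_le_add le_rfl ?_
    have h4 := integral_mono_ae h2 ((integrable_inv_sq u).const_mul k₀) h3
    rw [integral_const_mul, ← hJ] at h4
    calc _ ≤ 4 / ρ ^ 8 * (k₀ * J) := by gcongr
      _ = _ := by ring
  -- The dissipation has a sign only after integration in v. As the cutoff depends on x alone, it
  -- can be bounded below by 1/2 on the smaller ball after that integration.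
  have hleft : 1 / 2 * ∫ x, totalDissipation θ b u F x ∂(gasBall Ω (ρ ^ 2 / 4)) ≤
      ∫ x, (∫ v, phaseDissipation θ b u F (x, v) * cutoffBall (ρ ^ 2) x) ∂(gasBall Ω (ρ ^ 2)) := by
    have hsub : Metric.closedBall (0 : E) (ρ ^ 2 / 4) ⊆ Metric.closedBall 0 (ρ ^ 2) :=
      Metric.closedBall_subset_closedBall (by linarith)
    have hg : gasBall Ω (ρ ^ 2 / 4) = (gasBall Ω (ρ ^ 2)).restrict (Metric.closedBall 0 (ρ ^ 2 / 4)) := by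
      conv_rhs => rw [gasBall, Measure.restrict_restrict Metric.isClosed_closedBall.measurableSet,
        inter_eq_left.2 hsub]
      rfl
    have hn : ∀ᵐ x ∂(gasBall Ω (ρ ^ 2)), 0 ≤ totalDissipation θ b u F x :=
      ae_restrict_of_ae H.ae_totalDissipation_nonneg
    have hi1 : Integrable (fun x => totalDissipation θ b u F x * cutoffBall (ρ ^ 2) x)
        (gasBall Ω (ρ ^ 2)) := by
      have := (hcut _ hdm hdi).integral_prod_left
      simp only [integral_mul_const] at this
      exact this
    simp only [integral_mul_const]
    rw [hg, ← integral_const_mul]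
    refine le_trans ?_ (setIntegral_le_integral (s := Metric.closedBall 0 (ρ ^ 2 / 4)) hi1
      (hn.mono fun x hx => mul_nonneg hx (cutoffBall_nonneg _ _)))
    refine setIntegral_mono_on_ae (hdi.integral_prod_left.const_mul _).integrableOn hi1.integrableOn
      Metric.isClosed_closedBall.measurableSet ?_
    filter_upwards [hn] with x hx hmem
    rw [mul_comm]
    exact mul_le_mul_of_nonneg_left (half_le_cutoffBall hR hmem) hx
  refine le_trans ?_ (hprod.trans hright)
  calc _ = 2 * ε⁻¹ * (1 / 2 * ∫ x, totalDissipation θ b u F x ∂(gasBall Ω (ρ ^ 2 / 4))) := by ring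
    _ ≤ _ := mul_le_mul_of_nonneg_left hleft (by positivity)

end DecayingSolution

end

/-! ### A contracting recursion. -/

section Recursion

/-- Inserting growth x^(j+1) into the right side gains the factor 2^(-j). The condition x ≥ 1 lets
the additive 1 be absorbed into x^j. -/
lemma exists_le_half_pow {a : ℕ → ℝ} {C x : ℝ} (ha0 : ∀ j, 0 ≤ a j) (hC : 0 ≤ C) (hx : 1 ≤ x)
    (hrec : ∀ j, a j ≤ C / 2 ^ j * (a (j + 1) + 1)) (h : ∃ C' : ℝ, ∀ j, a j ≤ C' * x ^ j) :
    ∃ C' : ℝ, ∀ j, a j ≤ C' * (x / 2) ^ j := by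
  obtain ⟨C', hC'⟩ := h
  have h0 : 0 ≤ C' := by simpa using (ha0 0).trans (hC' 0)
  refine ⟨C * (C' * x + 1), fun j => (hrec j).trans ?_⟩
  have h1 : a (j + 1) + 1 ≤ (C' * x + 1) * x ^ j := by
    have h2 := hC' (j + 1)
    have h3 : 1 ≤ x ^ j := one_le_pow₀ hx
    rw [pow_succ] at h2
    linarith
  calc C / 2 ^ j * (a (j + 1) + 1) ≤ C / 2 ^ j * ((C' * x + 1) * x ^ j) := by gcongr
    _ = _ := by rw [div_pow]; ring

/-- A monotone sequence of polynomial growth in `4 ^ j` that satisfies a contracting recursion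
vanishes. -/
theorem eq_zero_of_recursion {a : ℕ → ℝ} {C : ℝ} (ha0 : ∀ j, 0 ≤ a j) (hmono : Monotone a)
    (hC : 0 ≤ C) (hrec : ∀ j, a j ≤ C / 2 ^ j * (a (j + 1) + 1))
    (hgrow : ∃ C' : ℝ, ∀ j, a j ≤ C' * 64 ^ j) (j : ℕ) : a j = 0 := by
  -- Seven halvings take the base from 64 to 1/2; each is applied with a base at least 1.
  have h : ∃ C' : ℝ, ∀ j, a j ≤ C' * (1 / 2) ^ j := by
    have h6 := exists_le_half_pow ha0 hC (by norm_num) hrec hgrow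
    have h5 := exists_le_half_pow ha0 hC (by norm_num) hrec h6
    have h4 := exists_le_half_pow ha0 hC (by norm_num) hrec h5
    have h3 := exists_le_half_pow ha0 hC (by norm_num) hrec h4
    have h2 := exists_le_half_pow ha0 hC (by norm_num) hrec h3
    have h1 := exists_le_half_pow ha0 hC (by norm_num) hrec h2
    have h0 := exists_le_half_pow ha0 hC (by norm_num) hrec h1
    norm_num at h0 ⊢
    exact h0
  obtain ⟨C', hC'⟩ := h
  refine le_antisymm ?_ (ha0 j)
  have h1 : Tendsto (fun i : ℕ => C' * (1 / 2 : ℝ) ^ (j + i)) atTop (𝓝 (C' * 0)) := by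
    refine Tendsto.const_mul _ ?_
    have := tendsto_pow_atTop_nhds_zero_of_lt_one (by norm_num : (0 : ℝ) ≤ 1 / 2) (by norm_num)
    exact this.comp (tendsto_add_atTop_nat j |>.congr fun i => add_comm i j)
  rw [mul_zero] at h1
  exact ge_of_tendsto' h1 fun i => (hmono (Nat.le_add_right j i)).trans (hC' _)

end Recursion

/-! ### Vanishing of the dissipation. -/

section

variable {Ω : Set E} {n : E → E} {θ : ℝ} {b : ℝ → ℝ} {ε : ℝ} {c : E} {F : E → E → ℝ} {A C : ℝ}

lemma gasBall_real_le (Ω : Set E) {R : ℝ} (hR : 0 ≤ R) :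
    (gasBall Ω R).real univ ≤ R ^ 3 * (volume : Measure E).real (Metric.closedBall 0 1) := by
  rw [gasBall, measureReal_restrict_apply_univ]
  have h1 : ((volume : Measure E).restrict (gas Ω)).real (Metric.closedBall 0 R) ≤
      (volume : Measure E).real (Metric.closedBall 0 R) :=
    ENNReal.toReal_mono measure_closedBall_lt_top.ne (Measure.restrict_apply_le _ _)
  refine h1.trans (le_of_eq ?_)
  have h2 := Measure.addHaar_real_closedBall' (volume : Measure E) 0 hR
  rwa [finrank_euclideanSpace_fin] at h2

lemma lintegral_posP_sub_le (u : E) (F : E → E → ℝ) (x : E) :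
    ∫⁻ v, ‖posP F x v - maxwellian u v‖ₑ ≤ ∫⁻ v, ‖F x v - maxwellian u v‖ₑ := by
  refine lintegral_mono fun v => ?_
  refine enorm_le_iff_norm_le.2 ?_
  rw [Real.norm_eq_abs, Real.norm_eq_abs]
  have := abs_max_sub_max_le_abs (F x v) (maxwellian u v) 0
  rwa [max_eq_left (maxwellian_pos u v).le] at this

namespace DecayingSolution

lemma exists_totalEnergy_le_const (H : DecayingSolution Ω n θ b ε c F A C) :
    ∃ k : ℝ, 0 ≤ k ∧ ∀ᵐ x ∂((volume : Measure E).restrict (gas Ω)),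
      Integrable (fun v => energyDensity (ε • c) F (x, v)) ∧ totalEnergy (ε • c) F x ≤ k := by
  have hi := (integrable_inv_sq (ε • c)).const_mul (16 * (1 + ‖ε • c‖) ^ 8 * A ^ 2)
  refine ⟨∫ v, 16 * (1 + ‖ε • c‖) ^ 8 * A ^ 2 * ((1 + ‖v - ε • c‖ ^ 2) ^ 2)⁻¹,
    integral_nonneg fun v => by positivity, ?_⟩
  filter_upwards [Measure.ae_ae_of_ae_prod H.energyDensity_le'] with x hx
  have hm := (measurable_energyDensity (ε • c) H.solves.measurable).comp
    (measurable_prodMk_left (x := x))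
  have h1 : Integrable (fun v => energyDensity (ε • c) F (x, v)) := by
    refine hi.mono' hm.aestronglyMeasurable ?_
    filter_upwards [hx] with v hv
    rwa [Real.norm_of_nonneg (energyDensity_nonneg _ _ _)]
  exact ⟨h1, integral_mono_ae h1 hi hx⟩

/-- Away from a set of finite measure the dissipation controls the energy. -/
theorem exists_totalEnergy_le (H : DecayingSolution Ω n θ b ε c F A C) :
    ∃ k : ℝ, 0 ≤ k ∧ ∃ C₁ : ℝ, 0 ≤ C₁ ∧ ∃ s : Set E, MeasurableSet s ∧
      (volume : Measure E).restrict (gas Ω) s < ∞ ∧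
      ∀ᵐ x ∂((volume : Measure E).restrict (gas Ω)),
        totalEnergy (ε • c) F x ≤
          C₁ * totalDissipation θ b (ε • c) F x + s.indicator (fun _ => k) x := by
  obtain ⟨k, hk0, hk⟩ := H.exists_totalEnergy_le_const
  obtain ⟨δ, hδ, C₁, hC₁, hcoer⟩ :=
    exists_integral_sq_le_dissipation (C := C) H.cutoff (ε • c) H.decay_nonneg
  have hm := H.solves.measurable
  have hmeas : Measurable fun x => ∫⁻ v, ‖F x v - maxwellian (ε • c) v‖ₑ := by
    refine Measurable.lintegral_prod_right' (f := fun p : E × E => ‖F p.1 p.2 - maxwellian (ε • c) p.2‖ₑ) ?_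
    have h1 : Measurable fun p : E × E => F p.1 p.2 := hm
    exact (h1.sub ((continuous_maxwellian _).measurable.comp measurable_snd)).enorm
  have hsm : MeasurableSet {x | δ < ∫⁻ v, ‖F x v - maxwellian (ε • c) v‖ₑ} :=
    measurableSet_lt measurable_const hmeas
  refine ⟨k, hk0, C₁, hC₁, _, hsm, ?_, ?_⟩
  · rw [Measure.restrict_apply hsm]
    refine lt_of_le_of_lt (measure_mono fun x hx => ?_) (H.solves.infinity δ hδ)
    exact ⟨hx.2, hx.1⟩
  -- Where F is δ-far from μ in L¹, a set of finite measure in the gas, the uniform bound k is used.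
  -- Elsewhere F⁺ is at least as close to μ as F, and coercivity applies.
  · filter_upwards [hk, H.ae_bounds, H.ae_totalDissipation_nonneg] with x h1 h2 h3
    by_cases hx : δ < ∫⁻ v, ‖F x v - maxwellian (ε • c) v‖ₑ
    · rw [indicator_of_mem (by exact hx)]
      have := mul_nonneg hC₁ h3
      linarith [h1.2]
    · rw [indicator_of_notMem (by exact hx), add_zero]
      exact hcoer _ _ (measurable_section (measurable_posP hm) x)
        (measurable_section (measurable_negP hm) x) (posP_nonneg F x) (negP_nonneg F x) h2.1 h2.2
        ((lintegral_posP_sub_le _ _ _).trans (not_lt.1 hx))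

lemma integrable_totalDissipation (H : DecayingSolution Ω n θ b ε c F A C) (R : ℝ) :
    Integrable (totalDissipation θ b (ε • c) F) (gasBall Ω R) := by
  obtain ⟨kd, -, hkd⟩ := H.exists_abs_phaseDissipation_le
  exact (integrable_gasBall_prod (R := R) (ε • c)
    (measurable_phaseDissipation H.cutoff.meas _ H.solves.measurable) hkd).integral_prod_left

lemma integrable_totalEnergy (H : DecayingSolution Ω n θ b ε c F A C) (R : ℝ) :
    Integrable (totalEnergy (ε • c) F) (gasBall Ω R) := by
  refine (integrable_gasBall_prod (R := R) (ε • c) (measurable_energyDensity _ H.solves.measurable)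
    (k := 16 * (1 + ‖ε • c‖) ^ 8 * A ^ 2) ?_).integral_prod_left
  filter_upwards [H.energyDensity_le'] with p hp
  rwa [abs_of_nonneg (energyDensity_nonneg _ _ _)]

/-- The dissipation vanishes. -/
theorem ae_totalDissipation_eq_zero (H : DecayingSolution Ω n θ b ε c F A C) :
    ∀ᵐ x ∂((volume : Measure E).restrict (gas Ω)), totalDissipation θ b (ε • c) F x = 0 := by
  set a : ℕ → ℝ := fun j => ∫ x, totalDissipation θ b (ε • c) F x ∂(gasBall Ω (4 ^ j)) with ha
  have hn := H.ae_totalDissipation_nonneg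
  have hnB : ∀ R, ∀ᵐ x ∂(gasBall Ω R), 0 ≤ totalDissipation θ b (ε • c) F x := fun R =>
    ae_restrict_of_ae hn
  have ha0 : ∀ j, 0 ≤ a j := fun j => integral_nonneg_of_ae (hnB _)
  have hmono : Monotone a := monotone_nat_of_le_succ fun j => by
    refine integral_mono_measure ?_ (hnB _) (H.integrable_totalDissipation _)
    refine Measure.restrict_mono (Metric.closedBall_subset_closedBall ?_) le_rfl
    rw [pow_succ]
    have : (0 : ℝ) < 4 ^ j := by positivity
    linarith
  set V := (volume : Measure E).real (Metric.closedBall 0 1) with hV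
  have hV0 : 0 ≤ V := measureReal_nonneg
  have hgrow : ∃ C' : ℝ, ∀ j, a j ≤ C' * 64 ^ j := by
    obtain ⟨kd, hkd0, hkd⟩ := H.exists_abs_phaseDissipation_le
    set J := ∫ v : E, kd * ((1 + ‖v - ε • c‖ ^ 2) ^ 2)⁻¹ with hJ
    have hJ0 : 0 ≤ J := integral_nonneg fun v => by positivity
    refine ⟨J * V, fun j => ?_⟩
    have hle : ∀ᵐ x ∂(gasBall Ω (4 ^ j)), totalDissipation θ b (ε • c) F x ≤ J := by
      refine ae_restrict_of_ae ?_
      filter_upwards [Measure.ae_ae_of_ae_prod hkd] with x hx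
      refine (le_abs_self _).trans ?_
      exact norm_integral_le_of_norm_le
        (f := fun v => phaseDissipation θ b (ε • c) F (x, v)) ((integrable_inv_sq (ε • c)).const_mul kd) hx
    calc a j ≤ ∫ x, J ∂(gasBall Ω (4 ^ j)) :=
          integral_mono_ae (H.integrable_totalDissipation _) (integrable_const _) hle
      _ = (gasBall Ω (4 ^ j)).real univ * J := by rw [integral_const, smul_eq_mul]
      _ ≤ (4 ^ j) ^ 3 * V * J :=
          mul_le_mul_of_nonneg_right (gasBall_real_le Ω (by positivity)) hJ0
      _ = J * V * 64 ^ j := by rw [← pow_mul, mul_comm j 3, pow_mul]; norm_num; ring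
  have hrec : ∃ C' : ℝ, 0 ≤ C' ∧ ∀ j, a j ≤ C' / 2 ^ j * (a (j + 1) + 1) := by
    obtain ⟨k, hk0, hk⟩ := H.integral_gasBall_le
    obtain ⟨k', hk'0, C₁, hC₁, s, hsm, hs, hle⟩ := H.exists_totalEnergy_le
    set m := ((volume : Measure E).restrict (gas Ω)).real s with hm
    have hm0 : 0 ≤ m := measureReal_nonneg
    have hε := H.eps_pos
    refine ⟨ε * (4 * C₁ + (4 * k' * m + k * V)), by positivity, fun j => ?_⟩
    -- With this ρ the inner radius ρ²/4 is 4^j and the outer radius ρ² is 4^(j+1), so the energy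
    -- inequality links consecutive terms.
    set ρ : ℝ := 2 ^ (j + 1) with hρ
    have hρ0 : 0 < ρ := by positivity
    have hρ1 : 1 ≤ ρ := one_le_pow₀ one_le_two
    have e1 : ρ ^ 2 = 4 ^ (j + 1) := by
      rw [hρ, ← pow_mul, mul_comm, pow_mul]; norm_num
    have e2 : ρ ^ 2 / 4 = 4 ^ j := by rw [e1, pow_succ]; ring
    have h1 := hk ρ hρ0
    rw [e2] at h1
    have hind : ∫ x, s.indicator (fun _ => k') x ∂(gasBall Ω (ρ ^ 2)) ≤ k' * m := by
      rw [integral_indicator_const _ hsm, smul_eq_mul, mul_comm]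
      refine mul_le_mul_of_nonneg_left ?_ hk'0
      exact ENNReal.toReal_mono hs.ne (Measure.restrict_apply_le _ _)
    have hii : Integrable (s.indicator fun _ => k') (gasBall Ω (ρ ^ 2)) :=
      (integrable_const _).indicator hsm
    have h2 : ∫ x, (4 / ρ * totalEnergy (ε • c) F x + k / ρ ^ 8) ∂(gasBall Ω (ρ ^ 2)) ≤
        4 / ρ * (C₁ * a (j + 1) + k' * m) + k / ρ ^ 8 * ((ρ ^ 2) ^ 3 * V) := by
      rw [integral_add ((H.integrable_totalEnergy _).const_mul _) (integrable_const _),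
        integral_const_mul, integral_const, smul_eq_mul, mul_comm _ (k / ρ ^ 8)]
      have h3 : ∫ x, totalEnergy (ε • c) F x ∂(gasBall Ω (ρ ^ 2)) ≤ C₁ * a (j + 1) + k' * m := by
        refine (integral_mono_ae (H.integrable_totalEnergy _)
          (((H.integrable_totalDissipation _).const_mul C₁).add hii) (ae_restrict_of_ae hle)).trans ?_
        simp only [Pi.add_apply]
        rw [integral_add ((H.integrable_totalDissipation _).const_mul C₁) hii, integral_const_mul]
        refine add_le_add (le_of_eq ?_) hind
        rw [ha, e1]
      have h4 := gasBall_real_le Ω (sq_nonneg ρ)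
      gcongr
    -- The volume grows like (ρ²)³, so the tail of large velocities contributes O(ρ⁻²), which is
    -- more than enough.
    have h5 : k / ρ ^ 8 * ((ρ ^ 2) ^ 3 * V) ≤ k * V / ρ := by
      rw [show k / ρ ^ 8 * ((ρ ^ 2) ^ 3 * V) = k * V / ρ ^ 2 by field_simp]
      refine div_le_div_of_nonneg_left (by positivity) hρ0 ?_
      nlinarith
    have h6 := h1.trans (h2.trans (add_le_add le_rfl h5))
    rw [inv_mul_le_iff₀ hε] at h6
    refine h6.trans ?_
    have haj := ha0 (j + 1)
    have h7 : 4 / ρ * (C₁ * a (j + 1) + k' * m) + k * V / ρ ≤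
        (4 * C₁ + (4 * k' * m + k * V)) / ρ * (a (j + 1) + 1) := by
      have : (4 * C₁ + (4 * k' * m + k * V)) / ρ * (a (j + 1) + 1) -
          (4 / ρ * (C₁ * a (j + 1) + k' * m) + k * V / ρ) =
          (4 * C₁ + (4 * k' * m + k * V) * a (j + 1)) / ρ := by field_simp; ring
      have h8 : 0 ≤ (4 * C₁ + (4 * k' * m + k * V) * a (j + 1)) / ρ := by positivity
      linarith
    have h9 : (4 * C₁ + (4 * k' * m + k * V)) / ρ ≤ (4 * C₁ + (4 * k' * m + k * V)) / 2 ^ j :=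
      div_le_div_of_nonneg_left (by positivity) (by positivity)
        (pow_le_pow_right₀ one_le_two (Nat.le_succ j))
    calc ε * (4 / ρ * (C₁ * a (j + 1) + k' * m) + k * V / ρ)
        ≤ ε * ((4 * C₁ + (4 * k' * m + k * V)) / 2 ^ j * (a (j + 1) + 1)) := by
          refine mul_le_mul_of_nonneg_left (h7.trans ?_) hε.le
          exact mul_le_mul_of_nonneg_right h9 (by linarith)
      _ = _ := by ring
  obtain ⟨C', hC', hrec⟩ := hrec
  have hz : ∀ j : ℕ, ∀ᵐ x ∂((volume : Measure E).restrict (gas Ω)),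
      x ∈ Metric.closedBall (0 : E) (4 ^ j) → totalDissipation θ b (ε • c) F x = 0 := by
    intro j
    have h1 := (integral_eq_zero_iff_of_nonneg_ae (hnB _) (H.integrable_totalDissipation _)).1
      (eq_zero_of_recursion ha0 hmono hC' hrec hgrow j)
    exact (ae_restrict_iff' Metric.isClosed_closedBall.measurableSet).1 h1
  filter_upwards [ae_all_iff.2 hz] with x hx
  obtain ⟨j, hj⟩ := pow_unbounded_of_one_lt ‖x‖ (by norm_num : (1 : ℝ) < 4)
  exact hx j (mem_closedBall_zero_iff.2 hj.le)

end DecayingSolution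

end

/-! ### A weight decreasing along the free flow. -/

section DispersiveWeight

/-- The bounded slope of a position along a velocity. -/
def slope (p : E × E) : ℝ := ⟪p.1, p.2⟫_ℝ / (1 + ‖p.2‖ ^ 2)

/-- A bounded weight that decreases along the free flow. -/
def dispersiveWeight (p : E × E) : ℝ := Real.pi / 2 - Real.arctan (slope p)

/-- The derivative of `dispersiveWeight` along the free flow. -/
def dispersiveWeightDeriv (p : E × E) : ℝ :=
  -(1 / (1 + slope p ^ 2) * (‖p.2‖ ^ 2 / (1 + ‖p.2‖ ^ 2)))

lemma continuous_slope : Continuous slope := by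
  unfold slope
  exact Continuous.div (by fun_prop) (by fun_prop) fun p => by positivity

lemma continuous_dispersiveWeight : Continuous dispersiveWeight :=
  continuous_const.sub (Real.continuous_arctan.comp continuous_slope)

lemma continuous_dispersiveWeightDeriv : Continuous dispersiveWeightDeriv := by
  have h := continuous_slope
  unfold dispersiveWeightDeriv
  exact ((continuous_const.div (by fun_prop) fun p => by positivity).mul
    (Continuous.div (by fun_prop) (by fun_prop) fun p => by positivity)).neg

lemma hasDerivAt_dispersiveWeight (p : E × E) (s : ℝ) :
    HasDerivAt (fun s => dispersiveWeight (flow s p)) (dispersiveWeightDeriv (flow s p)) s := by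
  have h1 : HasDerivAt (fun s : ℝ => p.1 + s • p.2) p.2 s := by
    simpa using ((hasDerivAt_id s).smul_const p.2).const_add p.1
  have h2 := (h1.inner ℝ (hasDerivAt_const s p.2)).div_const (1 + ‖p.2‖ ^ 2)
  simp only [inner_zero_right, zero_add, real_inner_self_eq_norm_sq] at h2
  exact (h2.arctan).const_sub (Real.pi / 2)

lemma dispersiveWeight_nonneg (p : E × E) : 0 ≤ dispersiveWeight p :=
  sub_nonneg.2 (Real.arctan_lt_pi_div_two _).le

lemma dispersiveWeight_le (p : E × E) : dispersiveWeight p ≤ Real.pi := by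
  have := (Real.neg_pi_div_two_lt_arctan (slope p)).le
  unfold dispersiveWeight
  linarith

lemma dispersiveWeightDeriv_nonpos (p : E × E) : dispersiveWeightDeriv p ≤ 0 :=
  neg_nonpos.2 (by positivity)

/-- Dividing x·v by 1+|v|² keeps the derivative bounded uniformly in v, so integrability of the
energy itself suffices. -/
lemma abs_dispersiveWeightDeriv_le (p : E × E) : |dispersiveWeightDeriv p| ≤ 1 := by
  rw [dispersiveWeightDeriv, abs_neg, abs_of_nonneg (by positivity)]
  refine mul_le_one₀ ?_ (by positivity) ?_
  · rw [div_le_one (by positivity)]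
    linarith [sq_nonneg (slope p)]
  · rw [div_le_one (by positivity)]
    linarith

lemma dispersiveWeightDeriv_ne_zero {p : E × E} (h : p.2 ≠ 0) : dispersiveWeightDeriv p ≠ 0 := by
  have : 0 < ‖p.2‖ := norm_pos_iff.2 h
  refine neg_ne_zero.2 (ne_of_gt ?_)
  positivity

end DispersiveWeight

/-! ### Vanishing of the negative part in the gas. -/

section

variable {Ω : Set E} {n : E → E} {θ : ℝ} {b : ℝ → ℝ} {ε : ℝ} {c : E} {F : E → E → ℝ} {A C : ℝ}

namespace DecayingSolution

lemma ae_phaseDissipation_eq_zero (H : DecayingSolution Ω n θ b ε c F A C) :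
    ∀ᵐ p ∂(gasPhase Ω), phaseDissipation θ b (ε • c) F p = 0 := by
  have hm := H.solves.measurable
  refine (Measure.ae_prod_iff_ae_ae ((measurable_phaseDissipation H.cutoff.meas _ hm)
    (measurableSet_singleton 0))).2 ?_
  filter_upwards [H.ae_bounds, H.ae_totalDissipation_eq_zero] with x h1 h2
  filter_upwards [mul_eq_zero_of_dissipation_eq_zero H.cutoff
    (measurable_section (measurable_posP hm) x) (measurable_section (measurable_negP hm) x)
    (posP_nonneg F x) (negP_nonneg F x) H.decay_nonneg h1.1 h1.2 h2] with v hv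
  rw [phaseDissipation, dissipation, div_mul_eq_mul_div, hv, zero_div]
  exact mem_singleton _

/-- With zero dissipation, coercivity confines the energy to a set of x of finite measure, on which
its v-integral is bounded. -/
lemma integrable_energyDensity (H : DecayingSolution Ω n θ b ε c F A C) :
    Integrable (energyDensity (ε • c) F) (gasPhase Ω) := by
  obtain ⟨k₀, hk₀, h0⟩ := H.exists_totalEnergy_le_const
  obtain ⟨k, hk, C₁, hC₁, s, hsm, hs, hle⟩ := H.exists_totalEnergy_le
  have hm := measurable_energyDensity (ε • c) H.solves.measurable
  have hae : AEStronglyMeasurable (energyDensity (ε • c) F)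
      (((volume : Measure E).restrict (gas Ω)).prod volume) := hm.aestronglyMeasurable
  refine (integrable_prod_iff hae).2 ⟨h0.mono fun x hx => hx.1, ?_⟩
  have hi : Integrable (s.indicator fun _ => k) ((volume : Measure E).restrict (gas Ω)) :=
    (integrable_indicator_iff hsm).2 (integrableOn_const hs.ne)
  refine hi.mono' hae.norm.integral_prod_right' ?_
  filter_upwards [hle, H.ae_totalDissipation_eq_zero] with x h1 h2
  rw [h2, mul_zero, zero_add] at h1
  rw [Real.norm_of_nonneg (integral_nonneg fun v => norm_nonneg _)]
  refine le_trans (le_of_eq ?_) h1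
  exact integral_congr_ae (Eventually.of_forall fun v =>
    Real.norm_of_nonneg (energyDensity_nonneg _ _ _))

/-- The negative part vanishes almost everywhere in the gas. -/
theorem ae_negP_eq_zero (H : DecayingSolution Ω n θ b ε c F A C) :
    ∀ᵐ p : E × E, p.1 ∈ gas Ω → negP F p.1 p.2 = 0 := by
  have hm := H.solves.measurable
  have hem := measurable_energyDensity (ε • c) hm
  have hei := H.integrable_energyDensity
  have hw := continuous_dispersiveWeight.measurable
  have hw' := continuous_dispersiveWeightDeriv.measurable
  have hD0 : ∀ᵐ p ∂(gasPhase Ω), phaseDissipation θ b (ε • c) F p * dispersiveWeight p = 0 := by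
    filter_upwards [H.ae_phaseDissipation_eq_zero] with p hp
    rw [hp, zero_mul]
  have hU : Integrable (fun p => energyDensity (ε • c) F p * dispersiveWeight p) (gasPhase Ω) := by
    refine (hei.const_mul Real.pi).mono' (hem.mul hw).aestronglyMeasurable
      (Eventually.of_forall fun p => ?_)
    rw [Real.norm_of_nonneg (mul_nonneg (energyDensity_nonneg _ _ _) (dispersiveWeight_nonneg p)),
      mul_comm]
    exact mul_le_mul_of_nonneg_right (dispersiveWeight_le p) (energyDensity_nonneg _ _ _)
  have hU' : Integrable (fun p => energyDensity (ε • c) F p * dispersiveWeightDeriv p)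
      (gasPhase Ω) := by
    refine hei.mono' (hem.mul hw').aestronglyMeasurable (Eventually.of_forall fun p => ?_)
    rw [norm_mul, Real.norm_of_nonneg (energyDensity_nonneg _ _ _), Real.norm_eq_abs]
    exact mul_le_of_le_one_right (energyDensity_nonneg _ _ _) (abs_dispersiveWeightDeriv_le p)
  -- The production is zero, so the integral of the energy against the derivative of the weight is
  -- nonnegative. That derivative is negative for v ≠ 0, hence the energy vanishes almost
  -- everywhere.
  have h := H.production_le hw hw' dispersiveWeight_nonneg hasDerivAt_dispersiveWeight
    (fun p => continuous_dispersiveWeightDeriv.comp (continuous_flow p)) hU hU'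
    ((integrable_zero _ _ _).congr (hD0.mono fun p hp => hp.symm))
  rw [integral_eq_zero_of_ae hD0, mul_zero] at h
  have h1 : 0 ≤ fun p => -(energyDensity (ε • c) F p * dispersiveWeightDeriv p) := fun p =>
    neg_nonneg.2 (mul_nonpos_of_nonneg_of_nonpos (energyDensity_nonneg _ _ _)
      (dispersiveWeightDeriv_nonpos p))
  have h2 : ∫ p, -(energyDensity (ε • c) F p * dispersiveWeightDeriv p) ∂(gasPhase Ω) = 0 := by
    refine le_antisymm ?_ (integral_nonneg h1)
    rw [integral_neg]
    linarith
  have h3 := ae_gasPhase_iff.1 ((integral_eq_zero_iff_of_nonneg h1 hU'.neg).1 h2)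
  filter_upwards [h3, Measure.quasiMeasurePreserving_snd.ae ae_ne_zero] with p hp hv hg
  have h4 := hp hg
  simp only [Pi.zero_apply, neg_eq_zero, mul_eq_zero] at h4
  have h5 := h4.resolve_right (dispersiveWeightDeriv_ne_zero hv)
  rw [energyDensity, div_eq_zero_iff] at h5
  exact pow_eq_zero_iff two_ne_zero |>.1 (h5.resolve_right (maxwellian_pos _ _).ne')

end DecayingSolution

/-- The negative part of a solution of the modified problem vanishes almost everywhere. -/
theorem ae_negP_eq_zero_of_solvesModifiedProblem (hΩ : IsOpen Ω) (hΩb : Bornology.IsBounded Ω)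
    (hn : HasC2BoundaryWithInnerNormal Ω n) (hb : AngularCutoff θ b) (hε : 0 < ε)
    (hF : SolvesModifiedProblem Ω n (kern θ b) ε c F) :
    ∀ᵐ p : E × E, p.1 ∈ gas Ω → negP F p.1 p.2 = 0 := by
  obtain ⟨C, hC⟩ := hF.bounded
  obtain ⟨A, hA0, hA⟩ := exists_negP_le hb hε hF.measurable hF.transport
    (ae_exit_trace_nonneg hΩ hΩb hn (fun x => posP_nonneg F x) hF.traces hF.inflow) hC
  exact DecayingSolution.ae_negP_eq_zero ⟨hΩ, hΩb, hn, hb, hε, hF, hA0.le, hC, hA⟩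

end

/-! ### Boundary values and passage to the Boltzmann problem. -/

section

variable {Ω : Set E} {n : E → E} {θ : ℝ} {b : ℝ → ℝ} {ε : ℝ} {c : E} {F S S' : E → E → ℝ} {C : ℝ}

lemma frequently_nhdsGT_of_ae {P : ℝ → Prop} (h : ∀ᵐ s : ℝ, P s) : ∃ᶠ s in 𝓝[>] (0 : ℝ), P s := by
  intro hev
  obtain ⟨η, hη, hsub⟩ := mem_nhdsGT_iff_exists_Ioo_subset.1 hev
  have h1 : volume (Ioo (0 : ℝ) η) = 0 := measure_mono_null hsub (ae_iff.1 h)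
  rw [Real.volume_Ioo, sub_zero, ENNReal.ofReal_eq_zero] at h1
  exact (not_le.2 hη) h1

lemma negP_eq_zero_iff {x v : E} : negP F x v = 0 ↔ 0 ≤ F x v := by
  rw [negP, max_eq_right_iff, neg_nonpos]

lemma posP_eq_self {x v : E} (h : 0 ≤ F x v) : posP F x v = F x v := max_eq_left h

/-- If the negative part vanishes in the gas, it vanishes on the boundary. -/
theorem ae_boundary_negP_eq_zero (hΩ : IsOpen Ω) (hΩb : Bornology.IsBounded Ω)
    (hn : HasC2BoundaryWithInnerNormal Ω n) (htr : HasTraces Ω n F)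
    (hin : InflowEq Ω n F (diffuse n (posP F)))
    (h0 : ∀ᵐ p : E × E, p.1 ∈ gas Ω → negP F p.1 p.2 = 0) :
    ∀ᵐ p ∂(phaseBoundary Ω), ⟪n p.1, p.2⟫_ℝ ≠ 0 → negP F p.1 p.2 = 0 := by
  filter_upwards [htr, hin, ae_boundary_line hΩ hΩb hn h0, ae_mem_frontier] with p h1 h2 h3 h4 h5
  rw [negP_eq_zero_iff]
  rcases lt_or_gt_of_ne h5 with h | h
  · rw [h2 h]
    exact diffuse_nonneg (fun x => posP_nonneg F x) _ _
  · have h6 := eventually_mem_gas_of_normal_pos hΩ hn h4 h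
    have h7 : ∀ᵐ s : ℝ, p.1 + (-s) • p.2 ∈ gas Ω → negP F (p.1 + (-s) • p.2) p.2 = 0 :=
      (Measure.measurePreserving_neg (volume : Measure ℝ)).quasiMeasurePreserving.ae h3
    -- Along the line F ≥ 0 is known only for almost every s; such s accumulate at 0, which is
    -- enough for the sign of the limit.
    refine ge_of_tendsto_of_frequently (h1.2 h) ?_
    refine ((frequently_nhdsGT_of_ae h7).and_eventually h6).mono fun s hs => ?_
    rw [neg_smul, ← sub_eq_add_neg] at hs
    exact negP_eq_zero_iff.1 (hs.1 hs.2)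

lemma SolvesTransport.congr (h : SolvesTransport Ω S F)
    (hS : ∀ᵐ p : E × E, p.1 ∈ gas Ω → S p.1 p.2 = S' p.1 p.2) : SolvesTransport Ω S' F := by
  unfold SolvesTransport at h ⊢
  filter_upwards [h, ae_flow hS] with p h1 h2 hg t ht
  obtain ⟨h3, h4⟩ := h1 hg t ht
  have h5 : ∀ᵐ s : ℝ, s ∈ uIoc 0 t → S (p.1 + s • p.2) p.2 = S' (p.1 + s • p.2) p.2 := by
    filter_upwards [h2] with s hs hmem
    exact hs (ht s (uIoc_subset_uIcc hmem))
  refine ⟨h3.congr_ae ((ae_restrict_iff' measurableSet_uIoc).2 h5), ?_⟩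
  rw [h4, intervalIntegral.integral_congr_ae h5]

/-- A solution whose negative part vanishes almost everywhere coincides with its positive part along
almost every line. -/
lemma SolvesTransport.positivePart (h : SolvesTransport Ω S F)
    (h0 : ∀ᵐ p : E × E, p.1 ∈ gas Ω → negP F p.1 p.2 = 0) : SolvesTransport Ω S (posP F) := by
  have hT := h.ae_freeFlight
  unfold SolvesTransport at h ⊢
  filter_upwards [h, hT, h0, ae_flow h0] with p h1 h2 h3 h4 hg t ht
  obtain ⟨h5, h6⟩ := h1 hg t ht
  have e0 : flow 0 p = p := by simp [flow]
  have hff : (p, t) ∈ freeFlight Ω := mem_freeFlight_iff.2 ht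
  -- F⁻ vanishes at almost every point of the line, so the integral formula with weight 1 gives F⁻ =
  -- 0 at every time t. Thus F⁺ satisfies the mild equation at all times, not just almost all.
  have h7 := sq_negPart_eq_integral (f := fun s => F (flow s p).1 (flow s p).2) (ψ := fun _ => 1)
    (ψ' := fun _ => 0) (h2 hg t hff).1 (fun s hs => by
      simp only [e0]
      exact (h2 hg s (freeFlight_of_mem_uIcc hff hs)).2) (fun s => hasDerivAt_const s 1)
    continuous_const
  have h8 : ∀ᵐ s : ℝ, s ∈ uIoc 0 t → -2 * max (-F (flow s p).1 (flow s p).2) 0 *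
      S (flow s p).1 (flow s p).2 * 1 + max (-F (flow s p).1 (flow s p).2) 0 ^ 2 * 0 = 0 := by
    filter_upwards [h4] with s hs hmem
    have h9 : max (-F (flow s p).1 (flow s p).2) 0 = 0 := hs (ht s (uIoc_subset_uIcc hmem))
    rw [h9]; ring
  rw [intervalIntegral.integral_congr_ae h8, intervalIntegral.integral_zero] at h7
  have h10 : max (-F p.1 p.2) 0 = 0 := h3 hg
  simp only [e0, h10, ne_eq, OfNat.ofNat_ne_zero, not_false_eq_true, zero_pow, mul_one,
    add_zero, pow_eq_zero_iff] at h7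
  refine ⟨h5, ?_⟩
  have h11 : negP F (p.1 + t • p.2) p.2 = 0 := h7
  rw [posP_eq_self (negP_eq_zero_iff.1 h11), posP_eq_self (negP_eq_zero_iff.1 (h3 hg))]
  exact h6

lemma HasTraces.positivePart (h : HasTraces Ω n F) : HasTraces Ω n (posP F) := by
  unfold HasTraces at h ⊢
  filter_upwards [h] with p hp
  exact ⟨fun hv => (hp.1 hv).max tendsto_const_nhds, fun hv => (hp.2 hv).max tendsto_const_nhds⟩

/-- Diffuse reflection does not see a negative part that vanishes on the boundary. -/
lemma ae_diffuse_posP_eq (hΩ : IsOpen Ω) (hΩb : Bornology.IsBounded Ω)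
    (hn : HasC2BoundaryWithInnerNormal Ω n)
    (h0 : ∀ᵐ p ∂(phaseBoundary Ω), ⟪n p.1, p.2⟫_ℝ ≠ 0 → negP F p.1 p.2 = 0) :
    ∀ᵐ p ∂(phaseBoundary Ω), diffuse n (posP F) p.1 p.2 = diffuse n F p.1 p.2 := by
  have : IsFiniteMeasure ((μHE[2] : Measure E).restrict (frontier Ω)) :=
    ⟨by rw [Measure.restrict_apply_univ]; exact measure_frontier_lt_top hΩ hΩb hn⟩
  have h1 : ∀ᵐ y ∂((μHE[2] : Measure E).restrict (frontier Ω)), ∀ v,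
      diffuse n (posP F) y v = diffuse n F y v := by
    filter_upwards [Measure.ae_ae_of_ae_prod h0] with y hy v
    rw [diffuse, diffuse]
    congr 1
    refine setIntegral_congr_ae (isOpen_lt continuous_const (by fun_prop)).measurableSet ?_
    filter_upwards [hy] with w hw hpos
    rw [posP_eq_self (negP_eq_zero_iff.1 (hw (ne_of_gt hpos)))]
  filter_upwards [Measure.quasiMeasurePreserving_fst.ae h1] with p hp
  exact hp p.2

lemma Q_zero_right (B : E → E → ℝ) (f : E → ℝ) (v : E) : Q B f (fun _ => 0) v = 0 := by
  simp [Q, Qplus, Qminus]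

lemma Q_zero_left (B : E → E → ℝ) (f : E → ℝ) (v : E) : Q B (fun _ => 0) f v = 0 := by
  simp [Q, Qplus, Qminus]

/-- The right hand sides agree if the negative part vanishes. -/
theorem ae_rhs_eq (hb : AngularCutoff θ b) (hm : Measurable (Function.uncurry F))
    (hC : ∀ᵐ p : E × E, p.1 ∈ gas Ω → |F p.1 p.2| ≤ C * sqrtM (ε • c) p.2)
    (h0 : ∀ᵐ p : E × E, p.1 ∈ gas Ω → negP F p.1 p.2 = 0) :
    ∀ᵐ p : E × E, p.1 ∈ gas Ω →
      modifiedRHS (kern θ b) ε c F p.1 p.2 = boltzmannRHS (kern θ b) ε (posP F) p.1 p.2 ∧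
      modifiedRHS (kern θ b) ε c F p.1 p.2 = boltzmannRHS (kern θ b) ε F p.1 p.2 := by
  obtain ⟨K, hK0, hK⟩ := exists_lintegral_kern_sqrtM_le hb (ε • c)
  have hμm : Measurable (maxwellian (ε • c)) := (continuous_maxwellian _).measurable
  have hμ : ∀ᵐ v, |maxwellian (ε • c) v| ≤ 1 * sqrtM (ε • c) v := Eventually.of_forall fun v => by
    rw [one_mul, abs_of_pos (maxwellian_pos _ _)]; exact maxwellian_le_sqrtM _ _
  have m1 := measurable_modifiedRHS (θ := θ) (ε := ε) (c := c) hb.meas hm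
  have m2 : Measurable fun p : E × E => boltzmannRHS (kern θ b) ε (posP F) p.1 p.2 :=
    (measurable_Q hb.meas (measurable_posP hm) (measurable_posP hm)).const_mul ε⁻¹
  have m3 : Measurable fun p : E × E => boltzmannRHS (kern θ b) ε F p.1 p.2 :=
    (measurable_Q hb.meas hm hm).const_mul ε⁻¹
  refine ae_of_slice ((measurableSet_eq_fun m1 m2).inter (measurableSet_eq_fun m1 m3)) ?_
  filter_upwards [ae_slice hC, ae_slice h0] with x h1 h2 hg
  have hF : ∀ᵐ v, |F x v| ≤ C * sqrtM (ε • c) v := h1 hg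
  have hp : ∀ᵐ v, |posP F x v| ≤ C * sqrtM (ε • c) v :=
    hF.mono fun v hv => (abs_posP_le F x v).trans hv
  have hh : ∀ᵐ v, |negP F x v| ≤ C * sqrtM (ε • c) v :=
    hF.mono fun v hv => (abs_negP_le F x v).trans hv
  have hpm := measurable_section (measurable_posP hm) x
  have hhm := measurable_section (measurable_negP hm) x
  have hFm := measurable_section hm x
  have e1 : posP F x =ᵐ[volume] F x :=
    (h2 hg).mono fun v hv => posP_eq_self (negP_eq_zero_iff.1 hv)
  have e2 : negP F x =ᵐ[volume] fun _ => 0 := h2 hg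
  filter_upwards [Q_congr_ae e1 e1 hb hK hpm hpm hFm hFm hp hp,
    Q_congr_ae (EventuallyEq.refl _ _) e2 hb hK hμm hhm hμm measurable_const hμ hh,
    Q_congr_ae e2 (EventuallyEq.refl _ _) hb hK hhm hμm measurable_const hμm hh hμ] with v q1 q2 q3
  rw [Q_zero_right] at q2
  rw [Q_zero_left] at q3
  have q4 : modifiedRHS (kern θ b) ε c F x v = boltzmannRHS (kern θ b) ε (posP F) x v := by
    rw [modifiedRHS, boltzmannRHS, q2, q3, add_zero, sub_zero]
  exact ⟨q4, q4.trans (by rw [boltzmannRHS, boltzmannRHS, q1])⟩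

/-- Nonnegative solutions of the modified problem solve the Boltzmann problem. -/
theorem solvesBoltzmannProblem_of_negP_eq_zero (hΩ : IsOpen Ω) (hΩb : Bornology.IsBounded Ω)
    (hn : HasC2BoundaryWithInnerNormal Ω n) (hb : AngularCutoff θ b)
    (hF : SolvesModifiedProblem Ω n (kern θ b) ε c F)
    (h0 : ∀ᵐ p : E × E, p.1 ∈ gas Ω → negP F p.1 p.2 = 0) :
    SolvesBoltzmannProblem Ω n (kern θ b) ε c F ∧
      SolvesBoltzmannProblem Ω n (kern θ b) ε c (posP F) := by
  obtain ⟨C, hC⟩ := hF.bounded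
  have hrhs := ae_rhs_eq hb hF.measurable hC h0
  have hbd := ae_boundary_negP_eq_zero hΩ hΩb hn hF.traces hF.inflow h0
  constructor
  · refine ⟨hF.measurable, hF.bounded, hF.transport.congr ?_, hF.traces, ?_, hF.infinity⟩
    · exact hrhs.mono fun p hp hg => (hp hg).2
    · have hin := hF.inflow
      unfold InflowEq at hin ⊢
      filter_upwards [hin, ae_diffuse_posP_eq hΩ hΩb hn hbd] with p h1 h2 hv
      rw [h1 hv, h2]
  · refine ⟨measurable_posP hF.measurable, ⟨C, ?_⟩, (hF.transport.congr ?_).positivePart h0,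
      hF.traces.positivePart, ?_, fun δ hδ => ?_⟩
    · exact hC.mono fun p hp hg => (abs_posP_le F _ _).trans (hp hg)
    · exact hrhs.mono fun p hp hg => (hp hg).1
    · have hin := hF.inflow
      unfold InflowEq at hin ⊢
      filter_upwards [hin, hbd] with p h1 h2 hv
      rw [posP_eq_self (negP_eq_zero_iff.1 (h2 hv.ne)), h1 hv]
    · refine (measure_mono fun x hx => ?_).trans_lt (hF.infinity δ hδ)
      exact ⟨hx.1, hx.2.trans_le (lintegral_posP_sub_le _ F x)⟩

end

end ExteriorBoltzmann

end

theorem proposition6p1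
    (Ω : Set ExteriorBoltzmann.E) (hΩo : IsOpen Ω) (hΩb : Bornology.IsBounded Ω)
    (n : ExteriorBoltzmann.E → ExteriorBoltzmann.E)
    (hn : ExteriorBoltzmann.HasC2BoundaryWithInnerNormal Ω n)
    (θ : ℝ) (B : ExteriorBoltzmann.E → ExteriorBoltzmann.E → ℝ)
    (hB : ExteriorBoltzmann.IsCutoffHardPotential θ B)
    (ε : ℝ) (hε : 0 < ε) (c : ExteriorBoltzmann.E)
    (F : ExteriorBoltzmann.E → ExteriorBoltzmann.E → ℝ)
    (hF : ExteriorBoltzmann.SolvesModifiedProblem Ω n B ε c F) :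
    ExteriorBoltzmann.NegPartVanishes Ω n F ∧
      ExteriorBoltzmann.SolvesBoltzmannProblem Ω n B ε c F ∧
      ExteriorBoltzmann.SolvesBoltzmannProblem Ω n B ε c (ExteriorBoltzmann.posP F) := by
  obtain ⟨b, hb, hBb⟩ := hB.exists_kern
  have hQ := ExteriorBoltzmann.Q_congr_kernel hBb
  have e1 : ExteriorBoltzmann.modifiedRHS B = ExteriorBoltzmann.modifiedRHS
      (ExteriorBoltzmann.kern θ b) := by
    funext ε c F x v
    simp only [ExteriorBoltzmann.modifiedRHS, hQ]
  have e2 : ExteriorBoltzmann.boltzmannRHS B = ExteriorBoltzmann.boltzmannRHS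
      (ExteriorBoltzmann.kern θ b) := by
    funext ε F x v
    simp only [ExteriorBoltzmann.boltzmannRHS, hQ]
  unfold ExteriorBoltzmann.SolvesModifiedProblem at hF
  unfold ExteriorBoltzmann.SolvesBoltzmannProblem
  rw [e1] at hF
  rw [e2]
  have h0 := ExteriorBoltzmann.ae_negP_eq_zero_of_solvesModifiedProblem hΩo hΩb hn hb hε hF
  exact ⟨⟨h0, ExteriorBoltzmann.ae_boundary_negP_eq_zero hΩo hΩb hn hF.traces hF.inflow h0⟩,
    ExteriorBoltzmann.solvesBoltzmannProblem_of_negP_eq_zero hΩo hΩb hn hb hF h0⟩
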